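/- Let $V_0=\{0,\dots,n-1\}$, $n\ge 1$, and let $f:2^{V_0}\to\mathbb{R}$ be submodular, i.e. $f(Y)+f(Z)\ge f(Y\cup Z)+f(Y\cap Z)$ for all $Y,Z$, with $f(\emptyset)=0$. Time is counted on a real random access machine with an evaluation oracle for $f$: every access to a memory cell, every (exact) arithmetic operation on real numbers or on natural numbers, every comparison, assignment and test, and every oracle call (which returns $f(Q)$ for a set $Q$ stored in memory by its membership flags) takes one unit of time. **Theorem.** The implementation on this machine of the algorithm below that is spelled out in the formal statement (one program, the same for all $n$ and $f$) halts for every such $n$ and $f$; its output $X\subseteq V_0$ satisfies $f(X)=\min_{Y\subseteq V_0}f(Y)$; and its running time is $O(n^7\log n)$, independently of the function values: there is an absolute constant $C$ such that the time is at most $C\,n^7\log n$ for $n\ge 2$, and at most $C$ for $n=1$. **The algorithm.** It keeps a set $X$ (initially $\emptyset$), a vertex set $V$ (initially $V_0$; later its elements represent disjoint classes of elements of $V_0$), the current function $f$ on $2^V$ and an acyclic digraph $D=(V,F)$ (initially $F=\emptyset$). $R(v)$ denotes the set of vertices reachable from $v$ in $D$ (including $v$), and $f_v(Y)=f(Y\cup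 R(v))-f(R(v))$ for $Y\subseteq V\setminus R(v)$. An ordering is consistent with $D$ if no arc of $F$ goes from an earlier to a later vertex. While $V\ne\emptyset$, repeat: 1. If $f(V)>0$, set $f(V)\gets 0$. 2. Let $\eta=\max_{v\in V}\bigl(f(R(v))-f(R(v)\setminus\{v\})\bigr)$. If $\eta\le 0$, leave the loop. Otherwise let $u$ attain the maximum. 3. If $f(R(u))\ge\eta/2$, let $w$ be the result of $\mathsf{Fix}(f_u,x,\eta)$, where $x$ is the extreme base of $f_u$ that the greedy algorithm generates from a consistent ordering. If $u\in R(w)$, contract $\{v: v\in R(w),\,u\in R(v)\}$ to a single vertex; otherwise add the arc $(u,w)$ to $F$. 4. If $f(R(u))<\eta/2$, let $w$ be the result of $\mathsf{Fix}(f,x,\eta)$, where $x$ is the extreme base of $f$ that the greedy algorithm generates from a consistent ordering. Add to $X$ the elements of $V_0$ represented by $R(w)$, and replace $f$ by $f_w$ and $V$ by $V\setminus R(w)$. After the loop, if $f(V)<0$, add to $X$ the elements of $V_0$ represented by $V$. Output $X$. *$\mathsf{Fix}(f,x,\eta)$*, for a function $f$ on the subsets of a set $V$ with $k$ elements and an extreme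 base $x$ generated by an ordering $L$: start with the one-term convex combination $x=\sum_{i\in I}\lambda_iy_i$, with $L$ as the ordering of its only term, with the zero flow $\varphi$ and with $\delta=\eta$. Perform scaling phases as long as $\delta\ge(\eta/2)/k^3$, and then return a vertex $w$ with $x(w)<-k^2\delta$. *Scaling phase.* Halve $\delta$, and move each $\varphi(a,b)$ to the nearest value in $[-\delta,\delta]$. At every moment let $z=x-\partial\varphi$ with $\partial\varphi(v)=\sum_a\varphi(a,v)$, let $S=\{v:z(v)\le-\delta\}$ and $T=\{v:z(v)\ge\delta\}$, and let $W$ be the set of vertices reachable from $S$ along arcs $(a,b)$, $a\ne b$, with $\varphi(a,b)\le 0$. A pair $(i,v)$ is active if $v$ is the last vertex of the ordering $L_i$ that is not in $W$ and is followed by some vertex of $W$. Repeat the following until $S=\emptyset$, or $T=\emptyset$, or $W\cap T=\emptyset$ and there is no active pair. As long as $W\cap T=\emptyset$ and there is an active pair, choose an active pair $(i,v)$, let $u$ be the immediate successor of $v$ in $L_i$, and push on $(i,u,v)$. If $W\cap T\neq\emptyset$, then choose a path from $S$ to $T$ along arcs $(a,b)$, $a\ne b$, with $\varphi(a,b)\le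 0$, and for each arc $(a,b)$ of the path add $\delta$ to $\varphi(a,b)$ and subtract $\delta$ from $\varphi(b,a)$. Then express $x$ by an affinely independent subfamily of the $y_i$ with positive coefficients (by Gaussian elimination). *Push on $(i,u,v)$.* Let $L_i(u)$ be the set of $u$ and its predecessors in $L_i$, $c=f(L_i(u)\setminus\{v\})-f(L_i(u))+y_i(v)$ and $\alpha=\min\{\delta,\lambda_ic\}$. Decrease $\varphi(u,v)$ by $\alpha$ and increase $\varphi(v,u)$ by $\alpha$. If $\alpha<\lambda_ic$, add a new index $j$ with $y_j=y_i$, $L_j=L_i$, $\lambda_j=\lambda_i-\alpha/c$, and set $\lambda_i\gets\alpha/c$. Then replace $y_i$ by $y_i+c(\chi_u-\chi_v)$ and $x$ by $x+\alpha(\chi_u-\chi_v)$, where $\chi_a$ is the unit vector of $a$, and interchange $u$ and $v$ in $L_i$. -/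

import Mathlib

namespace SFM

/-!
### A real random access machine with an evaluation oracle

The machine has a memory of natural number cells and a memory of real number cells. Both are
organised in named two-dimensional arrays; a scalar variable `a` is the cell `a[0, 0]`, and a
one-dimensional array is the column `a[·, 0]`. Every access to a cell, every arithmetic operation,
every comparison, every assignment, every test and every oracle call takes one unit of time. -/

/-- The names of the natural number variables and arrays. -/
inductive NName
  -- variables of the main loop
  | X | V | nV | cls | F | R | go | u | uSet | v | b | j | l | a | e
  -- variables for the evaluation of the current set function
  | Q | cnt | mem | start | t | p₀
  -- variables of the procedure that fixes an element
  | sel | fb | G | k | num | w | p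
  -- variables of a scaling phase
  | run | L | m | q | sAny | tAny | srch | found | tgt | W | par | que | head | tail | g | h
  | grew | i | vv | uu | r
  -- variables of the reduction to an affinely independent family
  | c | rk | pr | jr | piv | s | mm
  deriving DecidableEq

/-- The names of the real variables and arrays. -/
inductive RName
  | fV | off | top | sub | eta | fu | d | r₁ | r₂ | prev
  | x | y | lam | phi | delta | z | cap | lc | alpha
  | A | theta | cand | tmp | fac
  deriving DecidableEq

/-- Natural number expressions; `size` is the number `n` of elements of the ground set. -/
inductive NExp
  | size
  | lit (c : ℕ)
  | get (arr : NName) (row col : NExp)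
  | add (e₁ e₂ : NExp)
  | sub (e₁ e₂ : NExp)

/-- Real expressions. -/
inductive RExp
  | cast (e : NExp)
  | get (arr : RName) (row col : NExp)
  | add (e₁ e₂ : RExp)
  | sub (e₁ e₂ : RExp)
  | mul (e₁ e₂ : RExp)
  | div (e₁ e₂ : RExp)

/-- Boolean expressions. -/
inductive BExp
  | natEq (e₁ e₂ : NExp)
  | natLt (e₁ e₂ : NExp)
  | realEq (e₁ e₂ : RExp)
  | realLe (e₁ e₂ : RExp)
  | realLt (e₁ e₂ : RExp)
  | neg (b : BExp)
  | and (b₁ b₂ : BExp)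
  | or (b₁ b₂ : BExp)

/-- A reference to the natural number cell `arr[row, col]`. -/
structure NRef where
  arr : NName
  row : NExp
  col : NExp

/-- A reference to the real number cell `arr[row, col]`. -/
structure RRef where
  arr : RName
  row : NExp
  col : NExp

/-- Programs. `query ρ S` stores in the cell `ρ` the value `f {j | S[j] ≠ 0}`. -/
inductive Cmd
  | skip
  | nset (ρ : NRef) (e : NExp)
  | rset (ρ : RRef) (e : RExp)
  | query (ρ : RRef) (S : NName)
  | seq (c₁ c₂ : Cmd)
  | cond (b : BExp) (c₁ c₂ : Cmd)
  | loop (b : BExp) (c : Cmd)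

/-- The contents of the memory. -/
@[ext]
structure Mem where
  nat : NName → ℕ → ℕ → ℕ
  real : RName → ℕ → ℕ → ℝ

/-- The memory after writing `val` to the natural number cell `arr[row, col]`. -/
def Mem.setNat (σ : Mem) (arr : NName) (row col val : ℕ) : Mem :=
  { σ with nat := fun arr' row' col' =>
      if arr' = arr ∧ row' = row ∧ col' = col then val else σ.nat arr' row' col' }

/-- The memory after writing `val` to the real number cell `arr[row, col]`. -/
noncomputable def Mem.setReal (σ : Mem) (arr : RName) (row col : ℕ) (val : ℝ) : Mem :=
  { σ with real := fun arr' row' col' =>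
      if arr' = arr ∧ row' = row ∧ col' = col then val else σ.real arr' row' col' }

/-- The memory in which every cell is zero. -/
def Mem.zero : Mem where
  nat := fun _ _ _ => 0
  real := fun _ _ _ => 0

/-- The set stored in the array `arr` through its membership flags. -/
def Mem.set (n : ℕ) (σ : Mem) (arr : NName) : Finset (Fin n) :=
  Finset.univ.filter fun j : Fin n => σ.nat arr j 0 ≠ 0

def NExp.eval (n : ℕ) (σ : Mem) : NExp → ℕ
  | size => n
  | lit c => c
  | get arr row col => σ.nat arr (row.eval n σ) (col.eval n σ)
  | add e₁ e₂ => e₁.eval n σ + e₂.eval n σ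
  | sub e₁ e₂ => e₁.eval n σ - e₂.eval n σ

noncomputable def RExp.eval (n : ℕ) (σ : Mem) : RExp → ℝ
  | cast e => (e.eval n σ : ℝ)
  | get arr row col => σ.real arr (row.eval n σ) (col.eval n σ)
  | add e₁ e₂ => e₁.eval n σ + e₂.eval n σ
  | sub e₁ e₂ => e₁.eval n σ - e₂.eval n σ
  | mul e₁ e₂ => e₁.eval n σ * e₂.eval n σ
  | div e₁ e₂ => e₁.eval n σ / e₂.eval n σ

def BExp.eval (n : ℕ) (σ : Mem) : BExp → Prop
  | natEq e₁ e₂ => e₁.eval n σ = e₂.eval n σ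
  | natLt e₁ e₂ => e₁.eval n σ < e₂.eval n σ
  | realEq e₁ e₂ => e₁.eval n σ = e₂.eval n σ
  | realLe e₁ e₂ => e₁.eval n σ ≤ e₂.eval n σ
  | realLt e₁ e₂ => e₁.eval n σ < e₂.eval n σ
  | neg b => ¬ b.eval n σ
  | and b₁ b₂ => b₁.eval n σ ∧ b₂.eval n σ
  | or b₁ b₂ => b₁.eval n σ ∨ b₂.eval n σ

/-- The time for evaluating a natural number expression. -/
def NExp.cost : NExp → ℕ
  | size => 1
  | lit _ => 1
  | get _ row col => row.cost + col.cost + 1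
  | add e₁ e₂ => e₁.cost + e₂.cost + 1
  | sub e₁ e₂ => e₁.cost + e₂.cost + 1

/-- The time for evaluating a real expression. -/
def RExp.cost : RExp → ℕ
  | cast e => e.cost + 1
  | get _ row col => row.cost + col.cost + 1
  | add e₁ e₂ => e₁.cost + e₂.cost + 1
  | sub e₁ e₂ => e₁.cost + e₂.cost + 1
  | mul e₁ e₂ => e₁.cost + e₂.cost + 1
  | div e₁ e₂ => e₁.cost + e₂.cost + 1

/-- The time for evaluating a Boolean expression. -/
def BExp.cost : BExp → ℕ
  | natEq e₁ e₂ => e₁.cost + e₂.cost + 1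
  | natLt e₁ e₂ => e₁.cost + e₂.cost + 1
  | realEq e₁ e₂ => e₁.cost + e₂.cost + 1
  | realLe e₁ e₂ => e₁.cost + e₂.cost + 1
  | realLt e₁ e₂ => e₁.cost + e₂.cost + 1
  | neg b => b.cost + 1
  | and b₁ b₂ => b₁.cost + b₂.cost + 1
  | or b₁ b₂ => b₁.cost + b₂.cost + 1

/-- `Exec f c σ σ' t`: the program `c`, started with memory contents `σ` and with the evaluation
oracle for `f`, halts after exactly `t` time units with memory contents `σ'`. -/
inductive Exec {n : ℕ} (f : Finset (Fin n) → ℝ) : Cmd → Mem → Mem → ℕ → Prop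
  | skip (σ : Mem) : Exec f .skip σ σ 1
  | nset (ρ : NRef) (e : NExp) (σ : Mem) :
      Exec f (.nset ρ e) σ
        (σ.setNat ρ.arr (ρ.row.eval n σ) (ρ.col.eval n σ) (e.eval n σ))
        (ρ.row.cost + ρ.col.cost + e.cost + 1)
  | rset (ρ : RRef) (e : RExp) (σ : Mem) :
      Exec f (.rset ρ e) σ
        (σ.setReal ρ.arr (ρ.row.eval n σ) (ρ.col.eval n σ) (e.eval n σ))
        (ρ.row.cost + ρ.col.cost + e.cost + 1)
  | query (ρ : RRef) (S : NName) (σ : Mem) :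
      Exec f (.query ρ S) σ
        (σ.setReal ρ.arr (ρ.row.eval n σ) (ρ.col.eval n σ) (f (σ.set n S)))
        (ρ.row.cost + ρ.col.cost + 1)
  | seq {c₁ c₂ : Cmd} {σ₁ σ₂ σ₃ : Mem} {t₁ t₂ : ℕ} :
      Exec f c₁ σ₁ σ₂ t₁ → Exec f c₂ σ₂ σ₃ t₂ → Exec f (.seq c₁ c₂) σ₁ σ₃ (t₁ + t₂)
  | condTrue {b : BExp} {c₁ c₂ : Cmd} {σ σ' : Mem} {t : ℕ} :
      b.eval n σ → Exec f c₁ σ σ' t → Exec f (.cond b c₁ c₂) σ σ' (b.cost + 1 + t)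
  | condFalse {b : BExp} {c₁ c₂ : Cmd} {σ σ' : Mem} {t : ℕ} :
      ¬ b.eval n σ → Exec f c₂ σ σ' t → Exec f (.cond b c₁ c₂) σ σ' (b.cost + 1 + t)
  | loopTrue {b : BExp} {c : Cmd} {σ₁ σ₂ σ₃ : Mem} {t₁ t₂ : ℕ} :
      b.eval n σ₁ → Exec f c σ₁ σ₂ t₁ → Exec f (.loop b c) σ₂ σ₃ t₂ →
      Exec f (.loop b c) σ₁ σ₃ (b.cost + 1 + t₁ + t₂)
  | loopFalse {b : BExp} {c : Cmd} {σ : Mem} :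
      ¬ b.eval n σ → Exec f (.loop b c) σ σ (b.cost + 1)

/-! ### Concrete syntax -/

instance (c : ℕ) : OfNat NExp c := ⟨.lit c⟩
instance (c : ℕ) : OfNat RExp c := ⟨.cast (.lit c)⟩

/-- A name alone denotes a scalar variable. -/
instance : Coe NName NRef := ⟨fun arr => ⟨arr, 0, 0⟩⟩
instance : Coe RName RRef := ⟨fun arr => ⟨arr, 0, 0⟩⟩
instance : Coe NRef NExp := ⟨fun ρ => .get ρ.arr ρ.row ρ.col⟩
instance : Coe RRef RExp := ⟨fun ρ => .get ρ.arr ρ.row ρ.col⟩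
instance : Coe NName NExp := ⟨fun arr => .get arr 0 0⟩
instance : Coe RName RExp := ⟨fun arr => .get arr 0 0⟩

/-- The cell `a[i]` of a one-dimensional array. -/
abbrev NName.at₁ (arr : NName) (row : NExp) : NRef := ⟨arr, row, 0⟩
/-- The cell `a[i, j]` of a two-dimensional array. -/
abbrev NName.at₂ (arr : NName) (row col : NExp) : NRef := ⟨arr, row, col⟩
/-- The cell `a[i]` of a one-dimensional array. -/
abbrev RName.at₁ (arr : RName) (row : NExp) : RRef := ⟨arr, row, 0⟩
/-- The cell `a[i, j]` of a two-dimensional array. -/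
abbrev RName.at₂ (arr : RName) (row col : NExp) : RRef := ⟨arr, row, col⟩

section Program

local infixr:20 " ;; " => Cmd.seq
local infix:40 " ≔ " => Cmd.nset
local infix:40 " ≔ᵣ " => Cmd.rset
local infixl:65 " +ₙ " => NExp.add
local infixl:65 " -ₙ " => NExp.sub
local infixl:65 " +ᵣ " => RExp.add
local infixl:65 " -ᵣ " => RExp.sub
local infixl:70 " *ᵣ " => RExp.mul
local infixl:70 " /ᵣ " => RExp.div
local infix:50 " =ₙ " => BExp.natEq
local infix:50 " <ₙ " => BExp.natLt
local infix:50 " =ᵣ " => BExp.realEq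
local infix:50 " ≤ᵣ " => BExp.realLe
local infix:50 " <ᵣ " => BExp.realLt
local infixr:35 " ∧ₘ " => BExp.and
local infixr:30 " ∨ₘ " => BExp.or

/-- `if b then c`. -/
def when (b : BExp) (c : Cmd) : Cmd := .cond b c .skip

/-- `for i = lo, lo + 1, …, hi - 1 do c`. -/
def forTo (ι : NName) (lo hi : NExp) (body : Cmd) : Cmd :=
  ι ≔ lo ;; .loop (ι <ₙ hi) (body ;; ι ≔ ι +ₙ 1)

open NName RName

/-! #### Evaluation of the current set function

The vertices of the current set `V` are represented by elements of the original ground set: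
`V[v] = 1` if `v` is a current vertex, and then `v` stands for the class
`{j | cls[j] = v}`, which is listed in `mem[start[v]], …, mem[start[v + 1] - 1]`. The set `X`
consists of the elements already deleted (`cls[j] = n`). With `Q = X ∪ (the classes of Y)`, the
current function is `Y ↦ f(Q) - off`, except that its value at `Y = V` is `fV`. In the same way,
the function handed to the procedure `fix` is `Y ↦ f(Q) - sub` for
`Q = fb ∪ (the classes of Y)`, except that its value at the whole set is `top`.
The number of elements of `Q` is kept in `cnt`. -/

/-- List the classes. -/
def listClasses : Cmd :=
  p₀ ≔ 0 ;;
  forTo v 0 .size (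
    start.at₁ v ≔ p₀ ;;
    forTo j 0 .size (
      when (cls.at₁ j =ₙ v) (
        mem.at₁ p₀ ≔ j ;;
        p₀ ≔ p₀ +ₙ 1))) ;;
  start.at₁ .size ≔ p₀

/-- `Q ← S`. -/
def load (S : NName) : Cmd :=
  cnt ≔ 0 ;;
  forTo j 0 .size (
    Q.at₁ j ≔ S.at₁ j ;;
    when (.neg (S.at₁ j =ₙ 0)) (cnt ≔ cnt +ₙ 1))

/-- `Q ← Q ∪ (the class of v)`, for a class disjoint from `Q`. -/
def insertClass (v : NExp) : Cmd :=
  forTo t (start.at₁ v) (start.at₁ (v +ₙ 1)) (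
    Q.at₁ (mem.at₁ t) ≔ 1 ;;
    cnt ≔ cnt +ₙ 1)

/-- `Q ← Q \ (the class of v)`, for a class contained in `Q`. -/
def removeClass (v : NExp) : Cmd :=
  forTo t (start.at₁ v) (start.at₁ (v +ₙ 1)) (
    Q.at₁ (mem.at₁ t) ≔ 0 ;;
    cnt ≔ cnt -ₙ 1)

/-- `ρ ← full` if `Q` is the whole ground set, and `ρ ← f(Q) - shift` otherwise. -/
def evalQ (full shift ρ : RName) : Cmd :=
  .cond (cnt =ₙ .size) (ρ ≔ᵣ full) (
    .query ρ Q ;;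
    ρ ≔ᵣ ρ -ᵣ shift)

/-! #### Scaling phases

These work on the vertices `G[0], …, G[k - 1]` and on the function described above. The base `x`
is the convex combination of the extreme bases `y[i, ·]` with coefficients `lam[i]`, for
`i < m`, and `y[i, ·]` is generated by the ordering `L[i, 0], …, L[i, k - 1]`. The flow is
`phi`, the scaling parameter is `delta`, and `z = x - ∂phi`. -/

/-- The flow becomes `delta`-feasible: each `phi[a, b]` moves to the nearest value in
`[-delta, delta]`. -/
def clip : Cmd :=
  forTo a 0 .size (forTo b 0 .size (
    when (delta <ᵣ phi.at₂ a b) (phi.at₂ a b ≔ᵣ delta) ;;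
    when (phi.at₂ a b <ᵣ 0 -ᵣ delta) (phi.at₂ a b ≔ᵣ 0 -ᵣ delta)))

/-- Compute `z = x - ∂phi`, whether `S = {v | z(v) ≤ -delta}` is nonempty, and whether
`T = {v | z(v) ≥ delta}` is nonempty. -/
def computeZ : Cmd :=
  sAny ≔ 0 ;;
  tAny ≔ 0 ;;
  forTo g 0 k (
    vv ≔ G.at₁ g ;;
    z.at₁ vv ≔ᵣ x.at₁ vv ;;
    forTo h 0 k (z.at₁ vv ≔ᵣ z.at₁ vv -ᵣ phi.at₂ (G.at₁ h) vv) ;;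
    when (z.at₁ vv ≤ᵣ 0 -ᵣ delta) (sAny ≔ 1) ;;
    when (delta ≤ᵣ z.at₁ vv) (tAny ≔ 1))

/-- Breadth-first search from `S` along the arcs `(a, b)` with `phi[a, b] ≤ 0`: compute the set
`W` of reachable vertices and a predecessor `par[v]` of each `v ∈ W` (with `par[v] = v` for
`v ∈ S`), and look for a vertex `tgt ∈ W ∩ T`. -/
def reach : Cmd :=
  head ≔ 0 ;;
  tail ≔ 0 ;;
  forTo g 0 k (
    vv ≔ G.at₁ g ;;
    W.at₁ vv ≔ 0 ;;
    when (z.at₁ vv ≤ᵣ 0 -ᵣ delta) (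
      W.at₁ vv ≔ 1 ;;
      par.at₁ vv ≔ vv ;;
      que.at₁ tail ≔ vv ;;
      tail ≔ tail +ₙ 1)) ;;
  .loop (head <ₙ tail) (
    uu ≔ que.at₁ head ;;
    head ≔ head +ₙ 1 ;;
    forTo g 0 k (
      vv ≔ G.at₁ g ;;
      when (W.at₁ vv =ₙ 0 ∧ₘ phi.at₂ uu vv ≤ᵣ 0) (
        W.at₁ vv ≔ 1 ;;
        par.at₁ vv ≔ uu ;;
        que.at₁ tail ≔ vv ;;
        tail ≔ tail +ₙ 1))) ;;
  found ≔ 0 ;;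
  forTo g 0 k (
    vv ≔ G.at₁ g ;;
    when (W.at₁ vv =ₙ 1 ∧ₘ delta ≤ᵣ z.at₁ vv) (
      found ≔ 1 ;;
      tgt ≔ vv))

/-- `Push(i, u, v)` for `v = vv` at position `q` of the ordering `L[i, ·]` and its immediate
successor `u`. On entry `Q` represents the predecessors of `v`, on exit the predecessors of `v`
in the new ordering. The exchange capacity is `cap = f(L(u) \ {v}) - f(L(u)) + y_i(v)`. The flag
`grew` is raised if the arc `(u, v)` becomes available. -/
def push : Cmd :=
  uu ≔ L.at₂ i (q +ₙ 1) ;;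
  insertClass uu ;;
  evalQ top sub r₁ ;;
  insertClass vv ;;
  evalQ top sub r₂ ;;
  removeClass vv ;;
  cap ≔ᵣ r₁ -ᵣ r₂ +ᵣ y.at₂ i vv ;;
  lc ≔ᵣ lam.at₁ i *ᵣ cap ;;
  .cond (lc ≤ᵣ delta) (alpha ≔ᵣ lc) (alpha ≔ᵣ delta) ;;
  phi.at₂ uu vv ≔ᵣ phi.at₂ uu vv -ᵣ alpha ;;
  phi.at₂ vv uu ≔ᵣ phi.at₂ vv uu +ᵣ alpha ;;
  when (alpha <ᵣ lc) (
    lam.at₁ m ≔ᵣ lam.at₁ i -ᵣ alpha /ᵣ cap ;;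
    lam.at₁ i ≔ᵣ alpha /ᵣ cap ;;
    forTo r 0 k (
      y.at₂ m (G.at₁ r) ≔ᵣ y.at₂ i (G.at₁ r) ;;
      L.at₂ m r ≔ L.at₂ i r) ;;
    m ≔ m +ₙ 1) ;;
  y.at₂ i uu ≔ᵣ y.at₂ i uu +ᵣ cap ;;
  y.at₂ i vv ≔ᵣ y.at₂ i vv -ᵣ cap ;;
  L.at₂ i q ≔ uu ;;
  L.at₂ i (q +ₙ 1) ≔ vv ;;
  x.at₁ uu ≔ᵣ x.at₁ uu +ᵣ alpha ;;
  x.at₁ vv ≔ᵣ x.at₁ vv -ᵣ alpha ;;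
  q ≔ q +ₙ 1 ;;
  when (phi.at₂ uu vv ≤ᵣ 0) (grew ≔ 1)

/-- Repeatedly take the active vertex of the ordering `L[i, ·]` (the last vertex outside `W` that
precedes some vertex of `W`) and push, until there is no active vertex or `W` grows. The ordering
is scanned from its end; `Q` represents the vertices at positions before `p`. -/
def scan : Cmd :=
  cnt ≔ .size ;;
  forTo j 0 .size (Q.at₁ j ≔ 1) ;;
  p ≔ k ;;
  .loop (0 <ₙ p ∧ₘ grew =ₙ 0) (
    p ≔ p -ₙ 1 ;;
    vv ≔ L.at₂ i p ;;
    removeClass vv ;;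
    when (W.at₁ vv =ₙ 0) (
      q ≔ p ;;
      .loop (q +ₙ 1 <ₙ k ∧ₘ W.at₁ (L.at₂ i (q +ₙ 1)) =ₙ 1 ∧ₘ grew =ₙ 0) push ;;
      forTo r p q (removeClass (L.at₂ i r))))

/-- Look for an augmenting path, pushing on active pairs as long as there is neither such a path
nor an empty set of active pairs. -/
def search : Cmd :=
  srch ≔ 1 ;;
  .loop (srch =ₙ 1) (
    reach ;;
    .cond (found =ₙ 1) (srch ≔ 0) (
      grew ≔ 0 ;;
      i ≔ 0 ;;
      .loop (i <ₙ m ∧ₘ grew =ₙ 0) (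
        scan ;;
        i ≔ i +ₙ 1) ;;
      when (grew =ₙ 0) (srch ≔ 0)))

/-- Augment the flow by `delta` along the path that was found. -/
def augment : Cmd :=
  vv ≔ tgt ;;
  .loop (.neg (par.at₁ vv =ₙ vv)) (
    uu ≔ par.at₁ vv ;;
    phi.at₂ uu vv ≔ᵣ phi.at₂ uu vv +ᵣ delta ;;
    phi.at₂ vv uu ≔ᵣ phi.at₂ vv uu -ᵣ delta ;;
    vv ≔ uu)

/-- Gauss–Jordan elimination in the matrix `A` (rows `0, …, k`, columns `0, …, m - 1`) with
pivot `A[ρ, c]`. -/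
def pivot (ρ : NName) : Cmd :=
  fac ≔ᵣ A.at₂ ρ c ;;
  forTo l 0 m (A.at₂ ρ l ≔ᵣ A.at₂ ρ l /ᵣ fac) ;;
  forTo s 0 (k +ₙ 1) (
    when (.neg (s =ₙ ρ)) (
      fac ≔ᵣ A.at₂ s c ;;
      forTo l 0 m (A.at₂ s l ≔ᵣ A.at₂ s l -ᵣ fac *ᵣ A.at₂ ρ l)))

/-- Express `x` by a smaller affinely independent family with positive coefficients. Column `c` of
`A` starts as the vector `(y_c, 1)`. The columns are treated one after the other; the columns
`piv[0], …, piv[rk - 1]` are the current independent ones, reduced to unit vectors. If column `c`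
depends on them, with `y_c - ∑ A[r, c] y_{piv[r]} = 0`, the coefficients move along this
dependency until one of them vanishes, and the index of that one is dropped. -/
def reduce : Cmd :=
  forTo c 0 m (
    forTo r 0 k (A.at₂ r c ≔ᵣ y.at₂ c (G.at₁ r)) ;;
    A.at₂ k c ≔ᵣ 1) ;;
  rk ≔ 0 ;;
  forTo c 0 m (
    pr ≔ k +ₙ 1 ;;
    forTo r rk (k +ₙ 1) (when (.neg (A.at₂ r c =ᵣ 0)) (pr ≔ r)) ;;
    .cond (pr <ₙ k +ₙ 1) (
      forTo l 0 m (
        tmp ≔ᵣ A.at₂ pr l ;;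
        A.at₂ pr l ≔ᵣ A.at₂ rk l ;;
        A.at₂ rk l ≔ᵣ tmp) ;;
      piv.at₁ rk ≔ c ;;
      pivot rk ;;
      rk ≔ rk +ₙ 1) (
      theta ≔ᵣ lam.at₁ c ;;
      jr ≔ k +ₙ 1 ;;
      forTo r 0 rk (
        when (A.at₂ r c <ᵣ 0) (
          cand ≔ᵣ lam.at₁ (piv.at₁ r) /ᵣ (0 -ᵣ A.at₂ r c) ;;
          when (cand <ᵣ theta) (
            theta ≔ᵣ cand ;;
            jr ≔ r))) ;;
      forTo r 0 rk (
        lam.at₁ (piv.at₁ r) ≔ᵣ lam.at₁ (piv.at₁ r) +ᵣ theta *ᵣ A.at₂ r c) ;;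
      lam.at₁ c ≔ᵣ lam.at₁ c -ᵣ theta ;;
      when (jr <ₙ k +ₙ 1) (
        piv.at₁ jr ≔ c ;;
        pivot jr))) ;;
  mm ≔ 0 ;;
  forTo c 0 m (
    when (0 <ᵣ lam.at₁ c) (
      forTo r 0 k (
        y.at₂ mm (G.at₁ r) ≔ᵣ y.at₂ c (G.at₁ r) ;;
        L.at₂ mm r ≔ L.at₂ c r) ;;
      lam.at₁ mm ≔ᵣ lam.at₁ c ;;
      mm ≔ mm +ₙ 1)) ;;
  m ≔ mm

/-- A scaling phase. It ends when `S = ∅`, or `T = ∅`, or there is neither an augmenting path nor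
an active pair. -/
def phase : Cmd :=
  delta ≔ᵣ delta /ᵣ 2 ;;
  clip ;;
  run ≔ 1 ;;
  .loop (run =ₙ 1) (
    computeZ ;;
    .cond (sAny =ₙ 0 ∨ₘ tAny =ₙ 0) (run ≔ 0) (
      search ;;
      .cond (found =ₙ 1) augment (run ≔ 0) ;;
      reduce))

/-! #### The procedure that fixes an element -/

/-- List the selected vertices in an ordering consistent with the digraph: in the order of
increasing number of reachable vertices. -/
def consistentOrder : Cmd :=
  forTo v 0 .size (
    num.at₁ v ≔ 0 ;;
    forTo b 0 .size (num.at₁ v ≔ num.at₁ v +ₙ R.at₂ v b)) ;;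
  k ≔ 0 ;;
  forTo l 1 (.size +ₙ 1) (forTo v 0 .size (
    when (sel.at₁ v =ₙ 1 ∧ₘ num.at₁ v =ₙ l) (
      G.at₁ k ≔ v ;;
      k ≔ k +ₙ 1)))

/-- The greedy algorithm: the extreme base generated by the ordering `G[0], …, G[k - 1]`. -/
def greedy : Cmd :=
  load fb ;;
  prev ≔ᵣ 0 ;;
  forTo p 0 k (
    vv ≔ G.at₁ p ;;
    insertClass vv ;;
    evalQ top sub r₁ ;;
    x.at₁ vv ≔ᵣ r₁ -ᵣ prev ;;
    y.at₂ 0 vv ≔ᵣ r₁ -ᵣ prev ;;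
    L.at₂ 0 p ≔ vv ;;
    prev ≔ᵣ r₁) ;;
  m ≔ 1 ;;
  lam.at₁ 0 ≔ᵣ 1

/-- `Fix`: start with a consistent extreme base, the zero flow and `delta = eta`, perform scaling
phases until `delta < (eta / 2) / k³`, and let `w` be a vertex with `x(w) < -k² delta`. -/
def fix : Cmd :=
  consistentOrder ;;
  greedy ;;
  forTo a 0 .size (forTo b 0 .size (phi.at₂ a b ≔ᵣ 0)) ;;
  delta ≔ᵣ eta ;;
  .loop (eta /ᵣ 2 /ᵣ (.cast k *ᵣ .cast k *ᵣ .cast k) ≤ᵣ delta) phase ;;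
  forTo p 0 k (
    when (x.at₁ (G.at₁ p) <ᵣ 0 -ᵣ .cast k *ᵣ .cast k *ᵣ delta) (w ≔ G.at₁ p))

/-! #### The main loop

`F` is the arc set of the directed acyclic graph on the current vertices, and
`R[v, b] = 1` if `b` is reachable from `v`. -/

/-- Compute the reachability relation. -/
def closure : Cmd :=
  forTo a 0 .size (forTo b 0 .size (
    .cond (a =ₙ b) (R.at₂ a b ≔ 1) (R.at₂ a b ≔ F.at₂ a b))) ;;
  forTo l 0 .size (forTo a 0 .size (forTo b 0 .size (
    when (R.at₂ a l =ₙ 1 ∧ₘ R.at₂ l b =ₙ 1) (R.at₂ a b ≔ 1))))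

/-- Compute `eta = max {f(R(v)) - f(R(v) \ {v}) | v ∈ V}`, a vertex `u` that attains the maximum,
and `fu = f(R(u))`. -/
def computeEta : Cmd :=
  uSet ≔ 0 ;;
  forTo v 0 .size (
    when (V.at₁ v =ₙ 1) (
      load X ;;
      forTo b 0 .size (
        when (R.at₂ v b =ₙ 1 ∧ₘ .neg (b =ₙ v)) (insertClass b)) ;;
      evalQ fV off r₂ ;;
      insertClass v ;;
      evalQ fV off r₁ ;;
      d ≔ᵣ r₁ -ᵣ r₂ ;;
      when (uSet =ₙ 0 ∨ₘ eta <ᵣ d) (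
        uSet ≔ 1 ;;
        eta ≔ᵣ d ;;
        u ≔ v ;;
        fu ≔ᵣ r₁)))

/-- Delete the vertex `v` and its arcs from the digraph. -/
def deleteVertex : Cmd :=
  V.at₁ v ≔ 0 ;;
  nV ≔ nV -ₙ 1 ;;
  forTo a 0 .size (
    F.at₂ v a ≔ 0 ;;
    F.at₂ a v ≔ 0)

/-- Contract `{v | v ∈ R(w), u ∈ R(v)}` to the single vertex `u`. -/
def contract : Cmd :=
  forTo v 0 .size (
    when (R.at₂ w v =ₙ 1 ∧ₘ R.at₂ v u =ₙ 1 ∧ₘ .neg (v =ₙ u)) (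
      forTo j 0 .size (when (cls.at₁ j =ₙ v) (cls.at₁ j ≔ u)) ;;
      forTo a 0 .size (
        when (F.at₂ v a =ₙ 1) (F.at₂ u a ≔ 1) ;;
        when (F.at₂ a v =ₙ 1) (F.at₂ a u ≔ 1)) ;;
      deleteVertex)) ;;
  F.at₂ u u ≔ 0

/-- The case `f(R(u)) ≥ eta / 2`: apply `fix` to `f_u`. -/
def caseArc : Cmd :=
  forTo v 0 .size (
    .cond (V.at₁ v =ₙ 1 ∧ₘ R.at₂ u v =ₙ 0) (sel.at₁ v ≔ 1) (sel.at₁ v ≔ 0)) ;;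
  load X ;;
  forTo b 0 .size (when (R.at₂ u b =ₙ 1) (insertClass b)) ;;
  forTo j 0 .size (fb.at₁ j ≔ Q.at₁ j) ;;
  top ≔ᵣ fV -ᵣ fu ;;
  sub ≔ᵣ off +ᵣ fu ;;
  fix ;;
  .cond (R.at₂ w u =ₙ 1) contract (F.at₂ u w ≔ 1)

/-- The case `f(R(u)) < eta / 2`: apply `fix` to `f`, move `R(w)` to `X`, and replace `f`
by `f_w`. -/
def caseDelete : Cmd :=
  forTo v 0 .size (sel.at₁ v ≔ V.at₁ v) ;;
  forTo j 0 .size (fb.at₁ j ≔ X.at₁ j) ;;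
  top ≔ᵣ fV ;;
  sub ≔ᵣ off ;;
  fix ;;
  load X ;;
  forTo b 0 .size (when (R.at₂ w b =ₙ 1) (insertClass b)) ;;
  evalQ fV off r₁ ;;
  fV ≔ᵣ fV -ᵣ r₁ ;;
  off ≔ᵣ off +ᵣ r₁ ;;
  forTo v 0 .size (
    when (R.at₂ w v =ₙ 1) (
      forTo j 0 .size (
        when (cls.at₁ j =ₙ v) (
          X.at₁ j ≔ 1 ;;
          cls.at₁ j ≔ .size)) ;;
      deleteVertex))

/-- Initially every element is a vertex, there are no arcs, and `X = ∅`. -/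
def setup : Cmd :=
  forTo j 0 .size (
    X.at₁ j ≔ 0 ;;
    V.at₁ j ≔ 1 ;;
    cls.at₁ j ≔ j ;;
    Q.at₁ j ≔ 1 ;;
    forTo l 0 .size (F.at₂ j l ≔ 0)) ;;
  nV ≔ .size ;;
  off ≔ᵣ 0 ;;
  .query fV Q ;;
  go ≔ 1

/-- The strongly polynomial algorithm for submodular function minimization. Its output is the
set `X`. -/
def algorithm : Cmd :=
  setup ;;
  .loop (0 <ₙ nV ∧ₘ go =ₙ 1) (
    when (0 <ᵣ fV) (fV ≔ᵣ 0) ;;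
    listClasses ;;
    closure ;;
    computeEta ;;
    .cond (eta ≤ᵣ 0) (go ≔ 0) (
      .cond (eta /ᵣ 2 ≤ᵣ fu) caseArc caseDelete)) ;;
  when (fV <ᵣ 0) (
    forTo j 0 .size (when (.neg (cls.at₁ j =ₙ .size)) (X.at₁ j ≔ 1)))

end Program

end SFM

/-!
# Submodular function minimization in time `O(n ^ 7 log n)`

**Programs.** `wp f c σ Q` says that the program `c`, started in the memory `σ`, halts in a memory
`σ'` after a time `t` with `Q σ' t`. The rules of this calculus (`wp_seq`, `wp_cond`, `wp_loop`,
`wp_forTo`) derive termination, correctness and time together: the invariant of a loop speaks of a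
credit `τ`, from which each round has to be paid. `Agree c σ σ'` records which arrays `c` leaves
alone, so that an invariant needs to mention only what changes.

**Finding an element of all minimizers.** Let `x` be a base of the submodular function `g` on `k`
vertices and `φ` a flow with capacities `δ` on all arcs. If the negative part of `z = x - ∂φ` is at
least `g W - k * δ` for some set `W`, then `W` minimizes `g` up to an error of order `k ^ 2 * δ`,
and a vertex `w` with `x w < -k ^ 2 * δ` belongs to every minimizer (`mem_minimizer`): for a
minimizer `Y` without `w`, the negative part of `z` would be at most the sum of `z` over `Y` and
`w`, which is too small. Such a vertex exists if `g` has a value of at most `-η / 2` and `δ` is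
below `η / (2 * k ^ 3)` (`exists_very_negative`). The scaling phases establish the bound for smaller
and smaller `δ`. Within a phase, an augmentation raises the negative part by `δ` (`negSum_augment`),
and weak duality (`negSum_le`) limits the number of augmentations to `O(k ^ 2)`. If no path is left
and every ordering starts with the set `W` of the vertices reachable from the sources, then `W` is
tight for every term of the convex combination (`Family.sum_eq_of_prefix`), which gives the bound
for this `W` (`le_negSum_of_cut`).

**The time of a search.** Between two augmentations the set `W` only grows, so that it is computed
at most `n + 1` times. A push moves an element of `W` one place forward in one ordering (`wp_push`)
and never back, so the potential `Env.pot` pays for it. The set function is defined on classes of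
elements, and it is evaluated incrementally: the cost of a push is proportional to the sizes of the
two classes that are interchanged. The potential weighs vertices accordingly, and since the classes
are disjoint it is only `O(n ^ 2)` for each of the `O(n)` terms. So the search takes time `O(n ^ 3)`
(`wp_scan`, `wp_search`), as does the elimination (`wp_reduce`), a phase takes time `O(n ^ 5)`
(`wp_phase`), and one call of `fix` time `O(n ^ 5 log n)` (`wp_fix`).

**The main loop.** The invariant `Inv` describes the current function by a function `fh` on the
subsets of the ground set, which differs from `f` at most at the whole set. An arc `(u, w)` means
that a minimizer containing `u` contains `w`. With the consistent ordering all components of the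
greedy base are at most `η`, the largest marginal value of a vertex `v` at `R(v) \ {v}`
(`Inv.marginal_le`), which is what the first phase needs. Each iteration finds a new arc, or an arc
that closes a cycle and allows a contraction, or an element of all minimizers (`Inv.addArc`,
`Inv.contract`, `Inv.delete`). In each case the number `progress` of known relations between
elements increases (`progress_lt`), so there are at most `n ^ 2 + n + 1` iterations. If no marginal
value is positive, then adding vertices to a minimizer in a consistent order shows that the whole
set is a minimizer (`Inv.fh_univ_eq`). The product of the two bounds is `time_le`.
-/

namespace SFM

set_option linter.constructorNameAsVariable false
set_option linter.unusedSimpArgs false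
set_option linter.unusedVariables false

open Finset

/-! ### Weakest preconditions with time -/

attribute [simp] NExp.eval RExp.eval BExp.eval NExp.cost RExp.cost BExp.cost

@[simp] theorem NExp.eval_ofNat (n : ℕ) (σ : Mem) (c : ℕ) :
    NExp.eval n σ (OfNat.ofNat c) = c := rfl

@[simp] theorem NExp.cost_ofNat (c : ℕ) : NExp.cost (OfNat.ofNat c) = 1 := rfl

@[simp] theorem RExp.eval_ofNat (n : ℕ) (σ : Mem) (c : ℕ) :
    RExp.eval n σ (OfNat.ofNat c) = c := rfl

@[simp] theorem RExp.cost_ofNat (c : ℕ) : RExp.cost (OfNat.ofNat c) = 2 := rfl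

@[simp] theorem Mem.setNat_nat_self (σ : Mem) (a : NName) (r c v r' c' : ℕ) :
    (σ.setNat a r c v).nat a r' c' = if r' = r ∧ c' = c then v else σ.nat a r' c' := by
  simp [Mem.setNat]

@[simp] theorem Mem.setNat_nat_of_ne (σ : Mem) {a a' : NName} (h : a' ≠ a) (r c v : ℕ) :
    (σ.setNat a r c v).nat a' = σ.nat a' := by
  funext r' c'
  simp [Mem.setNat, h]

@[simp] theorem Mem.setNat_real (σ : Mem) (a : NName) (r c v : ℕ) :
    (σ.setNat a r c v).real = σ.real := rfl

@[simp] theorem Mem.setReal_nat (σ : Mem) (a : RName) (r c : ℕ) (v : ℝ) :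
    (σ.setReal a r c v).nat = σ.nat := rfl

@[simp] theorem Mem.setReal_real_self (σ : Mem) (a : RName) (r c : ℕ) (v : ℝ) (r' c' : ℕ) :
    (σ.setReal a r c v).real a r' c' = if r' = r ∧ c' = c then v else σ.real a r' c' := by
  simp [Mem.setReal]

@[simp] theorem Mem.setReal_real_of_ne (σ : Mem) {a a' : RName} (h : a' ≠ a) (r c : ℕ) (v : ℝ) :
    (σ.setReal a r c v).real a' = σ.real a' := by
  funext r' c'
  simp [Mem.setReal, h]

@[simp] theorem Mem.set_setReal (n : ℕ) (σ : Mem) (a : RName) (r c : ℕ) (v : ℝ) (S : NName) :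
    (σ.setReal a r c v).set n S = σ.set n S := rfl

@[simp] theorem Mem.set_setNat_of_ne (n : ℕ) (σ : Mem) {a S : NName} (h : S ≠ a) (r c v : ℕ) :
    (σ.setNat a r c v).set n S = σ.set n S := by
  simp [Mem.set, h]

theorem Mem.set_congr {n : ℕ} {σ σ' : Mem} {S S' : NName} (h : σ'.nat S' = σ.nat S) :
    σ'.set n S' = σ.set n S := by
  simp [Mem.set, h]

theorem Mem.mem_set {n : ℕ} {σ : Mem} {S : NName} {j : Fin n} :
    j ∈ σ.set n S ↔ σ.nat S j 0 ≠ 0 := by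
  simp [Mem.set]

/-- The natural number arrays that occur as targets of assignments in a program. -/
def Cmd.writesNat : Cmd → NName → Bool
  | skip, _ => false
  | nset ρ _, a => a = ρ.arr
  | rset _ _, _ => false
  | query _ _, _ => false
  | seq c₁ c₂, a => c₁.writesNat a || c₂.writesNat a
  | cond _ c₁ c₂, a => c₁.writesNat a || c₂.writesNat a
  | loop _ c, a => c.writesNat a

/-- The real arrays that occur as targets of assignments in a program. -/
def Cmd.writesReal : Cmd → RName → Bool
  | skip, _ => false
  | nset _ _, _ => false
  | rset ρ _, a => a = ρ.arr
  | query ρ _, a => a = ρ.arr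
  | seq c₁ c₂, a => c₁.writesReal a || c₂.writesReal a
  | cond _ c₁ c₂, a => c₁.writesReal a || c₂.writesReal a
  | loop _ c, a => c.writesReal a

/-- `σ'` differs from `σ` only in arrays that `c` may write to. -/
structure Agree (c : Cmd) (σ σ' : Mem) : Prop where
  nat : ∀ a, c.writesNat a = false → σ'.nat a = σ.nat a
  real : ∀ a, c.writesReal a = false → σ'.real a = σ.real a

theorem Agree.refl (c : Cmd) (σ : Mem) : Agree c σ σ := ⟨fun _ _ => rfl, fun _ _ => rfl⟩

theorem Agree.trans {c : Cmd} {σ₁ σ₂ σ₃ : Mem} (h₁ : Agree c σ₁ σ₂) (h₂ : Agree c σ₂ σ₃) :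
    Agree c σ₁ σ₃ :=
  ⟨fun a h => (h₂.nat a h).trans (h₁.nat a h), fun a h => (h₂.real a h).trans (h₁.real a h)⟩

theorem Agree.mono {c d : Cmd} {σ σ' : Mem} (h : Agree c σ σ')
    (hN : ∀ a, d.writesNat a = false → c.writesNat a = false)
    (hR : ∀ a, d.writesReal a = false → c.writesReal a = false) : Agree d σ σ' :=
  ⟨fun a ha => h.nat a (hN a ha), fun a ha => h.real a (hR a ha)⟩

theorem Exec.agree {n : ℕ} {f : Finset (Fin n) → ℝ} {c : Cmd} {σ σ' : Mem} {t : ℕ}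
    (h : Exec f c σ σ' t) : Agree c σ σ' := by
  induction h with
  | skip σ => exact Agree.refl _ _
  | nset ρ e σ =>
    refine ⟨fun a ha => ?_, fun _ _ => rfl⟩
    have : a ≠ ρ.arr := by simpa [Cmd.writesNat] using ha
    simp [this]
  | rset ρ e σ =>
    refine ⟨fun _ _ => rfl, fun a ha => ?_⟩
    have : a ≠ ρ.arr := by simpa [Cmd.writesReal] using ha
    simp [this]
  | query ρ S σ =>
    refine ⟨fun _ _ => rfl, fun a ha => ?_⟩
    have : a ≠ ρ.arr := by simpa [Cmd.writesReal] using ha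
    simp [this]
  | seq _ _ ih₁ ih₂ =>
    exact (ih₁.mono (by simp +contextual [Cmd.writesNat])
      (by simp +contextual [Cmd.writesReal])).trans
      (ih₂.mono (by simp +contextual [Cmd.writesNat]) (by simp +contextual [Cmd.writesReal]))
  | condTrue _ _ ih =>
    exact ih.mono (by simp +contextual [Cmd.writesNat]) (by simp +contextual [Cmd.writesReal])
  | condFalse _ _ ih =>
    exact ih.mono (by simp +contextual [Cmd.writesNat]) (by simp +contextual [Cmd.writesReal])
  | loopTrue _ _ _ ih₁ ih₂ =>
    exact (ih₁.mono (by simp [Cmd.writesNat]) (by simp [Cmd.writesReal])).trans ih₂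
  | loopFalse _ => exact Agree.refl _ _

/-- `wp f c σ Q`: the program `c`, started in `σ`, halts after some time `t` in a state `σ'`
with `Q σ' t`. -/
def wp {n : ℕ} (f : Finset (Fin n) → ℝ) (c : Cmd) (σ : Mem) (Q : Mem → ℕ → Prop) : Prop :=
  ∃ σ' t, Exec f c σ σ' t ∧ Q σ' t

section

variable {n : ℕ} {f : Finset (Fin n) → ℝ}

/-- The postcondition may use that only arrays written by the program have changed. -/
theorem wp_mono {c : Cmd} {σ : Mem} {Q Q' : Mem → ℕ → Prop} (h : wp f c σ Q)
    (hQ : ∀ σ' t, Q σ' t → Agree c σ σ' → Q' σ' t) : wp f c σ Q' := by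
  obtain ⟨σ', t, he, hq⟩ := h
  exact ⟨σ', t, he, hQ σ' t hq he.agree⟩

@[simp] theorem wp_skip {σ : Mem} {Q : Mem → ℕ → Prop} : wp f .skip σ Q ↔ Q σ 1 :=
  ⟨by rintro ⟨_, _, h, hq⟩; cases h; exact hq, fun h => ⟨_, _, .skip σ, h⟩⟩

@[simp] theorem wp_nset {ρ : NRef} {e : NExp} {σ : Mem} {Q : Mem → ℕ → Prop} :
    wp f (.nset ρ e) σ Q ↔
      Q (σ.setNat ρ.arr (ρ.row.eval n σ) (ρ.col.eval n σ) (e.eval n σ))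
        (ρ.row.cost + ρ.col.cost + e.cost + 1) :=
  ⟨by rintro ⟨_, _, h, hq⟩; cases h; exact hq, fun h => ⟨_, _, .nset ρ e σ, h⟩⟩

@[simp] theorem wp_rset {ρ : RRef} {e : RExp} {σ : Mem} {Q : Mem → ℕ → Prop} :
    wp f (.rset ρ e) σ Q ↔
      Q (σ.setReal ρ.arr (ρ.row.eval n σ) (ρ.col.eval n σ) (e.eval n σ))
        (ρ.row.cost + ρ.col.cost + e.cost + 1) :=
  ⟨by rintro ⟨_, _, h, hq⟩; cases h; exact hq, fun h => ⟨_, _, .rset ρ e σ, h⟩⟩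

@[simp] theorem wp_query {ρ : RRef} {S : NName} {σ : Mem} {Q : Mem → ℕ → Prop} :
    wp f (.query ρ S) σ Q ↔
      Q (σ.setReal ρ.arr (ρ.row.eval n σ) (ρ.col.eval n σ) (f (σ.set n S)))
        (ρ.row.cost + ρ.col.cost + 1) :=
  ⟨by rintro ⟨_, _, h, hq⟩; cases h; exact hq, fun h => ⟨_, _, .query ρ S σ, h⟩⟩

@[simp] theorem wp_seq {c₁ c₂ : Cmd} {σ : Mem} {Q : Mem → ℕ → Prop} :
    wp f (.seq c₁ c₂) σ Q ↔
      wp f c₁ σ (fun σ₁ t₁ => wp f c₂ σ₁ (fun σ₂ t₂ => Q σ₂ (t₁ + t₂))) := by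
  constructor
  · rintro ⟨_, _, h, hq⟩
    cases h with
    | seq h₁ h₂ => exact ⟨_, _, h₁, _, _, h₂, hq⟩
  · rintro ⟨_, _, h₁, _, _, h₂, hq⟩
    exact ⟨_, _, .seq h₁ h₂, hq⟩

theorem wp_cond {b : BExp} {c₁ c₂ : Cmd} {σ : Mem} {Q : Mem → ℕ → Prop}
    (h₁ : b.eval n σ → wp f c₁ σ (fun σ' t => Q σ' (b.cost + 1 + t)))
    (h₂ : ¬ b.eval n σ → wp f c₂ σ (fun σ' t => Q σ' (b.cost + 1 + t))) :
    wp f (.cond b c₁ c₂) σ Q := by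
  by_cases hb : b.eval n σ
  · obtain ⟨_, _, h, hq⟩ := h₁ hb
    exact ⟨_, _, .condTrue hb h, hq⟩
  · obtain ⟨_, _, h, hq⟩ := h₂ hb
    exact ⟨_, _, .condFalse hb h, hq⟩

theorem wp_when {b : BExp} {c : Cmd} {σ : Mem} {Q : Mem → ℕ → Prop}
    (h₁ : b.eval n σ → wp f c σ (fun σ' t => Q σ' (b.cost + 1 + t)))
    (h₂ : ¬ b.eval n σ → Q σ (b.cost + 2)) :
    wp f (when b c) σ Q :=
  wp_cond h₁ fun hb => by simpa using h₂ hb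

/-- The rule for loops, with an amortised account of the time: `P σ τ` is the invariant, with the
credit `τ` still available for the rest of the loop. Every iteration is paid for by credit, which
also proves termination. -/
theorem wp_loop {b : BExp} {c : Cmd} {σ : Mem} {Q : Mem → ℕ → Prop} (P : Mem → ℕ → Prop)
    (τ : ℕ) (h₀ : P σ τ)
    (step : ∀ σ' τ, P σ' τ → Agree c σ σ' → b.eval n σ' →
      wp f c σ' (fun σ'' t => ∃ τ', P σ'' τ' ∧ b.cost + 1 + t + τ' ≤ τ))
    (post : ∀ σ' τ' t, P σ' τ' → Agree c σ σ' → ¬ b.eval n σ' →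
      t + τ' ≤ τ + b.cost + 1 → Q σ' t) :
    wp f (.loop b c) σ Q := by
  suffices H : ∀ τ σ', P σ' τ → Agree c σ σ' → wp f (.loop b c) σ' (fun σ'' t =>
      ∃ τ', P σ'' τ' ∧ Agree c σ σ'' ∧ ¬ b.eval n σ'' ∧ t + τ' ≤ τ + b.cost + 1) by
    obtain ⟨σ'', t, he, τ', hp, ha, hb, ht⟩ := H τ σ h₀ (Agree.refl _ _)
    exact ⟨σ'', t, he, post σ'' τ' t hp ha hb ht⟩
  intro τ
  induction τ using Nat.strong_induction_on with
  | _ τ ih =>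
    intro σ' hp ha
    by_cases hb : b.eval n σ'
    · obtain ⟨σ₁, t₁, he₁, τ₁, hp₁, ht₁⟩ := step σ' τ hp ha hb
      obtain ⟨σ₂, t₂, he₂, τ₂, hp₂, ha₂, hb₂, ht₂⟩ :=
        ih τ₁ (by omega) σ₁ hp₁ (ha.trans he₁.agree)
      exact ⟨σ₂, _, .loopTrue hb he₁ he₂, τ₂, hp₂, ha₂, hb₂, by omega⟩
    · exact ⟨σ', _, .loopFalse hb, τ, hp, ha, hb, by omega⟩

/-- The rule for counting loops. `I j` is the invariant before the iteration with index `j`, and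
`T j` bounds the time of that iteration. -/
theorem wp_forTo {ι : NName} {lo hi : NExp} {body : Cmd} {σ : Mem} {Q : Mem → ℕ → Prop}
    (N : ℕ) (I : ℕ → Mem → Prop) (T : ℕ → ℕ)
    (hι : body.writesNat ι = false)
    (hlo : lo.eval n σ ≤ N)
    (hhi : ∀ σ', Agree (forTo ι lo hi body) σ σ' → hi.eval n σ' = N)
    (h₀ : I (lo.eval n σ) (σ.setNat ι 0 0 (lo.eval n σ)))
    (step : ∀ j σ', lo.eval n σ ≤ j → j < N → I j σ' → σ'.nat ι 0 0 = j →
      Agree (forTo ι lo hi body) σ σ' →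
      wp f body σ' (fun σ'' t => t ≤ T j ∧ I (j + 1) (σ''.setNat ι 0 0 (j + 1))))
    (post : ∀ σ' t, I N σ' → Agree (forTo ι lo hi body) σ σ' →
      t ≤ (∑ j ∈ Ico (lo.eval n σ) N, (T j + (hi.cost + 13))) + lo.cost + hi.cost + 8 →
      Q σ' t) :
    wp f (forTo ι lo hi body) σ Q := by
  have hfor : ∀ σ₁ σ₂, Agree (.nset ι lo) σ σ₁ →
      Agree (.seq body (.nset ι (.add (.get ι 0 0) 1))) σ₁ σ₂ →
      Agree (forTo ι lo hi body) σ σ₂ := fun σ₁ σ₂ h₁ h₂ =>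
    (h₁.mono (d := forTo ι lo hi body) (by simp +contextual [Cmd.writesNat, forTo])
      (by simp +contextual [Cmd.writesReal, forTo])).trans
    (h₂.mono (by simp +contextual [Cmd.writesNat, forTo])
      (by simp +contextual [Cmd.writesReal, forTo]))
  have hset : Agree (.nset ι lo) σ (σ.setNat ι 0 0 (lo.eval n σ)) :=
    (Exec.nset ι lo σ (f := f)).agree
  unfold forTo
  rw [wp_seq, wp_nset]
  refine wp_loop (fun σ' τ => ∃ j, σ'.nat ι 0 0 = j ∧ lo.eval n σ ≤ j ∧ j ≤ N ∧ I j σ' ∧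
    τ = ∑ j ∈ Ico j N, (T j + (hi.cost + 13)))
    (∑ j ∈ Ico (lo.eval n σ) N, (T j + (hi.cost + 13))) ?_ ?_ ?_
  · exact ⟨lo.eval n σ, by simp, le_rfl, hlo, h₀, rfl⟩
  · rintro σ' τ ⟨j, hj, hlj, hjN, hI, rfl⟩ ha hb
    have haf := hfor _ _ hset ha
    have hjN' : j < N := by
      simpa [hj, hhi σ' haf] using hb
    rw [wp_seq]
    refine wp_mono (step j σ' hlj hjN' hI hj haf) ?_
    rintro σ'' t ⟨ht, hI'⟩ ha'
    have hj'' : σ''.nat ι 0 0 = j := by rw [ha'.nat ι hι, hj]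
    rw [wp_nset]
    simp only [NExp.eval_ofNat, NExp.eval, hj'']
    refine ⟨_, ⟨j + 1, by simp, by omega, hjN', hI', rfl⟩, ?_⟩
    rw [sum_eq_sum_Ico_succ_bot hjN']
    simp
    omega
  · rintro σ' τ t ⟨j, hj, hlj, hjN, hI, rfl⟩ ha hb ht
    have haf := hfor _ _ hset ha
    have hjN' : j = N := by
      have : ¬ j < N := by simpa [hj, hhi σ' haf] using hb
      omega
    subst hjN'
    refine post σ' _ hI haf ?_
    simp at ht ⊢
    omega

/-- The rule for counting loops from zero whose iterations have a common time bound. -/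
theorem wp_forTo_zero {ι : NName} {hi : NExp} {body : Cmd} {σ : Mem} {Q : Mem → ℕ → Prop}
    (N : ℕ) (I : ℕ → Mem → Prop) (T : ℕ)
    (hι : body.writesNat ι = false)
    (hhi : ∀ σ', Agree (forTo ι 0 hi body) σ σ' → hi.eval n σ' = N)
    (h₀ : I 0 (σ.setNat ι 0 0 0))
    (step : ∀ j σ', j < N → I j σ' → σ'.nat ι 0 0 = j →
      Agree (forTo ι 0 hi body) σ σ' →
      wp f body σ' (fun σ'' t => t ≤ T ∧ I (j + 1) (σ''.setNat ι 0 0 (j + 1))))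
    (post : ∀ σ' t, I N σ' → Agree (forTo ι 0 hi body) σ σ' →
      t ≤ N * (T + (hi.cost + 13)) + hi.cost + 9 → Q σ' t) :
    wp f (forTo ι 0 hi body) σ Q :=
  wp_forTo N I (fun _ => T) hι (by simp) hhi (by simpa using h₀)
    (fun j σ' _ hj hI hjj ha => step j σ' hj hI hjj ha)
    (fun σ' t hI ha ht => post σ' t hI ha (by simp at ht; omega))

end

/-! ### Evaluation of the current set function -/

/-- The array `me` lists the elements of `C` at the positions `lo, …, hi - 1`. -/
structure Lists {n : ℕ} (me : ℕ → ℕ → ℕ) (lo hi : ℕ) (C : Finset (Fin n)) : Prop where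
  le : lo ≤ hi
  lt : ∀ t, lo ≤ t → t < hi → me t 0 < n
  inj : ∀ t t', lo ≤ t → t < hi → lo ≤ t' → t' < hi → me t 0 = me t' 0 → t = t'
  mem : ∀ j : Fin n, j ∈ C ↔ ∃ t, lo ≤ t ∧ t < hi ∧ me t 0 = j

/-- The arrays `start` and `mem` list the classes `Cl v`. -/
def Listing {n : ℕ} (st me : ℕ → ℕ → ℕ) (Cl : ℕ → Finset (Fin n)) : Prop :=
  ∀ v < n, Lists me (st v 0) (st (v + 1) 0) (Cl v)

/-- `Q` and `cnt` represent the set `B`. -/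
structure QRep {n : ℕ} (σ : Mem) (B : Finset (Fin n)) : Prop where
  set : σ.set n .Q = B
  card : σ.nat .cnt 0 0 = B.card

theorem QRep.congr {n : ℕ} {σ σ' : Mem} {B : Finset (Fin n)} (h : QRep σ B)
    (hQ : σ'.nat .Q = σ.nat .Q) (hc : σ'.nat .cnt = σ.nat .cnt) : QRep σ' B :=
  ⟨(Mem.set_congr hQ).trans h.set, by rw [hc]; exact h.card⟩

theorem Lists.snoc {n : ℕ} {me me' : ℕ → ℕ → ℕ} {lo hi : ℕ} {C : Finset (Fin n)}
    (h : Lists me lo hi C) {j : Fin n} (hj : j ∉ C) (hhi : me' hi 0 = j)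
    (hme : ∀ t < hi, me' t 0 = me t 0) : Lists me' lo (hi + 1) (insert j C) where
  le := h.le.trans (Nat.le_succ _)
  lt t h₁ h₂ := by
    rcases Nat.lt_succ_iff_lt_or_eq.1 h₂ with h₂ | rfl
    · rw [hme t h₂]; exact h.lt t h₁ h₂
    · rw [hhi]; exact j.2
  inj t t' h₁ h₂ h₁' h₂' he := by
    rcases Nat.lt_succ_iff_lt_or_eq.1 h₂ with h₂ | rfl <;>
      rcases Nat.lt_succ_iff_lt_or_eq.1 h₂' with h₂' | rfl
    · rw [hme t h₂, hme t' h₂'] at he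
      exact h.inj t t' h₁ h₂ h₁' h₂' he
    · rw [hme t h₂, hhi] at he
      exact absurd ((h.mem j).2 ⟨t, h₁, h₂, he⟩) hj
    · rw [hme t' h₂', hhi] at he
      exact absurd ((h.mem j).2 ⟨t', h₁', h₂', he.symm⟩) hj
    · rfl
  mem i := by
    rw [mem_insert, h.mem]
    constructor
    · rintro (rfl | ⟨t, h₁, h₂, h₃⟩)
      · exact ⟨hi, h.le, Nat.lt_succ_self _, hhi⟩
      · exact ⟨t, h₁, h₂.trans (Nat.lt_succ_self _), by rw [hme t h₂, h₃]⟩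
    · rintro ⟨t, h₁, h₂, h₃⟩
      rcases Nat.lt_succ_iff_lt_or_eq.1 h₂ with h₂ | rfl
      · exact Or.inr ⟨t, h₁, h₂, by rw [← hme t h₂, h₃]⟩
      · exact Or.inl (Fin.ext (h₃.symm.trans hhi))

theorem Lists.congr {n : ℕ} {me me' : ℕ → ℕ → ℕ} {lo hi : ℕ} {C : Finset (Fin n)}
    (h : Lists me lo hi C) (hme : ∀ t < hi, me' t 0 = me t 0) : Lists me' lo hi C where
  le := h.le
  lt t h₁ h₂ := by rw [hme t h₂]; exact h.lt t h₁ h₂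
  inj t t' h₁ h₂ h₁' h₂' he := by
    rw [hme t h₂, hme t' h₂'] at he
    exact h.inj t t' h₁ h₂ h₁' h₂' he
  mem i := by
    rw [h.mem]
    exact ⟨fun ⟨t, h₁, h₂, h₃⟩ => ⟨t, h₁, h₂, by rw [hme t h₂, h₃]⟩,
      fun ⟨t, h₁, h₂, h₃⟩ => ⟨t, h₁, h₂, by rw [← hme t h₂, h₃]⟩⟩

open scoped Classical in
/-- The elements listed at the positions `lo, …, s - 1`. -/
noncomputable def listed (n : ℕ) (me : ℕ → ℕ → ℕ) (lo s : ℕ) : Finset (Fin n) :=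
  univ.filter fun j => ∃ t, lo ≤ t ∧ t < s ∧ me t 0 = j

theorem listed_self (n : ℕ) (me : ℕ → ℕ → ℕ) (lo : ℕ) : listed n me lo lo = ∅ := by
  ext j
  simp [listed]
  intro t _ _
  omega

section

variable {n : ℕ} {me : ℕ → ℕ → ℕ} {lo hi : ℕ} {C : Finset (Fin n)}

theorem Lists.listed_hi (h : Lists me lo hi C) : listed n me lo hi = C := by
  ext j
  simp [listed, h.mem]

theorem Lists.listed_succ (h : Lists me lo hi C) {s : ℕ} (h₁ : lo ≤ s) (h₂ : s < hi) :
    listed n me lo (s + 1) = insert ⟨me s 0, h.lt s h₁ h₂⟩ (listed n me lo s) := by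
  ext j
  simp only [listed, mem_filter, mem_univ, true_and, mem_insert]
  constructor
  · rintro ⟨t, a, b, c⟩
    rcases Nat.lt_succ_iff_lt_or_eq.1 b with b | rfl
    · exact Or.inr ⟨t, a, b, c⟩
    · exact Or.inl (Fin.ext c.symm)
  · rintro (rfl | ⟨t, a, b, c⟩)
    · exact ⟨s, h₁, Nat.lt_succ_self _, rfl⟩
    · exact ⟨t, a, by omega, c⟩

theorem Lists.notMem_listed (h : Lists me lo hi C) {s : ℕ} (h₁ : lo ≤ s) (h₂ : s < hi) :
    (⟨me s 0, h.lt s h₁ h₂⟩ : Fin n) ∉ listed n me lo s := by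
  simp only [listed, mem_filter, mem_univ, true_and, not_exists, not_and]
  intro t a b c
  have := h.inj t s a (by omega) h₁ h₂ c
  omega

theorem Lists.mem_of (h : Lists me lo hi C) {s : ℕ} (h₁ : lo ≤ s) (h₂ : s < hi) :
    (⟨me s 0, h.lt s h₁ h₂⟩ : Fin n) ∈ C :=
  (h.mem _).2 ⟨s, h₁, h₂, rfl⟩

theorem Lists.card_listed (h : Lists me lo hi C) (s : ℕ) (h₁ : lo ≤ s) (h₂ : s ≤ hi) :
    (listed n me lo s).card = s - lo := by
  induction s, h₁ using Nat.le_induction with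
  | base => simp [listed_self]
  | succ s h₁ ih =>
    rw [h.listed_succ h₁ h₂, card_insert_of_notMem (h.notMem_listed h₁ h₂), ih (by omega)]
    omega

theorem Lists.card (h : Lists me lo hi C) : hi - lo = C.card := by
  rw [← h.listed_hi, h.card_listed hi h.le le_rfl]

end

section

variable {n : ℕ} {f : Finset (Fin n) → ℝ} {σ : Mem} {Q : Mem → ℕ → Prop}

theorem QRep.insert {B : Finset (Fin n)} (h : QRep σ B) {e : Fin n} (he : e ∉ B) {σ' : Mem}
    (hQ : ∀ i : ℕ, i < n → σ'.nat .Q i 0 = if i = e then 1 else σ.nat .Q i 0)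
    (hc : σ'.nat .cnt 0 0 = σ.nat .cnt 0 0 + 1) : QRep σ' (insert e B) := by
  refine ⟨?_, by rw [hc, h.card, card_insert_of_notMem he]⟩
  ext j
  rw [mem_insert, ← h.set, Mem.mem_set, Mem.mem_set, hQ j j.2]
  by_cases hj : j = e
  · simp [hj]
  · simp [hj, Fin.val_inj]

theorem QRep.erase {B : Finset (Fin n)} (h : QRep σ B) {e : Fin n} (he : e ∈ B) {σ' : Mem}
    (hQ : ∀ i : ℕ, i < n → σ'.nat .Q i 0 = if i = e then 0 else σ.nat .Q i 0)
    (hc : σ'.nat .cnt 0 0 = σ.nat .cnt 0 0 - 1) : QRep σ' (B.erase e) := by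
  refine ⟨?_, by rw [hc, h.card, card_erase_of_mem he]⟩
  ext j
  rw [mem_erase, ← h.set, Mem.mem_set, Mem.mem_set, hQ j j.2]
  by_cases hj : j = e
  · simp [hj]
  · simp [hj, Fin.val_inj]

/-- With the classes listed and the flags and the cardinality of the current set maintained, a class
is added in time proportional to its size; this is what makes a push cost only the sizes of the two
classes involved. -/
theorem wp_insertClass {v : NExp} {w : ℕ} {B : Finset (Fin n)} {Cl : ℕ → Finset (Fin n)}
    (hv : ∀ σ', Agree (insertClass v) σ σ' → v.eval n σ' = w) (hcost : v.cost ≤ 10)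
    (hL : Listing (σ.nat .start) (σ.nat .mem) Cl) (hw : w < n) (hB : QRep σ B)
    (hd : Disjoint B (Cl w))
    (post : ∀ σ' t, QRep σ' (B ∪ Cl w) → Agree (insertClass v) σ σ' →
      t ≤ 60 * (Cl w).card + 60 → Q σ' t) :
    wp f (insertClass v) σ Q := by
  have hl := hL w hw
  have hv₀ := hv σ (Agree.refl _ _)
  refine wp_forTo (σ.nat .start (w + 1) 0)
    (fun s σ' => QRep σ' (B ∪ listed n (σ.nat .mem) (σ.nat .start w 0) s)) (fun _ => 30) rfl
    ?_ ?_ ?_ ?_ ?_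
  · simpa [hv₀] using hl.le
  · intro σ' ha
    simp [hv σ' ha, ha.nat .start rfl]
  · simp only [NExp.eval, NExp.eval_ofNat, hv₀, listed_self, union_empty]
    exact hB.congr (by simp) (by simp)
  · intro s σ' h₁ h₂ hI hs ha
    simp only [NExp.eval, hv₀, NExp.eval_ofNat] at h₁
    simp [hs, ha.nat .mem rfl]
    rw [hl.listed_succ h₁ h₂, union_insert]
    refine hI.insert ?_ (fun i hi => by simp) (by simp)
    rw [mem_union, not_or]
    exact ⟨disjoint_right.1 hd (hl.mem_of h₁ h₂), hl.notMem_listed h₁ h₂⟩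
  · intro σ' t hI ha ht
    refine post σ' t (by rwa [hl.listed_hi] at hI) ha ?_
    simp [hv₀] at ht
    rw [hl.card] at ht
    nlinarith

theorem wp_removeClass {v : NExp} {w : ℕ} {B : Finset (Fin n)} {Cl : ℕ → Finset (Fin n)}
    (hv : ∀ σ', Agree (removeClass v) σ σ' → v.eval n σ' = w) (hcost : v.cost ≤ 10)
    (hL : Listing (σ.nat .start) (σ.nat .mem) Cl) (hw : w < n) (hB : QRep σ B)
    (hd : Cl w ⊆ B)
    (post : ∀ σ' t, QRep σ' (B \ Cl w) → Agree (removeClass v) σ σ' →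
      t ≤ 60 * (Cl w).card + 60 → Q σ' t) :
    wp f (removeClass v) σ Q := by
  have hl := hL w hw
  have hv₀ := hv σ (Agree.refl _ _)
  refine wp_forTo (σ.nat .start (w + 1) 0)
    (fun s σ' => QRep σ' (B \ listed n (σ.nat .mem) (σ.nat .start w 0) s)) (fun _ => 30) rfl
    ?_ ?_ ?_ ?_ ?_
  · simpa [hv₀] using hl.le
  · intro σ' ha
    simp [hv σ' ha, ha.nat .start rfl]
  · simp only [NExp.eval, NExp.eval_ofNat, hv₀, listed_self, sdiff_empty]
    exact hB.congr (by simp) (by simp)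
  · intro s σ' h₁ h₂ hI hs ha
    simp only [NExp.eval, hv₀, NExp.eval_ofNat] at h₁
    simp [hs, ha.nat .mem rfl]
    rw [hl.listed_succ h₁ h₂, sdiff_insert]
    refine hI.erase ?_ (fun i hi => by simp) (by simp)
    rw [mem_sdiff]
    exact ⟨hd (hl.mem_of h₁ h₂), hl.notMem_listed h₁ h₂⟩
  · intro σ' t hI ha ht
    refine post σ' t (by rwa [hl.listed_hi] at hI) ha ?_
    simp [hv₀] at ht
    rw [hl.card] at ht
    nlinarith

/-- Loading a set through its membership flags takes linear time. -/
theorem wp_load {S : NName} (h₁ : S ≠ .Q) (h₂ : S ≠ .cnt) (h₃ : S ≠ .j) :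
    wp f (load S) σ (fun σ' t =>
      QRep σ' (σ.set n S) ∧
      t ≤ 60 * n + 60) := by
  unfold load
  simp only [wp_seq, wp_nset]
  refine wp_forTo_zero n (fun j σ' => (∀ i < j, σ'.nat .Q i 0 = σ.nat S i 0) ∧
    σ'.nat .cnt 0 0 = ((σ.set n S).filter fun i : Fin n => (i : ℕ) < j).card) 40 rfl
    (fun _ _ => rfl) (by simp) ?_ ?_
  · intro j σ' hj hI hjj ha
    have hS : σ'.nat S = σ.nat S := by
      rw [ha.nat S (by simp [forTo, when, Cmd.writesNat, h₁, h₂, h₃])]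
      simp [h₂]
    have hfil : ((σ.set n S).filter fun i : Fin n => (i : ℕ) < j + 1) =
        if σ.nat S j 0 = 0 then (σ.set n S).filter fun i : Fin n => (i : ℕ) < j
        else insert ⟨j, hj⟩ ((σ.set n S).filter fun i : Fin n => (i : ℕ) < j) := by
      ext i
      split_ifs with h0
      · simp only [mem_filter, Mem.mem_set, and_congr_right_iff]
        intro hi
        have : (i : ℕ) ≠ j := fun h => hi (h ▸ h0)
        omega
      · simp only [mem_filter, Mem.mem_set, mem_insert, Fin.ext_iff]
        constructor
        · rintro ⟨a, b⟩
          by_cases hij : (i : ℕ) = j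
          · exact Or.inl hij
          · exact Or.inr ⟨a, by omega⟩
        · rintro (a | ⟨a, b⟩)
          · exact ⟨by rw [a]; exact h0, by omega⟩
          · exact ⟨a, by omega⟩
    have hQ : ∀ i < j + 1, (if i = j then σ.nat S j 0 else σ'.nat .Q i 0) = σ.nat S i 0 := by
      intro i hi
      split_ifs with h
      · rw [h]
      · exact hI.1 i (by omega)
    rw [wp_seq, wp_nset]
    refine wp_when ?_ ?_
    · intro hb
      simp [hjj, hS, h₁] at hb
      simp [hjj, hS, hI.2]
      refine ⟨by simpa using hQ, ?_⟩
      have := congrArg card hfil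
      rw [if_neg hb, card_insert_of_notMem (by simp)] at this
      simpa using this.symm
    · intro hb
      simp [hjj, hS, h₁] at hb
      simp [hjj, hS, hI.2]
      refine ⟨by simpa using hQ, ?_⟩
      have := congrArg card hfil
      rw [if_pos hb] at this
      simpa using this.symm
  · intro σ' t hI ha ht
    have hset : σ'.set n .Q = σ.set n S := by
      ext i
      rw [Mem.mem_set, Mem.mem_set, hI.1 i i.2]
    refine ⟨⟨hset, ?_⟩, ?_⟩
    · rw [hI.2, filter_true_of_mem]
      intro i _
      exact i.2
    · simp at ht ⊢
      omega

/-- The set function `fh` that the programs evaluate: it coincides with the oracle, except for its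
value at the whole ground set, which is stored in the memory. -/
theorem wp_evalQ {full shift ρ : RName} {B : Finset (Fin n)} {fh : Finset (Fin n) → ℝ}
    (hB : QRep σ B) (hfh : ∀ S, S ≠ univ → fh S = f S)
    (hfull : σ.real full 0 0 + σ.real shift 0 0 = fh univ) (hne : shift ≠ ρ)
    (post : ∀ t, t ≤ 30 → Q (σ.setReal ρ 0 0 (fh B - σ.real shift 0 0)) t) :
    wp f (evalQ full shift ρ) σ Q := by
  unfold evalQ
  refine wp_cond ?_ ?_
  · intro hb
    simp only [BExp.eval, NExp.eval, NExp.eval_ofNat, hB.card] at hb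
    have hu : B = univ := by
      rw [← card_eq_iff_eq_univ, hb, Fintype.card_fin]
    have : fh B - σ.real shift 0 0 = σ.real full 0 0 := by rw [hu, ← hfull]; ring
    have h := post 12
    rw [this] at h
    simpa using h
  · intro hb
    simp only [BExp.eval, NExp.eval, NExp.eval_ofNat, hB.card] at hb
    have hu : B ≠ univ := by
      rintro rfl
      simp at hb
    rw [hfh B hu] at post
    simp [hB.set, hne]
    convert post 19 (by norm_num) using 1
    unfold Mem.setReal
    ext
    · rfl
    · simp
      split_ifs <;> simp_all

/-- Listing the classes of the map `cls`. -/
theorem wp_listClasses :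
    wp f listClasses σ (fun σ' t =>
      Listing (σ'.nat .start) (σ'.nat .mem) (fun v => univ.filter fun j : Fin n =>
        σ.nat .cls j 0 = v) ∧
      t ≤ 100 * n * n + 100 * n + 100) := by
  set Cl : ℕ → Finset (Fin n) := fun v => univ.filter fun j : Fin n => σ.nat .cls j 0 = v
    with hCl
  unfold listClasses
  simp only [wp_seq, wp_nset]
  refine wp_forTo_zero n (fun v σ' => (∀ u < v, Lists (σ'.nat .mem) (σ'.nat .start u 0)
    (if u + 1 < v then σ'.nat .start (u + 1) 0 else σ'.nat .p₀ 0 0) (Cl u)) ∧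
    (∀ u < v, (if u + 1 < v then σ'.nat .start (u + 1) 0 else σ'.nat .p₀ 0 0) ≤
      σ'.nat .p₀ 0 0)) (60 * n + 60) rfl (fun _ _ => rfl) (by simp) ?_ ?_
  · rintro v σ' hv ⟨hI, hI'⟩ hvv ha
    have hcls : σ'.nat .cls = σ.nat .cls := by rw [ha.nat .cls rfl]; simp
    simp only [wp_seq, wp_nset]
    set p := σ'.nat .p₀ 0 0 with hp
    refine wp_forTo_zero n (fun j σ'' => p ≤ σ''.nat .p₀ 0 0 ∧
      (∀ t < p, σ''.nat .mem t 0 = σ'.nat .mem t 0) ∧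
      Lists (σ''.nat .mem) p (σ''.nat .p₀ 0 0) ((Cl v).filter fun i : Fin n => (i : ℕ) < j)) 40
      rfl (fun _ _ => rfl) ?_ ?_ ?_
    · refine ⟨by simp [hp], by simp, ?_⟩
      simp
      exact ⟨by simp [hp], by omega, by omega, by intro j; simp; omega⟩
    · rintro j σ'' hj ⟨h₁, h₂, h₃⟩ hjj ha'
      have hcls' : σ''.nat .cls = σ.nat .cls := by
        rw [ha'.nat .cls rfl]; simp [hcls]
      have hvv' : σ''.nat .v 0 0 = v := by
        rw [ha'.nat .v rfl]; simp [hvv]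
      refine wp_when ?_ ?_
      · intro hb
        simp [hcls', hvv', hjj] at hb
        simp [hjj]
        refine ⟨by omega, fun t ht => ?_, ?_⟩
        · rw [if_neg (by omega), h₂ t ht]
        · have : ((Cl v).filter fun i : Fin n => (i : ℕ) < j + 1) =
              insert ⟨j, hj⟩ ((Cl v).filter fun i : Fin n => (i : ℕ) < j) := by
            ext i
            simp only [hCl, mem_filter, mem_univ, true_and, mem_insert,
              Fin.ext_iff]
            constructor
            · rintro ⟨a, b⟩
              by_cases hij : (i : ℕ) = j
              · exact Or.inl hij
              · exact Or.inr ⟨a, by omega⟩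
            · rintro (a | ⟨a, b⟩)
              · exact ⟨by rw [a]; exact hb, by omega⟩
              · exact ⟨a, by omega⟩
          simp only [Nat.lt_succ_iff] at this
          rw [this]
          refine h₃.snoc (by simp) (by simp) fun t ht => ?_
          simp
          omega
      · intro hb
        simp [hcls', hvv', hjj] at hb
        simp
        refine ⟨h₁, h₂, ?_⟩
        convert h₃ using 1
        ext i
        simp only [hCl, mem_filter, mem_univ, true_and, and_congr_right_iff]
        intro hi
        have : (i : ℕ) ≠ j := fun h => hb (h ▸ hi)
        omega
    · rintro σ'' t ⟨h₁, h₂, h₃⟩ ha' ht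
      have hst : ∀ u, σ''.nat .start u 0 = if u = v then p else σ'.nat .start u 0 := by
        intro u
        rw [ha'.nat .start rfl]; simp [hvv, hp]
      have hC : ((Cl v).filter fun i : Fin n => (i : ℕ) < n) = Cl v :=
        filter_true_of_mem fun i _ => i.2
      rw [hC] at h₃
      refine ⟨by simp at ht ⊢; omega, ?_, ?_⟩
      · intro u hu
        simp only [Mem.setNat_nat_of_ne, ne_eq, reduceCtorEq, not_false_eq_true, hst]
        rcases Nat.lt_succ_iff_lt_or_eq.1 hu with hu | rfl
        · have hne : u ≠ v := by omega
          rw [if_pos (by omega : u + 1 < v + 1), if_neg hne]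
          have hh := hI u hu
          have hle := hI' u hu
          by_cases huv : u + 1 < v
          · rw [if_pos huv] at hh hle
            rw [if_neg (by omega : ¬ u + 1 = v)]
            exact hh.congr fun t ht => h₂ t (by omega)
          · rw [if_neg huv] at hh hle
            rw [if_pos (by omega : u + 1 = v)]
            exact hh.congr fun t ht => h₂ t (by omega)
        · rw [if_neg (by omega : ¬ u + 1 < u + 1), if_pos rfl]
          exact h₃
      · intro u hu
        simp only [Mem.setNat_nat_of_ne, ne_eq, reduceCtorEq, not_false_eq_true, hst]
        rcases Nat.lt_succ_iff_lt_or_eq.1 hu with hu | rfl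
        · rw [if_pos (by omega)]
          have hle := hI' u hu
          by_cases huv : u + 1 < v
          · rw [if_pos huv] at hle
            rw [if_neg (by omega)]
            omega
          · rw [if_pos (by omega)]
            omega
        · rw [if_neg (by omega)]
  · rintro σ' t ⟨hI, hI'⟩ ha ht
    refine ⟨?_, ?_⟩
    · intro v hv
      have := hI v hv
      simp
      by_cases h : v + 1 < n
      · rw [if_pos h] at this
        rw [if_neg (by omega), if_neg (by omega)]
        exact this
      · rw [if_neg h] at this
        rw [if_neg (by omega), if_pos (by omega)]
        exact this
    · simp at ht ⊢
      nlinarith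

end

/-! ### Extreme bases of submodular functions -/

/-- Submodularity on the subsets of `V`. -/
def SubmodOn (V : Finset ℕ) (g : Finset ℕ → ℝ) : Prop :=
  ∀ Y ⊆ V, ∀ Z ⊆ V, g (Y ∪ Z) + g (Y ∩ Z) ≤ g Y + g Z

/-- `x` is a base of `g`. -/
structure IsBase (V : Finset ℕ) (g : Finset ℕ → ℝ) (x : ℕ → ℝ) : Prop where
  le : ∀ Y ⊆ V, ∑ v ∈ Y, x v ≤ g Y
  eq : ∑ v ∈ V, x v = g V

/-- `L 0, …, L (k - 1)` is an ordering of `V`. -/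
structure Enum (k : ℕ) (L : ℕ → ℕ) (V : Finset ℕ) : Prop where
  mem : ∀ p < k, L p ∈ V
  inj : ∀ p q, p < k → q < k → L p = L q → p = q
  surj : ∀ v ∈ V, ∃ p < k, L p = v

/-- The first `p` elements of an ordering. -/
def pre (L : ℕ → ℕ) (p : ℕ) : Finset ℕ := (range p).image L

/-- `y` is the vector that the greedy algorithm generates from the ordering `L`. -/
def Greedy (g : Finset ℕ → ℝ) (k : ℕ) (L : ℕ → ℕ) (y : ℕ → ℝ) : Prop :=
  ∀ p < k, y (L p) = g (pre L (p + 1)) - g (pre L p)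

@[simp] theorem pre_zero (L : ℕ → ℕ) : pre L 0 = ∅ := rfl

theorem pre_succ (L : ℕ → ℕ) (p : ℕ) : pre L (p + 1) = insert (L p) (pre L p) := by
  simp [pre, range_add_one]

theorem mem_pre {L : ℕ → ℕ} {p v : ℕ} : v ∈ pre L p ↔ ∃ q < p, L q = v := by
  simp [pre]

theorem pre_congr {L L' : ℕ → ℕ} {p : ℕ} (h : ∀ q < p, L' q = L q) : pre L' p = pre L p :=
  image_congr fun q hq => h q (by simpa using hq)

/-- Marginal values decrease. -/
theorem SubmodOn.marginal {V A B : Finset ℕ} {g : Finset ℕ → ℝ} (hg : SubmodOn V g)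
    (hAB : A ⊆ B) (hB : B ⊆ V) {v : ℕ} (hv : v ∈ V) (hvB : v ∉ B) :
    g (insert v B) - g B ≤ g (insert v A) - g A := by
  have h := hg (insert v A) (insert_subset hv (hAB.trans hB)) B hB
  have h₁ : insert v A ∪ B = insert v B := by
    rw [insert_union, union_eq_right.2 hAB]
  have h₂ : insert v A ∩ B = A := by
    rw [insert_inter_of_notMem hvB, inter_eq_left.2 hAB]
  rw [h₁, h₂] at h
  linarith

section

variable {k m : ℕ} {L L' : ℕ → ℕ} {V : Finset ℕ} {g : Finset ℕ → ℝ} {y y' : ℕ → ℝ}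

theorem Enum.congr (h : Enum k L V) (hL : ∀ p < k, L' p = L p) : Enum k L' V where
  mem p hp := by rw [hL p hp]; exact h.mem p hp
  inj p q hp hq he := h.inj p q hp hq (by rwa [hL p hp, hL q hq] at he)
  surj v hv := by
    obtain ⟨p, hp, he⟩ := h.surj v hv
    exact ⟨p, hp, by rw [hL p hp, he]⟩

theorem Enum.pre_subset (h : Enum k L V) {p : ℕ} (hp : p ≤ k) : pre L p ⊆ V := by
  intro v hv
  obtain ⟨q, hq, rfl⟩ := mem_pre.1 hv
  exact h.mem q (by omega)

theorem Enum.notMem_pre (h : Enum k L V) {p q : ℕ} (hp : p < k) (hq : q ≤ p) :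
    L p ∉ pre L q := by
  intro hv
  obtain ⟨r, hr, he⟩ := mem_pre.1 hv
  have := h.inj r p (by omega) hp he
  omega

theorem Enum.pre_eq (h : Enum k L V) : pre L k = V :=
  Subset.antisymm (h.pre_subset le_rfl) fun v hv => mem_pre.2 (h.surj v hv)

theorem Enum.sum {M : Type*} [AddCommMonoid M] (h : Enum k L V) (w : ℕ → M) :
    ∑ p ∈ range k, w (L p) = ∑ v ∈ V, w v := by
  rw [← h.pre_eq, pre, sum_image]
  intro p hp q hq he
  exact h.inj p q (by simpa using hp) (by simpa using hq) he

theorem Enum.card (h : Enum k L V) : V.card = k := by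
  rw [card_eq_sum_ones, ← h.sum]
  simp

theorem Greedy.congr (hL : Enum k L V) (h : Greedy g k L y) (hL' : ∀ p < k, L' p = L p)
    (hy : ∀ v ∈ V, y' v = y v) : Greedy g k L' y' := by
  intro p hp
  rw [hL' p hp, hy _ (hL.mem p hp), h p hp, pre_congr fun q hq => hL' q (by omega),
    pre_congr fun q hq => hL' q (by omega)]

theorem Greedy.sum_pre (hL : Enum k L V) (h : Greedy g k L y) (h0 : g ∅ = 0) {p : ℕ}
    (hp : p ≤ k) : ∑ v ∈ pre L p, y v = g (pre L p) := by
  induction p with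
  | zero => simp [h0]
  | succ p ih =>
    rw [pre_succ, sum_insert (hL.notMem_pre hp le_rfl), ih (by omega), h p hp, pre_succ]
    ring

/-- The greedy algorithm generates a base of a submodular function. -/
theorem Greedy.isBase (hL : Enum k L V) (hg : SubmodOn V g) (h0 : g ∅ = 0)
    (h : Greedy g k L y) : IsBase V g y := by
  have key : ∀ p ≤ k, ∀ Y ⊆ pre L p, ∑ v ∈ Y, y v ≤ g Y := by
    intro p
    induction p with
    | zero =>
      intro _ Y hY
      rw [pre_zero, subset_empty] at hY
      simp [hY, h0]
    | succ p ih =>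
      intro hp Y hY
      by_cases hv : L p ∈ Y
      · have hsub : Y.erase (L p) ⊆ pre L p := by
          rw [pre_succ] at hY
          rwa [← subset_insert_iff]
        have h₁ := ih (by omega) _ hsub
        have h₂ := hg.marginal hsub (hL.pre_subset (by omega)) (hL.mem p hp)
          (hL.notMem_pre hp le_rfl)
        rw [insert_erase hv, ← pre_succ, ← h p hp] at h₂
        have h₃ := add_sum_erase Y y hv
        linarith
      · refine ih (by omega) Y fun v hvY => ?_
        have := hY hvY
        rw [pre_succ, mem_insert] at this
        rcases this with rfl | this
        · exact absurd hvY hv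
        · exact this
  refine ⟨fun Y hY => key k le_rfl Y (by rwa [hL.pre_eq]), ?_⟩
  have := h.sum_pre hL h0 le_rfl
  rwa [hL.pre_eq] at this

theorem pre_swap_succ {q : ℕ} (hq : q + 1 < k) (h₁ : L' q = L (q + 1))
    (h₃ : ∀ p < k, p ≠ q → p ≠ q + 1 → L' p = L p) :
    pre L' (q + 1) = insert (L (q + 1)) (pre L q) := by
  rw [pre_succ, h₁, pre_congr fun p hp => h₃ p (by omega) (by omega) (by omega)]

section Swap

variable {q : ℕ} (hq : q + 1 < k) (h₁ : L' q = L (q + 1)) (h₂ : L' (q + 1) = L q)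
  (h₃ : ∀ p < k, p ≠ q → p ≠ q + 1 → L' p = L p)

include hq h₁ h₂ h₃

theorem Enum.swap (h : Enum k L V) : Enum k L' V := by
  have hs : ∀ p < k, L' p = L (Equiv.swap q (q + 1) p) := by
    intro p hp
    by_cases hpq : p = q
    · rw [hpq, h₁, Equiv.swap_apply_left]
    by_cases hpq' : p = q + 1
    · rw [hpq', h₂, Equiv.swap_apply_right]
    rw [h₃ p hp hpq hpq', Equiv.swap_apply_of_ne_of_ne hpq hpq']
  have hlt : ∀ p < k, Equiv.swap q (q + 1) p < k := by
    intro p hp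
    rw [Equiv.swap_apply_def]
    split_ifs <;> omega
  refine ⟨fun p hp => ?_, fun p p' hp hp' he => ?_, fun v hv => ?_⟩
  · rw [hs p hp]; exact h.mem _ (hlt p hp)
  · rw [hs p hp, hs p' hp'] at he
    exact (Equiv.swap q (q + 1)).injective (h.inj _ _ (hlt p hp) (hlt p' hp') he)
  · obtain ⟨p, hp, he⟩ := h.surj v hv
    exact ⟨_, hlt p hp, by rw [hs _ (hlt p hp), Equiv.swap_apply_self, he]⟩

theorem pre_swap_of_ne {p : ℕ} (hp : p ≤ k) (hpq : p ≠ q + 1) : pre L' p = pre L p := by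
  rcases Nat.lt_or_ge p (q + 1) with h | h
  · exact pre_congr fun r hr => h₃ r (by omega) (by omega) (by omega)
  · have hp' : q + 2 ≤ p := by omega
    clear h hpq
    induction p, hp' using Nat.le_induction with
    | base =>
      rw [pre_succ, h₂, pre_swap_succ hq h₁ h₃, pre_succ, pre_succ, insert_comm]
    | succ p hp' ih =>
      rw [pre_succ, pre_succ, ih (by omega), h₃ p (by omega) (by omega) (by omega)]

/-- Interchanging two neighbours of an ordering changes the extreme base by a multiple of the
difference of two unit vectors; the multiplier is the exchange capacity `c`. -/
theorem Greedy.swap (hL : Enum k L V) (h : Greedy g k L y) {c : ℝ}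
    (hc : c = g (insert (L (q + 1)) (pre L q)) - g (pre L (q + 2)) + y (L q))
    (hu : y' (L (q + 1)) = y (L (q + 1)) + c) (hv : y' (L q) = y (L q) - c)
    (hy : ∀ v ∈ V, v ≠ L q → v ≠ L (q + 1) → y' v = y v) : Greedy g k L' y' := by
  have hu' := h (q + 1) hq
  have hv' := h q (by omega)
  intro p hp
  by_cases hpq : p = q
  · subst hpq
    rw [h₁, pre_swap_succ hq h₁ h₃, pre_swap_of_ne hq h₁ h₂ h₃ (by omega) (by omega), hu, hc,
      hu', hv']
    ring
  by_cases hpq' : p = q + 1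
  · subst hpq'
    rw [h₂, pre_swap_succ hq h₁ h₃, pre_swap_of_ne hq h₁ h₂ h₃ (by omega) (by omega), hv, hc]
    ring
  · rw [h₃ p hp hpq hpq', pre_swap_of_ne hq h₁ h₂ h₃ (by omega) (by omega),
      pre_swap_of_ne hq h₁ h₂ h₃ (by omega) (by omega), hy _ (hL.mem p hp), h p hp]
    · exact fun he => hpq (hL.inj p q hp (by omega) he)
    · exact fun he => hpq' (hL.inj p (q + 1) hp (by omega) he)

end Swap

/-- The exchange capacity of two neighbours of an ordering is nonnegative. -/
theorem Greedy.exchange_nonneg (hL : Enum k L V) (hg : SubmodOn V g) (h : Greedy g k L y)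
    {q : ℕ} (hq : q + 1 < k) :
    0 ≤ g (insert (L (q + 1)) (pre L q)) - g (pre L (q + 2)) + y (L q) := by
  have := hg.marginal (A := pre L q) (B := pre L (q + 1)) (by rw [pre_succ]; simp)
    (hL.pre_subset (by omega)) (hL.mem _ hq) (hL.notMem_pre hq le_rfl)
  rw [← pre_succ] at this
  rw [h q (by omega)]
  linarith

end

/-! ### Convex combinations of extreme bases -/

/-- `x` is the convex combination with coefficients `lam` of the extreme bases `y i` generated by
the orderings `L i`, for `i < m`. The vectors `lam` and `x` are stored in columns `0`. -/
structure Family (V : Finset ℕ) (g : Finset ℕ → ℝ) (k m : ℕ) (L : ℕ → ℕ → ℕ)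
    (y lam x : ℕ → ℕ → ℝ) : Prop where
  enum : ∀ i < m, Enum k (L i) V
  greedy : ∀ i < m, Greedy g k (L i) (y i)
  nonneg : ∀ i < m, 0 ≤ lam i 0
  one : ∑ i ∈ range m, lam i 0 = 1
  comb : ∀ v ∈ V, x v 0 = ∑ i ∈ range m, lam i 0 * y i v

theorem sum_range_of_eq_off {M : Type*} [AddCommGroup M] {m i : ℕ} (hi : i < m) {a b : ℕ → M}
    (h : ∀ j < m, j ≠ i → b j = a j) :
    ∑ j ∈ range m, b j = ∑ j ∈ range m, a j + (b i - a i) := by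
  rw [← add_sum_erase _ b (mem_range.2 hi),
    ← add_sum_erase _ a (mem_range.2 hi),
    sum_congr rfl fun j hj => h j (by simp at hj; exact hj.2) (by simp at hj; exact hj.1)]
  abel

section

variable {V : Finset ℕ} {g : Finset ℕ → ℝ} {k m : ℕ} {L L' : ℕ → ℕ → ℕ}
  {y y' lam lam' x x' : ℕ → ℕ → ℝ}

/-- Convex combinations of bases are bases. -/
theorem Family.isBase (h : Family V g k m L y lam x) (hg : SubmodOn V g) (h0 : g ∅ = 0) :
    IsBase V g (fun v => x v 0) := by
  have hb : ∀ i < m, IsBase V g (y i) := fun i hi =>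
    (h.greedy i hi).isBase (h.enum i hi) hg h0
  have hsum : ∀ Y ⊆ V, ∑ v ∈ Y, x v 0 = ∑ i ∈ range m, lam i 0 * ∑ v ∈ Y, y i v := by
    intro Y hY
    rw [sum_congr rfl fun v hv => h.comb v (hY hv), sum_comm]
    simp_rw [mul_sum]
  refine ⟨fun Y hY => ?_, ?_⟩
  · simp only [hsum Y hY]
    calc _ ≤ ∑ i ∈ range m, lam i 0 * g Y := sum_le_sum fun i hi => by
          have hi := mem_range.1 hi
          exact mul_le_mul_of_nonneg_left ((hb i hi).le Y hY) (h.nonneg i hi)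
      _ = g Y := by rw [← sum_mul, h.one, one_mul]
  · simp only [hsum V subset_rfl]
    rw [sum_congr rfl fun i hi => by rw [(hb i (mem_range.1 hi)).eq],
      ← sum_mul, h.one, one_mul]

/-- If every ordering starts with the elements of `W`, then the constraint of `W` is tight. -/
theorem Family.sum_eq_of_prefix (h : Family V g k m L y lam x) (h0 : g ∅ = 0) {W : Finset ℕ}
    (hW : ∀ i < m, ∃ p ≤ k, pre (L i) p = W) (hWV : W ⊆ V) : ∑ v ∈ W, x v 0 = g W := by
  rw [sum_congr rfl fun v hv => h.comb v (hWV hv), sum_comm]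
  have : ∀ i ∈ range m, ∑ v ∈ W, lam i 0 * y i v = lam i 0 * g W := by
    intro i hi
    have hi := mem_range.1 hi
    obtain ⟨p, hp, rfl⟩ := hW i hi
    rw [← mul_sum, (h.greedy i hi).sum_pre (h.enum i hi) h0 hp]
  rw [sum_congr rfl this, ← sum_mul, h.one, one_mul]

theorem Family.congr (h : Family V g k m L y lam x)
    (hL : ∀ i < m, ∀ p < k, L' i p = L i p) (hy : ∀ i < m, ∀ v ∈ V, y' i v = y i v)
    (hlam : ∀ i < m, lam' i 0 = lam i 0) (hx : ∀ v ∈ V, x' v 0 = x v 0) :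
    Family V g k m L' y' lam' x' where
  enum i hi := (h.enum i hi).congr (hL i hi)
  greedy i hi := (h.greedy i hi).congr (h.enum i hi) (hL i hi) (hy i hi)
  nonneg i hi := by rw [hlam i hi]; exact h.nonneg i hi
  one := by
    rw [← h.one]
    exact sum_congr rfl fun i hi => hlam i (mem_range.1 hi)
  comb v hv := by
    rw [hx v hv, h.comb v hv]
    refine sum_congr rfl fun i hi => ?_
    have hi := mem_range.1 hi
    rw [hlam i hi, hy i hi v hv]

/-- Splitting the term `i` of the combination into two. -/
theorem Family.split (h : Family V g k m L y lam x) {i : ℕ} (hi : i < m) {β : ℝ} (hβ : 0 ≤ β)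
    (hβ' : β ≤ lam i 0)
    (hL : ∀ j < m, ∀ p < k, L' j p = L j p) (hLm : ∀ p < k, L' m p = L i p)
    (hy : ∀ j < m, ∀ v ∈ V, y' j v = y j v) (hym : ∀ v ∈ V, y' m v = y i v)
    (hlam : ∀ j < m, j ≠ i → lam' j 0 = lam j 0) (hlami : lam' i 0 = β)
    (hlamm : lam' m 0 = lam i 0 - β) : Family V g k (m + 1) L' y' lam' x where
  enum j hj := by
    rcases Nat.lt_succ_iff_lt_or_eq.1 hj with hj | rfl
    · exact (h.enum j hj).congr (hL j hj)
    · exact (h.enum i hi).congr hLm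
  greedy j hj := by
    rcases Nat.lt_succ_iff_lt_or_eq.1 hj with hj | rfl
    · exact (h.greedy j hj).congr (h.enum j hj) (hL j hj) (hy j hj)
    · exact (h.greedy i hi).congr (h.enum i hi) hLm hym
  nonneg j hj := by
    rcases Nat.lt_succ_iff_lt_or_eq.1 hj with hj | rfl
    · by_cases hji : j = i
      · rw [hji, hlami]; exact hβ
      · rw [hlam j hj hji]; exact h.nonneg j hj
    · rw [hlamm]; linarith
  one := by
    rw [sum_range_succ, sum_range_of_eq_off hi (a := fun j => lam j 0) hlam, h.one, hlami,
      hlamm]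
    ring
  comb v hv := by
    rw [sum_range_succ, sum_range_of_eq_off hi (a := fun j => lam j 0 * y j v), hlami,
      hlamm, hy i hi v hv, hym v hv, h.comb v hv]
    · ring
    · intro j hj hji
      rw [hlam j hj hji, hy j hj v hv]

/-- The effect of a push on the convex combination. -/
theorem Family.push (h : Family V g k m L y lam x) {i q : ℕ} (hi : i < m) (hq : q + 1 < k)
    {c : ℝ} (hc : c = g (insert (L i (q + 1)) (pre (L i) q)) - g (pre (L i) (q + 2)) + y i (L i q))
    (hL : ∀ j < m, j ≠ i → ∀ p < k, L' j p = L j p)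
    (h₁ : L' i q = L i (q + 1)) (h₂ : L' i (q + 1) = L i q)
    (h₃ : ∀ p < k, p ≠ q → p ≠ q + 1 → L' i p = L i p)
    (hy : ∀ j < m, j ≠ i → ∀ v ∈ V, y' j v = y j v)
    (hyi : ∀ v ∈ V, y' i v =
      y i v + (if v = L i (q + 1) then c else 0) - (if v = L i q then c else 0))
    (hx : ∀ v ∈ V, x' v 0 = x v 0 + (if v = L i (q + 1) then lam i 0 * c else 0) -
      (if v = L i q then lam i 0 * c else 0)) :
    Family V g k m L' y' lam x' where
  enum j hj := by
    by_cases hji : j = i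
    · subst hji
      exact (h.enum j hj).swap hq h₁ h₂ h₃
    · exact (h.enum j hj).congr (hL j hj hji)
  greedy j hj := by
    by_cases hji : j = i
    · subst hji
      have hne : L j (q + 1) ≠ L j q := fun he => by
        have := (h.enum j hj).inj _ _ hq (by omega) he
        omega
      refine (h.greedy j hj).swap hq h₁ h₂ h₃ (h.enum j hj) hc ?_ ?_ ?_
      · rw [hyi _ ((h.enum j hj).mem _ hq), if_pos rfl, if_neg hne]; ring
      · rw [hyi _ ((h.enum j hj).mem _ (by omega)), if_pos rfl, if_neg hne.symm]; ring
      · intro v hv hv₁ hv₂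
        rw [hyi v hv, if_neg hv₁, if_neg hv₂]; ring
    · exact (h.greedy j hj).congr (h.enum j hj) (hL j hj hji) (hy j hj hji)
  nonneg := h.nonneg
  one := h.one
  comb v hv := by
    rw [sum_range_of_eq_off hi (a := fun j => lam j 0 * y j v), ← h.comb v hv, hx v hv, hyi v hv]
    · split_ifs <;> ring
    · intro j hj hji
      rw [hy j hj hji v hv]

end

/-! ### Flows -/

/-- The net inflow of the vertex `v`. -/
def net (V : Finset ℕ) (φ : ℕ → ℕ → ℝ) (v : ℕ) : ℝ := ∑ a ∈ V, φ a v

/-- `φ` is a skew-symmetric flow with capacities `δ`. -/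
structure IsFlow (V : Finset ℕ) (δ : ℝ) (φ : ℕ → ℕ → ℝ) : Prop where
  skew : ∀ a ∈ V, ∀ b ∈ V, φ b a = -φ a b
  le : ∀ a ∈ V, ∀ b ∈ V, φ a b ≤ δ

/-- The sum of the negative parts. -/
def negSum (V : Finset ℕ) (z : ℕ → ℝ) : ℝ := ∑ v ∈ V, min (z v) 0

section

variable {V : Finset ℕ} {δ : ℝ} {φ : ℕ → ℕ → ℝ} {g : Finset ℕ → ℝ}

theorem IsFlow.neg_le (h : IsFlow V δ φ) {a b : ℕ} (ha : a ∈ V) (hb : b ∈ V) : -δ ≤ φ a b := by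
  have := h.le b hb a ha
  rw [h.skew a ha b hb] at this
  linarith

theorem IsFlow.nonneg (h : IsFlow V δ φ) {a : ℕ} (ha : a ∈ V) : 0 ≤ δ := by
  have h₁ := h.neg_le ha ha
  have h₂ := h.le a ha a ha
  linarith

theorem IsFlow.self (h : IsFlow V δ φ) {a : ℕ} (ha : a ∈ V) : φ a a = 0 := by
  have := h.skew a ha a ha
  linarith

theorem IsFlow.abs_net_le (h : IsFlow V δ φ) {v : ℕ} (hv : v ∈ V) :
    |net V φ v| ≤ ((V.card : ℝ) - 1) * δ := by
  rw [net, ← add_sum_erase _ _ hv, h.self hv, zero_add]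
  refine (abs_sum_le_sum_abs _ _).trans ?_
  have : ∀ a ∈ V.erase v, |φ a v| ≤ δ := fun a ha =>
    abs_le.2 ⟨h.neg_le (mem_of_mem_erase ha) hv, h.le a (mem_of_mem_erase ha) v hv⟩
  refine (sum_le_card_nsmul _ _ _ this).trans (le_of_eq ?_)
  rw [nsmul_eq_mul, card_erase_of_mem hv,
    Nat.cast_pred (card_pos.2 ⟨v, hv⟩)]

/-- The net inflow of `W` comes through the arcs that enter `W`. -/
theorem IsFlow.sum_net (h : IsFlow V δ φ) {W : Finset ℕ} (hW : W ⊆ V) :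
    ∑ v ∈ W, net V φ v = ∑ v ∈ W, ∑ a ∈ V \ W, φ a v := by
  have h₁ : ∀ v ∈ W, net V φ v = ∑ a ∈ W, φ a v + ∑ a ∈ V \ W, φ a v := fun v _ => by
    rw [net, add_comm, sum_sdiff hW]
  rw [sum_congr rfl h₁, sum_add_distrib]
  have h₂ : ∑ v ∈ W, ∑ a ∈ W, φ a v = -∑ v ∈ W, ∑ a ∈ W, φ a v := by
    conv_lhs => rw [sum_comm]
    rw [← sum_neg_distrib]
    refine sum_congr rfl fun v hv => ?_
    rw [← sum_neg_distrib]
    exact sum_congr rfl fun a ha => h.skew a (hW ha) v (hW hv)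
  linarith

theorem negSum_sub_le {z z' : ℕ → ℝ} {d : ℝ} (h : ∀ v ∈ V, |z v - z' v| ≤ d) :
    negSum V z - V.card * d ≤ negSum V z' := by
  have : negSum V z ≤ ∑ v ∈ V, (min (z' v) 0 + d) := by
    refine sum_le_sum fun v hv => ?_
    have h₁ := (abs_le.1 (h v hv)).2
    have h₂ : 0 ≤ d := (abs_nonneg _).trans (h v hv)
    rw [← min_add_add_right]
    exact min_le_min (by linarith) (by linarith)
  rw [sum_add_distrib, sum_const, nsmul_eq_mul] at this
  unfold negSum at this ⊢
  linarith

theorem negSum_le_sum {W : Finset ℕ} (hW : W ⊆ V) (z : ℕ → ℝ) : negSum V z ≤ ∑ v ∈ W, z v := by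
  calc negSum V z ≤ ∑ v ∈ W, min (z v) 0 := by
        rw [negSum, ← sum_sdiff hW]
        have : ∑ v ∈ V \ W, min (z v) 0 ≤ 0 := sum_nonpos fun v _ => min_le_right _ _
        linarith
    _ ≤ _ := sum_le_sum fun v _ => min_le_left _ _

/-- When no augmenting path is left, the negative part of `z` is close to the value of the set
`W`. -/
theorem le_negSum_of_cut (h : IsFlow V δ φ) (hδ : 0 ≤ δ) {x z : ℕ → ℝ} {W : Finset ℕ}
    (hW : W ⊆ V) (hx : ∑ v ∈ W, x v = g W) (hz : ∀ v ∈ V, z v = x v - net V φ v)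
    (h₁ : ∀ v ∈ W, z v < δ) (h₂ : ∀ v ∈ V, v ∉ W → -δ < z v)
    (h₃ : ∀ a ∈ W, ∀ b ∈ V, b ∉ W → 0 < φ a b) :
    g W - V.card * δ ≤ negSum V z := by
  have hnet : ∑ v ∈ W, net V φ v ≤ 0 := by
    rw [h.sum_net hW]
    refine sum_nonpos fun v hv => sum_nonpos fun a ha => ?_
    obtain ⟨ha, ha'⟩ := mem_sdiff.1 ha
    rw [h.skew v (hW hv) a ha]
    linarith [h₃ v hv a ha ha']
  have hzW : g W ≤ ∑ v ∈ W, z v := by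
    rw [sum_congr rfl fun v hv => hz v (hW hv), sum_sub_distrib, hx]
    linarith
  have hle : ∑ v ∈ W, z v ≤ ∑ v ∈ V, (min (z v) 0 + δ) := by
    rw [← sum_sdiff hW]
    have e₁ : ∑ v ∈ W, z v ≤ ∑ v ∈ W, (min (z v) 0 + δ) := sum_le_sum fun v hv => by
      rcases min_choice (z v) 0 with h | h <;> rw [h]
      · linarith
      · linarith [h₁ v hv]
    have e₂ : 0 ≤ ∑ v ∈ V \ W, (min (z v) 0 + δ) := sum_nonneg fun v hv => by
      obtain ⟨hv, hv'⟩ := mem_sdiff.1 hv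
      rcases min_choice (z v) 0 with h | h <;> rw [h]
      · linarith [h₂ v hv hv']
      · linarith
    linarith
  rw [sum_add_distrib, sum_const, nsmul_eq_mul] at hle
  rw [negSum]
  linarith

/-- Weak duality. -/
theorem negSum_le (h : IsFlow V δ φ) (hδ : 0 ≤ δ) {x z : ℕ → ℝ} (hx : IsBase V g x)
    (hz : ∀ v ∈ V, z v = x v - net V φ v) {W : Finset ℕ} (hW : W ⊆ V) :
    negSum V z ≤ g W + V.card * V.card * δ := by
  refine (negSum_le_sum hW z).trans ?_
  have : ∑ v ∈ W, z v ≤ ∑ v ∈ W, (x v + V.card * δ) := sum_le_sum fun v hv => by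
    rw [hz v (hW hv)]
    have := (abs_le.1 (h.abs_net_le (hW hv))).1
    linarith
  rw [sum_add_distrib, sum_const, nsmul_eq_mul] at this
  have h₁ := hx.le W hW
  have h₂ : (W.card : ℝ) ≤ V.card := by exact_mod_cast card_le_card hW
  have h₃ : (W.card : ℝ) * (V.card * δ) ≤ V.card * (V.card * δ) :=
    mul_le_mul_of_nonneg_right h₂ (by positivity)
  linarith

/-- An augmentation by `δ` along a path from `s` to `t` increases the negative part by `δ`. -/
theorem negSum_augment (hδ : 0 ≤ δ) {z z' : ℕ → ℝ} {s t : ℕ} (hs : s ∈ V)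
    (hzs : z s ≤ -δ) (hzt : δ ≤ z t)
    (hz' : ∀ v ∈ V, z' v = z v + (if v = s then δ else 0) - (if v = t then δ else 0)) :
    negSum V z + δ ≤ negSum V z' := by
  have : ∑ v ∈ V, (min (z v) 0 + (if v = s then δ else 0)) ≤ negSum V z' := by
    refine sum_le_sum fun v hv => ?_
    rw [hz' v hv]
    by_cases h₁ : v = s <;> by_cases h₂ : v = t <;> simp only [h₁, h₂, if_true, if_false]
    · subst h₁; subst h₂
      have : δ = 0 := by linarith
      simp [this]
    · subst h₁
      rw [if_neg h₂, min_eq_left (by linarith : z v ≤ 0)]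
      exact le_min (by linarith) (by linarith)
    · subst h₂
      rw [if_neg h₁, min_eq_right (by linarith : 0 ≤ z v)]
      exact le_min (by linarith) (by linarith)
    · simp
  rw [sum_add_distrib, sum_ite_eq' V s, if_pos hs] at this
  exact this

/-- A vertex with a sufficiently negative component belongs to every minimizer. -/
theorem mem_minimizer (h : IsFlow V δ φ) (hδ : 0 ≤ δ) {x z : ℕ → ℝ} (hx : IsBase V g x)
    (hz : ∀ v ∈ V, z v = x v - net V φ v) {W : Finset ℕ} (hW : W ⊆ V)
    (hzW : g W - V.card * δ ≤ negSum V z) {w : ℕ} (hw : w ∈ V)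
    (hxw : x w < -(V.card * V.card * δ)) {Y : Finset ℕ} (hY : Y ⊆ V)
    (hmin : ∀ Z ⊆ V, g Y ≤ g Z) : w ∈ Y := by
  by_contra hwY
  have h₁ : negSum V z - V.card * (((V.card : ℝ) - 1) * δ) ≤ negSum V x := by
    refine negSum_sub_le fun v hv => ?_
    rw [hz v hv, sub_right_comm, sub_self, zero_sub, abs_neg]
    exact h.abs_net_le hv
  have h₂ := negSum_le_sum (V := V) (W := insert w Y) (insert_subset hw hY) x
  rw [sum_insert hwY] at h₂
  have h₃ := hx.le Y hY
  have h₄ := hmin W hW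
  nlinarith

/-- If some set has a value of at most `-η / 2`, then a base has a very negative component as soon as
`δ` is below `η / (2 k ^ 3)`. -/
theorem exists_very_negative {η : ℝ} {x : ℕ → ℝ} (hx : IsBase V g x) {Y : Finset ℕ} (hY : Y ⊆ V)
    (hgY : g Y ≤ -(η / 2)) (hδ : 0 ≤ δ) (hη : V.card * V.card * V.card * δ < η / 2) :
    ∃ w ∈ V, x w < -(V.card * V.card * δ) := by
  by_contra! hc
  have h₁ : ∑ v ∈ Y, -(V.card * V.card * δ) ≤ ∑ v ∈ Y, x v :=
    sum_le_sum fun v hv => hc v (hY hv)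
  rw [sum_const, nsmul_eq_mul] at h₁
  have h₂ := hx.le Y hY
  have h₃ : (Y.card : ℝ) ≤ V.card := by exact_mod_cast card_le_card hY
  have h₄ : (Y.card : ℝ) * (V.card * V.card * δ) ≤ V.card * (V.card * V.card * δ) :=
    mul_le_mul_of_nonneg_right h₃ (by positivity)
  linarith

/-- The bound with which the first scaling phase starts: the base of a consistent ordering has no
component above `η`, and the flow is zero. -/
theorem le_negSum_of_le {η : ℝ} (hη : 0 ≤ η) {x : ℕ → ℝ} (hx : IsBase V g x)
    (h : ∀ v ∈ V, x v ≤ η) : g V - V.card * η ≤ negSum V x := by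
  have : ∑ v ∈ V, (x v - η) ≤ negSum V x := sum_le_sum fun v hv =>
    le_min (by linarith) (by linarith [h v hv])
  rw [sum_sub_distrib, hx.eq, sum_const, nsmul_eq_mul] at this
  exact this

end

variable {n : ℕ} {f : Finset (Fin n) → ℝ} {σ : Mem} {Q : Mem → ℕ → Prop}

theorem net_update {V : Finset ℕ} {φ φ' : ℕ → ℕ → ℝ} {u w : ℕ} {α : ℝ} (hu : u ∈ V) (hw : w ∈ V)
    (h : ∀ a b, φ' a b = φ a b + (if a = u ∧ b = w then α else 0) -
      (if a = w ∧ b = u then α else 0)) (v : ℕ) :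
    net V φ' v = net V φ v + (if v = w then α else 0) - (if v = u then α else 0) := by
  unfold net
  simp only [h, sum_sub_distrib, sum_add_distrib]
  have h₁ : ∑ a ∈ V, (if a = u ∧ v = w then α else 0) = if v = w then α else 0 := by
    by_cases hv : v = w <;> simp [hv, hu]
  have h₂ : ∑ a ∈ V, (if a = w ∧ v = u then α else 0) = if v = u then α else 0 := by
    by_cases hv : v = u <;> simp [hv, hw]
  rw [h₁, h₂]

theorem IsFlow.update {V : Finset ℕ} {φ φ' : ℕ → ℕ → ℝ} {δ : ℝ} (hφ : IsFlow V δ φ) {u w : ℕ}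
    {α : ℝ} (h : ∀ a b, φ' a b = φ a b + (if a = u ∧ b = w then α else 0) -
      (if a = w ∧ b = u then α else 0))
    (h₁ : φ u w + α ≤ δ) (h₂ : -δ ≤ φ u w + α) (hu : u ∈ V) (hw : w ∈ V) (huw : u ≠ w) :
    IsFlow V δ φ' := by
  refine ⟨fun a ha b hb => ?_, fun a ha b hb => ?_⟩
  · rw [h, h, hφ.skew a ha b hb]
    simp only [and_comm (a := b = u), and_comm (a := b = w)]
    ring
  · rw [h]
    have h₃ := hφ.le a ha b hb
    have h₄ := hφ.skew u hu w hw
    by_cases h₅ : a = u ∧ b = w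
    · obtain ⟨rfl, rfl⟩ := h₅
      rw [if_pos ⟨rfl, rfl⟩, if_neg (fun h => huw h.1)]
      linarith
    · rw [if_neg h₅]
      by_cases h₆ : a = w ∧ b = u
      · obtain ⟨rfl, rfl⟩ := h₆
        rw [if_pos ⟨rfl, rfl⟩]
        linarith
      · rw [if_neg h₆]
        linarith

/-! ### Double loops -/

/-- The rule for two nested loops over the ground set. `I a b` is the invariant before the
iteration with indices `a` and `b`. -/
theorem wp_forTo_forTo {ι κ : NName} {body : Cmd} (I : ℕ → ℕ → Mem → Prop) (T : ℕ)
    (hικ : ι ≠ κ) (hι : body.writesNat ι = false) (hκ : body.writesNat κ = false)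
    (hI : ∀ a b σ' v, I a b σ' → I a b (σ'.setNat ι 0 0 v) ∧ I a b (σ'.setNat κ 0 0 v))
    (h₀ : I 0 0 σ)
    (step : ∀ a b σ', a < n → b < n → I a b σ' → σ'.nat ι 0 0 = a → σ'.nat κ 0 0 = b →
      Agree (forTo ι 0 .size (forTo κ 0 .size body)) σ σ' →
      wp f body σ' (fun σ'' t => t ≤ T ∧ I a (b + 1) σ''))
    (next : ∀ a σ', a < n → I a n σ' → I (a + 1) 0 σ')
    (post : ∀ σ' t, I n 0 σ' → Agree (forTo ι 0 .size (forTo κ 0 .size body)) σ σ' →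
      t ≤ n * (n * (T + 14) + 24) + 10 → Q σ' t) :
    wp f (forTo ι 0 .size (forTo κ 0 .size body)) σ Q := by
  refine wp_forTo_zero n (fun a σ' => I a 0 σ') (n * (T + 14) + 10) ?_ (fun _ _ => rfl)
    (hI _ _ _ _ h₀).1 ?_ ?_
  · simp [forTo, Cmd.writesNat, hι, hικ]
  · intro a σ' ha hIa haι hA
    refine wp_forTo_zero n (fun b σ'' => I a b σ'' ∧ σ''.nat ι 0 0 = a) T hκ (fun _ _ => rfl)
      ⟨(hI _ _ _ _ hIa).2, by simp [hικ, haι]⟩ ?_ ?_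
    · rintro b σ'' hb ⟨hIb, hι'⟩ hbκ hA'
      refine wp_mono (step a b σ'' ha hb hIb hι' hbκ (hA.trans (hA'.mono ?_ ?_))) ?_
      · simp +contextual [forTo, Cmd.writesNat]
      · simp +contextual [forTo, Cmd.writesReal]
      · rintro σ₃ t ⟨ht, hI'⟩ hA''
        refine ⟨ht, (hI _ _ _ _ hI').2, ?_⟩
        simp [hικ, hA''.nat ι hι, hι']
    · rintro σ'' t ⟨hI', hι'⟩ hA' ht
      refine ⟨by simpa using ht, (hI _ _ _ _ (next a σ'' ha hI')).1⟩
  · intro σ' t hI' hA ht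
    exact post σ' t hI' hA (by simp at ht; linarith)

/-! ### The flow and the search for an augmenting path -/

theorem wp_clip {δ : ℝ} (hδ : σ.real .delta 0 0 = δ) (h0 : 0 ≤ δ)
    (post : ∀ σ' t, (∀ a < n, ∀ b < n, σ'.real .phi a b = max (-δ) (min δ (σ.real .phi a b))) →
      Agree clip σ σ' → t ≤ 200 * n * n + 100 * n + 100 → Q σ' t) :
    wp f clip σ Q := by
  refine wp_forTo_forTo (fun a b σ' => ∀ a' < n, ∀ b' < n, σ'.real .phi a' b' =
    if a' < a ∨ (a' = a ∧ b' < b) then max (-δ) (min δ (σ.real .phi a' b')) else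
      σ.real .phi a' b') 90 (by simp) rfl rfl
    (fun a b σ' v h => ⟨by simpa using h, by simpa using h⟩)
    (by simp) ?_ ?_ ?_
  · intro a b σ' ha hb hI hσa hσb hA
    have hd : σ'.real .delta 0 0 = δ := by rw [hA.real .delta rfl, hδ]
    have hab := hI a ha b hb
    simp at hab
    have hne : ∀ a' b', ¬ (a' = a ∧ b' = b) →
        ((a' < a ∨ (a' = a ∧ b' < b + 1)) ↔ (a' < a ∨ (a' = a ∧ b' < b))) := by omega
    rw [wp_seq]
    refine wp_when ?_ ?_
    · intro h₁
      simp [hd, hσa, hσb, hab] at h₁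
      simp
      refine wp_when ?_ ?_
      · intro h₂
        simp [hd, hσa, hσb, hab] at h₂
        linarith
      · intro h₂
        simp [hd, hσa, hσb]
        intro a' ha' b' hb'
        by_cases hc : a' = a ∧ b' = b
        · obtain ⟨rfl, rfl⟩ := hc
          rw [if_pos ⟨rfl, rfl⟩, if_pos (by omega), min_eq_left h₁.le,
            max_eq_right (by linarith)]
        · rw [if_neg hc, hI a' ha' b' hb']
          refine if_congr ?_ rfl rfl
          omega
    · intro h₁
      simp [hd, hσa, hσb, hab] at h₁
      refine wp_when ?_ ?_
      · intro h₂
        simp [hd, hσa, hσb, hab] at h₂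
        simp [hd, hσa, hσb]
        intro a' ha' b' hb'
        by_cases hc : a' = a ∧ b' = b
        · obtain ⟨rfl, rfl⟩ := hc
          rw [if_pos ⟨rfl, rfl⟩, if_pos (by omega), min_eq_right h₁, max_eq_left (by linarith)]
        · rw [if_neg hc, hI a' ha' b' hb']
          refine if_congr ?_ rfl rfl
          omega
      · intro h₂
        simp [hd, hσa, hσb, hab] at h₂
        simp
        intro a' ha' b' hb'
        by_cases hc : a' = a ∧ b' = b
        · obtain ⟨rfl, rfl⟩ := hc
          rw [if_pos (by omega), min_eq_right h₁, max_eq_right (by linarith), hab]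
        · rw [hI a' ha' b' hb']
          refine if_congr ?_ rfl rfl
          omega
  · intro a σ' ha hI a' ha' b' hb'
    rw [hI a' ha' b' hb']
    refine if_congr ?_ rfl rfl
    omega
  · intro σ' t hI hA ht
    refine post σ' t (fun a ha b hb => ?_) hA ?_
    · rw [hI a ha b hb, if_pos (Or.inl ha)]
    · nlinarith

/-- The program computes `z = x - ∂φ` and tests whether `S` and `T` are empty. -/
theorem wp_computeZ {V : Finset ℕ} {k : ℕ} {δ : ℝ} (hk : σ.nat .k 0 0 = k)
    (hG : Enum k (fun p => σ.nat .G p 0) V) (hkn : k ≤ n) (hδ : σ.real .delta 0 0 = δ)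
    (post : ∀ σ' t, (∀ v ∈ V, σ'.real .z v 0 = σ.real .x v 0 - net V (σ.real .phi) v) →
      (σ'.nat .sAny 0 0 = 0 ↔ ∀ v ∈ V, -δ < σ'.real .z v 0) →
      (σ'.nat .tAny 0 0 = 0 ↔ ∀ v ∈ V, σ'.real .z v 0 < δ) →
      Agree computeZ σ σ' → t ≤ 200 * n * n + 200 * n + 100 → Q σ' t) :
    wp f computeZ σ Q := by
  set zv : ℕ → ℝ := fun v => σ.real .x v 0 - net V (σ.real .phi) v with hzv
  suffices H : wp f computeZ σ (fun σ' t => (∀ v ∈ V, σ'.real .z v 0 = zv v) ∧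
      (σ'.nat .sAny 0 0 = 0 ↔ ∀ v ∈ V, -δ < zv v) ∧ (σ'.nat .tAny 0 0 = 0 ↔ ∀ v ∈ V, zv v < δ) ∧
      t ≤ 200 * n * n + 200 * n + 100) by
    refine wp_mono H fun σ' t h hA => post σ' t h.1 ?_ ?_ hA h.2.2.2
    · rw [h.2.1]
      exact forall₂_congr fun v hv => by rw [h.1 v hv]
    · rw [h.2.2.1]
      exact forall₂_congr fun v hv => by rw [h.1 v hv]
  unfold computeZ
  simp only [wp_seq, wp_nset, wp_rset]
  refine wp_forTo_zero k (fun g σ' => (∀ p < g, σ'.real .z (σ.nat .G p 0) 0 = zv (σ.nat .G p 0)) ∧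
    (σ'.nat .sAny 0 0 = 0 ↔ ∀ p < g, -δ < zv (σ.nat .G p 0)) ∧
    (σ'.nat .tAny 0 0 = 0 ↔ ∀ p < g, zv (σ.nat .G p 0) < δ)) (60 * k + 100) rfl
    (fun σ' hA => by simp [hA.nat .k rfl, hk]) (by simp) ?_ ?_
  · rintro g σ' hg ⟨h₁, h₂, h₃⟩ hgg hA
    set v := σ.nat .G g 0 with hv
    have e₁ : σ'.nat .G = σ.nat .G := by rw [hA.nat .G rfl]; simp
    have e₂ : σ'.real .x = σ.real .x := by rw [hA.real .x rfl]; simp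
    have e₃ : σ'.real .phi = σ.real .phi := by rw [hA.real .phi rfl]; simp
    have e₄ : σ'.real .delta = σ.real .delta := by rw [hA.real .delta rfl]; simp
    have e₅ : σ'.nat .k = σ.nat .k := by rw [hA.nat .k rfl]; simp
    simp only [wp_seq, wp_nset, wp_rset]
    refine wp_forTo_zero k (fun h σ'' => (∀ p < g, σ''.real .z (σ.nat .G p 0) 0 =
      zv (σ.nat .G p 0)) ∧ σ''.real .z v 0 = σ.real .x v 0 -
      ∑ p ∈ range h, σ.real .phi (σ.nat .G p 0) v) 40 rfl
      (fun σ'' hA => by simp [hA.nat .k rfl, hk, e₅]) ?_ ?_ ?_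
    · simp [e₁, e₂, hgg, ← hv]
      intro p hp
      have : σ.nat .G p 0 ≠ v := fun he => by
        have := hG.inj p g (by omega) hg he
        omega
      rw [if_neg this, h₁ p hp]
    · rintro h σ'' hh ⟨h₄, h₅⟩ hhh hA'
      have e₆ : σ''.nat .vv 0 0 = v := by rw [hA'.nat .vv rfl]; simp [e₁, hgg, ← hv]
      have e₇ : σ''.nat .G = σ.nat .G := by rw [hA'.nat .G rfl]; simp [e₁]
      have e₈ : σ''.real .phi = σ.real .phi := by rw [hA'.real .phi rfl]; simp [e₃]
      simp [e₆, e₇, e₈, hhh, h₅]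
      refine ⟨fun p hp => ?_, ?_⟩
      · have : σ.nat .G p 0 ≠ v := fun he => by
          have := hG.inj p g (by omega) hg he
          omega
        rw [if_neg this, h₄ p hp]
      · rw [sum_range_succ]
        ring
    · rintro σ'' t ⟨h₄, h₅⟩ hA' ht
      have hsum : σ''.real .z v 0 = zv v := by
        rw [h₅, hG.sum (fun u => σ.real .phi u v)]
        rfl
      have e₆ : σ''.nat .vv 0 0 = v := by rw [hA'.nat .vv rfl]; simp [e₁, hgg, ← hv]
      have e₇ : σ''.real .delta 0 0 = δ := by rw [hA'.real .delta rfl]; simp [e₄, hδ]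
      have e₈ : σ''.nat .sAny 0 0 = σ'.nat .sAny 0 0 := by rw [hA'.nat .sAny rfl]; simp
      have e₉ : σ''.nat .tAny 0 0 = σ'.nat .tAny 0 0 := by rw [hA'.nat .tAny rfl]; simp
      have hz : ∀ p < g + 1, σ''.real .z (σ.nat .G p 0) 0 = zv (σ.nat .G p 0) := by
        intro p hp
        rcases Nat.lt_succ_iff_lt_or_eq.1 hp with hp | rfl
        · exact h₄ p hp
        · exact hsum
      have hforall : ∀ P : ℝ → Prop, (∀ p < g + 1, P (zv (σ.nat .G p 0))) ↔
          (∀ p < g, P (zv (σ.nat .G p 0))) ∧ P (zv v) := fun P => by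
        constructor
        · intro h
          exact ⟨fun p hp => h p (by omega), h g (by omega)⟩
        · rintro ⟨a, b⟩ p hp
          rcases Nat.lt_succ_iff_lt_or_eq.1 hp with hp | rfl
          · exact a p hp
          · exact b
      simp only [hforall (fun r => -δ < r), hforall (fun r => r < δ), ← h₂, ← h₃]
      simp at ht
      refine wp_when ?_ ?_
      · intro hs
        simp [e₆, e₇, hsum] at hs
        simp
        refine wp_when ?_ ?_
        · intro ht'
          simp [e₆, e₇, hsum] at ht'
          simp
          exact ⟨by omega, by simpa using hz, fun _ => hs, fun _ => ht'⟩
        · intro ht'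
          simp [e₆, e₇, hsum] at ht'
          simp [ht', e₉]
          exact ⟨by omega, by simpa using hz, fun _ => hs⟩
      · intro hs
        simp [e₆, e₇, hsum] at hs
        refine wp_when ?_ ?_
        · intro ht'
          simp [e₆, e₇, hsum] at ht'
          simp [hs, e₈]
          exact ⟨by omega, by simpa using hz, fun _ => ht'⟩
        · intro ht'
          simp [e₆, e₇, hsum] at ht'
          simp [ht', e₉, hs, e₈]
          exact ⟨by omega, by simpa using hz⟩
  · rintro σ' t ⟨h₁, h₂, h₃⟩ hA ht
    refine ⟨fun v hv => ?_, ?_, ?_, ?_⟩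
    · obtain ⟨p, hp, rfl⟩ := hG.surj v hv
      exact h₁ p hp
    · rw [h₂]
      refine ⟨fun h v hv => ?_, fun h p hp => h _ (hG.mem p hp)⟩
      obtain ⟨p, hp, rfl⟩ := hG.surj v hv
      exact h p hp
    · rw [h₃]
      refine ⟨fun h v hv => ?_, fun h p hp => h _ (hG.mem p hp)⟩
      obtain ⟨p, hp, rfl⟩ := hG.surj v hv
      exact h p hp
    · simp at ht ⊢
      nlinarith

/-- The state of the breadth-first search: `que 0, …, que (tl - 1)` are the vertices found so far;
`W` is their membership flag, which is set up for the vertices in `P`; every vertex found is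
either a source, or was found from its predecessor `par`, earlier in the queue. -/
structure SearchTree (V P : Finset ℕ) (φ z : ℕ → ℕ → ℝ) (δ : ℝ) (W que par : ℕ → ℕ → ℕ)
    (tl : ℕ) : Prop where
  que_mem : ∀ h < tl, que h 0 ∈ V
  que_inj : ∀ h h', h < tl → h' < tl → que h 0 = que h' 0 → h = h'
  flag : ∀ v ∈ P, W v 0 = 0 ∨ W v 0 = 1
  mem_iff : ∀ v ∈ P, W v 0 = 1 ↔ ∃ h < tl, que h 0 = v
  processed : ∀ h < tl, que h 0 ∈ P
  source : ∀ v ∈ P, z v 0 ≤ -δ → W v 0 = 1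
  par : ∀ h < tl, (par (que h 0) 0 = que h 0 ∧ z (que h 0) 0 ≤ -δ) ∨
    ∃ h' < h, par (que h 0) 0 = que h' 0 ∧ φ (que h' 0) (que h 0) ≤ 0

section

variable {V P : Finset ℕ} {φ z : ℕ → ℕ → ℝ} {δ : ℝ} {W W' que que' par par' : ℕ → ℕ → ℕ} {tl : ℕ}

theorem SearchTree.tl_le (h : SearchTree V P φ z δ W que par tl) : tl ≤ V.card := by
  have : ((range tl).image fun p => que p 0) ⊆ V := by
    intro v hv
    obtain ⟨p, hp, rfl⟩ := mem_image.1 hv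
    exact h.que_mem p (by simpa using hp)
  have h₂ := card_le_card this
  rwa [card_image_of_injOn, card_range] at h₂
  intro p hp q hq he
  exact h.que_inj p q (by simpa using hp) (by simpa using hq) he

/-- The search finds only vertices that are reachable from the sources. -/
theorem SearchTree.least (h : SearchTree V P φ z δ W que par tl) {U : Finset ℕ}
    (hs : ∀ v ∈ V, z v 0 ≤ -δ → v ∈ U)
    (hU : ∀ a ∈ U, a ∈ V → ∀ b ∈ V, W a 0 = 1 → W b 0 = 1 → φ a b ≤ 0 → b ∈ U) {v : ℕ}
    (hvP : v ∈ P) (hv : W v 0 = 1) : v ∈ U := by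
  have key : ∀ q < tl, que q 0 ∈ U := by
    intro q
    induction q using Nat.strong_induction_on with
    | _ q ih =>
      intro hq
      rcases h.par q hq with ⟨_, h₁⟩ | ⟨q', hq', _, h₁⟩
      · exact hs _ (h.que_mem q hq) h₁
      · exact hU _ (ih q' hq' (by omega)) (h.que_mem q' (by omega)) _ (h.que_mem q hq)
          ((h.mem_iff _ (h.processed q' (by omega))).2 ⟨q', by omega, rfl⟩)
          ((h.mem_iff _ (h.processed q hq)).2 ⟨q, hq, rfl⟩) h₁
  obtain ⟨q, hq, rfl⟩ := (h.mem_iff v hvP).1 hv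
  exact key q hq

/-- A new vertex enters the queue. -/
theorem SearchTree.add (h : SearchTree V P φ z δ W que par tl) {v : ℕ} (hv : v ∈ V)
    (hnew : v ∈ P → W v 0 = 0)
    (hpar : (par' v 0 = v ∧ z v 0 ≤ -δ) ∨ ∃ h' < tl, par' v 0 = que h' 0 ∧ φ (que h' 0) v ≤ 0)
    (hW : ∀ a, W' a 0 = if a = v then 1 else W a 0)
    (hque : ∀ a, que' a 0 = if a = tl then v else que a 0)
    (hpar' : ∀ a, a ≠ v → par' a 0 = par a 0) :
    SearchTree V (insert v P) φ z δ W' que' par' (tl + 1) := by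
  have hne : ∀ q < tl, que q 0 ≠ v := by
    rintro q hq rfl
    have h₁ := h.processed q hq
    have := (h.mem_iff _ h₁).2 ⟨q, hq, rfl⟩
    rw [hnew h₁] at this
    omega
  have hq₁ : ∀ q < tl, que' q 0 = que q 0 := fun q hq => by rw [hque, if_neg (by omega)]
  have hq₂ : que' tl 0 = v := by rw [hque, if_pos rfl]
  have hlt : ∀ q, q < tl + 1 → q < tl ∨ q = tl := fun q hq => by omega
  refine ⟨?_, ?_, ?_, ?_, ?_, ?_, ?_⟩
  · intro q hq
    rcases hlt q hq with hq | rfl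
    · rw [hq₁ q hq]; exact h.que_mem q hq
    · rwa [hq₂]
  · intro q q' hq hq' he
    rcases hlt q hq with hq | rfl <;> rcases hlt q' hq' with hq' | rfl
    · rw [hq₁ q hq, hq₁ q' hq'] at he
      exact h.que_inj q q' hq hq' he
    · rw [hq₁ q hq, hq₂] at he
      exact absurd he (hne q hq)
    · rw [hq₁ q' hq', hq₂] at he
      exact absurd he.symm (hne q' hq')
    · rfl
  · intro a ha
    rw [hW]
    split_ifs with hav
    · exact Or.inr rfl
    · exact h.flag a ((mem_insert.1 ha).resolve_left hav)
  · intro a ha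
    rw [hW]
    split_ifs with hav
    · simp only [true_iff]
      exact ⟨tl, by omega, by rw [hq₂, hav]⟩
    · rw [h.mem_iff a ((mem_insert.1 ha).resolve_left hav)]
      constructor
      · rintro ⟨q, hq, rfl⟩
        exact ⟨q, by omega, hq₁ q hq⟩
      · rintro ⟨q, hq, rfl⟩
        rcases hlt q hq with hq | rfl
        · exact ⟨q, hq, (hq₁ q hq).symm⟩
        · exact absurd hq₂ hav
  · intro q hq
    rcases hlt q hq with hq | rfl
    · rw [hq₁ q hq]; exact mem_insert_of_mem (h.processed q hq)
    · rw [hq₂]; exact mem_insert_self _ _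
  · intro a ha hz
    rw [hW]
    split_ifs with hav
    · rfl
    · exact h.source a ((mem_insert.1 ha).resolve_left hav) hz
  · intro q hq
    rcases hlt q hq with hq | rfl
    · rw [hq₁ q hq, hpar' _ (hne q hq)]
      refine (h.par q hq).imp id ?_
      rintro ⟨q', hq', h₁⟩
      exact ⟨q', hq', by rwa [hq₁ q' (by omega)]⟩
    · rw [hq₂]
      refine hpar.imp id ?_
      rintro ⟨q', hq', h₁⟩
      exact ⟨q', hq', by rwa [hq₁ q' hq']⟩

/-- A vertex that is not a source is set up. -/
theorem SearchTree.skip (h : SearchTree V P φ z δ W que par tl) {v : ℕ} (hnew : v ∉ P)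
    (hz : ¬ z v 0 ≤ -δ) (hW : ∀ a, W' a 0 = if a = v then 0 else W a 0) :
    SearchTree V (insert v P) φ z δ W' que par tl := by
  have hne : ∀ q < tl, que q 0 ≠ v := by
    rintro q hq rfl
    exact hnew (h.processed q hq)
  refine ⟨h.que_mem, h.que_inj, ?_, ?_, fun q hq => mem_insert_of_mem (h.processed q hq),
    ?_, h.par⟩
  · intro a ha
    rw [hW]
    split_ifs with hav
    · exact Or.inl rfl
    · exact h.flag a ((mem_insert.1 ha).resolve_left hav)
  · intro a ha
    rw [hW]
    split_ifs with hav
    · simp only [zero_ne_one, false_iff, not_exists, not_and]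
      intro q hq
      rw [hav]
      exact hne q hq
    · exact h.mem_iff a ((mem_insert.1 ha).resolve_left hav)
  · intro a ha hza
    rw [hW]
    split_ifs with hav
    · exact absurd (hav ▸ hza) hz
    · exact h.source a ((mem_insert.1 ha).resolve_left hav) hza

end

/-- The result of the search for an augmenting path: the flags `W` mark the vertices that are
reachable from the sources, and `found` tells whether a sink `tgt` is among them. -/
structure Reached (V : Finset ℕ) (δ : ℝ) (σ : Mem) : Prop where
  tree : ∃ tl, SearchTree V V (σ.real .phi) (σ.real .z) δ (σ.nat .W) (σ.nat .que) (σ.nat .par) tl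
  closed : ∀ a ∈ V, ∀ b ∈ V, σ.nat .W a 0 = 1 → σ.real .phi a b ≤ 0 → σ.nat .W b 0 = 1
  found : (σ.nat .found 0 0 = 1 ∧ σ.nat .tgt 0 0 ∈ V ∧ σ.nat .W (σ.nat .tgt 0 0) 0 = 1 ∧
      δ ≤ σ.real .z (σ.nat .tgt 0 0) 0) ∨
    (σ.nat .found 0 0 = 0 ∧ ∀ v ∈ V, σ.nat .W v 0 = 1 → σ.real .z v 0 < δ)

/-- Breadth-first search from `S` along the arcs without flow. -/
theorem wp_reach {V : Finset ℕ} {k : ℕ} {δ : ℝ} (hk : σ.nat .k 0 0 = k)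
    (hG : Enum k (fun p => σ.nat .G p 0) V) (hδ : σ.real .delta 0 0 = δ) :
    wp f reach σ (fun σ' t =>
      Reached V δ σ' ∧
      t ≤ 200 * k * k + 300 * k + 100) := by
  have hGi : ∀ {p q}, p < k → q < k → p < q → σ.nat .G p 0 ≠ σ.nat .G q 0 := by
    intro p q hp hq hpq he
    have := hG.inj p q hp hq he
    omega
  set G : ℕ → ℕ := fun p => σ.nat .G p 0 with hGdef
  unfold reach
  simp only [wp_seq, wp_nset]
  refine wp_forTo_zero k (fun g σ' => SearchTree V (pre G g) (σ.real .phi) (σ.real .z) δ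
    (σ'.nat .W) (σ'.nat .que) (σ'.nat .par) (σ'.nat .tail 0 0)) 60 rfl
    (fun σ' hA => by simp [hA.nat .k rfl, hk]) ?_ ?_ ?_
  · simp
    refine ⟨?_, ?_, ?_, ?_, ?_, ?_, ?_⟩ <;> simp
  · intro g σ' hg hT hgg hA
    have e₁ : σ'.nat .G = σ.nat .G := by rw [hA.nat .G rfl]; simp
    have e₂ : σ'.real = σ.real := by ext a r c; rw [hA.real a rfl]; simp
    have hv : σ.nat .G g 0 = G g := rfl
    simp only [wp_seq, wp_nset]
    refine wp_when ?_ ?_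
    · intro hz
      simp [e₁, e₂, hgg, hδ, hv] at hz
      simp [e₁, hgg, hv]
      rw [pre_succ]
      refine hT.add (hG.mem g hg) (fun h => absurd h (hG.notMem_pre hg le_rfl))
        (Or.inl ⟨by simp, hz⟩) (fun a => ?_) (fun a => by simp) (fun a ha => by simp [ha])
      by_cases ha : a = G g <;> simp [ha]
    · intro hz
      simp [e₁, e₂, hgg, hδ, hv] at hz
      simp [e₁, hgg, hv]
      rw [pre_succ]
      exact hT.skip (hG.notMem_pre hg le_rfl) (by linarith) (fun a => by simp)
  · intro σ₁ t₁ hT₁ hA₁ ht₁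
    rw [hG.pre_eq] at hT₁
    have e₁ : σ₁.nat .G = σ.nat .G := by rw [hA₁.nat .G rfl]; simp
    have e₂ : σ₁.real = σ.real := by ext a r c; rw [hA₁.real a rfl]; simp
    have e₃ : σ₁.nat .k 0 0 = k := by rw [hA₁.nat .k rfl]; simp [hk]
    have e₄ : σ₁.nat .head 0 0 = 0 := by rw [hA₁.nat .head rfl]; simp
    refine wp_loop (fun σ' τ => SearchTree V V (σ.real .phi) (σ.real .z) δ
      (σ'.nat .W) (σ'.nat .que) (σ'.nat .par) (σ'.nat .tail 0 0) ∧
      σ'.nat .head 0 0 ≤ σ'.nat .tail 0 0 ∧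
      (∀ h < σ'.nat .head 0 0, ∀ b ∈ V, σ.real .phi (σ'.nat .que h 0) b ≤ 0 → σ'.nat .W b 0 = 1) ∧
      τ = (k - σ'.nat .head 0 0) * (100 * k + 100)) (k * (100 * k + 100)) ?_ ?_ ?_
    · exact ⟨hT₁, by omega, by rw [e₄]; simp, by rw [e₄]; simp⟩
    · rintro σ₂ τ ⟨hT₂, hht, hcl, rfl⟩ hA₂ hb
      simp at hb
      set hd := σ₂.nat .head 0 0 with hhd
      set uu := σ₂.nat .que hd 0 with huu
      have hdk : hd < k := by
        have := hT₂.tl_le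
        rw [hG.card] at this
        omega
      have e₅ : σ₂.nat .G = σ.nat .G := by rw [hA₂.nat .G rfl, e₁]
      have e₆ : σ₂.real = σ.real := by ext a r c; rw [hA₂.real a rfl, e₂]
      have e₇ : σ₂.nat .k 0 0 = k := by rw [hA₂.nat .k rfl, e₃]
      simp only [wp_seq, wp_nset]
      refine wp_forTo_zero k (fun g σ' => SearchTree V V (σ.real .phi) (σ.real .z) δ
        (σ'.nat .W) (σ'.nat .que) (σ'.nat .par) (σ'.nat .tail 0 0) ∧
        hd < σ'.nat .tail 0 0 ∧ (∀ h ≤ hd, σ'.nat .que h 0 = σ₂.nat .que h 0) ∧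
        (∀ b ∈ V, σ₂.nat .W b 0 = 1 → σ'.nat .W b 0 = 1) ∧
        (∀ p < g, σ.real .phi uu (G p) ≤ 0 → σ'.nat .W (G p) 0 = 1)) 60 rfl
        (fun σ' hA => by simp [hA.nat .k rfl, e₇]) ?_ ?_ ?_
      · simp
        exact ⟨hT₂, by omega⟩
      · rintro g σ' hg ⟨hT', h₁, h₂, h₃, h₄⟩ hgg hA'
        have e₈ : σ'.nat .G = σ.nat .G := by rw [hA'.nat .G rfl]; simp [e₅]
        have e₉ : σ'.real = σ.real := by ext a r c; rw [hA'.real a rfl]; simp [e₆]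
        have e₁₀ : σ'.nat .uu 0 0 = uu := by rw [hA'.nat .uu rfl]; simp [huu, hhd]
        have hv : σ.nat .G g 0 = G g := rfl
        simp only [wp_seq, wp_nset]
        refine wp_when ?_ ?_
        · intro hc
          simp [e₈, hgg, e₉, e₁₀, hv] at hc
          simp [e₈, hgg, e₁₀, hv]
          refine ⟨?_, by omega, fun h hh => ?_, fun b hb hW _ => h₃ b hb hW, fun p hp hφ => ?_⟩
          · have := hT'.add (W' := ((((σ'.setNat .vv 0 0 (G g)).setNat .W (G g) 0 1).setNat .par
              (G g) 0 uu).setNat .que (σ'.nat .tail 0 0) 0 (G g)).nat .W)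
              (que' := ((((σ'.setNat .vv 0 0 (G g)).setNat .W (G g) 0 1).setNat .par
              (G g) 0 uu).setNat .que (σ'.nat .tail 0 0) 0 (G g)).nat .que)
              (par' := ((((σ'.setNat .vv 0 0 (G g)).setNat .W (G g) 0 1).setNat .par
              (G g) 0 uu).setNat .que (σ'.nat .tail 0 0) 0 (G g)).nat .par)
              (hG.mem g hg) (fun _ => hc.1)
              (Or.inr ⟨hd, h₁, by simp [h₂ hd le_rfl, huu], by rw [h₂ hd le_rfl]; exact hc.2⟩)
              (fun a => by simp) (fun a => by simp) (fun a ha => by simp [ha])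
            rw [insert_eq_of_mem (hG.mem g hg)] at this
            simpa using this
          · rw [if_neg (by omega), h₂ h hh]
          · rcases Nat.lt_or_ge p g with hpg | hpg
            · exact fun _ => h₄ p hpg hφ
            · exact fun hc => absurd (by rw [show p = g by omega]) hc
        · intro hc
          simp [e₈, hgg, e₉, e₁₀, hv] at hc
          simp
          refine ⟨hT', h₁, h₂, h₃, fun p hp hφ => ?_⟩
          rcases Nat.lt_or_ge p g with hpg | hpg
          · exact h₄ p hpg hφ
          · obtain rfl : p = g := by omega
            rcases hT'.flag _ (hG.mem p hg) with hW | hW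
            · linarith [hc hW]
            · exact hW
      · rintro σ' t ⟨hT', h₁, h₂, h₃, h₄⟩ hA' ht
        have e₈ : σ'.nat .head 0 0 = hd + 1 := by rw [hA'.nat .head rfl]; simp [hhd]
        refine ⟨_, ⟨hT', by omega, ?_, rfl⟩, ?_⟩
        · rw [e₈]
          intro h hh b hb hφ
          rcases Nat.lt_succ_iff_lt_or_eq.1 hh with hh | rfl
          · rw [h₂ h hh.le] at hφ
            exact h₃ b hb (hcl h hh b hb hφ)
          · rw [h₂ hd le_rfl] at hφ
            obtain ⟨p, hp, rfl⟩ := hG.surj b hb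
            exact h₄ p hp hφ
        · rw [e₈, show k - hd = (k - (hd + 1)) + 1 by omega]
          simp at ht ⊢
          nlinarith
    · rintro σ₂ τ t₂ ⟨hT₂, hht, hcl, rfl⟩ hA₂ hb ht₂
      simp at hb
      have e₅ : σ₂.nat .G = σ.nat .G := by rw [hA₂.nat .G rfl, e₁]
      have e₆ : σ₂.real = σ.real := by ext a r c; rw [hA₂.real a rfl, e₂]
      have e₇ : σ₂.nat .k 0 0 = k := by rw [hA₂.nat .k rfl, e₃]
      refine wp_forTo_zero k (fun g σ' => (σ'.nat .found 0 0 = 1 ∧ σ'.nat .tgt 0 0 ∈ V ∧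
        σ₂.nat .W (σ'.nat .tgt 0 0) 0 = 1 ∧ δ ≤ σ.real .z (σ'.nat .tgt 0 0) 0) ∨
        (σ'.nat .found 0 0 = 0 ∧ ∀ p < g, σ₂.nat .W (G p) 0 = 1 → σ.real .z (G p) 0 < δ)) 40 rfl
        (fun σ' hA => by simp [hA.nat .k rfl, e₇]) ?_ ?_ ?_
      · simp
      · intro g σ' hg hI hgg hA'
        have e₈ : σ'.nat .G = σ.nat .G := by rw [hA'.nat .G rfl]; simp [e₅]
        have e₉ : σ'.real = σ.real := by ext a r c; rw [hA'.real a rfl]; simp [e₆]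
        have e₁₀ : σ'.nat .W = σ₂.nat .W := by rw [hA'.nat .W rfl]; simp
        have hv : σ.nat .G g 0 = G g := rfl
        simp only [wp_seq, wp_nset]
        refine wp_when ?_ ?_
        · intro hc
          simp [e₈, hgg, e₉, e₁₀, hv, hδ] at hc
          simp [e₈, hgg, hv]
          exact ⟨hG.mem g hg, hc.1, hc.2⟩
        · intro hc
          simp [e₈, hgg, e₉, e₁₀, hv, hδ] at hc
          simp
          refine hI.imp id fun h => ⟨h.1, fun p hp hW => ?_⟩
          rcases Nat.lt_or_ge p g with hpg | hpg
          · exact h.2 p hpg hW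
          · obtain rfl : p = g := by omega
            exact hc hW
      · intro σ' t hI hA' ht
        have e₈ : σ'.nat .W = σ₂.nat .W := by rw [hA'.nat .W rfl]; simp
        have e₉ : σ'.real = σ.real := by ext a r c; rw [hA'.real a rfl]; simp [e₆]
        have e₁₀ : σ'.nat .que = σ₂.nat .que := by rw [hA'.nat .que rfl]; simp
        have e₁₁ : σ'.nat .par = σ₂.nat .par := by rw [hA'.nat .par rfl]; simp
        refine ⟨⟨⟨_, by rw [e₈, e₉, e₁₀, e₁₁]; exact hT₂⟩, ?_, ?_⟩, ?_⟩
        · rw [e₈, e₉]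
          intro a ha b hb hW hφ
          obtain ⟨h, hh, rfl⟩ := (hT₂.mem_iff a ha).1 hW
          exact hcl h (by omega) b hb hφ
        · rw [e₈, e₉]
          refine hI.imp id fun h => ⟨h.1, fun v hv hW => ?_⟩
          obtain ⟨p, hp, rfl⟩ := hG.surj v hv
          exact h.2 p hp hW
        · simp at ht ht₁ ht₂ ⊢
          nlinarith

/-- The predecessors stored by the search give a path from `S` to `T`; sending `δ` along it keeps the
flow feasible, and changes the net inflow at the two ends of the path only. -/
theorem wp_augment {V : Finset ℕ} {δ : ℝ} (hδ : σ.real .delta 0 0 = δ) (h0 : 0 < δ)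
    (hφ : IsFlow V δ (σ.real .phi)) (hR : Reached V δ σ) (hf : σ.nat .found 0 0 = 1) :
    wp f augment σ (fun σ' t =>
      IsFlow V δ (σ'.real .phi) ∧
      (∃ s ∈ V, σ.real .z s 0 ≤ -δ ∧ ∃ r ∈ V, δ ≤ σ.real .z r 0 ∧ ∀ v,
        net V (σ'.real .phi) v = net V (σ.real .phi) v - (if v = s then δ else 0) +
          (if v = r then δ else 0)) ∧
      t ≤ 100 * V.card + 100) := by
  obtain ⟨tl, hT⟩ := hR.tree
  obtain ⟨_, htV, htW, htz⟩ : _ ∧ σ.nat .tgt 0 0 ∈ V ∧ _ ∧ δ ≤ σ.real .z (σ.nat .tgt 0 0) 0 := by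
    rcases hR.found with h | h
    · exact h
    · omega
  set r := σ.nat .tgt 0 0 with hr
  set que : ℕ → ℕ := fun h => σ.nat .que h 0 with hque
  obtain ⟨h₀, hh₀, hq₀⟩ := (hT.mem_iff r htV).1 htW
  unfold augment
  simp only [wp_seq, wp_nset]
  -- Only arcs between the current vertex and later vertices of the queue have been changed.
  refine wp_loop (fun σ' τ => IsFlow V δ (σ'.real .phi) ∧ ∃ h < tl, σ'.nat .vv 0 0 = que h ∧
    τ = h * 70 ∧ (∀ h₁ ≤ h, ∀ h₂ ≤ h, σ'.real .phi (que h₁) (que h₂) =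
      σ.real .phi (que h₁) (que h₂)) ∧
    ∀ v, net V (σ'.real .phi) v = net V (σ.real .phi) v - (if v = que h then δ else 0) +
      (if v = r then δ else 0)) (h₀ * 70) ?_ ?_ ?_
  · refine ⟨by simpa using hφ, h₀, hh₀, by simp [hque, hq₀, hr], rfl, by simp, ?_⟩
    intro v
    have : que h₀ = r := hq₀
    simp [this]
  · rintro σ' τ ⟨hφ', h, hh, hvv, rfl, hsame, hnet⟩ hA hb
    have e₁ : σ'.nat .par = σ.nat .par := by rw [hA.nat .par rfl]; simp
    have e₂ : σ'.real .delta 0 0 = δ := by rw [hA.real .delta rfl]; simp [hδ]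
    simp [e₁, hvv] at hb
    rcases hT.par h hh with hp | ⟨h', hh', hp, hpφ⟩
    · exact absurd hp.1 hb
    have hp' : σ.nat .par (que h) 0 = que h' := hp
    have hne : que h' ≠ que h := by rw [← hp']; exact hb
    have hφ0 : σ'.real .phi (que h') (que h) ≤ 0 := by
      rw [hsame h' hh'.le h le_rfl]; exact hpφ
    have hV := hT.que_mem h hh
    have hV' := hT.que_mem h' (by omega)
    set φ' := ((σ'.setNat .uu 0 0 (que h')).setReal .phi (que h') (que h)
      (σ'.real .phi (que h') (que h) + δ)).setReal .phi (que h) (que h')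
      ((if que h = que h' ∧ que h' = que h then σ'.real .phi (que h') (que h) + δ
        else σ'.real .phi (que h) (que h')) - δ) |>.real .phi with hφ'def
    have hupd : ∀ a b, φ' a b = σ'.real .phi a b + (if a = que h' ∧ b = que h then δ else 0) -
        (if a = que h ∧ b = que h' then δ else 0) := by
      intro a b
      simp only [hφ'def, Mem.setReal_real_self, Mem.setNat_real]
      by_cases hc : a = que h ∧ b = que h'
      · rw [if_pos hc, if_neg (fun hc' => hne (hc'.2)), if_pos hc, if_neg]
        · rw [hc.1, hc.2]; ring
        · rintro ⟨rfl, _⟩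
          exact hne hc.1
      · rw [if_neg hc, if_neg hc]
        split_ifs with hc'
        · rw [hc'.1, hc'.2]; ring
        · ring
    have hflow : IsFlow V δ φ' := hφ'.update hupd (by linarith)
      (by linarith [hφ'.neg_le hV' hV]) hV' hV hne
    have hsame' : ∀ h₁ ≤ h', ∀ h₂ ≤ h', φ' (que h₁) (que h₂) =
        σ.real .phi (que h₁) (que h₂) := by
      intro h₁ hh₁ h₂ hh₂
      have hn : ∀ q ≤ h', que q ≠ que h := fun q hq he => by
        have := hT.que_inj q h (by omega) hh he
        omega
      rw [hupd, if_neg (fun hc => hn _ hh₂ hc.2), if_neg (fun hc => hn _ hh₁ hc.1), add_zero,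
        sub_zero, hsame h₁ (by omega) h₂ (by omega)]
    have hnet' : ∀ v, net V φ' v = net V (σ.real .phi) v - (if v = que h' then δ else 0) +
        (if v = r then δ else 0) := by
      intro v
      rw [net_update hV' hV hupd, hnet v]
      ring
    simp only [wp_seq, wp_nset, wp_rset]
    refine ⟨h' * 70, ⟨?_, h', by omega, ?_, rfl, ?_, ?_⟩, ?_⟩
    · simpa [e₁, e₂, hvv, hp', hφ'def] using hflow
    · simp [e₁, hvv, hp']
    · simpa [e₁, e₂, hvv, hp', hφ'def] using hsame'
    · simpa [e₁, e₂, hvv, hp', hφ'def] using hnet'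
    · simp
      omega
  · rintro σ' τ t ⟨hφ', h, hh, hvv, rfl, hsame, hnet⟩ hA hb ht
    have e₁ : σ'.nat .par = σ.nat .par := by rw [hA.nat .par rfl]; simp
    simp [e₁, hvv] at hb
    refine ⟨hφ', ⟨que h, hT.que_mem h hh, ?_, r, htV, htz, hnet⟩, ?_⟩
    · rcases hT.par h hh with hp | ⟨h', hh', hp, hpφ⟩
      · exact hp.2
      · have := hT.que_inj h' h (by omega) hh (hp.symm.trans hb)
        omega
    · have := hT.tl_le
      simp at ht ⊢
      omega

/-! ### The data of a call of `fix` -/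

/-- The data on which the scaling phases work: the vertex set `V` of size `k`, the classes `Cl v`
of the vertices, the fixed set `B`, and the set function `fh` together with its shift. -/
structure Env (n : ℕ) (f : Finset (Fin n) → ℝ) where
  V : Finset ℕ
  k : ℕ
  Cl : ℕ → Finset (Fin n)
  B : Finset (Fin n)
  fh : Finset (Fin n) → ℝ
  pos : 0 < n
  card : V.card = k
  lt : ∀ v ∈ V, v < n
  disj : ∀ v ∈ V, ∀ w ∈ V, v ≠ w → Disjoint (Cl v) (Cl w)
  disjB : ∀ v ∈ V, Disjoint B (Cl v)
  cover : B ∪ V.biUnion Cl = univ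
  fh_eq : ∀ S, S ≠ univ → fh S = f S
  submod : ∀ S T, fh (S ∪ T) + fh (S ∩ T) ≤ fh S + fh T

/-- The subset of the ground set represented by the vertex set `Y`. -/
def Env.set (E : Env n f) (Y : Finset ℕ) : Finset (Fin n) := E.B ∪ Y.biUnion E.Cl

/-- The set function handed to `fix`. -/
def Env.g (E : Env n f) (Y : Finset ℕ) : ℝ := E.fh (E.set Y) - E.fh E.B

/-- The number of elements of a class, plus one. -/
def Env.wt (E : Env n f) (v : ℕ) : ℕ := (E.Cl v).card + 1

theorem Env.set_empty (E : Env n f) : E.set ∅ = E.B := by simp [Env.set]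

theorem Env.g_empty (E : Env n f) : E.g ∅ = 0 := by simp [Env.g, E.set_empty]

theorem Env.set_insert (E : Env n f) (v : ℕ) (Y : Finset ℕ) :
    E.set (insert v Y) = E.set Y ∪ E.Cl v := by
  rw [Env.set, Env.set, biUnion_insert, union_comm (E.Cl v), union_assoc]

theorem Env.disjoint_set (E : Env n f) {Y : Finset ℕ} (hY : Y ⊆ E.V) {v : ℕ} (hv : v ∈ E.V)
    (hvY : v ∉ Y) : Disjoint (E.set Y) (E.Cl v) := by
  rw [Env.set, disjoint_union_left]
  refine ⟨E.disjB v hv, (disjoint_biUnion_left _ _ _).2 fun w hw => ?_⟩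
  exact E.disj w (hY hw) v hv fun h => hvY (h ▸ hw)

theorem Env.set_union (E : Env n f) (Y Z : Finset ℕ) : E.set (Y ∪ Z) = E.set Y ∪ E.set Z := by
  ext j
  simp only [Env.set, mem_union, mem_biUnion]
  aesop

theorem Env.set_inter (E : Env n f) {Y Z : Finset ℕ} (hY : Y ⊆ E.V) (hZ : Z ⊆ E.V) :
    E.set (Y ∩ Z) = E.set Y ∩ E.set Z := by
  ext j
  simp only [Env.set, mem_union, mem_inter, mem_biUnion]
  constructor
  · rintro (h | ⟨v, ⟨h₁, h₂⟩, h₃⟩)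
    · exact ⟨Or.inl h, Or.inl h⟩
    · exact ⟨Or.inr ⟨v, h₁, h₃⟩, Or.inr ⟨v, h₂, h₃⟩⟩
  · rintro ⟨h | ⟨v, h₁, h₂⟩, h' | ⟨w, h₃, h₄⟩⟩
    · exact Or.inl h
    · exact Or.inl h
    · exact Or.inl h'
    · refine Or.inr ⟨v, ⟨h₁, ?_⟩, h₂⟩
      by_cases hvw : v = w
      · rwa [hvw]
      · exact absurd h₄ (disjoint_left.1 (E.disj v (hY h₁) w (hZ h₃) hvw) h₂)

theorem Env.submodOn (E : Env n f) : SubmodOn E.V E.g := by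
  intro Y hY Z hZ
  have := E.submod (E.set Y) (E.set Z)
  rw [← E.set_union, ← E.set_inter hY hZ] at this
  unfold Env.g
  linarith

theorem Env.sum_card_le (E : Env n f) {Y : Finset ℕ} (hY : Y ⊆ E.V) :
    ∑ v ∈ Y, (E.Cl v).card ≤ n := by
  rw [← card_biUnion fun v hv w hw h => E.disj v (hY hv) w (hY hw) h]
  simpa using card_le_univ (Y.biUnion E.Cl)

theorem Env.k_le (E : Env n f) : E.k ≤ n := by
  have : E.V ⊆ range n := fun v hv => mem_range.2 (E.lt v hv)
  simpa [E.card] using card_le_card this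

/-- The vertices represent disjoint classes. -/
theorem Env.sum_wt_le (E : Env n f) {Y : Finset ℕ} (hY : Y ⊆ E.V) :
    ∑ v ∈ Y, E.wt v ≤ 2 * n := by
  have h₁ := E.sum_card_le hY
  have h₂ := card_le_card hY
  have h₃ := E.k_le
  rw [E.card] at h₂
  simp only [Env.wt, sum_add_distrib, sum_const, smul_eq_mul, mul_one]
  omega

/-- The memory holds the data `E`. -/
structure Env.Holds (E : Env n f) (σ : Mem) : Prop where
  k : σ.nat .k 0 0 = E.k
  enum : Enum E.k (fun p => σ.nat .G p 0) E.V
  listing : Listing (σ.nat .start) (σ.nat .mem) E.Cl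
  full : σ.real .top 0 0 + σ.real .sub 0 0 = E.fh univ
  sub : σ.real .sub 0 0 = E.fh E.B

theorem Env.Holds.congr {E : Env n f} {σ σ' : Mem} (h : E.Holds σ)
    (h₁ : σ'.nat .k = σ.nat .k) (h₂ : σ'.nat .G = σ.nat .G) (h₃ : σ'.nat .start = σ.nat .start)
    (h₄ : σ'.nat .mem = σ.nat .mem) (h₅ : σ'.real .top = σ.real .top)
    (h₆ : σ'.real .sub = σ.real .sub) : E.Holds σ' where
  k := by rw [h₁]; exact h.k
  enum := by rw [h₂]; exact h.enum
  listing := by rw [h₃, h₄]; exact h.listing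
  full := by rw [h₅, h₆]; exact h.full
  sub := by rw [h₆]; exact h.sub

theorem Env.Holds.agree {E : Env n f} {c : Cmd} {σ σ' : Mem} (h : E.Holds σ) (hA : Agree c σ σ')
    (h₁ : c.writesNat .k = false := by rfl) (h₂ : c.writesNat .G = false := by rfl)
    (h₃ : c.writesNat .start = false := by rfl) (h₄ : c.writesNat .mem = false := by rfl)
    (h₅ : c.writesReal .top = false := by rfl) (h₆ : c.writesReal .sub = false := by rfl) :
    E.Holds σ' :=
  h.congr (hA.nat _ h₁) (hA.nat _ h₂) (hA.nat _ h₃) (hA.nat _ h₄) (hA.real _ h₅) (hA.real _ h₆)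

/-- The invariant of a scaling phase with parameter `δ`: the memory holds a convex combination of
extreme bases and a `δ`-feasible flow; `zv` is the difference of the base and the net inflow. -/
structure Core (E : Env n f) (δ : ℝ) (zv : ℕ → ℝ) (σ : Mem) : Prop where
  holds : E.Holds σ
  family : Family E.V E.g E.k (σ.nat .m 0 0) (σ.nat .L) (σ.real .y) (σ.real .lam) (σ.real .x)
  flow : IsFlow E.V δ (σ.real .phi)
  z : ∀ v ∈ E.V, zv v = σ.real .x v 0 - net E.V (σ.real .phi) v
  delta : σ.real .delta 0 0 = δ

theorem Core.congr {E : Env n f} {δ : ℝ} {zv : ℕ → ℝ} {σ σ' : Mem} (h : Core E δ zv σ)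
    (hN : ∀ a, a = .k ∨ a = .G ∨ a = .start ∨ a = .mem ∨ a = .m ∨ a = .L → σ'.nat a = σ.nat a)
    (hR : ∀ a, a = .top ∨ a = .sub ∨ a = .y ∨ a = .lam ∨ a = .x ∨ a = .phi ∨ a = .delta →
      σ'.real a = σ.real a) : Core E δ zv σ' where
  holds := h.holds.congr (hN _ (by simp)) (hN _ (by simp)) (hN _ (by simp)) (hN _ (by simp))
    (hR _ (by simp)) (hR _ (by simp))
  family := by
    rw [hN .m (by simp), hN .L (by simp), hR .y (by simp), hR .lam (by simp), hR .x (by simp)]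
    exact h.family
  flow := by rw [hR .phi (by simp)]; exact h.flow
  z := by rw [hR .phi (by simp), hR .x (by simp)]; exact h.z
  delta := by rw [hR .delta (by simp)]; exact h.delta

theorem Core.agree {E : Env n f} {δ : ℝ} {zv : ℕ → ℝ} {c : Cmd} {σ σ' : Mem} (h : Core E δ zv σ)
    (hA : Agree c σ σ')
    (hN : ∀ a, a = .k ∨ a = .G ∨ a = .start ∨ a = .mem ∨ a = .m ∨ a = .L →
      c.writesNat a = false := by rintro a (rfl | rfl | rfl | rfl | rfl | rfl) <;> rfl)
    (hR : ∀ a, a = .top ∨ a = .sub ∨ a = .y ∨ a = .lam ∨ a = .x ∨ a = .phi ∨ a = .delta →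
      c.writesReal a = false := by
        rintro a (rfl | rfl | rfl | rfl | rfl | rfl | rfl) <;> rfl) : Core E δ zv σ' :=
  h.congr (fun a ha => hA.nat a (hN a ha)) fun a ha => hA.real a (hR a ha)

/-! ### Pushes -/

/-- The state of the pushes, relative to the flow `φ₀` and the number `m₀` of terms at the last
search: `W` is still closed, or an arc that leaves `W` has become available. -/
structure Status (V W : Finset ℕ) (φ₀ : ℕ → ℕ → ℝ) (m₀ : ℕ) (σ : Mem) : Prop where
  same : ∀ a ∈ V, ∀ b ∈ V, (a ∈ W ↔ b ∈ W) → σ.real .phi a b = φ₀ a b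
  cases : (σ.nat .grew 0 0 = 0 ∧ σ.nat .m 0 0 = m₀ ∧
      ∀ a ∈ V, ∀ b ∈ V, a ∈ W → b ∉ W → 0 < σ.real .phi a b) ∨
    (σ.nat .grew 0 0 = 1 ∧ m₀ ≤ σ.nat .m 0 0 ∧ σ.nat .m 0 0 ≤ m₀ + 1 ∧
      ∃ a ∈ V, ∃ b ∈ V, a ∈ W ∧ b ∉ W ∧ σ.real .phi a b ≤ 0)

theorem Status.congr {V W : Finset ℕ} {φ₀ : ℕ → ℕ → ℝ} {m₀ : ℕ} {σ σ' : Mem}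
    (h : Status V W φ₀ m₀ σ) (h₁ : σ'.real .phi = σ.real .phi) (h₂ : σ'.nat .m = σ.nat .m)
    (h₃ : σ'.nat .grew = σ.nat .grew) : Status V W φ₀ m₀ σ' :=
  ⟨by rw [h₁]; exact h.same, by rw [h₁, h₂, h₃]; exact h.cases⟩

/-- A push leaves `x - ∂φ` unchanged and interchanges `u` and `v` in the ordering `i`. If it is not
saturating, then it also splits the term `i`, and the `δ` units of flow that it moves make the arc
`(u, v)` available, so that `W` can grow. -/
theorem wp_push {E : Env n f} {δ : ℝ} {zv : ℕ → ℝ} {W : Finset ℕ} {φ₀ : ℕ → ℕ → ℝ} {m₀ i q : ℕ}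
    {u v : ℕ} (hC : Core E δ zv σ) (hδ : 0 < δ) (hS : Status E.V W φ₀ m₀ σ)
    (hgrew : σ.nat .grew 0 0 = 0) (hi : σ.nat .i 0 0 = i) (him : i < m₀)
    (hq : σ.nat .q 0 0 = q) (hqk : q + 1 < E.k) (hu : σ.nat .L i (q + 1) = u)
    (hv : σ.nat .L i q = v) (hvv : σ.nat .vv 0 0 = v) (huW : u ∈ W) (hvW : v ∉ W)
    (hQ : QRep σ (E.set (pre (σ.nat .L i) q)))
    (post : ∀ σ' t, Core E δ zv σ' → Status E.V W φ₀ m₀ σ' → σ'.nat .q 0 0 = q + 1 →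
      (∀ p < E.k, σ'.nat .L i p = if p = q + 1 then v else if p = q then u else σ.nat .L i p) →
      (∀ j < m₀, j ≠ i → σ'.nat .L j = σ.nat .L j) →
      QRep σ' (E.set (pre (σ'.nat .L i) (q + 1))) → Agree push σ σ' →
      t ≤ 500 * E.wt u + 500 * E.wt v + (if σ'.nat .grew 0 0 = 0 then 0 else 200 * n) → Q σ' t) :
    wp f push σ Q := by
  have hm : σ.nat .m 0 0 = m₀ ∧ ∀ a ∈ E.V, ∀ b ∈ E.V, a ∈ W → b ∉ W → 0 < σ.real .phi a b := by
    rcases hS.cases with h | h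
    · exact h.2
    · omega
  obtain ⟨hm, hcl⟩ := hm
  have hF := hC.family
  rw [hm] at hF
  have hLi := hF.enum i him
  have huV : u ∈ E.V := hu ▸ hLi.mem _ hqk
  have hvV : v ∈ E.V := hv ▸ hLi.mem _ (by omega)
  have hne : u ≠ v := fun h => hvW (h ▸ huW)
  have hφuv := hcl u huV v hvV huW hvW
  have hφle := hC.flow.le u huV v hvV
  have huq : u ∉ pre (σ.nat .L i) q := hu ▸ hLi.notMem_pre hqk (by omega)
  have hvq : v ∉ insert u (pre (σ.nat .L i) q) := by
    rw [mem_insert, not_or]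
    exact ⟨hne.symm, hv ▸ hLi.notMem_pre (by omega) le_rfl⟩
  have hpq : pre (σ.nat .L i) q ⊆ E.V := hLi.pre_subset (by omega)
  have hpq' : insert u (pre (σ.nat .L i) q) ⊆ E.V := insert_subset huV hpq
  have hpre2 : insert v (insert u (pre (σ.nat .L i) q)) = pre (σ.nat .L i) (q + 2) := by
    rw [pre_succ, pre_succ, hu, hv, insert_comm]
  suffices H : wp f push σ (fun σ' t => Core E δ zv σ' ∧ Status E.V W φ₀ m₀ σ' ∧
      σ'.nat .q 0 0 = q + 1 ∧
      (∀ p < E.k, σ'.nat .L i p = if p = q + 1 then v else if p = q then u else σ.nat .L i p) ∧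
      (∀ j < m₀, j ≠ i → σ'.nat .L j = σ.nat .L j) ∧
      QRep σ' (E.set (insert u (pre (σ.nat .L i) q))) ∧
      t ≤ 500 * E.wt u + 500 * E.wt v + (if σ'.nat .grew 0 0 = 0 then 0 else 200 * n)) by
    refine wp_mono H ?_
    rintro σ' t ⟨h₁, h₂, h₃, h₄, h₅, h₆, h₇⟩ hA
    refine post σ' t h₁ h₂ h₃ h₄ h₅ ?_ hA h₇
    rw [pre_succ, h₄ q (by omega), if_neg (by omega), if_pos rfl,
      pre_congr (L := σ.nat .L i) (L' := σ'.nat .L i)]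
    · exact h₆
    · intro r hr
      rw [h₄ r (by omega), if_neg (by omega), if_neg (by omega)]
  unfold push
  rw [wp_seq, wp_nset]
  simp only [NExp.eval, NExp.eval_ofNat, hi, hq, hu]
  rw [wp_seq]
  refine wp_insertClass (w := u) (fun σ' hA => by simp [hA.nat .uu rfl]) (by simp)
    hC.holds.listing (E.lt u huV) (hQ.congr (by simp) (by simp)) (E.disjoint_set hpq huV huq) ?_
  intro σ₁ t₁ hQ₁ hA₁ ht₁
  rw [← E.set_insert] at hQ₁
  have eN₁ : ∀ a, a ≠ .uu → a ≠ .Q → a ≠ .cnt → a ≠ .t → σ₁.nat a = σ.nat a := by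
    intro a h₁ h₂ h₃ h₄
    rw [hA₁.nat a (by simp [insertClass, forTo, Cmd.writesNat, h₂, h₃, h₄])]
    simp [h₁]
  have eR₁ : σ₁.real = σ.real := by ext a r c; rw [hA₁.real a rfl]; simp
  have eu₁ : σ₁.nat .uu 0 0 = u := by rw [hA₁.nat .uu rfl]; simp
  rw [wp_seq]
  refine wp_evalQ (fh := E.fh) hQ₁ E.fh_eq (by rw [eR₁]; exact hC.holds.full) (by simp) ?_
  intro t₂ ht₂
  rw [eR₁, hC.holds.sub]
  rw [wp_seq]
  refine wp_insertClass (w := v) (fun σ' hA => by simp [hA.nat .vv rfl, eN₁, hvv]) (by simp)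
    (by simpa [eN₁] using hC.holds.listing) (E.lt v hvV) (hQ₁.congr (by simp) (by simp))
    (E.disjoint_set hpq' hvV hvq) ?_
  intro σ₃ t₃ hQ₃ hA₃ ht₃
  rw [← E.set_insert, hpre2] at hQ₃
  have eN₃ : ∀ a, a ≠ .uu → a ≠ .Q → a ≠ .cnt → a ≠ .t → σ₃.nat a = σ.nat a := by
    intro a h₁ h₂ h₃ h₄
    rw [hA₃.nat a (by simp [insertClass, forTo, Cmd.writesNat, h₂, h₃, h₄])]
    simp [eN₁ a h₁ h₂ h₃ h₄]
  have eR₃ : ∀ a, a ≠ .r₁ → σ₃.real a = σ.real a := by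
    intro a h; rw [hA₃.real a rfl]; simp [h, eR₁]
  have er₃ : σ₃.real .r₁ 0 0 = E.g (insert u (pre (σ.nat .L i) q)) := by
    rw [hA₃.real .r₁ rfl]; simp [Env.g]
  have eu₃ : σ₃.nat .uu 0 0 = u := by rw [hA₃.nat .uu rfl]; simp [eu₁]
  rw [wp_seq]
  refine wp_evalQ (fh := E.fh) hQ₃ E.fh_eq
    (by rw [eR₃ _ (by simp), eR₃ _ (by simp)]; exact hC.holds.full) (by simp) ?_
  intro t₄ ht₄
  rw [eR₃ _ (by simp), hC.holds.sub]
  rw [wp_seq]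
  refine wp_removeClass (w := v) (fun σ' hA => by simp [hA.nat .vv rfl, eN₃, hvv]) (by simp)
    (by simpa [eN₃] using hC.holds.listing) (E.lt v hvV) (hQ₃.congr (by simp) (by simp))
    (by rw [← hpre2, E.set_insert]; exact subset_union_right) ?_
  intro σ₅ t₅ hQ₅ hA₅ ht₅
  rw [← hpre2, E.set_insert, union_sdiff_cancel_right (E.disjoint_set hpq' hvV hvq)] at hQ₅
  have eN : ∀ a, a ≠ .uu → a ≠ .Q → a ≠ .cnt → a ≠ .t → σ₅.nat a = σ.nat a := by
    intro a h₁ h₂ h₃ h₄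
    rw [hA₅.nat a (by simp [removeClass, forTo, Cmd.writesNat, h₂, h₃, h₄])]
    simp [eN₃ a h₁ h₂ h₃ h₄]
  have eR : ∀ a, a ≠ .r₁ → a ≠ .r₂ → σ₅.real a = σ.real a := by
    intro a h h'; rw [hA₅.real a rfl]; simp [h', eR₃ a h]
  have er₁ : σ₅.real .r₁ 0 0 = E.g (insert u (pre (σ.nat .L i) q)) := by
    rw [hA₅.real .r₁ rfl]; simp [er₃]
  have er₂ : σ₅.real .r₂ 0 0 = E.g (pre (σ.nat .L i) (q + 2)) := by
    rw [hA₅.real .r₂ rfl]; simp [Env.g]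
  have eu : σ₅.nat .uu 0 0 = u := by rw [hA₅.nat .uu rfl]; simp [eu₃]
  have eHolds : E.Holds σ₅ := hC.holds.congr (eN _ (by simp) (by simp) (by simp) (by simp))
    (eN _ (by simp) (by simp) (by simp) (by simp)) (eN _ (by simp) (by simp) (by simp) (by simp))
    (eN _ (by simp) (by simp) (by simp) (by simp)) (eR _ (by simp) (by simp))
    (eR _ (by simp) (by simp))
  clear hA₁ hQ₁ hA₃ hQ₃ hA₅ eN₁ eN₃ eR₁ eR₃ er₃ eu₁ eu₃ hQ
  set c : ℝ := E.g (insert u (pre (σ.nat .L i) q)) - E.g (pre (σ.nat .L i) (q + 2)) +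
    σ.real .y i v with hc
  have hc0 : 0 ≤ c := by
    have := (hF.greedy i him).exchange_nonneg hLi E.submodOn hqk
    rwa [hu, hv] at this
  set lc : ℝ := σ.real .lam i 0 * c with hlc
  have hlc0 : 0 ≤ lc := mul_nonneg (hF.nonneg i him) hc0
  set α : ℝ := min lc δ with hα
  have hα0 : 0 ≤ α := le_min hlc0 hδ.le
  have hαδ : α ≤ δ := min_le_right _ _
  simp only [wp_seq, wp_nset, wp_rset]
  refine wp_mono (Q := fun σ' t => σ' = ((σ₅.setReal .cap 0 0 c).setReal .lc 0 0 lc).setReal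
    .alpha 0 0 α ∧ t ≤ 20) ?_ ?_
  · refine wp_cond ?_ ?_
    · intro h
      simp [er₁, er₂, eR, eN, hi, hvv, ← hc, ← hlc, hC.delta] at h
      simp [er₁, er₂, eR, eN, hi, hvv, ← hc, ← hlc, hC.delta]
      rw [hα, min_eq_left h]
    · intro h
      simp [er₁, er₂, eR, eN, hi, hvv, ← hc, ← hlc, hC.delta] at h
      simp [er₁, er₂, eR, eN, hi, hvv, ← hc, ← hlc, hC.delta]
      rw [hα, min_eq_right h.le]
  rintro _ t₆ ⟨rfl, ht₆⟩ -
  -- The flow after the push.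
  set φ' : ℕ → ℕ → ℝ := fun a b => σ.real .phi a b + (if a = v ∧ b = u then α else 0) -
    (if a = u ∧ b = v then α else 0) with hφ'
  have hskew := hC.flow.skew u huV v hvV
  have hflow : IsFlow E.V δ φ' :=
    hC.flow.update (u := v) (w := u) (α := α) (fun a b => rfl) (by linarith) (by linarith) hvV huV
      hne.symm
  have hnet : ∀ w, net E.V φ' w = net E.V (σ.real .phi) w + (if w = u then α else 0) -
      (if w = v then α else 0) := net_update hvV huV fun a b => rfl
  refine wp_mono (Q := fun σ' t => Family E.V E.g E.k (σ'.nat .m 0 0) (σ'.nat .L) (σ'.real .y)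
    (σ'.real .lam) (σ.real .x) ∧ σ'.real .lam i 0 * c = α ∧
    (∀ j < m₀, σ'.nat .L j = σ.nat .L j) ∧ (∀ w ∈ E.V, σ'.real .y i w = σ.real .y i w) ∧
    ((σ'.nat .m 0 0 = m₀ ∧ t ≤ 20) ∨ (σ'.nat .m 0 0 = m₀ + 1 ∧ α = δ ∧ t ≤ 100 + 100 * n)) ∧
    (∀ a, a ≠ .L → a ≠ .m → a ≠ .r → σ'.nat a = σ₅.nat a) ∧
    (∀ a, a ≠ .y → a ≠ .lam → a ≠ .cap → a ≠ .lc → a ≠ .alpha → a ≠ .phi →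
      σ'.real a = σ₅.real a) ∧ σ'.real .cap 0 0 = c ∧ σ'.real .alpha 0 0 = α ∧
    σ'.real .phi = φ') ?_ ?_
  · have hphi : ∀ a b, (if a = v ∧ b = u then σ.real .phi v u + α else
        if a = u ∧ b = v then σ.real .phi u v - α else σ.real .phi a b) = φ' a b := by
      intro a b
      simp only [hφ']
      by_cases h₁ : a = v ∧ b = u
      · rw [if_pos h₁, if_pos h₁, if_neg (fun h => hne (h.1.symm.trans h₁.1)), h₁.1, h₁.2]
        ring
      · rw [if_neg h₁, if_neg h₁]
        split_ifs with h₂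
        · rw [h₂.1, h₂.2]; ring
        · ring
    refine wp_when ?_ ?_
    · intro h
      simp at h
      have hδlc : δ < lc := by
        by_contra hcon
        rw [hα, min_eq_left (not_lt.1 hcon)] at h
        exact lt_irrefl _ h
      have hαeq : α = δ := min_eq_right hδlc.le
      have hcpos : 0 < c := by
        rcases hc0.lt_or_eq with h' | h'
        · exact h'
        · rw [hlc, ← h', mul_zero] at hδlc
          linarith
      have hαc : α / c ≤ σ.real .lam i 0 := by
        rw [div_le_iff₀ hcpos]
        exact h.le
      simp only [wp_seq, wp_nset, wp_rset]
      refine wp_forTo_zero E.k (fun r σ' => (∀ j, j ≠ m₀ → σ'.nat .L j = σ.nat .L j) ∧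
        (∀ j, j ≠ m₀ → σ'.real .y j = σ.real .y j) ∧
        (∀ p < r, σ'.nat .L m₀ p = σ.nat .L i p) ∧
        (∀ p < r, σ'.real .y m₀ (σ.nat .G p 0) = σ.real .y i (σ.nat .G p 0))) 40 rfl ?_ ?_ ?_ ?_
      · intro σ' hA
        have := hA.nat .k rfl
        simp [this, eN, hC.holds.k]
      · simp [eN, eR]
      · rintro r σ' hr ⟨h₁, h₂, h₃, h₄⟩ hrr hA
        have e₁ : σ'.nat .G = σ.nat .G := by rw [hA.nat .G rfl]; simp [eN]
        have e₂ : σ'.nat .m 0 0 = m₀ := by rw [hA.nat .m rfl]; simp [eN, hm]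
        have e₃ : σ'.nat .i 0 0 = i := by rw [hA.nat .i rfl]; simp [eN, hi]
        have him' : i ≠ m₀ := by omega
        simp only [wp_seq, wp_nset, wp_rset]
        refine ⟨by simp, ?_, ?_, ?_, ?_⟩
        · intro j hj
          funext p
          simp [hj, e₂, h₁ j hj]
        · intro j hj
          funext p
          simp [hj, e₂, h₂ j hj]
        · intro p hp
          simp [e₂, e₃, hrr, h₁ i him']
          split_ifs with hpr
          · rw [hpr]
          · exact h₃ p (by omega)
        · intro p hp
          simp [e₁, e₂, e₃, hrr, h₂ i him']
          by_cases hpr : p = r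
          · rw [hpr]; simp
          · rw [h₄ p (by omega)]
            split_ifs with hG
            · rw [hG]
            · rfl
      · rintro σ' t ⟨h₁, h₂, h₃, h₄⟩ hA ht
        have e₀ : ∀ a, a ≠ .L → a ≠ .r → σ'.nat a = σ₅.nat a := by
          intro a ha₁ ha₂
          rw [hA.nat a (by simp [forTo, Cmd.writesNat, ha₁, ha₂])]
          simp
        have e₁ : ∀ a, a ≠ .y → a ≠ .lam → a ≠ .cap → a ≠ .lc → a ≠ .alpha → a ≠ .phi →
            σ'.real a = σ₅.real a := by
          intro a b₁ b₂ b₃ b₄ b₅ b₆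
          rw [hA.real a (by simp [forTo, Cmd.writesReal, b₁])]
          simp [b₁, b₂, b₃, b₄, b₅, b₆]
        have e₂ : σ'.real .lam = fun a b => if a = i ∧ b = 0 then α / c else
            if a = m₀ ∧ b = 0 then σ.real .lam i 0 - α / c else σ.real .lam a b := by
          funext a b
          rw [hA.real .lam rfl]
          simp [eN, eR, hi, hm]
        have e₃ : σ'.real .cap 0 0 = c := by rw [hA.real .cap rfl]; simp
        have e₄ : σ'.real .alpha 0 0 = α := by rw [hA.real .alpha rfl]; simp
        have e₅ : σ'.real .phi = φ' := by
          funext a b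
          rw [hA.real .phi rfl]
          simp [eN, eR, hvv, eu, hne, hne.symm, hphi]
        have e₆ : σ'.nat .m 0 0 = m₀ := by rw [e₀ _ (by simp) (by simp)]; simp [eN, hm]
        have hfam : Family E.V E.g E.k (m₀ + 1) (σ'.nat .L) (σ'.real .y) (σ'.real .lam)
            (σ.real .x) := by
          refine hF.split him (β := α / c) (by positivity) hαc
            (fun j hj p hp => by rw [h₁ j (by omega)]) h₃ (fun j hj w hw => by rw [h₂ j (by omega)])
            ?_ ?_ ?_ ?_
          · intro w hw
            obtain ⟨p, hp, rfl⟩ := hC.holds.enum.surj w hw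
            exact h₄ p hp
          · intro j hj hji
            rw [e₂]
            simp [hji, show j ≠ m₀ by omega]
          · rw [e₂]; simp
          · rw [e₂]
            simp [show m₀ ≠ i by omega]
        have hkn := E.k_le
        simp [e₆] at ht ⊢
        refine ⟨hfam, ?_, fun j hj => h₁ j (by omega), fun w hw => by rw [h₂ i (by omega)],
          ⟨hαeq, by omega⟩, ?_, e₁, e₃, e₄, e₅⟩
        · rw [e₂]
          simp
          field_simp
        · intro a b₁ b₂ b₃
          simp [b₂, e₀ a b₁ b₃]
    · intro h
      simp at h
      have hαeq : α = lc := le_antisymm (min_le_left _ _) h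
      simp [eN, hm]
      refine ⟨by simpa [eR] using hF, ?_, by simp [eR], ?_, ?_⟩
      · simp [eR, ← hlc, hαeq]
      · intro a b₁ b₂ b₃ b₄ b₅ b₆
        simp [b₁, b₂, b₃, b₄, b₅, b₆]
      · funext a b
        simp [eN, eR, hvv, eu, hne, hne.symm, hphi]
  rintro σ₇ t₇ ⟨hfam, hlam, hL₇, hy₇, hcase, eN₇, eR₇, ecap, ealpha, ephi⟩ -
  have e₁ : σ₇.nat .i 0 0 = i := by rw [eN₇ _ (by simp) (by simp) (by simp)]; simp [eN, hi]
  have e₂ : σ₇.nat .uu 0 0 = u := by rw [eN₇ _ (by simp) (by simp) (by simp)]; exact eu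
  have e₃ : σ₇.nat .vv 0 0 = v := by rw [eN₇ _ (by simp) (by simp) (by simp)]; simp [eN, hvv]
  have e₄ : σ₇.nat .q 0 0 = q := by rw [eN₇ _ (by simp) (by simp) (by simp)]; simp [eN, hq]
  have e₅ : σ₇.real .x = σ.real .x := by
    rw [eR₇ _ (by simp) (by simp) (by simp) (by simp) (by simp) (by simp)]; simp [eR]
  have e₆ : σ₇.real .delta 0 0 = δ := by
    rw [eR₇ _ (by simp) (by simp) (by simp) (by simp) (by simp) (by simp)]; simp [eR, hC.delta]
  have e₇ : σ₇.nat .grew 0 0 = 0 := by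
    rw [eN₇ _ (by simp) (by simp) (by simp)]; simp [eN, hgrew]
  have e₈ : E.Holds σ₇ := eHolds.congr (eN₇ _ (by simp) (by simp) (by simp))
    (eN₇ _ (by simp) (by simp) (by simp)) (eN₇ _ (by simp) (by simp) (by simp))
    (eN₇ _ (by simp) (by simp) (by simp))
    (eR₇ _ (by simp) (by simp) (by simp) (by simp) (by simp) (by simp))
    (eR₇ _ (by simp) (by simp) (by simp) (by simp) (by simp) (by simp))
  have e₉ : QRep σ₇ (E.set (insert u (pre (σ.nat .L i) q))) :=
    hQ₅.congr (eN₇ _ (by simp) (by simp) (by simp)) (eN₇ _ (by simp) (by simp) (by simp))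
  have hm₇ : m₀ ≤ σ₇.nat .m 0 0 := by rcases hcase with h | h <;> omega
  have him₇ : i < σ₇.nat .m 0 0 := by omega
  have hφ'uv : φ' u v = σ.real .phi u v - α := by simp [hφ', hne]
  have fin : ∀ s : Mem, ∀ t : ℕ, s.real .phi = φ' → s.real .lam = σ₇.real .lam →
      s.real .delta = σ₇.real .delta → s.real .top = σ₇.real .top →
      s.real .sub = σ₇.real .sub →
      (∀ a b, s.real .y a b = σ₇.real .y a b + (if a = i ∧ b = u then c else 0) -
        (if a = i ∧ b = v then c else 0)) →
      (∀ a, s.real .x a 0 = σ.real .x a 0 + (if a = u then α else 0) - (if a = v then α else 0)) →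
      (∀ a b, s.nat .L a b = if a = i ∧ b = q + 1 then v else if a = i ∧ b = q then u
        else σ₇.nat .L a b) →
      (∀ a, a ≠ .L → a ≠ .q → a ≠ .grew → s.nat a = σ₇.nat a) → s.nat .q 0 0 = q + 1 →
      s.nat .grew 0 0 = (if φ' u v ≤ 0 then 1 else 0) →
      t ≤ t₁ + t₂ + t₃ + t₄ + t₅ + t₆ + t₇ + 250 →
      Core E δ zv s ∧ Status E.V W φ₀ m₀ s ∧
      s.nat .q 0 0 = q + 1 ∧
      (∀ p < E.k, s.nat .L i p = if p = q + 1 then v else if p = q then u else σ.nat .L i p) ∧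
      (∀ j < m₀, j ≠ i → s.nat .L j = σ.nat .L j) ∧
      QRep s (E.set (insert u (pre (σ.nat .L i) q))) ∧
      t ≤ 500 * E.wt u + 500 * E.wt v + (if s.nat .grew 0 0 = 0 then 0 else 200 * n) := by
    intro s t h₁ h₂ h₃ h₄ h₅ h₆ h₇ h₈ h₉ h₁₀ h₁₁ h₁₂
    have hsm : s.nat .m = σ₇.nat .m := h₉ _ (by simp) (by simp) (by simp)
    refine ⟨⟨?_, ?_, ?_, ?_, ?_⟩, ⟨?_, ?_⟩, h₁₀, ?_, ?_, ?_, ?_⟩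
    · exact e₈.congr (h₉ _ (by simp) (by simp) (by simp)) (h₉ _ (by simp) (by simp) (by simp))
        (h₉ _ (by simp) (by simp) (by simp)) (h₉ _ (by simp) (by simp) (by simp)) h₄ h₅
    · rw [hsm, h₂]
      refine hfam.push him₇ hqk (c := c) ?_ ?_ ?_ ?_ ?_ ?_ ?_ ?_
      · rw [hL₇ i him, hu, hv, hy₇ v hvV]
      · intro j hj hji p hp
        rw [h₈]; simp [hji]
      · rw [h₈, hL₇ i him, hu]; simp
      · rw [h₈, hL₇ i him, hv]; simp
      · intro p hp hp₁ hp₂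
        rw [h₈]; simp [hp₁, hp₂]
      · intro j hj hji w hw
        rw [h₆]; simp [hji]
      · intro w hw
        rw [h₆, hL₇ i him, hu, hv]; simp
      · intro w hw
        rw [h₇, hL₇ i him, hu, hv, hlam]
    · rw [h₁]; exact hflow
    · intro w hw
      rw [h₁, hnet, h₇, hC.z w hw]
      ring
    · rw [h₃]; exact e₆
    · intro a ha b hb hab
      rw [h₁, ← hS.same a ha b hb hab]
      simp only [hφ']
      rw [if_neg, if_neg]
      · ring
      · rintro ⟨rfl, rfl⟩; exact hvW (hab.1 huW)
      · rintro ⟨rfl, rfl⟩; exact hvW (hab.2 huW)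
    · rw [h₁₁, hsm, h₁]
      by_cases hle : φ' u v ≤ 0
      · rw [if_pos hle]
        refine Or.inr ⟨rfl, hm₇, by rcases hcase with h | h <;> omega, u, huV, v, hvV, huW, hvW,
          hle⟩
      · rw [if_neg hle]
        refine Or.inl ⟨rfl, ?_, ?_⟩
        · rcases hcase with h | ⟨_, h, _⟩
          · exact h.1
          · rw [hφ'uv] at hle
            exact absurd (by linarith) hle
        · intro a ha b hb haW hbW
          by_cases hab : a = u ∧ b = v
          · obtain ⟨rfl, rfl⟩ := hab
            exact not_le.1 hle
          · simp only [hφ']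
            rw [if_neg hab, if_neg, add_zero, sub_zero]
            · exact hcl a ha b hb haW hbW
            · rintro ⟨rfl, rfl⟩; exact hvW haW
    · intro p hp
      rw [h₈, hL₇ i him]; simp
    · intro j hj hji
      funext p
      rw [h₈, hL₇ j hj]; simp [hji]
    · exact e₉.congr (h₉ _ (by simp) (by simp) (by simp)) (h₉ _ (by simp) (by simp) (by simp))
    · have hn := E.pos
      rw [h₁₁]
      unfold Env.wt
      rcases hcase with h | ⟨_, h, ht₇⟩
      · have := h.2
        omega
      · rw [if_pos (show φ' u v ≤ 0 by rw [hφ'uv]; linarith), if_neg one_ne_zero]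
        omega
  have hyp : ∀ a b, (if a = i ∧ b = v then σ₇.real .y i v - c else if a = i ∧ b = u then
      σ₇.real .y i u + c else σ₇.real .y a b) = σ₇.real .y a b + (if a = i ∧ b = u then c else 0) -
        (if a = i ∧ b = v then c else 0) := by
    intro a b
    by_cases h₁ : a = i ∧ b = v
    · rw [if_pos h₁, if_pos h₁, if_neg (fun h => hne (h.2.symm.trans h₁.2)), h₁.1, h₁.2]; ring
    · rw [if_neg h₁, if_neg h₁]
      split_ifs with h₂
      · rw [h₂.1, h₂.2]; ring
      · ring
  have hxp : ∀ a, (if a = v then σ.real .x v 0 - α else if a = u then σ.real .x u 0 + α else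
      σ.real .x a 0) = σ.real .x a 0 + (if a = u then α else 0) - (if a = v then α else 0) := by
    intro a
    by_cases h₁ : a = v
    · rw [if_pos h₁, if_pos h₁, if_neg (fun h => hne (h.symm.trans h₁)), h₁]; ring
    · rw [if_neg h₁, if_neg h₁]
      split_ifs with h₂
      · rw [h₂]; ring
      · ring
  refine wp_when ?_ ?_
  · intro h
    simp [e₂, e₃, ephi] at h
    simp only [wp_nset]
    refine fin _ _ ?_ ?_ ?_ ?_ ?_ ?_ ?_ ?_ ?_ ?_ ?_ ?_
    · simp [ephi]
    · simp
    · simp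
    · simp
    · simp
    · intro a b
      simp [e₁, e₂, e₃, ecap, hne, hne.symm, hyp]
    · intro a
      simp [e₁, e₂, e₃, e₅, ealpha, hne, hne.symm, hxp]
    · intro a b
      simp [e₁, e₂, e₃, e₄]
    · intro a h₁ h₂ h₃
      simp [h₁, h₂, h₃]
    · simp [e₄]
    · simp [h]
    · simp
      omega
  · intro h
    simp [e₂, e₃, ephi] at h
    refine fin _ _ ?_ ?_ ?_ ?_ ?_ ?_ ?_ ?_ ?_ ?_ ?_ ?_
    · simp [ephi]
    · simp
    · simp
    · simp
    · simp
    · intro a b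
      simp [e₁, e₂, e₃, ecap, hne, hne.symm, hyp]
    · intro a
      simp [e₁, e₂, e₃, e₅, ealpha, hne, hne.symm, hxp]
    · intro a b
      simp [e₁, e₂, e₃, e₄]
    · intro a h₁ h₂ h₃
      simp [h₁, h₂, h₃]
    · simp [e₄]
    · simp [h, e₇]
    · simp
      omega

/-! ### Scanning the orderings for active vertices -/

/-- The potential that pays for the pushes on an ordering: elements of `W` only move to the left
and other elements only move to the right. It decreases when `W` grows. -/
def Env.pot (E : Env n f) (W : Finset ℕ) (L : ℕ → ℕ) : ℕ :=
  ∑ p ∈ range E.k, 1000 * E.wt (L p) * (if L p ∈ W then p else 2 * E.k - p)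

/-- From position `p` on, the elements of `W` precede the other elements. -/
def Sorted (W : Finset ℕ) (k : ℕ) (L : ℕ → ℕ) (p : ℕ) : Prop :=
  ∀ r s, p ≤ r → r < s → s < k → L r ∉ W → L s ∉ W

theorem Env.pot_le (E : Env n f) (W : Finset ℕ) {L : ℕ → ℕ} (hL : Enum E.k L E.V) :
    E.pot W L ≤ 4000 * n * n := by
  have hk := E.k_le
  have h₁ : E.pot W L ≤ ∑ p ∈ range E.k, E.wt (L p) * (2000 * n) := by
    refine sum_le_sum fun p hp => ?_
    have hp := mem_range.1 hp
    rw [mul_comm 1000, mul_assoc]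
    refine Nat.mul_le_mul_left _ ?_
    split_ifs <;> omega
  rw [hL.sum fun v => E.wt v * (2000 * n), ← sum_mul] at h₁
  have h₂ := E.sum_wt_le subset_rfl
  calc E.pot W L ≤ _ := h₁
    _ ≤ 2 * n * (2000 * n) := Nat.mul_le_mul_right _ h₂
    _ = _ := by ring

theorem Env.pot_anti (E : Env n f) {W W' : Finset ℕ} (h : W ⊆ W') (L : ℕ → ℕ) :
    E.pot W' L ≤ E.pot W L := by
  refine sum_le_sum fun p hp => Nat.mul_le_mul_left _ ?_
  have hp := mem_range.1 hp
  by_cases h₁ : L p ∈ W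
  · rw [if_pos h₁, if_pos (h h₁)]
  · rw [if_neg h₁]
    split_ifs <;> omega

/-- The decrease of the potential pays for a push. -/
theorem Env.pot_swap (E : Env n f) {W : Finset ℕ} {L L' : ℕ → ℕ} {q u v : ℕ} (hq : q + 1 < E.k)
    (hu : L (q + 1) = u) (hv : L q = v) (huW : u ∈ W) (hvW : v ∉ W)
    (hL' : ∀ p < E.k, L' p = if p = q + 1 then v else if p = q then u else L p) :
    E.pot W L' + 1000 * E.wt u + 1000 * E.wt v = E.pot W L := by
  have hsplit : ∀ h : ℕ → ℕ, ∑ p ∈ range E.k, h p =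
      h q + (h (q + 1) + ∑ p ∈ ((range E.k).erase q).erase (q + 1), h p) := by
    intro h
    rw [add_sum_erase _ h (by simp; omega), add_sum_erase _ h (by simp; omega)]
  unfold Env.pot
  rw [hsplit, hsplit fun p => 1000 * E.wt (L p) * (if L p ∈ W then p else 2 * E.k - p)]
  have hrest : ∑ p ∈ ((range E.k).erase q).erase (q + 1),
      1000 * E.wt (L' p) * (if L' p ∈ W then p else 2 * E.k - p) =
      ∑ p ∈ ((range E.k).erase q).erase (q + 1),
      1000 * E.wt (L p) * (if L p ∈ W then p else 2 * E.k - p) := by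
    refine sum_congr rfl fun p hp => ?_
    simp only [mem_erase, mem_range] at hp
    rw [hL' p hp.2.2, if_neg hp.1, if_neg hp.2.1]
  rw [hrest, hL' q (by omega), hL' (q + 1) hq, if_neg (by omega), if_pos rfl, if_pos rfl, hu, hv,
    if_pos huW, if_neg hvW, if_pos huW, if_neg hvW,
    show 2 * E.k - q = 2 * E.k - (q + 1) + 1 by omega]
  ring

/-- An ordering without active vertex starts with the elements of `W`. -/
theorem Sorted.exists_pre_eq {W V : Finset ℕ} {k : ℕ} {L : ℕ → ℕ} (hL : Enum k L V)
    (hW : W ⊆ V) (h : Sorted W k L 0) : ∃ p ≤ k, pre L p = W := by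
  have key : ∀ p ≤ k, (∀ r < p, L r ∈ W) ∨ ∃ p' ≤ k, pre L p' = W := by
    intro p
    induction p with
    | zero => intro _; left; simp
    | succ p ih =>
      intro hp
      rcases ih (by omega) with h' | h'
      · by_cases hpW : L p ∈ W
        · left
          intro r hr
          rcases Nat.lt_succ_iff_lt_or_eq.1 hr with hr | rfl
          · exact h' r hr
          · exact hpW
        · right
          refine ⟨p, by omega, ?_⟩
          ext v
          rw [mem_pre]
          constructor
          · rintro ⟨r, hr, rfl⟩
            exact h' r hr
          · intro hv
            obtain ⟨s, hs, rfl⟩ := hL.surj v (hW hv)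
            refine ⟨s, ?_, rfl⟩
            by_contra hsp
            rcases Nat.lt_or_ge p s with hps | hps
            · exact h p s (by omega) hps hs hpW hv
            · exact hpW (by rwa [show p = s by omega])
      · exact Or.inr h'
  rcases key k le_rfl with h' | h'
  · refine ⟨k, le_rfl, Subset.antisymm ?_ (by rw [hL.pre_eq]; exact hW)⟩
    intro v hv
    obtain ⟨r, hr, rfl⟩ := mem_pre.1 hv
    exact h' r hr
  · exact h'

/-- A scan of the ordering `i` performs pushes until it has no active vertex or `W` can grow. The time
is paid for by the potential, except for a linear term. -/
theorem wp_scan {E : Env n f} {δ : ℝ} {zv : ℕ → ℝ} {W : Finset ℕ} {φ₀ : ℕ → ℕ → ℝ} {m₀ i : ℕ}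
    (hC : Core E δ zv σ) (hδ : 0 < δ) (hS : Status E.V W φ₀ m₀ σ)
    (hgrew : σ.nat .grew 0 0 = 0) (hi : σ.nat .i 0 0 = i) (him : i < m₀)
    (hflag : ∀ v ∈ E.V, σ.nat .W v 0 = if v ∈ W then 1 else 0) :
    wp f scan σ (fun σ' t =>
      Core E δ zv σ' ∧
      Status E.V W φ₀ m₀ σ' ∧
      (∀ j < m₀, j ≠ i → σ'.nat .L j = σ.nat .L j) ∧
      (σ'.nat .grew 0 0 = 0 → Sorted W E.k (σ'.nat .L i) 0) ∧
      t + E.pot W (σ'.nat .L i) ≤ E.pot W (σ.nat .L i) + 1500 * n +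
        (if σ'.nat .grew 0 0 = 0 then 0 else 200 * n)) := by
  have hn := E.pos
  have hkn := E.k_le
  have mle : ∀ σ', Status E.V W φ₀ m₀ σ' → Core E δ zv σ' → σ'.nat .grew 0 0 = 0 →
      σ'.nat .m 0 0 = m₀ := by
    intro σ' h _ hg
    rcases h.cases with h | h
    · exact h.2.1
    · omega
  have menum : ∀ σ', Status E.V W φ₀ m₀ σ' → Core E δ zv σ' → (i < σ'.nat .m 0 0) →
      Enum E.k (σ'.nat .L i) E.V := fun σ' _ h h' => h.family.enum i h'
  have hg01 : ∀ σ', Status E.V W φ₀ m₀ σ' → σ'.nat .grew 0 0 = 0 ∨ σ'.nat .grew 0 0 = 1 := by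
    intro σ' h
    rcases h.cases with h | h
    · exact Or.inl h.1
    · exact Or.inr h.1
  have hLi₀ : Enum E.k (σ.nat .L i) E.V := hC.family.enum i (by rw [mle σ hS hC hgrew]; exact him)
  unfold scan
  simp only [wp_seq, wp_nset]
  refine wp_forTo_zero n (fun j σ' => ∀ i < j, σ'.nat .Q i 0 = 1) 10 rfl (fun _ _ => rfl)
    (by simp) ?_ ?_
  · intro j σ' hj hI hjj hA
    simp only [wp_nset]
    refine ⟨by simp, fun i hi => ?_⟩
    simp [hjj]
    intro hij
    exact hI i (by omega)
  intro σ₁ t₁ hI₁ hA₁ ht₁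
  have e₁ : ∀ a, a ≠ .Q → a ≠ .cnt → a ≠ .j → σ₁.nat a = σ.nat a := by
    intro a h₁ h₂ h₃
    rw [hA₁.nat a (by simp [forTo, Cmd.writesNat, h₁, h₃])]
    simp [h₂]
  have e₂ : σ₁.real = σ.real := by ext a r c; rw [hA₁.real a rfl]; simp
  have hC₁ : Core E δ zv σ₁ := hC.congr
    (by rintro a (rfl | rfl | rfl | rfl | rfl | rfl) <;> simp [e₁]) (by simp [e₂])
  have hQ₁ : QRep σ₁ (E.set (pre (σ₁.nat .L i) E.k)) := by
    rw [e₁ .L (by simp) (by simp) (by simp), hLi₀.pre_eq, Env.set, E.cover]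
    refine ⟨?_, by rw [hA₁.nat .cnt rfl]; simp⟩
    ext j
    simp [Mem.mem_set, hI₁ j j.2]
  have hS₁ : Status E.V W φ₀ m₀ σ₁ :=
    ⟨by simpa [e₂] using hS.same, by simpa [e₁, e₂] using hS.cases⟩
  refine wp_loop (fun σ' τ => ∃ p, σ'.nat .p 0 0 = p ∧ p ≤ E.k ∧ Core E δ zv σ' ∧
    Status E.V W φ₀ m₀ σ' ∧ (∀ j < m₀, j ≠ i → σ'.nat .L j = σ.nat .L j) ∧
    (σ'.nat .grew 0 0 = 0 → Sorted W E.k (σ'.nat .L i) p) ∧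
    QRep σ' (E.set (pre (σ'.nat .L i) p)) ∧
    τ = E.pot W (σ'.nat .L i) + ∑ r ∈ range p, 400 * E.wt (σ'.nat .L i r) +
      (if σ'.nat .grew 0 0 = 0 then 200 * n else 0))
    (E.pot W (σ.nat .L i) + ∑ r ∈ range E.k, 400 * E.wt (σ.nat .L i r) + 200 * n) ?_ ?_ ?_
  · refine ⟨E.k, by simp [hC₁.holds.k], le_rfl, ?_, ?_, ?_, ?_, ?_, ?_⟩
    · exact hC₁.congr (by rintro a (rfl | rfl | rfl | rfl | rfl | rfl) <;> simp) (by simp)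
    · exact ⟨by simpa using hS₁.same, by simpa using hS₁.cases⟩
    · simp [e₁]
    · intro _ r s h₁ h₂ h₃
      omega
    · simpa using hQ₁.congr (by simp) (by simp)
    · simp [e₁, hgrew]
  · rintro σ₂ τ ⟨p₁, hp, hpk, hC₂, hS₂, hrow₂, hsort₂, hQ₂, rfl⟩ hA₂ hb
    simp [hp] at hb
    obtain ⟨hp0, hg₂⟩ := hb
    obtain ⟨p, rfl⟩ : ∃ p, p₁ = p + 1 := ⟨p₁ - 1, by omega⟩
    have hm₂ := mle σ₂ hS₂ hC₂ hg₂
    have hL₂ : Enum E.k (σ₂.nat .L i) E.V := menum σ₂ hS₂ hC₂ (by omega)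
    have hi₂ : σ₂.nat .i 0 0 = i := by rw [hA₂.nat .i rfl]; simp [e₁, hi]
    have hW₂ : σ₂.nat .W = σ.nat .W := by rw [hA₂.nat .W rfl]; simp [e₁]
    set v := σ₂.nat .L i p with hv
    have hvV : v ∈ E.V := hL₂.mem p (by omega)
    have hvp : v ∉ pre (σ₂.nat .L i) p := hL₂.notMem_pre (by omega) le_rfl
    have hpp : pre (σ₂.nat .L i) p ⊆ E.V := hL₂.pre_subset (by omega)
    rw [pre_succ, E.set_insert] at hQ₂
    have hdis := E.disjoint_set hpp hvV hvp
    rw [wp_seq, wp_nset, wp_seq, wp_nset]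
    simp only [NExp.eval, NExp.eval_ofNat, hp, Nat.add_sub_cancel, Mem.setNat_nat_self, and_self,
      if_true, Mem.setNat_nat_of_ne, ne_eq, reduceCtorEq, not_false_eq_true, hi₂, ← hv]
    rw [wp_seq]
    refine wp_removeClass (w := v) (fun σ' hA => by simp [hA.nat .vv rfl]) (by simp)
      (by simpa using hC₂.holds.listing) (E.lt v hvV) (hQ₂.congr (by simp) (by simp))
      (subset_union_right) ?_
    intro σ₃ t₃ hQ₃ hA₃ ht₃
    rw [← hv, union_sdiff_cancel_right hdis] at hQ₃
    have eN : ∀ a, a ≠ .p → a ≠ .vv → a ≠ .Q → a ≠ .cnt → a ≠ .t → σ₃.nat a = σ₂.nat a := by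
      intro a h₁ h₂ h₃ h₄ h₅
      rw [hA₃.nat a (by simp [removeClass, forTo, Cmd.writesNat, h₃, h₄, h₅])]
      simp [h₁, h₂]
    have eR : σ₃.real = σ₂.real := by ext a r c; rw [hA₃.real a rfl]; simp
    have ep : σ₃.nat .p 0 0 = p := by rw [hA₃.nat .p rfl]; simp
    have ev : σ₃.nat .vv 0 0 = v := by rw [hA₃.nat .vv rfl]; simp
    have hC₃ : Core E δ zv σ₃ := hC₂.congr
      (by rintro a (rfl | rfl | rfl | rfl | rfl | rfl) <;> simp [eN]) (by simp [eR])
    have hS₃ : Status E.V W φ₀ m₀ σ₃ :=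
      ⟨by simpa [eR] using hS₂.same, by simpa [eN, eR] using hS₂.cases⟩
    have hflag₃ : σ₃.nat .W v 0 = if v ∈ W then 1 else 0 := by
      rw [eN _ (by simp) (by simp) (by simp) (by simp) (by simp), hW₂]
      exact hflag v hvV
    have hrow₃ : ∀ j < m₀, j ≠ i → σ₃.nat .L j = σ.nat .L j := by
      intro j h₁ h₂
      rw [eN _ (by simp) (by simp) (by simp) (by simp) (by simp)]
      exact hrow₂ j h₁ h₂
    have hLL : σ₃.nat .L = σ₂.nat .L := eN _ (by simp) (by simp) (by simp) (by simp) (by simp)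
    have hwt : E.wt v = (E.Cl v).card + 1 := rfl
    refine wp_when ?_ ?_
    swap
    · intro hb
      have hvW : v ∈ W := by
        by_contra hvW
        rw [if_neg hvW] at hflag₃
        simp [ev, hflag₃] at hb
      refine ⟨_, ⟨p, ep, by omega, hC₃, hS₃, hrow₃, ?_, by rw [hLL]; exact hQ₃, rfl⟩, ?_⟩
      · rw [hLL]
        intro hg r s h₁ h₂ h₃ h₄
        rcases Nat.lt_or_ge p r with h | h
        · exact hsort₂ hg₂ r s h h₂ h₃ h₄
        · rw [show r = p by omega] at h₄
          exact absurd hvW h₄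
      · rw [hLL, sum_range_succ, eN .grew (by simp) (by simp) (by simp) (by simp) (by simp),
          ← hv, hwt]
        simp
        omega
    · intro hb
      have hvW : v ∉ W := by
        intro hvW
        rw [if_pos hvW] at hflag₃
        simp [ev, hflag₃] at hb
      simp only [wp_seq, wp_nset]
      refine wp_loop (fun σ' τ => ∃ q, σ'.nat .q 0 0 = q ∧ p ≤ q ∧ q < E.k ∧ Core E δ zv σ' ∧
        Status E.V W φ₀ m₀ σ' ∧ (∀ j < m₀, j ≠ i → σ'.nat .L j = σ.nat .L j) ∧
        σ'.nat .L i q = v ∧ (∀ r, p ≤ r → r < q → σ'.nat .L i r ∈ W) ∧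
        (∀ r < p, σ'.nat .L i r = σ₂.nat .L i r) ∧ Sorted W E.k (σ'.nat .L i) (q + 1) ∧
        QRep σ' (E.set (pre (σ'.nat .L i) q)) ∧
        τ = E.pot W (σ'.nat .L i) + ∑ r ∈ Ico p q, 200 * E.wt (σ'.nat .L i r) +
          (if σ'.nat .grew 0 0 = 0 then 200 * n else 0))
        (E.pot W (σ₂.nat .L i) + 200 * n) ?_ ?_ ?_
      · refine ⟨p, by simp [ep], le_rfl, by omega, ?_, ?_, ?_, ?_, ?_, ?_, ?_, ?_, ?_⟩
        · exact hC₃.congr (by rintro a (rfl | rfl | rfl | rfl | rfl | rfl) <;> simp) (by simp)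
        · exact ⟨by simpa using hS₃.same, by simpa using hS₃.cases⟩
        · simpa using hrow₃
        · simp [hLL, hv]
        · intro r h₁ h₂; omega
        · simp [hLL]
        · simpa [hLL] using hsort₂ hg₂
        · simpa [hLL] using hQ₃.congr (by simp) (by simp)
        · simp [hLL, eN, hg₂]
      · rintro σ₄ τ ⟨q, hq, hpq, hqk, hC₄, hS₄, hrow₄, hv₄, hin₄, hlt₄, hsort₄, hQ₄, rfl⟩ hA₄ hb₄
        have hi₄ : σ₄.nat .i 0 0 = i := by rw [hA₄.nat .i rfl]; simp [eN, hi₂]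
        have hW₄ : σ₄.nat .W = σ.nat .W := by rw [hA₄.nat .W rfl]; simp [eN, hW₂]
        have hvv₄ : σ₄.nat .vv 0 0 = v := by rw [hA₄.nat .vv rfl]; simp [ev]
        simp [hq, hC₄.holds.k, hi₄, hW₄] at hb₄
        obtain ⟨hq₁, hWu, hg₄⟩ := hb₄
        have hm₄ := mle σ₄ hS₄ hC₄ hg₄
        have hL₄ : Enum E.k (σ₄.nat .L i) E.V := menum σ₄ hS₄ hC₄ (by omega)
        set u := σ₄.nat .L i (q + 1) with hu
        have huW : u ∈ W := by
          rw [hflag u (hL₄.mem _ hq₁)] at hWu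
          by_contra h
          simp [h] at hWu
        refine wp_push hC₄ hδ hS₄ hg₄ hi₄ him hq hq₁ hu.symm hv₄ hvv₄ huW hvW hQ₄ ?_
        intro σ₅ t₅ hC₅ hS₅ hq₅ hL₅ hrow₅ hQ₅ hA₅ ht₅
        refine ⟨_, ⟨q + 1, hq₅, by omega, hq₁, hC₅, hS₅, ?_, ?_, ?_, ?_, ?_, hQ₅, rfl⟩, ?_⟩
        · intro j h₁ h₂
          rw [hrow₅ j h₁ h₂, hrow₄ j h₁ h₂]
        · rw [hL₅ _ hq₁, if_pos rfl]
        · intro r h₁ h₂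
          rw [hL₅ r (by omega), if_neg (by omega)]
          split_ifs with h
          · exact huW
          · exact hin₄ r h₁ (by omega)
        · intro r hr
          rw [hL₅ r (by omega), if_neg (by omega), if_neg (by omega), hlt₄ r hr]
        · intro r s h₁ h₂ h₃
          rw [hL₅ r (by omega), hL₅ s h₃, if_neg (by omega), if_neg (by omega), if_neg (by omega),
            if_neg (by omega)]
          exact hsort₄ r s (by omega) h₂ h₃
        · have hpot := E.pot_swap hq₁ hu.symm hv₄ huW hvW hL₅
          have hsum : ∑ r ∈ Ico p (q + 1), 200 * E.wt (σ₅.nat .L i r) =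
              ∑ r ∈ Ico p q, 200 * E.wt (σ₄.nat .L i r) + 200 * E.wt u := by
            rw [sum_Ico_succ_top hpq, hL₅ q (by omega), if_neg (by omega), if_pos rfl]
            congr 1
            refine sum_congr rfl fun r hr => ?_
            have := mem_Ico.1 hr
            rw [hL₅ r (by omega), if_neg (by omega), if_neg (by omega)]
          have hwu : 1 ≤ E.wt u := Nat.le_add_left _ _
          have hwv : 1 ≤ E.wt v := Nat.le_add_left _ _
          rw [hsum, if_pos hg₄]
          simp only [BExp.cost, NExp.cost, NExp.cost_ofNat]
          rcases hg01 σ₅ hS₅ with h | h <;>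
            simp only [h, if_true, one_ne_zero, if_false] at ht₅ ⊢ <;>
            omega
      · rintro σ₄ τ t₄ ⟨q, hq, hpq, hqk, hC₄, hS₄, hrow₄, hv₄, hin₄, hlt₄, hsort₄, hQ₄, rfl⟩ hA₄
          hb₄ ht₄
        have hi₄ : σ₄.nat .i 0 0 = i := by rw [hA₄.nat .i rfl]; simp [eN, hi₂]
        have hp₄ : σ₄.nat .p 0 0 = p := by rw [hA₄.nat .p rfl]; simp [ep]
        have hW₄ : σ₄.nat .W = σ.nat .W := by rw [hA₄.nat .W rfl]; simp [eN, hW₂]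
        have him₄ : i < σ₄.nat .m 0 0 := by
          rcases hS₄.cases with h | h <;> omega
        have hL₄ : Enum E.k (σ₄.nat .L i) E.V := menum σ₄ hS₄ hC₄ him₄
        simp [hq, hC₄.holds.k, hi₄, hW₄] at hb₄
        set M := σ₄.nat .L i with hM
        set mid : ℕ → Finset ℕ := fun r => pre M p ∪ (Ico r q).image M with hmid
        have hmid0 : mid p = pre M q := by
          ext w
          simp only [hmid, mem_union, mem_pre, mem_image, mem_Ico]
          constructor
          · rintro (⟨r, h₁, h₂⟩ | ⟨r, h₁, h₂⟩)
            · exact ⟨r, by omega, h₂⟩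
            · exact ⟨r, by omega, h₂⟩
          · rintro ⟨r, h₁, h₂⟩
            rcases Nat.lt_or_ge r p with h | h
            · exact Or.inl ⟨r, h, h₂⟩
            · exact Or.inr ⟨r, ⟨h, h₁⟩, h₂⟩
        have hmidV : ∀ r, mid r ⊆ E.V := by
          intro r w hw
          simp only [hmid, mem_union, mem_pre, mem_image, mem_Ico] at hw
          rcases hw with ⟨r', h₁, rfl⟩ | ⟨r', h₁, rfl⟩
          · exact hL₄.mem _ (by omega)
          · exact hL₄.mem _ (by omega)
        have hmids : ∀ r, p ≤ r → r < q →
            mid r = insert (M r) (mid (r + 1)) ∧ M r ∉ mid (r + 1) := by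
          intro r h₁ h₂
          constructor
          · ext w
            simp only [hmid, mem_insert, mem_union, mem_pre, mem_image,
              mem_Ico]
            constructor
            · rintro (h | ⟨r', h₃, h₄⟩)
              · exact Or.inr (Or.inl h)
              · rcases Nat.lt_or_ge r r' with h | h
                · exact Or.inr (Or.inr ⟨r', ⟨h, h₃.2⟩, h₄⟩)
                · exact Or.inl (by rw [← h₄, show r = r' by omega])
            · rintro (h | h | ⟨r', h₃, h₄⟩)
              · exact Or.inr ⟨r, ⟨le_rfl, h₂⟩, h.symm⟩
              · exact Or.inl h
              · exact Or.inr ⟨r', ⟨by omega, h₃.2⟩, h₄⟩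
          · simp only [hmid, mem_union, mem_pre, mem_image, mem_Ico]
            rintro (⟨r', h₃, h₄⟩ | ⟨r', h₃, h₄⟩)
            · have := hL₄.inj r' r (by omega) (by omega) h₄
              omega
            · have := hL₄.inj r' r (by omega) (by omega) h₄
              omega
        refine wp_forTo q (fun r σ' => QRep σ' (E.set (mid r))) (fun r => 100 * E.wt (M r)) rfl
          (by simp [hp₄, hpq]) (fun σ' hA => by simp [hA.nat .q rfl, hq]) ?_ ?_ ?_
        · simp only [NExp.eval, NExp.eval_ofNat, hp₄, hmid0]
          exact hQ₄.congr (by simp) (by simp)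
        · intro r σ' h₁ h₂ hI hrr hA
          simp [hp₄] at h₁
          obtain ⟨h₃, h₄⟩ := hmids r h₁ h₂
          rw [h₃, E.set_insert] at hI
          have hdis := E.disjoint_set (hmidV (r + 1)) (hL₄.mem r (by omega)) h₄
          have hr₁ : σ'.nat .L = σ₄.nat .L := hA.nat .L rfl
          have hr₂ : σ'.nat .i 0 0 = i := by rw [hA.nat .i rfl, hi₄]
          refine wp_removeClass (w := M r) (Cl := E.Cl)
            (fun σ'' hA' => by
              simp [hA'.nat .L rfl, hA'.nat .i rfl, hA'.nat .r rfl, hr₁, hr₂, hrr, hM])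
            (by simp) (by rw [hA.nat .start rfl, hA.nat .mem rfl]; exact hC₄.holds.listing)
            (E.lt _ (hL₄.mem r (by omega))) hI subset_union_right ?_
          intro σ'' t hQ' hA' ht
          rw [union_sdiff_cancel_right hdis] at hQ'
          exact ⟨by rw [Env.wt]; omega, hQ'.congr (by simp) (by simp)⟩
        · intro σ₅ t₅ hI₅ hA₅ ht₅
          have hmidq : mid q = pre M p := by simp [hmid]
          rw [hmidq] at hI₅
          have hLL₅ : σ₅.nat .L i = M := by rw [hA₅.nat .L rfl]
          have hg₅ : σ₅.nat .grew = σ₄.nat .grew := hA₅.nat .grew rfl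
          refine ⟨_, ⟨p, by rw [hA₅.nat .p rfl, hp₄], by omega, ?_, ?_, ?_, ?_, ?_, rfl⟩, ?_⟩
          · exact hC₄.agree hA₅
          · exact hS₄.congr (hA₅.real .phi rfl) (hA₅.nat .m rfl) hg₅
          · rw [hA₅.nat .L rfl]; exact hrow₄
          · rw [hLL₅, hg₅]
            intro hg r s h₁ h₂ h₃ h₄
            have hrq : q ≤ r := by
              by_contra hc
              exact h₄ (hin₄ r h₁ (by omega))
            rcases Nat.lt_or_ge q r with h | h
            · exact hsort₄ r s h h₂ h₃ h₄
            · have hnext : M (q + 1) ∉ W := by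
                intro hin
                have := hflag _ (hL₄.mem (q + 1) (by omega))
                rw [if_pos hin] at this
                exact hb₄ (by omega) this hg
              rcases Nat.lt_or_ge (q + 1) s with h' | h'
              · exact hsort₄ (q + 1) s le_rfl h' h₃ hnext
              · rwa [show s = q + 1 by omega]
          · rw [hLL₅]; exact hI₅
          · rw [hLL₅, hg₅, sum_range_succ, ← hv, hwt]
            have hs : ∑ r ∈ range p, 400 * E.wt (σ₂.nat .L i r) =
                ∑ r ∈ range p, 400 * E.wt (M r) :=
              sum_congr rfl fun r hr => by rw [hlt₄ r (mem_range.1 hr)]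
            have hs' : ∑ r ∈ Ico p q, (100 * E.wt (M r) + 16) ≤
                ∑ r ∈ Ico p q, 200 * E.wt (M r) := by
              refine sum_le_sum fun r _ => ?_
              have : 1 ≤ E.wt (M r) := Nat.le_add_left _ _
              omega
            rw [hs, if_pos hg₂]
            simp [hp₄] at ht₅ ht₄ ⊢
            omega
  · rintro σ₂ τ t₂ ⟨p, hp, hpk, hC₂, hS₂, hrow₂, hsort₂, hQ₂, rfl⟩ hA₂ hb ht₂
    simp [hp] at hb
    refine ⟨hC₂, hS₂, hrow₂, ?_, ?_⟩
    · intro hg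
      have hp0 : p = 0 := by
        by_contra h
        exact hb (by omega) hg
      rw [← hp0]
      exact hsort₂ hg
    · have hsum : ∑ r ∈ range E.k, 400 * E.wt (σ.nat .L i r) ≤ 800 * n := by
        rw [hLi₀.sum fun v => 400 * E.wt v, ← mul_sum]
        have := E.sum_wt_le subset_rfl
        omega
      simp at ht₁ ht₂ ⊢
      rcases hg01 σ₂ hS₂ with h | h <;> simp only [h, if_true, one_ne_zero, if_false] at ht₂ ⊢ <;>
        omega

/-! ### The search for an augmenting path -/

/-- One pass over all orderings. -/
def scanAll : Cmd :=
  .loop (.and (.natLt NName.i NName.m) (.natEq NName.grew 0))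
    (.seq scan (.nset NName.i (.add NName.i 1)))

/-- A pass over all orderings ends with `W` having grown or with no active pair. The terms
`4000 * n * n` and `300 * n` pay for the term that the push that makes `W` grow may add. -/
theorem wp_scanAll {E : Env n f} {δ : ℝ} {zv : ℕ → ℝ} {W : Finset ℕ} {φ₀ : ℕ → ℕ → ℝ} {m₀ : ℕ}
    (hC : Core E δ zv σ) (hδ : 0 < δ) (hS : Status E.V W φ₀ m₀ σ)
    (hgrew : σ.nat .grew 0 0 = 0) (hi : σ.nat .i 0 0 = 0)
    (hflag : ∀ v ∈ E.V, σ.nat .W v 0 = if v ∈ W then 1 else 0)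
    (post : ∀ σ' t, Core E δ zv σ' → Status E.V W φ₀ m₀ σ' →
      (σ'.nat .grew 0 0 = 0 → ∀ i < m₀, Sorted W E.k (σ'.nat .L i) 0) →
      Agree scanAll σ σ' →
      t + ∑ j ∈ range (σ'.nat .m 0 0), E.pot W (σ'.nat .L j) ≤
        ∑ j ∈ range m₀, E.pot W (σ.nat .L j) + m₀ * (1600 * n) + 4000 * n * n + 300 * n →
      Q σ' t) :
    wp f scanAll σ Q := by
  have hn := E.pos
  have hm₀ : ∀ σ', Status E.V W φ₀ m₀ σ' → σ'.nat .grew 0 0 = 0 → σ'.nat .m 0 0 = m₀ := by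
    intro σ' h hg
    rcases h.cases with h | h
    · exact h.2.1
    · omega
  refine wp_loop (fun σ' τ => ∃ i, σ'.nat .i 0 0 = i ∧ i ≤ m₀ ∧ Core E δ zv σ' ∧
    Status E.V W φ₀ m₀ σ' ∧ (σ'.nat .grew 0 0 = 0 → ∀ j < i, Sorted W E.k (σ'.nat .L j) 0) ∧
    τ = ∑ j ∈ range (σ'.nat .m 0 0), E.pot W (σ'.nat .L j) + (m₀ - i) * (1600 * n) +
      (if σ'.nat .grew 0 0 = 0 then 4000 * n * n + 200 * n else 0)) _
    ⟨0, hi, Nat.zero_le _, hC, hS, fun _ j hj => absurd hj (Nat.not_lt_zero _), rfl⟩ ?_ ?_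
  · rintro σ₁ τ ⟨i, hi₁, him, hC₁, hS₁, hs₁, rfl⟩ hA₁ hb
    simp [hi₁] at hb
    obtain ⟨him₁, hg₁⟩ := hb
    have hm₁ := hm₀ σ₁ hS₁ hg₁
    rw [hm₁] at him₁
    rw [wp_seq]
    refine wp_mono (wp_scan hC₁ hδ hS₁ hg₁ hi₁ him₁ (by rw [hA₁.nat .W rfl]; exact hflag)) ?_
    rintro σ₂ t₂ ⟨hC₂, hS₂, hrow, hsort, ht₂⟩ hA₂
    have hi₂ : σ₂.nat .i 0 0 = i := by rw [hA₂.nat .i rfl, hi₁]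
    rw [wp_nset]
    refine ⟨_, ⟨i + 1, by simp [hi₂], by omega, ?_, ?_, ?_, rfl⟩, ?_⟩
    · exact hC₂.congr (by rintro a (rfl | rfl | rfl | rfl | rfl | rfl) <;> simp) (by simp)
    · exact hS₂.congr (by simp) (by simp) (by simp)
    · simp only [Mem.setNat_nat_of_ne, ne_eq, reduceCtorEq, not_false_eq_true]
      intro hg j hj
      rcases Nat.lt_or_ge j i with h | h
      · rw [hrow j (by omega) (by omega)]
        exact hs₁ hg₁ j h
      · rw [show j = i by omega]
        exact hsort hg
    · have hsum : ∑ j ∈ range m₀, E.pot W (σ₂.nat .L j) + E.pot W (σ₁.nat .L i) =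
          ∑ j ∈ range m₀, E.pot W (σ₁.nat .L j) + E.pot W (σ₂.nat .L i) := by
        rw [← add_sum_erase _ _ (mem_range.2 him₁),
          ← add_sum_erase _ (fun j => E.pot W (σ₁.nat .L j)) (mem_range.2 him₁)]
        rw [sum_congr rfl fun j hj => ?_]
        · ring
        · simp only [mem_erase, mem_range] at hj
          rw [hrow j hj.2 hj.1]
      have hmul : (m₀ - i) * (1600 * n) = (m₀ - (i + 1)) * (1600 * n) + 1600 * n := by
        rw [show m₀ - i = m₀ - (i + 1) + 1 by omega]; ring
      rw [hmul, hm₁, if_pos hg₁]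
      simp
      rcases hS₂.cases with ⟨h, hm, -⟩ | ⟨h, h', h'', -⟩
      · rw [h, hm, if_pos rfl]
        rw [if_pos h] at ht₂
        omega
      · rw [h, if_neg one_ne_zero]
        rw [h, if_neg one_ne_zero] at ht₂
        rcases Nat.lt_or_ge m₀ (σ₂.nat .m 0 0) with hlt | hge
        · have hm : σ₂.nat .m 0 0 = m₀ + 1 := by omega
          have := E.pot_le W (hC₂.family.enum m₀ (by omega))
          rw [hm, sum_range_succ]
          omega
        · rw [show σ₂.nat .m 0 0 = m₀ by omega]
          omega
  · rintro σ₁ τ t₁ ⟨i, hi₁, him, hC₁, hS₁, hs₁, rfl⟩ hA₁ hb ht₁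
    refine post σ₁ t₁ hC₁ hS₁ ?_ ⟨hA₁.nat, hA₁.real⟩ ?_
    · intro hg j hj
      simp [hi₁, hg, hm₀ σ₁ hS₁ hg] at hb
      exact hs₁ hg j (by omega)
    · rw [hm₀ σ hS hgrew, if_pos hgrew] at ht₁
      simp at ht₁
      omega

/-- The search ends with an augmenting path or with a set that certifies that the phase is over. Since
`W` grows with every round, there are at most `n` rounds, which add at most `n` terms, and the
potential of an ordering, being at most `4000 * n * n`, has to be paid for only once per term. -/
theorem wp_search {E : Env n f} {δ : ℝ} {zv : ℕ → ℝ} (hC : Core E δ zv σ) (hδ : 0 < δ)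
    (hz : ∀ v ∈ E.V, σ.real .z v 0 = zv v) (hm : σ.nat .m 0 0 ≤ n + 1) :
    wp f search σ (fun σ' t =>
      Core E δ zv σ' ∧
      σ'.nat .m 0 0 ≤ 2 * n + 1 ∧
      ((σ'.nat .found 0 0 = 1 ∧ Reached E.V δ σ') ∨ (σ'.nat .found 0 0 = 0 ∧
        ∃ W ⊆ E.V, E.g W - E.k * δ ≤ negSum E.V zv)) ∧
      t ≤ 40000 * n * n * n) := by
  have hn := E.pos
  have hkn := E.k_le
  unfold search
  rw [wp_seq, wp_nset]
  set m₁ := σ.nat .m 0 0 with hm₁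
  -- Every set that contains the sources and is closed under the current arcs has at least `c`
  -- elements and contains the set `Wp` reached by the last search. Each further round adds an element
  -- to that set, so that `E.k + 1 - c` bounds the number of rounds that are left; the potentials pay
  -- for their pushes.
  refine wp_loop (fun σ' τ => Core E δ zv σ' ∧
    ((σ'.nat .srch 0 0 = 1 ∧ ∃ Wp ⊆ E.V, ∃ c, (∀ U ⊆ E.V, (∀ v ∈ E.V, zv v ≤ -δ → v ∈ U) →
        (∀ a ∈ U, ∀ b ∈ E.V, σ'.real .phi a b ≤ 0 → b ∈ U) → Wp ⊆ U ∧ c ≤ U.card) ∧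
        σ'.nat .m 0 0 ≤ m₁ + c ∧
        τ = ∑ j ∈ range (σ'.nat .m 0 0), E.pot Wp (σ'.nat .L j) +
          (E.k + 1 - c) * (12000 * n * n)) ∨
      (σ'.nat .srch 0 0 = 0 ∧ σ'.nat .m 0 0 ≤ m₁ + n ∧
        ((σ'.nat .found 0 0 = 1 ∧ Reached E.V δ σ') ∨ (σ'.nat .found 0 0 = 0 ∧
        ∃ W ⊆ E.V, E.g W - E.k * δ ≤ negSum E.V zv)))))
    (∑ j ∈ range m₁, E.pot ∅ (σ.nat .L j) + (E.k + 1) * (12000 * n * n)) ?_ ?_ ?_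
  · refine ⟨?_, Or.inl ⟨by simp, ∅, by simp, 0, by simp, by simp [hm₁], ?_⟩⟩
    · exact hC.congr (by rintro a (rfl | rfl | rfl | rfl | rfl | rfl) <;> simp) (by simp)
    · simp [hm₁]
  · rintro σ₁ τ ⟨hC₁, h | h⟩ hA₁ hb
    swap
    · simp [h.1] at hb
    obtain ⟨hsr, Wp, hWp, c, hlow, hmc, rfl⟩ := h
    have hz₁ : ∀ v ∈ E.V, σ₁.real .z v 0 = zv v := by
      rw [hA₁.real .z rfl]; simpa using hz
    rw [wp_seq]
    refine wp_mono (wp_reach hC₁.holds.k hC₁.holds.enum hC₁.delta) ?_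
    rintro σ₂ t₂ ⟨hR, ht₂⟩ hA₂
    have hC₂ : Core E δ zv σ₂ := hC₁.agree hA₂
    have hz₂ : ∀ v ∈ E.V, σ₂.real .z v 0 = zv v := by rw [hA₂.real .z rfl]; exact hz₁
    have hm₂ : σ₂.nat .m = σ₁.nat .m := hA₂.nat .m rfl
    have hL₂ : σ₂.nat .L = σ₁.nat .L := hA₂.nat .L rfl
    have hφ₂ : σ₂.real .phi = σ₁.real .phi := hA₂.real .phi rfl
    obtain ⟨tl, htree⟩ := hR.tree
    have hcV : c ≤ E.k := by
      rw [← E.card]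
      exact (hlow E.V subset_rfl (fun v hv _ => hv) fun a _ b hb _ => hb).2
    have ht₂' : t₂ ≤ 600 * n * n := by
      have h₁ : E.k * E.k ≤ n * n := Nat.mul_le_mul hkn hkn
      have h₂ : n ≤ n * n := Nat.le_mul_self n
      calc t₂ ≤ 200 * (E.k * E.k) + 300 * E.k + 100 := by rw [← mul_assoc]; exact ht₂
        _ ≤ 600 * (n * n) := by omega
        _ = _ := by ring
    have hnn : n ≤ n * n := Nat.le_mul_self n
    refine wp_cond ?_ ?_
    · intro hb
      simp at hb
      rw [wp_nset]
      refine ⟨0, ⟨?_, Or.inr ⟨by simp, ?_, Or.inl ⟨by simpa using hb, ?_⟩⟩⟩, ?_⟩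
      · exact hC₂.congr (by rintro a (rfl | rfl | rfl | rfl | rfl | rfl) <;> simp) (by simp)
      · simp [hm₂]; omega
      · exact ⟨⟨tl, by simpa using htree⟩, by simpa using hR.closed, by simpa using hR.found⟩
      · have : 1 * (12000 * n * n) ≤ (E.k + 1 - c) * (12000 * n * n) :=
          Nat.mul_le_mul_right _ (by omega)
        simp [mul_assoc] at this ht₂' ⊢
        omega
    · intro hb
      simp at hb
      obtain ⟨hf₂, hnT⟩ : σ₂.nat .found 0 0 = 0 ∧
          ∀ v ∈ E.V, σ₂.nat .W v 0 = 1 → σ₂.real .z v 0 < δ := by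
        rcases hR.found with h | h
        · exact absurd h.1 hb
        · exact h
      set W : Finset ℕ := E.V.filter fun v => σ₂.nat .W v 0 = 1 with hW
      have hWV : W ⊆ E.V := filter_subset _ _
      have hmW : ∀ v, v ∈ W ↔ v ∈ E.V ∧ σ₂.nat .W v 0 = 1 := fun v => by simp [hW]
      have hWsrc : ∀ v ∈ E.V, zv v ≤ -δ → v ∈ W := fun v hv h =>
        (hmW v).2 ⟨hv, htree.source v hv (by rw [hz₂ v hv]; exact h)⟩
      obtain ⟨hWpW, hcW⟩ := hlow W hWV hWsrc fun a ha b hb h =>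
        (hmW b).2 ⟨hb, hR.closed a (hWV ha) b hb ((hmW a).1 ha).2 (by rw [hφ₂]; exact h)⟩
      have hpos : ∀ a ∈ E.V, ∀ b ∈ E.V, a ∈ W → b ∉ W → 0 < σ₂.real .phi a b := by
        intro a ha b hb haW hbW
        by_contra h
        exact hbW ((hmW b).2 ⟨hb, hR.closed a ha b hb ((hmW a).1 haW).2 (not_lt.1 h)⟩)
      simp only [wp_seq, wp_nset]
      refine wp_scanAll (E := E) (δ := δ) (zv := zv) (W := W) (φ₀ := σ₂.real .phi)
        (m₀ := σ₂.nat .m 0 0) (hC₂.congr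
          (by rintro a (rfl | rfl | rfl | rfl | rfl | rfl) <;> simp) (by simp)) hδ
        ⟨by simp, Or.inl ⟨by simp, by simp, by simpa using hpos⟩⟩ (by simp) (by simp) ?_ ?_
      · intro v hv
        simp only [Mem.setNat_nat_of_ne, ne_eq, reduceCtorEq, not_false_eq_true]
        by_cases h : v ∈ W
        · rw [if_pos h]; exact ((hmW v).1 h).2
        · rw [if_neg h]
          rcases htree.flag v hv with h' | h'
          · exact h'
          · exact absurd ((hmW v).2 ⟨hv, h'⟩) h
      intro σ₃ t₃ hC₃ hS₃ hsort hA₃ ht₃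
      simp only [Mem.setNat_nat_of_ne, ne_eq, reduceCtorEq, not_false_eq_true, hL₂, hm₂] at ht₃
      have hpot : ∑ j ∈ range (σ₁.nat .m 0 0), E.pot W (σ₁.nat .L j) ≤
          ∑ j ∈ range (σ₁.nat .m 0 0), E.pot Wp (σ₁.nat .L j) :=
        sum_le_sum fun j _ => E.pot_anti hWpW _
      have hm₀n : σ₁.nat .m 0 0 * (1600 * n) ≤ 4800 * n * n := by
        calc σ₁.nat .m 0 0 * (1600 * n) ≤ (3 * n) * (1600 * n) := Nat.mul_le_mul_right _ (by omega)
          _ = _ := by ring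
      have hWc : W.card ≤ E.k := by rw [← E.card]; exact card_le_card hWV
      refine wp_when ?_ ?_
      · intro hb₃
        simp at hb₃
        rw [wp_nset]
        have hm₃ : σ₃.nat .m 0 0 = σ₂.nat .m 0 0 := by
          rcases hS₃.cases with h | h
          · exact h.2.1
          · omega
        refine ⟨0, ⟨?_, Or.inr ⟨by simp, ?_, Or.inr ⟨?_, W, hWV, ?_⟩⟩⟩, ?_⟩
        · exact hC₃.congr (by rintro a (rfl | rfl | rfl | rfl | rfl | rfl) <;> simp) (by simp)
        · simp [hm₃, hm₂]; omega
        · simp; rw [hA₃.nat .found rfl]; simpa using hf₂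
        · rw [← E.card]
          refine le_negSum_of_cut hC₃.flow hδ.le hWV ?_ hC₃.z ?_ ?_ ?_
          · refine hC₃.family.sum_eq_of_prefix E.g_empty ?_ hWV
            intro i hi
            exact (hsort hb₃ i (by omega)).exists_pre_eq (hC₃.family.enum i hi) hWV
          · intro v hv
            obtain ⟨hv, hv'⟩ := (hmW v).1 hv
            rw [← hz₂ v hv]
            exact hnT v hv hv'
          · intro v hv hvW
            by_contra h
            exact hvW (hWsrc v hv (not_lt.1 h))
          · intro a ha b hb hbW
            rcases hS₃.cases with h | h
            · exact h.2.2 a (hWV ha) b hb ha hbW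
            · omega
        · have : 1 * (12000 * n * n) ≤ (E.k + 1 - c) * (12000 * n * n) :=
            Nat.mul_le_mul_right _ (by omega)
          simp [mul_assoc] at this ht₂' hm₀n ht₃ ⊢
          omega
      · intro hb₃
        simp at hb₃
        rcases hS₃.cases with h | ⟨hg, hm₃, hm₃', a, ha, b, hb, haW, hbW, hab⟩
        · exact absurd h.1 hb₃
        refine ⟨_, ⟨hC₃, Or.inl ⟨?_, W, hWV, W.card + 1, ?_, ?_, rfl⟩⟩, ?_⟩
        · rw [hA₃.nat .srch rfl]; simp [hA₂.nat .srch rfl, hsr]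
        · intro U hU hsrc hcl
          have hWU : W ⊆ U := by
            intro v hv
            refine htree.least (fun w hw h => hsrc w hw (by rwa [← hz₂ w hw])) ?_
              (hWV hv) ((hmW v).1 hv).2
            intro a' ha' haV b' hb' h₁ h₂ h₃
            refine hcl a' ha' b' hb' ?_
            rw [hS₃.same a' haV b' hb' (iff_of_true ((hmW a').2 ⟨haV, h₁⟩) ((hmW b').2 ⟨hb', h₂⟩))]
            exact h₃
          refine ⟨hWU, ?_⟩
          rw [← card_insert_of_notMem hbW]
          exact card_le_card (insert_subset (hcl a (hWU haW) b hb hab) hWU)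
        · rw [hm₂] at hm₃'; omega
        · have : (E.k + 1 - (W.card + 1)) * (12000 * n * n) + 1 * (12000 * n * n) ≤
              (E.k + 1 - c) * (12000 * n * n) := by
            rw [← Nat.add_mul]
            exact Nat.mul_le_mul_right _ (by omega)
          simp [mul_assoc] at this ht₂' hm₀n ht₃ ⊢
          omega
  · rintro σ₁ τ t₁ ⟨hC₁, h | h⟩ hA₁ hb ht₁
    · simp [h.1] at hb
    refine ⟨hC₁, by omega, h.2.2, ?_⟩
    have h₁ : ∑ j ∈ range m₁, E.pot ∅ (σ.nat .L j) ≤ ∑ j ∈ range m₁, 4000 * n * n :=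
      sum_le_sum fun j hj => E.pot_le ∅ (hC.family.enum j (mem_range.1 hj))
    rw [sum_const, card_range, smul_eq_mul] at h₁
    have h₂ : m₁ * (4000 * n * n) ≤ 2 * n * (4000 * n * n) := Nat.mul_le_mul_right _ (by omega)
    have h₃ : (E.k + 1) * (12000 * n * n) ≤ 2 * n * (12000 * n * n) :=
      Nat.mul_le_mul_right _ (by omega)
    have h₄ : n * n ≤ n * n * n := Nat.le_mul_of_pos_right _ hn
    have hnn : n ≤ n * n := Nat.le_mul_self n
    have h₅ : 2 * n * (4000 * n * n) = 8000 * (n * n * n) := by ring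
    have h₆ : 2 * n * (12000 * n * n) = 24000 * (n * n * n) := by ring
    have h₇ : 40000 * n * n * n = 40000 * (n * n * n) := by ring
    simp at ht₁ ⊢
    omega

section

/-! ### Reduction to an affinely independent family -/

/-- The state of the Gauss–Jordan elimination in a matrix `A` with rows `0, …, k` and columns
`0, …, m - 1`, of which the columns before `c` have been treated: the `ρ` pivot columns are unit
vectors, and the linear dependencies of the current columns are dependencies `K` of the original
ones. -/
structure Elim (k m c ρ : ℕ) (A : ℕ → ℕ → ℝ) (piv : ℕ → ℕ → ℕ) (K : (ℕ → ℝ) → Prop) : Prop where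
  le : ρ ≤ k + 1
  lt : ∀ r < ρ, piv r 0 < c
  inj : ∀ r < ρ, ∀ s < ρ, piv r 0 = piv s 0 → r = s
  unit : ∀ s ≤ k, ∀ r < ρ, A s (piv r 0) = if s = r then 1 else 0
  kernel : ∀ μ : ℕ → ℝ, (∀ s ≤ k, ∑ l ∈ range m, μ l * A s l = 0) → K μ

variable {k m c ρ : ℕ} {A A' : ℕ → ℕ → ℝ} {piv piv' : ℕ → ℕ → ℕ} {K : (ℕ → ℝ) → Prop}

theorem Elim.swap (h : Elim k m c ρ A piv K) (hc : c ≤ m) {p : ℕ} (hp : ρ ≤ p) (hpk : p ≤ k)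
    (hA : ∀ s, ∀ l < m, A' s l = A (Equiv.swap p ρ s) l) : Elim k m c ρ A' piv K where
  le := h.le
  lt := h.lt
  inj := h.inj
  unit s hs r hr := by
    rw [hA s _ (lt_of_lt_of_le (h.lt r hr) hc)]
    have hle : Equiv.swap p ρ s ≤ k := by
      rw [Equiv.swap_apply_def]; split_ifs <;> omega
    rw [h.unit _ hle r hr]
    refine if_congr ?_ rfl rfl
    rw [Equiv.swap_apply_def]
    split_ifs <;> omega
  kernel μ hμ := by
    refine h.kernel μ fun s hs => ?_
    have hle : Equiv.swap p ρ s ≤ k := by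
      rw [Equiv.swap_apply_def]; split_ifs <;> omega
    rw [← hμ _ hle]
    refine sum_congr rfl fun l hl => ?_
    rw [hA _ l (mem_range.1 hl), Equiv.swap_apply_self]

/-- A pivot step with pivot `A[p, c]` makes column `c` the `p`-th unit vector and keeps the pivot
columns with a zero in row `p`. -/
theorem Elim.pivot (hunit : ∀ s ≤ k, ∀ r < ρ, r ≠ p → A s (piv r 0) = if s = r then 1 else 0)
    (hlt : ∀ r < ρ, piv r 0 < c) (hinj : ∀ r < ρ, ∀ s < ρ, piv r 0 = piv s 0 → r = s)
    (hker : ∀ μ : ℕ → ℝ, (∀ s ≤ k, ∑ l ∈ range m, μ l * A s l = 0) → K μ)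
    {ρ' : ℕ} (hρ : ρ' ≤ k + 1) (hρ' : ∀ r < ρ', r ≠ p → r < ρ)
    (hc : c < m) (hpk : p ≤ k) (hfac : A p c ≠ 0)
    (h₁ : ∀ l < m, A' p l = A p l / A p c)
    (h₂ : ∀ s ≤ k, s ≠ p → ∀ l < m, A' s l = A s l - A s c * A' p l)
    (hp : piv' p 0 = c) (hpiv : ∀ r, r ≠ p → piv' r 0 = piv r 0) :
    Elim k m (c + 1) ρ' A' piv' K where
  le := hρ
  lt r hr := by
    by_cases h : r = p
    · rw [h, hp]; omega
    · rw [hpiv r h]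
      exact (hlt r (hρ' r hr h)).trans (Nat.lt_succ_self c)
  inj r hr s hs h := by
    by_cases hrp : r = p
    · by_cases hsp : s = p
      · rw [hrp, hsp]
      · rw [hrp, hp, hpiv s hsp] at h
        exact absurd h (hlt s (hρ' s hs hsp)).ne'
    · by_cases hsp : s = p
      · rw [hsp, hp, hpiv r hrp] at h
        exact absurd h (hlt r (hρ' r hr hrp)).ne
      · rw [hpiv r hrp, hpiv s hsp] at h
        exact hinj r (hρ' r hr hrp) s (hρ' s hs hsp) h
  unit s hs r hr := by
    by_cases hrp : r = p
    · rw [hrp, hp]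
      have h' : A' p c = 1 := by rw [h₁ c hc, div_self hfac]
      by_cases hsp : s = p
      · rw [if_pos hsp, hsp, h']
      · rw [if_neg hsp, h₂ s hs hsp c hc, h', mul_one, sub_self]
    · have hr' := hρ' r hr hrp
      have hlm := (hlt r hr').trans hc
      have h0 : A' p (piv r 0) = 0 := by
        rw [h₁ _ hlm, hunit p hpk r hr' hrp, if_neg (Ne.symm hrp), zero_div]
      rw [hpiv r hrp]
      by_cases hsp : s = p
      · rw [hsp, h0, if_neg (Ne.symm hrp)]
      · rw [h₂ s hs hsp _ hlm, h0, mul_zero, sub_zero, hunit s hs r hr' hrp]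
  kernel μ hμ := by
    refine hker μ ?_
    have hp0 : ∑ l ∈ range m, μ l * A' p l = 0 := hμ p hpk
    intro s hs
    by_cases hsp : s = p
    · rw [hsp]
      have : ∑ l ∈ range m, μ l * A p l =
          A p c * ∑ l ∈ range m, μ l * A' p l := by
        rw [mul_sum]
        refine sum_congr rfl fun l hl => ?_
        rw [h₁ l (mem_range.1 hl)]
        field_simp
      rw [this, hp0, mul_zero]
    · have : ∑ l ∈ range m, μ l * A s l =
          ∑ l ∈ range m, μ l * A' s l + A s c * ∑ l ∈ range m, μ l * A' p l := by
        rw [mul_sum, ← sum_add_distrib]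
        refine sum_congr rfl fun l hl => ?_
        rw [h₂ s hs hsp l (mem_range.1 hl)]
        ring
      rw [this, hp0, hμ s hs, mul_zero, add_zero]

/-- If column `c` depends on the pivot columns, then moving the coefficients along this dependency
preserves every quantity that the dependencies in `K` preserve. -/
theorem Elim.sum_eq (h : Elim k m c ρ A piv K) (hc : c < m)
    (hdep : ∀ s, ρ ≤ s → s ≤ k → A s c = 0) {lam lam' : ℕ → ℝ} {θ : ℝ}
    (h₁ : ∀ r < ρ, lam' (piv r 0) = lam (piv r 0) + θ * A r c) (h₂ : lam' c = lam c - θ)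
    (h₃ : ∀ l, l ≠ c → (∀ r < ρ, piv r 0 ≠ l) → lam' l = lam l) {w : ℕ → ℝ}
    (hw : ∀ μ, K μ → ∑ l ∈ range m, μ l * w l = 0) :
    ∑ l ∈ range m, lam' l * w l = ∑ l ∈ range m, lam l * w l := by
  set μ : ℕ → ℝ := fun l => (if l = c then 1 else 0) -
    ∑ r ∈ range ρ, if piv r 0 = l then A r c else 0 with hμ
  have hsum : ∀ w : ℕ → ℝ, ∑ l ∈ range m, μ l * w l =
      w c - ∑ r ∈ range ρ, A r c * w (piv r 0) := by
    intro w
    simp only [hμ, sub_mul, sum_sub_distrib, sum_mul, ite_mul, one_mul, zero_mul]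
    rw [sum_ite_eq', if_pos (mem_range.2 hc), sum_comm]
    congr 1
    refine sum_congr rfl fun r hr => ?_
    rw [sum_ite_eq, if_pos]
    exact mem_range.2 ((h.lt r (mem_range.1 hr)).trans hc)
  have hK : K μ := by
    refine h.kernel μ fun s hs => ?_
    rw [hsum]
    have : ∑ r ∈ range ρ, A r c * A s (piv r 0) =
        ∑ r ∈ range ρ, if s = r then A r c else 0 := by
      refine sum_congr rfl fun r hr => ?_
      rw [h.unit s hs r (mem_range.1 hr), mul_ite, mul_one, mul_zero]
    rw [this, sum_ite_eq]
    split_ifs with hsr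
    · ring
    · rw [hdep s (by simpa using hsr) hs, sub_zero]
  have hlam : ∀ l, lam' l = lam l - θ * μ l := by
    intro l
    by_cases hlc : l = c
    · have : ∑ r ∈ range ρ, (if piv r 0 = l then A r c else 0) = 0 :=
        sum_eq_zero fun r hr => by
          rw [if_neg]
          rw [hlc]
          exact (h.lt r (mem_range.1 hr)).ne
      simp only [hμ, this, if_pos hlc]
      rw [hlc, h₂]; ring
    · by_cases hl : ∃ r < ρ, piv r 0 = l
      · obtain ⟨r, hr, rfl⟩ := hl
        have : ∑ s ∈ range ρ, (if piv s 0 = piv r 0 then A s c else 0) = A r c := by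
          rw [sum_eq_single r, if_pos rfl]
          · intro s hs hsr
            rw [if_neg]
            exact fun h' => hsr (h.inj s (mem_range.1 hs) r hr h')
          · intro h'
            exact absurd (mem_range.2 hr) h'
        simp only [hμ, this, if_neg hlc, h₁ r hr]
        ring
      · push Not at hl
        have : ∑ r ∈ range ρ, (if piv r 0 = l then A r c else 0) = 0 :=
          sum_eq_zero fun r hr => if_neg (hl r (mem_range.1 hr))
        simp only [hμ, this, if_neg hlc, h₃ l hlc hl]
        ring
  have := hw μ hK
  calc ∑ l ∈ range m, lam' l * w l
      = ∑ l ∈ range m, lam l * w l - θ * ∑ l ∈ range m, μ l * w l := by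
        rw [mul_sum, ← sum_sub_distrib]
        exact sum_congr rfl fun l _ => by rw [hlam l]; ring
    _ = _ := by rw [this, mul_zero, sub_zero]

/-! #### The elimination steps of the program -/

theorem wp_pivot {κ : NName} (hl : κ ≠ .l) (hs : κ ≠ .s) {p : ℕ} (hk : σ.nat .k 0 0 = k)
    (hm : σ.nat .m 0 0 = m) (hp : σ.nat κ 0 0 = p) (hc : σ.nat .c 0 0 = c) (hpk : p ≤ k)
    (hcm : c < m) :
    wp f (SFM.pivot κ) σ (fun σ' t =>
      (∀ l < m, σ'.real .A p l = σ.real .A p l / σ.real .A p c) ∧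
      (∀ s ≤ k, s ≠ p → ∀ l < m, σ'.real .A s l =
        σ.real .A s l - σ.real .A s c * σ'.real .A p l) ∧
      t ≤ (k + 2) * (60 * m + 100)) := by
  have hκw : ∀ {e : NName}, e ≠ .l → e ≠ .s → (SFM.pivot κ).writesNat e = false := by
    intro e h₁ h₂
    simp [SFM.pivot, forTo, when, Cmd.writesNat, h₁, h₂]
  set B : ℕ → ℝ := fun l => σ.real .A p l / σ.real .A p c with hB
  unfold SFM.pivot
  simp only [wp_seq, wp_rset]
  refine wp_forTo_zero m (fun l σ' => ∀ a b, σ'.real .A a b =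
    if a = p ∧ b < l then B b else σ.real .A a b) 30 rfl
    (fun σ' hA => by simp [hA.nat .m rfl, hm]) (by simp) ?_ ?_
  · intro l σ' hlm hI hll hA
    have e₁ : σ'.nat κ 0 0 = p := by
      rw [hA.nat κ (by simp [forTo, Cmd.writesNat, hl])]; simp [hp]
    have e₂ : σ'.real .fac 0 0 = σ.real .A p c := by rw [hA.real .fac rfl]; simp [hp, hc]
    rw [wp_rset]
    refine ⟨by simp, ?_⟩
    intro a b
    simp [e₁, hll, e₂, hI, hB]
    by_cases h : a = p ∧ b = l
    · rw [if_pos h, if_pos ⟨h.1, h.2.le⟩, h.2]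
    · rw [if_neg h]
      refine if_congr ?_ rfl rfl
      constructor
      · rintro ⟨h₁, h₂⟩; exact ⟨h₁, h₂.le⟩
      · rintro ⟨h₁, h₂⟩; exact ⟨h₁, lt_of_le_of_ne h₂ fun h' => h ⟨h₁, h'⟩⟩
  intro σ₁ t₁ hI₁ hA₁ ht₁
  have e₁ : σ₁.nat κ 0 0 = p := by
    rw [hA₁.nat κ (by simp [forTo, Cmd.writesNat, hl])]; simp [hp]
  have ec₁ : σ₁.nat .c 0 0 = c := by rw [hA₁.nat .c rfl]; simp [hc]
  have em₁ : σ₁.nat .m 0 0 = m := by rw [hA₁.nat .m rfl]; simp [hm]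
  have ek₁ : σ₁.nat .k 0 0 = k := by rw [hA₁.nat .k rfl]; simp [hk]
  refine wp_forTo_zero (k + 1) (fun s σ' => ∀ a, ∀ b < m, σ'.real .A a b =
    if a = p then B b else if a < s then σ.real .A a b - σ.real .A a c * B b else σ.real .A a b)
    (45 * m + 60) rfl (fun σ' hA => by simp [hA.nat .k rfl, ek₁]) ?_ ?_ ?_
  · intro a b hb
    simp only [Nat.not_lt_zero, if_false]
    simp [hI₁, hb]
  · intro s σ₂ hsk hI₂ hss hA₂
    have e₂ : σ₂.nat κ 0 0 = p := by
      rw [hA₂.nat κ (by simp [forTo, when, Cmd.writesNat, hl, hs]), e₁]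
    have ec₂ : σ₂.nat .c 0 0 = c := by rw [hA₂.nat .c rfl, ec₁]
    have em₂ : σ₂.nat .m 0 0 = m := by rw [hA₂.nat .m rfl, em₁]
    refine wp_when ?_ ?_
    · intro hb
      simp [hss, e₂] at hb
      rw [wp_seq, wp_rset]
      refine wp_forTo_zero m (fun l σ' => ∀ a b, σ'.real .A a b =
        if a = s ∧ b < l then σ₂.real .A s b - σ₂.real .A s c * σ₂.real .A p b
        else σ₂.real .A a b) 26 rfl
        (fun σ' hA => by simp [hA.nat .m rfl, em₂]) (by simp) ?_ ?_
      · intro l σ' hlm hI hll hA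
        have e₃ : σ'.nat κ 0 0 = p := by
          rw [hA.nat κ (by simp [forTo, Cmd.writesNat, hl])]; simp [e₂]
        have e₄ : σ'.real .fac 0 0 = σ₂.real .A s c := by
          rw [hA.real .fac rfl]; simp [hss, ec₂]
        have e₅ : σ'.nat .s 0 0 = s := by rw [hA.nat .s rfl]; simp [hss]
        rw [wp_rset]
        refine ⟨by simp, ?_⟩
        intro a b
        simp [e₃, e₄, e₅, hll, hI, Ne.symm hb]
        by_cases h : a = s ∧ b = l
        · rw [if_pos h, if_pos ⟨h.1, h.2.le⟩, h.2]
        · rw [if_neg h]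
          refine if_congr ?_ rfl rfl
          constructor
          · rintro ⟨h₁, h₂⟩; exact ⟨h₁, h₂.le⟩
          · rintro ⟨h₁, h₂⟩; exact ⟨h₁, lt_of_le_of_ne h₂ fun h' => h ⟨h₁, h'⟩⟩
      · intro σ₃ t₃ hI₃ hA₃ ht₃
        refine ⟨?_, ?_⟩
        · simp at ht₃ ⊢; omega
        · intro a b hbm
          simp only [Mem.setNat_real, hI₃, hI₂ s b hbm, hI₂ s c hcm, hI₂ p b hbm, hI₂ a b hbm,
            if_neg hb, if_true, lt_irrefl, if_false, hbm, and_true]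
          by_cases has : a = s
          · rw [if_pos has, has, if_neg hb, if_pos (Nat.lt_succ_self s)]
          · rw [if_neg has]
            by_cases hap : a = p
            · rw [if_pos hap, if_pos hap]
            · rw [if_neg hap, if_neg hap]
              refine if_congr ?_ rfl rfl
              omega
    · intro hb
      simp [hss, e₂] at hb
      refine ⟨by simp, ?_⟩
      intro a b hbm
      simp only [Mem.setNat_real, hI₂ a b hbm]
      by_cases h : a = p
      · rw [if_pos h, if_pos h]
      · rw [if_neg h, if_neg h]
        refine if_congr ?_ rfl rfl
        omega
  intro σ₃ t₃ hI₃ hA₃ ht₃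
  refine ⟨?_, ?_, ?_⟩
  · intro l hlm
    rw [hI₃ p l hlm, if_pos rfl]
  · intro s hsk hsp l hlm
    rw [hI₃ s l hlm, hI₃ p l hlm, if_pos rfl, if_neg hsp, if_pos (by omega)]
  · have h : (k + 2) * (60 * m + 100) = (k + 1) * (60 * m + 100) + (60 * m + 100) := by ring
    have h' : (k + 1) * (45 * m + 60 + 18) ≤ (k + 1) * (60 * m + 100) :=
      Nat.mul_le_mul_left _ (by omega)
    simp at ht₁ ht₃ ⊢
    omega

end

section

local infixr:20 " ;; " => Cmd.seq
local infix:40 " ≔ " => Cmd.nset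
local infix:40 " ≔ᵣ " => Cmd.rset

open NName RName

/-- Look for a pivot in column `c`. -/
def findPivot : Cmd :=
  pr ≔ .add k 1 ;;
  forTo r rk (.add k 1) (when (.neg (.realEq (A.at₂ r c) 0)) (pr ≔ r))

/-- Interchange the rows `pr` and `rk`. -/
def swapRows : Cmd :=
  forTo l 0 m (
    tmp ≔ᵣ A.at₂ pr l ;;
    A.at₂ pr l ≔ᵣ A.at₂ rk l ;;
    A.at₂ rk l ≔ᵣ tmp)

/-- For each pivot column, bound how far the coefficients can move along the dependency of
column `c`. -/
def boundTheta : Cmd :=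
  forTo r 0 rk (
    when (.realLt (A.at₂ r c) 0) (
      cand ≔ᵣ .div (lam.at₁ (piv.at₁ r)) (.sub 0 (A.at₂ r c)) ;;
      when (.realLt cand theta) (
        theta ≔ᵣ cand ;;
        jr ≔ r)))

/-- Compute how far the coefficients can move along the dependency of column `c`. -/
def findTheta : Cmd :=
  (theta ≔ᵣ lam.at₁ c ;; jr ≔ .add k 1) ;; boundTheta

/-- Move the coefficients of the pivot columns along the dependency of column `c`. -/
def moveCoefficients : Cmd :=
  forTo r 0 rk (
    lam.at₁ (piv.at₁ r) ≔ᵣ .add (lam.at₁ (piv.at₁ r)) (.mul theta (A.at₂ r c)))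

end

section

variable {k m c ρ : ℕ}

theorem wp_findPivot (hk : σ.nat .k 0 0 = k) (hc : σ.nat .c 0 0 = c) (hrk : σ.nat .rk 0 0 = ρ)
    (hρ : ρ ≤ k + 1)
    (post : ∀ σ' t p, σ'.nat .pr 0 0 = p →
      ((p = k + 1 ∧ ∀ s, ρ ≤ s → s ≤ k → σ.real .A s c = 0) ∨
        (ρ ≤ p ∧ p ≤ k ∧ σ.real .A p c ≠ 0)) →
      Agree findPivot σ σ' → t ≤ 60 * (k + 1) + 60 → Q σ' t) : wp f findPivot σ Q := by
  suffices H : wp f findPivot σ (fun σ' t =>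
      ((σ'.nat .pr 0 0 = k + 1 ∧ ∀ s, ρ ≤ s → s ≤ k → σ.real .A s c = 0) ∨
        (ρ ≤ σ'.nat .pr 0 0 ∧ σ'.nat .pr 0 0 ≤ k ∧ σ.real .A (σ'.nat .pr 0 0) c ≠ 0)) ∧
      t ≤ 60 * (k + 1) + 60) from wp_mono H fun σ' t h hA => post σ' t _ rfl h.1 hA h.2
  unfold findPivot
  simp only [wp_seq, wp_nset]
  refine wp_forTo (k + 1) (fun r σ' =>
    ((σ'.nat .pr 0 0 = k + 1 ∧ ∀ s, ρ ≤ s → s < r → σ.real .A s c = 0) ∨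
      (ρ ≤ σ'.nat .pr 0 0 ∧ σ'.nat .pr 0 0 ≤ k ∧ σ.real .A (σ'.nat .pr 0 0) c ≠ 0))) (fun _ => 30)
    rfl (by simpa [hrk] using hρ) (fun σ' hA => by simp [hA.nat .k rfl, hk]) ?_ ?_ ?_
  · refine Or.inl ⟨by simp [hk], ?_⟩
    intro s h₁ h₂
    simp [hrk] at h₂
    omega
  · intro r σ' hr₁ hr₂ hI hrr hA
    simp [hrk] at hr₁
    have eA : σ'.real .A = σ.real .A := by rw [hA.real .A rfl]; simp
    have ec : σ'.nat .c 0 0 = c := by rw [hA.nat .c rfl]; simp [hc]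
    refine wp_when ?_ ?_
    · intro hb
      simp [hrr, ec, eA] at hb
      rw [wp_nset]
      refine ⟨by simp, Or.inr ?_⟩
      simp [hrr]
      exact ⟨hr₁, by omega, hb⟩
    · intro hb
      simp [hrr, ec, eA] at hb
      refine ⟨by simp, ?_⟩
      simp
      rcases hI with h | h
      · refine Or.inl ⟨h.1, fun s h₁ h₂ => ?_⟩
        rcases Nat.lt_or_ge s r with h' | h'
        · exact h.2 s h₁ h'
        · rw [show s = r by omega]; exact hb
      · exact Or.inr h
  · intro σ' t hI hA ht
    refine ⟨?_, ?_⟩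
    · rcases hI with h | h
      · exact Or.inl ⟨h.1, fun s h₁ h₂ => h.2 s h₁ (by omega)⟩
      · exact Or.inr h
    · have : (k + 1 - ρ) * 48 ≤ (k + 1) * 48 := Nat.mul_le_mul_right _ (by omega)
      simp [hrk] at ht ⊢
      omega

theorem wp_swapRows {p : ℕ} (hm : σ.nat .m 0 0 = m) (hp : σ.nat .pr 0 0 = p)
    (hrk : σ.nat .rk 0 0 = ρ)
    (post : ∀ σ' t, (∀ s, ∀ l < m, σ'.real .A s l = σ.real .A (Equiv.swap p ρ s) l) →
      Agree swapRows σ σ' → t ≤ 80 * m + 20 → Q σ' t) : wp f swapRows σ Q := by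
  unfold swapRows at *
  refine wp_forTo_zero m (fun l σ' => ∀ s l', σ'.real .A s l' =
    if l' < l then σ.real .A (Equiv.swap p ρ s) l' else σ.real .A s l') 60 rfl
    (fun σ' hA => by simp [hA.nat .m rfl, hm]) (by simp) ?_ ?_
  · intro l σ' hl hI hll hA
    have e₁ : σ'.nat .pr 0 0 = p := by rw [hA.nat .pr rfl, hp]
    have e₂ : σ'.nat .rk 0 0 = ρ := by rw [hA.nat .rk rfl, hrk]
    simp only [wp_seq, wp_rset]
    refine ⟨by simp, ?_⟩
    intro s l'
    simp [e₁, e₂, hll, hI, Equiv.swap_apply_def]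
    by_cases h : l' = l
    · subst h
      simp
      split_ifs <;> simp_all
    · have : l' ≤ l ↔ l' < l := ⟨fun h' => lt_of_le_of_ne h' h, le_of_lt⟩
      simp [h, this]
  · intro σ' t hI hA ht
    refine post σ' t (fun s l hl => by rw [hI, if_pos hl]) hA ?_
    simp at ht
    omega

/-- The ratio test: the coefficients remain nonnegative when they are moved by `θ` times the dependency
of column `c`, and then the coefficient of column `c` or that of the pivot column of row `j`
vanishes. -/
theorem wp_findTheta {K : (ℕ → ℝ) → Prop} (hk : σ.nat .k 0 0 = k) (hc : σ.nat .c 0 0 = c)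
    (hrk : σ.nat .rk 0 0 = ρ) (hE : Elim k m c ρ (σ.real .A) (σ.nat .piv) K)
    (hc0 : 0 ≤ σ.real .lam c 0) (hp0 : ∀ r < ρ, 0 ≤ σ.real .lam (σ.nat .piv r 0) 0)
    (post : ∀ σ' t θ j, σ'.real .theta 0 0 = θ → σ'.nat .jr 0 0 = j → 0 ≤ θ →
      θ ≤ σ.real .lam c 0 →
      (∀ r < ρ, 0 ≤ σ.real .lam (σ.nat .piv r 0) 0 + θ * σ.real .A r c) →
      ((j = k + 1 ∧ θ = σ.real .lam c 0) ∨ (j < ρ ∧ σ.real .A j c < 0 ∧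
        σ.real .lam (σ.nat .piv j 0) 0 + θ * σ.real .A j c = 0)) →
      Agree findTheta σ σ' → t ≤ 100 * ρ + 60 → Q σ' t) : wp f findTheta σ Q := by
  suffices H : wp f findTheta σ (fun σ' t => 0 ≤ σ'.real .theta 0 0 ∧
      σ'.real .theta 0 0 ≤ σ.real .lam c 0 ∧
      (∀ r < ρ, 0 ≤ σ.real .lam (σ.nat .piv r 0) 0 + σ'.real .theta 0 0 * σ.real .A r c) ∧
      ((σ'.nat .jr 0 0 = k + 1 ∧ σ'.real .theta 0 0 = σ.real .lam c 0) ∨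
        (σ'.nat .jr 0 0 < ρ ∧ σ.real .A (σ'.nat .jr 0 0) c < 0 ∧
        σ.real .lam (σ.nat .piv (σ'.nat .jr 0 0) 0) 0 +
          σ'.real .theta 0 0 * σ.real .A (σ'.nat .jr 0 0) c = 0)) ∧ t ≤ 100 * ρ + 60) from
    wp_mono H fun σ' t h hA => post σ' t _ _ rfl rfl h.1 h.2.1 h.2.2.1 h.2.2.2.1 hA h.2.2.2.2
  unfold findTheta boundTheta
  simp only [wp_seq, wp_nset, wp_rset]
  refine wp_forTo_zero ρ (fun s σ' => 0 ≤ σ'.real .theta 0 0 ∧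
      σ'.real .theta 0 0 ≤ σ.real .lam c 0 ∧
      (∀ r < s, 0 ≤ σ.real .lam (σ.nat .piv r 0) 0 + σ'.real .theta 0 0 * σ.real .A r c) ∧
      ((σ'.nat .jr 0 0 = k + 1 ∧ σ'.real .theta 0 0 = σ.real .lam c 0) ∨
        (σ'.nat .jr 0 0 < ρ ∧ σ.real .A (σ'.nat .jr 0 0) c < 0 ∧
        σ.real .lam (σ.nat .piv (σ'.nat .jr 0 0) 0) 0 +
          σ'.real .theta 0 0 * σ.real .A (σ'.nat .jr 0 0) c = 0))) 70
    rfl (fun σ' hA => by simp [hA.nat .rk rfl, hrk]) ?_ ?_ ?_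
  · refine ⟨by simpa [hc] using hc0, by simp [hc], fun r hr => absurd hr (Nat.not_lt_zero r), ?_⟩
    exact Or.inl ⟨by simp [hk], by simp [hc]⟩
  · rintro s σ' hs ⟨h₁, h₂, h₃, h₄⟩ hss hA
    have eA : σ'.real .A = σ.real .A := by rw [hA.real .A rfl]; simp
    have el : σ'.real .lam = σ.real .lam := by rw [hA.real .lam rfl]; simp
    have ep : σ'.nat .piv = σ.nat .piv := by rw [hA.nat .piv rfl]; simp
    have ec : σ'.nat .c 0 0 = c := by rw [hA.nat .c rfl]; simp [hc]
    set a := σ.real .A s c with ha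
    set L := σ.real .lam (σ.nat .piv s 0) 0 with hL
    have hL0 : 0 ≤ L := hp0 s hs
    refine wp_when ?_ ?_
    · intro hb
      simp [hss, ec, eA, ← ha] at hb
      simp only [wp_seq, wp_rset]
      have hcand : L / (-a) * a = -L := by
        rw [div_neg, neg_mul, div_mul_cancel₀ _ (ne_of_lt hb)]
      refine wp_when ?_ ?_
      · intro hb₂
        simp [hss, ec, eA, el, ep, ← ha, ← hL] at hb₂
        simp only [wp_seq, wp_rset, wp_nset]
        simp [hss, ec, eA, el, ep, ← ha, ← hL]
        have hneg : L / (-a) = -(L / a) := by rw [div_neg]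
        rw [← hneg] at *
        refine ⟨div_nonneg hL0 (by linarith), by linarith, ?_, Or.inr ⟨hs, hb, ?_⟩⟩
        · intro r hr
          rcases Nat.lt_or_ge r s with h | h
          · have := h₃ r h
            by_cases hpos : 0 ≤ σ.real .A r c
            · exact add_nonneg (hp0 r (by omega)) (mul_nonneg (div_nonneg hL0 (by linarith)) hpos)
            · nlinarith
          · rw [show r = s by omega, ← ha, ← hL, hcand]; linarith
        · rw [hcand]; ring
      · intro hb₂
        simp [hss, ec, eA, el, ep, ← ha, ← hL] at hb₂
        simp
        refine ⟨h₁, h₂, ?_, h₄⟩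
        intro r hr
        rcases Nat.lt_or_ge r s with h | h
        · exact h₃ r h
        · rw [show r = s by omega, ← ha, ← hL]
          have := (le_div_iff₀ (by linarith : 0 < -a)).1 hb₂
          linarith
    · intro hb
      simp [hss, ec, eA, ← ha] at hb
      simp
      refine ⟨h₁, h₂, ?_, h₄⟩
      intro r hr
      rcases Nat.lt_or_ge r s with h | h
      · exact h₃ r h
      · rw [show r = s by omega]
        exact add_nonneg hL0 (mul_nonneg h₁ hb)
  · rintro σ' t ⟨h₁, h₂, h₃, h₄⟩ hA ht
    refine ⟨h₁, h₂, h₃, h₄, ?_⟩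
    simp at ht ⊢
    omega

theorem wp_moveCoefficients {K : (ℕ → ℝ) → Prop} {θ : ℝ} (hc : σ.nat .c 0 0 = c)
    (hrk : σ.nat .rk 0 0 = ρ) (hE : Elim k m c ρ (σ.real .A) (σ.nat .piv) K)
    (hθ : σ.real .theta 0 0 = θ)
    (post : ∀ σ' t, (∀ r < ρ, σ'.real .lam (σ.nat .piv r 0) 0 =
        σ.real .lam (σ.nat .piv r 0) 0 + θ * σ.real .A r c) →
      (∀ l, (∀ r < ρ, σ.nat .piv r 0 ≠ l) → σ'.real .lam l 0 = σ.real .lam l 0) →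
      Agree moveCoefficients σ σ' → t ≤ 60 * ρ + 20 → Q σ' t) : wp f moveCoefficients σ Q := by
  unfold moveCoefficients at *
  refine wp_forTo_zero ρ (fun s σ' => (∀ r < ρ, σ'.real .lam (σ.nat .piv r 0) 0 =
      if r < s then σ.real .lam (σ.nat .piv r 0) 0 + θ * σ.real .A r c
      else σ.real .lam (σ.nat .piv r 0) 0) ∧
      (∀ l, (∀ r < ρ, σ.nat .piv r 0 ≠ l) → σ'.real .lam l 0 = σ.real .lam l 0)) 40
    rfl (fun σ' hA => by simp [hA.nat .rk rfl, hrk]) (by simp) ?_ ?_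
  · rintro s σ' hs ⟨h₁, h₂⟩ hss hA
    have eA : σ'.real .A = σ.real .A := hA.real .A rfl
    have eθ : σ'.real .theta 0 0 = θ := by rw [hA.real .theta rfl, hθ]
    have ep : σ'.nat .piv = σ.nat .piv := hA.nat .piv rfl
    have ec : σ'.nat .c 0 0 = c := by rw [hA.nat .c rfl, hc]
    simp only [wp_rset]
    refine ⟨by simp, ?_, ?_⟩
    · intro r hr
      simp [hss, eA, eθ, ep, ec, h₁ r hr, h₁ s hs]
      by_cases hrs : r = s
      · subst hrs; simp
      · have hne : σ.nat .piv r 0 ≠ σ.nat .piv s 0 := fun h => hrs (hE.inj r hr s hs h)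
        have : r ≤ s ↔ r < s := ⟨fun h' => lt_of_le_of_ne h' hrs, le_of_lt⟩
        simp [hne, this]
    · intro l hl
      simp [hss, eA, eθ, ep, ec, Ne.symm (hl s hs)]
      exact h₂ l hl
  · rintro σ' t ⟨h₁, h₂⟩ hA ht
    refine post σ' t (fun r hr => by rw [h₁ r hr, if_pos hr]) h₂ hA ?_
    simp at ht
    omega

end

theorem wp_seq_assoc {c₁ c₂ c₃ : Cmd} :
    wp f (.seq (.seq c₁ c₂) c₃) σ Q ↔ wp f (.seq c₁ (.seq c₂ c₃)) σ Q := by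
  simp only [wp_seq, add_assoc]

/-- The affine dependencies of the columns `(y_l, 1)`. -/
def Dependency (V : Finset ℕ) (m : ℕ) (y : ℕ → ℕ → ℝ) (μ : ℕ → ℝ) : Prop :=
  (∀ v ∈ V, ∑ l ∈ range m, μ l * y l v = 0) ∧ ∑ l ∈ range m, μ l = 0

/-- The state of `reduce` after the columns before `c` have been treated: only pivot columns have
kept a positive coefficient. -/
structure Reduced (E : Env n f) (m c : ℕ) (L : ℕ → ℕ → ℕ) (y x : ℕ → ℕ → ℝ) (σ : Mem) : Prop where
  elim : Elim E.k m c (σ.nat .rk 0 0) (σ.real .A) (σ.nat .piv) (Dependency E.V m y)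
  family : Family E.V E.g E.k m L y (σ.real .lam) x
  zero : ∀ l < c, (∀ r < σ.nat .rk 0 0, σ.nat .piv r 0 ≠ l) → σ.real .lam l 0 = 0

section

local infixr:20 " ;; " => Cmd.seq
local infix:40 " ≔ " => Cmd.nset
local infix:40 " ≔ᵣ " => Cmd.rset

open NName RName

/-- Make column `c` a pivot column, or move the coefficients along its dependency. -/
def treatColumn : Cmd :=
  findPivot ;;
  .cond (.natLt pr (.add k 1)) (
    swapRows ;;
    piv.at₁ rk ≔ c ;;
    pivot rk ;;
    rk ≔ .add rk 1) (
    theta ≔ᵣ lam.at₁ c ;;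
    jr ≔ .add k 1 ;;
    boundTheta ;;
    moveCoefficients ;;
    lam.at₁ c ≔ᵣ .sub (lam.at₁ c) theta ;;
    when (.natLt jr (.add k 1)) (
      piv.at₁ jr ≔ c ;;
      pivot jr))

end

/-- In each case column `c` becomes a pivot column, possibly in place of the column whose coefficient
vanished, or its coefficient becomes zero. -/
theorem wp_treatColumn {E : Env n f} {m c : ℕ} {L : ℕ → ℕ → ℕ} {y x : ℕ → ℕ → ℝ}
    (hR : Reduced E m c L y x σ) (hk : σ.nat .k 0 0 = E.k) (hm : σ.nat .m 0 0 = m)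
    (hc : σ.nat .c 0 0 = c) (hcm : c < m) (hmn : m ≤ 2 * n + 1)
    (post : ∀ σ' t, Reduced E m (c + 1) L y x σ' → Agree treatColumn σ σ' → t ≤ 2000 * n * n →
      Q σ' t) : wp f treatColumn σ Q := by
  have hn := E.pos
  have hkn := E.k_le
  have hpiv : (E.k + 2) * (60 * m + 100) ≤ 840 * n * n := by
    calc (E.k + 2) * (60 * m + 100) ≤ (3 * n) * (280 * n) := Nat.mul_le_mul (by omega) (by omega)
      _ = _ := by ring
  have hnn : n ≤ n * n := Nat.le_mul_self n
  suffices H : wp f treatColumn σ (fun σ' t => Reduced E m (c + 1) L y x σ' ∧ t ≤ 2000 * n * n) from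
    wp_mono H fun σ' t h hA => post σ' t h.1 hA h.2
  obtain ⟨hE, hF, hzero⟩ := hR
  set ρ := σ.nat .rk 0 0 with hρ
  have hρk := hE.le
  unfold treatColumn
  rw [wp_seq]
  refine wp_findPivot hk hc hρ.symm hE.le ?_
  intro σ₁ t₁ p hp₁ hp hA₁ ht₁
  have eA₁ : σ₁.real = σ.real := by ext a r c; rw [hA₁.real a rfl]
  have eN₁ : ∀ a, a ≠ .pr → a ≠ .r → σ₁.nat a = σ.nat a := by
    intro a h₁ h₂
    exact hA₁.nat a (by simp [findPivot, forTo, when, Cmd.writesNat, h₁, h₂])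
  refine wp_cond ?_ ?_
  · intro hb
    simp [hp₁, eN₁, hk] at hb
    obtain ⟨hρp, hpk, hpc⟩ : ρ ≤ p ∧ p ≤ E.k ∧ σ.real .A p c ≠ 0 := by
      rcases hp with h | h
      · omega
      · exact h
    rw [wp_seq]
    refine wp_swapRows (m := m) (p := p) (ρ := ρ) (by simp [eN₁, hm]) hp₁ (by simp [eN₁, ← hρ]) ?_
    intro σ₂ t₂ hsw hA₂ ht₂
    rw [eA₁] at hsw
    have eN₂ : ∀ a, a ≠ .pr → a ≠ .r → a ≠ .l → σ₂.nat a = σ.nat a := by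
      intro a h₁ h₂ h₃
      rw [hA₂.nat a (by simp [swapRows, forTo, when, Cmd.writesNat, h₃]), eN₁ a h₁ h₂]
    have hE₂ := hE.swap hcm.le hρp hpk hsw
    simp only [wp_seq, wp_nset]
    refine wp_mono (wp_pivot (k := E.k) (m := m) (c := c) (p := ρ) (by simp) (by simp)
      (by simp [eN₂, hk])
      (by simp [eN₂, hm]) (by simp [eN₂, ← hρ]) (by simp [eN₂, hc]) (by omega) hcm) ?_
    rintro σ₃ t₃ ⟨h₁, h₂, ht₃⟩ hA₃
    simp only [Mem.setNat_real] at h₁ h₂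
    have erk : σ₃.nat .rk 0 0 = ρ := by rw [hA₃.nat .rk rfl]; simp [eN₂, ← hρ]
    have elam : σ₃.real .lam = σ.real .lam := by
      rw [hA₃.real .lam rfl, Mem.setNat_real, hA₂.real .lam rfl, eA₁]
    have epiv : ∀ r, σ₃.nat .piv r 0 = if r = ρ then c else σ.nat .piv r 0 := by
      intro r
      rw [hA₃.nat .piv rfl]
      simp [eN₂, ← hρ, hc]
    have hfac : σ₂.real .A ρ c ≠ 0 := by
      rw [hsw ρ c hcm, Equiv.swap_apply_right]
      exact hpc
    have hE₃ : Elim E.k m (c + 1) (ρ + 1) (σ₃.real .A) (σ₃.nat .piv) (Dependency E.V m y) :=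
      Elim.pivot (fun s hs r hr _ => hE₂.unit s hs r hr) hE.lt hE.inj hE₂.kernel (by omega)
        (fun r _ _ => by omega) hcm (by omega) hfac h₁ h₂ (by rw [epiv, if_pos rfl])
        (fun r hr => by rw [epiv, if_neg hr])
    refine ⟨⟨?_, ?_, ?_⟩, ?_⟩
    · simpa [erk] using hE₃
    · simpa [elam] using hF
    · intro l hl hl'
      simp [erk] at hl'
      simp only [Mem.setNat_real, elam]
      have hlc : l ≠ c := by
        have := hl' ρ le_rfl
        rw [epiv, if_pos rfl] at this
        exact fun h => this h.symm
      refine hzero l (by omega) fun r hr => ?_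
      have := hl' r hr.le
      rwa [epiv, if_neg (by omega)] at this
    · simp [mul_assoc] at hpiv ht₁ ht₂ ht₃ ⊢
      omega
  · intro hb
    simp [hp₁, eN₁, hk] at hb
    have hdep : ∀ s, ρ ≤ s → s ≤ E.k → σ.real .A s c = 0 := by
      rcases hp with h | h
      · exact h.2
      · omega
    have hlp : ∀ r < ρ, σ.nat .piv r 0 < m := fun r hr => (hE.lt r hr).trans hcm
    rw [← wp_seq_assoc, ← wp_seq_assoc]
    change wp f (.seq findTheta _) _ _
    rw [wp_seq]
    refine wp_findTheta (k := E.k) (m := m) (c := c) (ρ := ρ) (K := Dependency E.V m y)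
      (by simp [eN₁, hk]) (by simp [eN₁, hc]) (by simp [eN₁, ← hρ]) (by simpa [eN₁, eA₁] using hE)
      (by rw [eA₁]; exact hF.nonneg c hcm)
      (by intro r hr; rw [eA₁, eN₁ _ (by simp) (by simp)]; exact hF.nonneg _ (hlp r hr)) ?_
    intro σ₂ t₂ θ j hθ hj hθ0 hθc hθp hjr hA₂ ht₂
    have eA₂ : ∀ a, a ≠ .theta → a ≠ .cand → σ₂.real a = σ.real a := by
      intro a h₁ h₂
      rw [hA₂.real a (by simp [findTheta, boundTheta, forTo, when, Cmd.writesReal, h₁, h₂]), eA₁]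
    have eN₂ : ∀ a, a ≠ .pr → a ≠ .r → a ≠ .jr → σ₂.nat a = σ.nat a := by
      intro a h₁ h₂ h₃
      rw [hA₂.nat a (by simp [findTheta, boundTheta, forTo, when, Cmd.writesNat, h₂, h₃]),
        eN₁ a h₁ h₂]
    rw [eA₁, eN₁ .piv (by simp) (by simp)] at *
    rw [wp_seq]
    refine wp_moveCoefficients (k := E.k) (m := m) (c := c) (ρ := ρ) (K := Dependency E.V m y)
      (by simp [eN₂, hc]) (by simp [eN₂, ← hρ]) (by simpa [eN₂, eA₂] using hE) hθ ?_
    intro σ₃ t₃ hm₁ hm₂ hA₃ ht₃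
    rw [eN₂ .piv (by simp) (by simp) (by simp), eA₂ .lam (by simp) (by simp)] at hm₁ hm₂
    rw [eA₂ .A (by simp) (by simp)] at hm₁
    have eA₃ : ∀ a, a ≠ .theta → a ≠ .cand → a ≠ .lam → σ₃.real a = σ.real a := by
      intro a h₁ h₂ h₃
      rw [hA₃.real a (by simp [moveCoefficients, forTo, when, Cmd.writesReal, h₃]), eA₂ a h₁ h₂]
    have eN₃ : ∀ a, a ≠ .pr → a ≠ .r → a ≠ .jr → σ₃.nat a = σ.nat a := by
      intro a h₁ h₂ h₃
      rw [hA₃.nat a (by simp [moveCoefficients, forTo, when, Cmd.writesNat, h₂]), eN₂ a h₁ h₂ h₃]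
    have eθ₃ : σ₃.real .theta 0 0 = θ := by rw [hA₃.real .theta rfl, hθ]
    have ej₃ : σ₃.nat .jr 0 0 = j := by rw [hA₃.nat .jr rfl, hj]
    have hcp : ∀ r < ρ, σ.nat .piv r 0 ≠ c := fun r hr => (hE.lt r hr).ne
    have elc₃ : σ₃.real .lam c 0 = σ.real .lam c 0 := hm₂ c hcp
    simp only [wp_seq, wp_rset]
    set σ₄ := σ₃.setReal .lam c 0 (σ.real .lam c 0 - θ) with hσ₄
    have hrw : σ₃.setReal (RName.at₁ .lam (NExp.get .c 0 0)).arr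
        ((RName.at₁ .lam (NExp.get .c 0 0)).row.eval n σ₃)
        ((RName.at₁ .lam (NExp.get .c 0 0)).col.eval n σ₃)
        (((RExp.get RName.lam (NExp.get .c 0 0) 0).sub (RExp.get RName.theta 0 0)).eval n σ₃) =
        σ₄ := by
      simp [hσ₄, eN₃, hc, elc₃, eθ₃]
    rw [hrw]
    have hlc : ∀ l, σ₄.real .lam l 0 = if l = c then σ.real .lam c 0 - θ else σ₃.real .lam l 0 := by
      intro l; simp [hσ₄]
    have hl₁ : ∀ r < ρ, σ₄.real .lam (σ.nat .piv r 0) 0 =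
        σ.real .lam (σ.nat .piv r 0) 0 + θ * σ.real .A r c := by
      intro r hr
      rw [hlc, if_neg (hcp r hr), hm₁ r hr]
    have hl₂ : σ₄.real .lam c 0 = σ.real .lam c 0 - θ := by rw [hlc, if_pos rfl]
    have hl₃ : ∀ l, l ≠ c → (∀ r < ρ, σ.nat .piv r 0 ≠ l) →
        σ₄.real .lam l 0 = σ.real .lam l 0 := by
      intro l h h'
      rw [hlc, if_neg h, hm₂ l h']
    have hF₄ : Family E.V E.g E.k m L y (σ₄.real .lam) x := by
      refine ⟨hF.enum, hF.greedy, ?_, ?_, ?_⟩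
      · intro l hl
        by_cases h : l = c
        · rw [h, hl₂]; linarith
        · by_cases h' : ∃ r < ρ, σ.nat .piv r 0 = l
          · obtain ⟨r, hr, rfl⟩ := h'
            rw [hl₁ r hr]
            exact hθp r hr
          · push Not at h'
            rw [hl₃ l h h']
            exact hF.nonneg l hl
      · have := hE.sum_eq hcm hdep (lam := fun l => σ.real .lam l 0)
          (lam' := fun l => σ₄.real .lam l 0) hl₁ hl₂ hl₃ (w := fun _ => 1)
          (fun μ h => by simpa using h.2)
        simp only [mul_one] at this
        rw [this, hF.one]
      · intro v hv
        rw [hF.comb v hv]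
        exact (hE.sum_eq hcm hdep (lam := fun l => σ.real .lam l 0)
          (lam' := fun l => σ₄.real .lam l 0) hl₁ hl₂ hl₃ (w := fun l => y l v)
          (fun μ h => h.1 v hv)).symm
    have ej₄ : σ₄.nat .jr 0 0 = j := by rw [← ej₃]; rfl
    have ek₄ : σ₄.nat .k 0 0 = E.k := by rw [← hk, ← eN₃ .k (by simp) (by simp) (by simp)]; rfl
    have eN₄ : σ₄.nat = σ₃.nat := rfl
    have eA₄ : σ₄.real .A = σ.real .A := by
      rw [← eA₃ .A (by simp) (by simp) (by simp)]; simp [hσ₄]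
    refine wp_when ?_ ?_
    · intro hb₄
      simp [ej₄, ek₄] at hb₄
      obtain ⟨hjρ, hjc, hj0⟩ : j < ρ ∧ σ.real .A j c < 0 ∧
          σ.real .lam (σ.nat .piv j 0) 0 + θ * σ.real .A j c = 0 := by
        rcases hjr with h | h
        · omega
        · exact h
      simp only [wp_seq, wp_nset]
      refine wp_mono (wp_pivot (k := E.k) (m := m) (c := c) (p := j) (by simp) (by simp)
        (by simp [ek₄])
        (by simp [eN₄, eN₃, hm]) (by simp [ej₄]) (by simp [eN₄, eN₃, hc]) (by omega) hcm) ?_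
      rintro σ₅ t₅ ⟨h₁, h₂, ht₅⟩ hA₅
      simp only [Mem.setNat_real, eA₄] at h₁ h₂
      have erk : σ₅.nat .rk 0 0 = ρ := by rw [hA₅.nat .rk rfl]; simp [eN₄, eN₃, ← hρ]
      have elam : σ₅.real .lam = σ₄.real .lam := by rw [hA₅.real .lam rfl, Mem.setNat_real]
      have epiv : ∀ r, σ₅.nat .piv r 0 = if r = j then c else σ.nat .piv r 0 := by
        intro r
        rw [hA₅.nat .piv rfl]
        simp [eN₄, eN₃, ej₄, hc]
      have hE₅ : Elim E.k m (c + 1) ρ (σ₅.real .A) (σ₅.nat .piv) (Dependency E.V m y) :=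
        Elim.pivot (fun s hs r hr _ => hE.unit s hs r hr) hE.lt hE.inj hE.kernel hE.le
          (fun r h _ => h) hcm (by omega) hjc.ne h₁ h₂ (by rw [epiv, if_pos rfl])
          (fun r hr => by rw [epiv, if_neg hr])
      refine ⟨⟨?_, ?_, ?_⟩, ?_⟩
      · rw [erk]; exact hE₅
      · rw [elam]; exact hF₄
      · intro l hl hl'
        rw [erk] at hl'
        have hlc : l ≠ c := by
          have := hl' j hjρ
          rw [epiv, if_pos rfl] at this
          exact this.symm
        rw [elam]
        by_cases hlj : l = σ.nat .piv j 0
        · rw [hlj, hl₁ j hjρ, hj0]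
        · have hl'' : ∀ r < ρ, σ.nat .piv r 0 ≠ l := by
            intro r hr
            by_cases hrj : r = j
            · rw [hrj]; exact Ne.symm hlj
            · have := hl' r hr
              rwa [epiv, if_neg hrj] at this
          rw [hl₃ l hlc hl'']
          exact hzero l (by omega) hl''
      · simp [mul_assoc] at hpiv ht₁ ht₂ ht₃ ht₅ ⊢
        omega
    · intro hb₄
      simp [ej₄, ek₄] at hb₄
      have hθc : θ = σ.real .lam c 0 := by
        rcases hjr with h | h
        · exact h.2
        · omega
      have erk : σ₄.nat .rk 0 0 = ρ := by simp [eN₄, eN₃, ← hρ]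
      have epiv : σ₄.nat .piv = σ.nat .piv := by simp [eN₄, eN₃]
      refine ⟨⟨?_, hF₄, ?_⟩, ?_⟩
      · rw [erk, epiv, eA₄]
        exact ⟨hE.le, fun r hr => (hE.lt r hr).trans (Nat.lt_succ_self c), hE.inj, hE.unit,
          hE.kernel⟩
      · intro l hl hl'
        rw [erk, epiv] at hl'
        by_cases hlc : l = c
        · rw [hlc, hl₂, hθc, sub_self]
        · rw [hl₃ l hlc hl']
          exact hzero l (by omega) hl'
      · simp [mul_assoc] at hpiv ht₁ ht₂ ht₃ ⊢
        omega

section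

local infixr:20 " ;; " => Cmd.seq
local infix:40 " ≔ " => Cmd.nset
local infix:40 " ≔ᵣ " => Cmd.rset

open NName RName

/-- Write the vectors `(y_c, 1)` into the columns of `A`. -/
def fillMatrix : Cmd :=
  forTo c 0 m (
    forTo r 0 k (A.at₂ r c ≔ᵣ y.at₂ c (G.at₁ r)) ;;
    A.at₂ k c ≔ᵣ 1)

/-- Keep the terms with a positive coefficient. -/
def compact : Cmd :=
  forTo c 0 m (
    when (.realLt 0 (lam.at₁ c)) (
      forTo r 0 k (
        y.at₂ mm (G.at₁ r) ≔ᵣ y.at₂ c (G.at₁ r) ;;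
        L.at₂ mm r ≔ L.at₂ c r) ;;
      lam.at₁ mm ≔ᵣ lam.at₁ c ;;
      mm ≔ .add mm 1))

end

theorem wp_fillMatrix {m k : ℕ} (hm : σ.nat .m 0 0 = m) (hk : σ.nat .k 0 0 = k)
    (post : ∀ σ' t, (∀ c < m, (∀ r < k, σ'.real .A r c = σ.real .y c (σ.nat .G r 0)) ∧
      σ'.real .A k c = 1) → Agree fillMatrix σ σ' → t ≤ m * (60 * k + 60) + 20 → Q σ' t) :
    wp f fillMatrix σ Q := by
  unfold fillMatrix at *
  refine wp_forTo_zero m (fun c' σ' => ∀ c < c', (∀ r < k, σ'.real .A r c =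
    σ.real .y c (σ.nat .G r 0)) ∧ σ'.real .A k c = 1) (60 * k + 40) rfl
    (fun σ' hA => by simp [hA.nat .m rfl, hm]) (by simp) ?_ ?_
  · intro c σ' hc hI hcc hA
    have ek : σ'.nat .k 0 0 = k := by rw [hA.nat .k rfl, hk]
    have ey : σ'.real .y = σ.real .y := hA.real .y rfl
    have eG : σ'.nat .G = σ.nat .G := hA.nat .G rfl
    rw [wp_seq]
    refine wp_forTo_zero k (fun r' σ'' => (∀ a b, b ≠ c → σ''.real .A a b = σ'.real .A a b) ∧
      ∀ r < r', σ''.real .A r c = σ.real .y c (σ.nat .G r 0)) 40 rfl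
      (fun σ' hA => by simp [hA.nat .k rfl, ek]) (by simp) ?_ ?_
    · rintro r σ'' hr ⟨h₁, h₂⟩ hrr hA'
      have ec : σ''.nat .c 0 0 = c := by rw [hA'.nat .c rfl, hcc]
      have ey : σ''.real .y = σ.real .y := by rw [hA'.real .y rfl, ey]
      have eG : σ''.nat .G = σ.nat .G := by rw [hA'.nat .G rfl, eG]
      rw [wp_rset]
      refine ⟨by simp, ?_, ?_⟩
      · intro a b hb
        simp [ec, hb, h₁ a b hb]
      · intro r' hr'
        simp [ec, hrr, ey, eG]
        by_cases h : r' = r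
        · rw [if_pos h, h]
        · rw [if_neg h]
          exact h₂ r' (by omega)
    · rintro σ'' t ⟨h₁, h₂⟩ hA' ht
      have ec : σ''.nat .c 0 0 = c := by rw [hA'.nat .c rfl, hcc]
      have ek : σ''.nat .k 0 0 = k := by rw [hA'.nat .k rfl, ek]
      rw [wp_rset]
      refine ⟨by simp at ht ⊢; omega, ?_⟩
      intro c' hc'
      simp [ec, ek]
      by_cases h : c' = c
      · subst h
        refine ⟨fun r hr => ?_, fun h => absurd rfl h⟩
        rw [if_neg (by omega)]
        exact h₂ r hr
      · have := hI c' (by omega)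
        refine ⟨fun r hr => ?_, fun _ => ?_⟩
        · rw [if_neg (by tauto), h₁ _ _ h]
          exact this.1 r hr
        · rw [h₁ _ _ h]; exact this.2
  · intro σ' t hI hA ht
    refine post σ' t hI hA ?_
    have : m * (60 * k + 40 + 16) ≤ m * (60 * k + 60) := Nat.mul_le_mul_left _ (by omega)
    simp at ht
    omega

/-- Terms with coefficient zero are removed. -/
theorem wp_compact {V : Finset ℕ} {g : Finset ℕ → ℝ} {k m : ℕ} {x : ℕ → ℕ → ℝ}
    (hk : σ.nat .k 0 0 = k) (hm : σ.nat .m 0 0 = m) (hmm : σ.nat .mm 0 0 = 0)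
    (hG : Enum k (fun p => σ.nat .G p 0) V)
    (hF : Family V g k m (σ.nat .L) (σ.real .y) (σ.real .lam) x)
    (post : ∀ σ' t m', σ'.nat .mm 0 0 = m' →
      m' = ((range m).filter fun l => 0 < σ.real .lam l 0).card →
      Family V g k m' (σ'.nat .L) (σ'.real .y) (σ'.real .lam) x → Agree compact σ σ' →
      t ≤ m * (70 * k + 100) + 20 → Q σ' t) : wp f compact σ Q := by
  suffices H : wp f compact σ (fun σ' t =>
      σ'.nat .mm 0 0 = ((range m).filter fun l => 0 < σ.real .lam l 0).card ∧
      Family V g k (σ'.nat .mm 0 0) (σ'.nat .L) (σ'.real .y) (σ'.real .lam) x ∧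
      t ≤ m * (70 * k + 100) + 20) from
    wp_mono H fun σ' t h hA => post σ' t _ rfl h.1 h.2.1 hA h.2.2
  unfold compact
  -- The terms before `mm` and the terms from `c` on have the combination `x`.
  refine wp_forTo_zero m (fun c σ' => ∃ M, σ'.nat .mm 0 0 = M ∧ M ≤ c ∧
    M = ((range c).filter fun l => 0 < σ.real .lam l 0).card ∧
    (∀ l, c ≤ l → (∀ p, σ'.nat .L l p = σ.nat .L l p) ∧ (∀ v, σ'.real .y l v = σ.real .y l v) ∧
      σ'.real .lam l 0 = σ.real .lam l 0) ∧
    (∀ j < M, Enum k (σ'.nat .L j) V ∧ Greedy g k (σ'.nat .L j) (σ'.real .y j) ∧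
      0 ≤ σ'.real .lam j 0) ∧
    ∑ j ∈ range M, σ'.real .lam j 0 + ∑ l ∈ Ico c m, σ.real .lam l 0 = 1 ∧
    ∀ v ∈ V, ∑ j ∈ range M, σ'.real .lam j 0 * σ'.real .y j v +
      ∑ l ∈ Ico c m, σ.real .lam l 0 * σ.real .y l v = x v 0) (70 * k + 80) rfl
    (fun σ' hA => by simp [hA.nat .m rfl, hm]) ?_ ?_ ?_
  · refine ⟨0, by simp [hmm], le_rfl, by simp, by simp, by simp, ?_, ?_⟩
    · simpa using hF.one
    · intro v hv
      simpa using (hF.comb v hv).symm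
  · rintro c σ₁ hc ⟨M, hM, hMc, hcard, hrest, hdone, hone, hcomb⟩ hcc hA₁
    have ek : σ₁.nat .k 0 0 = k := by rw [hA₁.nat .k rfl]; exact hk
    have eG : σ₁.nat .G = σ.nat .G := by rw [hA₁.nat .G rfl]
    obtain ⟨hLc, hyc, hlc⟩ := hrest c le_rfl
    rw [sum_eq_sum_Ico_succ_bot hc] at hone
    have hcomb' : ∀ v ∈ V, ∑ j ∈ range M, σ₁.real .lam j 0 * σ₁.real .y j v +
      (σ.real .lam c 0 * σ.real .y c v +
      ∑ l ∈ Ico (c + 1) m, σ.real .lam l 0 * σ.real .y l v) = x v 0 := by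
      intro v hv
      rw [← hcomb v hv, sum_eq_sum_Ico_succ_bot hc]
    refine wp_when ?_ ?_
    · intro hb
      simp [hcc, hlc] at hb
      rw [wp_seq]
      refine wp_forTo_zero k (fun r' σ' =>
        (∀ j, j ≠ M → σ'.nat .L j = σ₁.nat .L j) ∧ (∀ j, j ≠ M → σ'.real .y j = σ₁.real .y j) ∧
        (∀ p, σ'.nat .L c p = σ.nat .L c p) ∧ (∀ v, σ'.real .y c v = σ.real .y c v) ∧
        ∀ r < r', σ'.nat .L M r = σ.nat .L c r ∧
          σ'.real .y M (σ.nat .G r 0) = σ.real .y c (σ.nat .G r 0)) 50 rfl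
        (fun σ' hA => by simp [hA.nat .k rfl, ek]) (by simp [hLc, hyc]) ?_ ?_
      · rintro r σ' hr ⟨h₁, h₂, h₃, h₄, h₅⟩ hrr hA'
        have ec : σ'.nat .c 0 0 = c := by rw [hA'.nat .c rfl, hcc]
        have eM : σ'.nat .mm 0 0 = M := by rw [hA'.nat .mm rfl, hM]
        have eG : σ'.nat .G = σ.nat .G := by rw [hA'.nat .G rfl, eG]
        simp only [wp_seq, wp_rset, wp_nset]
        refine ⟨by simp, ?_, ?_, ?_, ?_, ?_⟩ <;> simp [ec, eM, hrr, eG, h₃, h₄]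
        · intro j hj
          ext p
          simp [hj, h₁ j hj]
        · intro j hj
          ext p
          simp [hj, h₂ j hj]
        · intro r' hr'
          refine ⟨?_, ?_⟩
          · by_cases h : r' = r
            · rw [if_pos h, h]
            · rw [if_neg h]
              exact (h₅ r' (by omega)).1
          · split_ifs with h
            · rw [h]
            · refine (h₅ r' ?_).2
              have : r' ≠ r := by rintro rfl; exact h rfl
              omega
      · rintro σ₂ t₂ ⟨h₁, h₂, h₃, h₄, h₅⟩ hA₂ ht₂
        have ec : σ₂.nat .c 0 0 = c := by rw [hA₂.nat .c rfl, hcc]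
        have eM : σ₂.nat .mm 0 0 = M := by rw [hA₂.nat .mm rfl, hM]
        have elam : σ₂.real .lam = σ₁.real .lam := hA₂.real .lam rfl
        have hyM : ∀ v ∈ V, σ₂.real .y M v = σ.real .y c v := by
          intro v hv
          obtain ⟨p, hp, rfl⟩ := hG.surj v hv
          exact (h₅ p hp).2
        simp only [wp_seq, wp_rset, wp_nset]
        refine ⟨by simp at ht₂ ⊢; omega, M + 1, by simp [eM], by omega, ?_, ?_, ?_, ?_, ?_⟩
        · rw [range_add_one, filter_insert, if_pos hb, card_insert_of_notMem
            (by simp), ← hcard]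
        · intro l hl
          have hlM : l ≠ M := by omega
          simp [h₁ l hlM, h₂ l hlM, eM, hlM, elam]
          exact hrest l (by omega)
        · intro j hj
          simp [eM, ec, elam, hlc]
          rcases Nat.lt_or_ge j M with h | h
          · rw [if_neg h.ne, h₁ j h.ne, h₂ j h.ne]
            exact hdone j h
          · obtain rfl : j = M := by omega
            rw [if_pos rfl]
            have hE := (hF.enum c hc).congr fun p hp => (h₅ p hp).1
            exact ⟨hE, (hF.greedy c hc).congr (hF.enum c hc) (fun p hp => (h₅ p hp).1) hyM,
              hF.nonneg c hc⟩
        · simp [eM, ec, elam, hlc, sum_range_succ]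
          rw [sum_congr rfl fun j hj => if_neg (mem_range.1 hj).ne, ← hone]
          ring
        · intro v hv
          simp [eM, ec, elam, hlc, sum_range_succ]
          rw [sum_congr rfl fun j hj => by
            rw [if_neg (mem_range.1 hj).ne, h₂ j (mem_range.1 hj).ne],
            ← hcomb' v hv, hyM v hv]
          ring
    · intro hb
      simp [hcc, hlc] at hb
      have h0 : σ.real .lam c 0 = 0 := le_antisymm hb (hF.nonneg c hc)
      refine ⟨by simp, M, by simp [hM], by omega, ?_, ?_, ?_, ?_, ?_⟩
      · rw [range_add_one, filter_insert, if_neg (not_lt.2 hb), ← hcard]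
      · intro l hl
        simpa using hrest l (by omega)
      · simpa using hdone
      · simp only [Mem.setNat_real]
        rw [h0, zero_add] at hone
        exact hone
      · intro v hv
        have := hcomb' v hv
        rw [h0, zero_mul, zero_add] at this
        simpa using this
  · rintro σ' t ⟨M, hM, hMc, hcard, hrest, hdone, hone, hcomb⟩ hA ht
    rw [hM]
    refine ⟨hcard, ⟨fun i hi => (hdone i hi).1, fun i hi => (hdone i hi).2.1,
      fun i hi => (hdone i hi).2.2, by simpa using hone, fun v hv => ?_⟩, ?_⟩
    · rw [← hcomb v hv]; simp
    · have : m * (70 * k + 80 + 16) ≤ m * (70 * k + 100) := Nat.mul_le_mul_left _ (by omega)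
      simp at ht ⊢
      omega

/-- Only pivot columns keep a positive coefficient, and there are at most `k + 1` of them; so the
reduction brings the number of terms down to at most `n + 1`. -/
theorem wp_reduce {E : Env n f} {δ : ℝ} {zv : ℕ → ℝ} (hC : Core E δ zv σ)
    (hm : σ.nat .m 0 0 ≤ 2 * n + 1)
    (post : ∀ σ' t, Core E δ zv σ' → σ'.nat .m 0 0 ≤ n + 1 → Agree reduce σ σ' →
      t ≤ 10000 * n * n * n → Q σ' t) : wp f reduce σ Q := by
  have hn := E.pos
  have hkn := E.k_le
  suffices H : wp f reduce σ (fun σ' t =>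
      Family E.V E.g E.k (σ'.nat .m 0 0) (σ'.nat .L) (σ'.real .y) (σ'.real .lam) (σ.real .x) ∧
      σ'.nat .m 0 0 ≤ n + 1 ∧ t ≤ 10000 * n * n * n) by
    refine wp_mono H fun σ' t h hA => post σ' t ?_ h.2.1 hA h.2.2
    exact ⟨hC.holds.agree hA, by rw [hA.real .x rfl]; exact h.1,
      by rw [hA.real .phi rfl]; exact hC.flow,
      by rw [hA.real .phi rfl, hA.real .x rfl]; exact hC.z,
      by rw [hA.real .delta rfl]; exact hC.delta⟩
  set m := σ.nat .m 0 0 with hmdef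
  unfold reduce
  rw [wp_seq]
  refine wp_fillMatrix hmdef.symm hC.holds.k ?_
  intro σ₁ t₁ hI₁ hA₁ ht₁
  have em₁ : σ₁.nat .m 0 0 = m := by rw [hA₁.nat .m rfl]
  have ek₁ : σ₁.nat .k 0 0 = E.k := by rw [hA₁.nat .k rfl, hC.holds.k]
  rw [wp_seq, wp_nset, wp_seq]
  refine wp_forTo_zero m (fun c σ' =>
    Reduced E m c (σ.nat .L) (σ.real .y) (σ.real .x) σ') (2000 * n * n + 20) rfl
    (fun σ' hA => by simp [hA.nat .m rfl, em₁]) ?_ ?_ ?_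
  · refine ⟨⟨by simp, by simp, by simp, by simp, ?_⟩, ?_, by simp⟩
    · intro μ hμ
      simp only [Mem.setNat_real] at hμ
      refine ⟨fun v hv => ?_, ?_⟩
      · obtain ⟨p, hp, rfl⟩ := hC.holds.enum.surj v hv
        rw [← hμ p hp.le]
        exact sum_congr rfl fun l hl => by rw [(hI₁ l (mem_range.1 hl)).1 p hp]
      · rw [← hμ E.k le_rfl]
        exact sum_congr rfl fun l hl => by
          rw [(hI₁ l (mem_range.1 hl)).2, mul_one]
    · simp only [Mem.setNat_real, hA₁.real .lam rfl]
      exact hC.family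
  · intro c σ₂ hc hI hcc hA₂
    have em : σ₂.nat .m 0 0 = m := by rw [hA₂.nat .m rfl]; simp [em₁]
    have ek : σ₂.nat .k 0 0 = E.k := by rw [hA₂.nat .k rfl]; simp [ek₁]
    rw [← wp_seq_assoc]
    change wp f treatColumn σ₂ _
    refine wp_treatColumn hI ek em hcc hc hm ?_
    intro σ₃ t₃ hR hA₃ ht₃
    exact ⟨by omega, ⟨by simpa using hR.elim, by simpa using hR.family, by simpa using hR.zero⟩⟩
  intro σ₂ t₂ hR hA₂ ht₂
  have em₂ : σ₂.nat .m 0 0 = m := by rw [hA₂.nat .m rfl]; simp [em₁]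
  have ek₂ : σ₂.nat .k 0 0 = E.k := by rw [hA₂.nat .k rfl]; simp [ek₁]
  have eG₂ : σ₂.nat .G = σ.nat .G := by rw [hA₂.nat .G rfl]; simp [hA₁.nat .G rfl]
  have eL₂ : σ₂.nat .L = σ.nat .L := by rw [hA₂.nat .L rfl]; simp [hA₁.nat .L rfl]
  have ey₂ : σ₂.real .y = σ.real .y := by rw [hA₂.real .y rfl]; simp [hA₁.real .y rfl]
  simp only [wp_seq, wp_nset]
  refine wp_compact (V := E.V) (g := E.g) (k := E.k) (m := m) (x := σ.real .x) (by simp [ek₂])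
    (by simp [em₂]) (by simp) (by simpa [eG₂] using hC.holds.enum)
    (by simpa [eL₂, ey₂] using hR.family) ?_
  intro σ₃ t₃ M hM hcard hF hA₃ ht₃
  have hMk : M ≤ E.k + 1 := by
    rw [hcard]
    refine le_trans ?_ hR.elim.le
    have hsub : ((range m).filter fun l => 0 < σ₂.real .lam l 0) ⊆
        (range (σ₂.nat .rk 0 0)).image fun r => σ₂.nat .piv r 0 := by
      intro l hl
      rw [mem_filter, mem_range] at hl
      by_contra h
      refine hl.2.ne' (hR.zero l hl.1 fun r hr h' => h ?_)
      exact mem_image.2 ⟨r, mem_range.2 hr, h'⟩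
    exact (card_le_card hsub).trans (card_image_le.trans (by simp))
  refine ⟨by simpa [hM] using hF, by simp [hM]; omega, ?_⟩
  have h₁ : m * (60 * E.k + 60) ≤ 3 * n * (120 * n) := Nat.mul_le_mul (by omega) (by omega)
  have h₂ : m * (2000 * n * n + 20 + 16) ≤ 3 * n * (2036 * n * n) :=
    Nat.mul_le_mul (by omega) (by nlinarith)
  have h₃ : m * (70 * E.k + 100) ≤ 3 * n * (170 * n) := Nat.mul_le_mul (by omega) (by omega)
  have h₄ : n * n ≤ n * n * n := Nat.le_mul_of_pos_right _ hn
  have h₅ : n ≤ n * n := Nat.le_mul_self n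
  have e₁ : 3 * n * (120 * n) = 360 * (n * n) := by ring
  have e₂ : 3 * n * (2036 * n * n) = 6108 * (n * n * n) := by ring
  have e₃ : 3 * n * (170 * n) = 510 * (n * n) := by ring
  have e₄ : 10000 * n * n * n = 10000 * (n * n * n) := by ring
  simp at ht₁ ht₂ ht₃ ⊢
  omega

/-! ### Scaling phases -/

/-- Moving each value of the flow to the nearest value in `[-δ, δ]`. -/
theorem IsFlow.clip {V : Finset ℕ} {δ : ℝ} {φ φ' : ℕ → ℕ → ℝ} (h : IsFlow V (2 * δ) φ)
    (hδ : 0 ≤ δ) (hφ' : ∀ a ∈ V, ∀ b ∈ V, φ' a b = max (-δ) (min δ (φ a b))) :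
    IsFlow V δ φ' where
  skew a ha b hb := by
    rw [hφ' b hb a ha, hφ' a ha b hb, h.skew a ha b hb]
    rcases le_total δ (φ a b) with h₁ | h₁ <;> rcases le_total (φ a b) (-δ) with h₂ | h₂
    · rw [min_eq_left h₁, min_eq_right (by linarith), max_eq_right (by linarith),
        max_eq_left (by linarith)]
      linarith
    · rw [min_eq_left h₁, min_eq_right (by linarith), max_eq_left (by linarith),
        max_eq_right (by linarith)]
    · rw [min_eq_right h₁, min_eq_left (by linarith), max_eq_right (by linarith),
        max_eq_left (by linarith)]
      ring
    · rw [min_eq_right h₁, min_eq_right (by linarith), max_eq_right (by linarith),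
        max_eq_right (by linarith)]
  le a ha b hb := by
    rw [hφ' a ha b hb]
    exact max_le (by linarith) (min_le_left _ _)

/-- Halving the capacities costs at most `k ^ 2 * δ` of the negative part of `z`. -/
theorem negSum_clip {V : Finset ℕ} {δ : ℝ} {φ φ' : ℕ → ℕ → ℝ} {x z z' : ℕ → ℝ}
    (h : IsFlow V (2 * δ) φ) (hδ : 0 ≤ δ)
    (hφ' : ∀ a ∈ V, ∀ b ∈ V, φ' a b = max (-δ) (min δ (φ a b)))
    (hz : ∀ v ∈ V, z v = x v - net V φ v) (hz' : ∀ v ∈ V, z' v = x v - net V φ' v) :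
    negSum V z - V.card * (V.card * δ) ≤ negSum V z' := by
  refine negSum_sub_le fun v hv => ?_
  rw [hz v hv, hz' v hv]
  have : x v - net V φ v - (x v - net V φ' v) = ∑ a ∈ V, (φ' a v - φ a v) := by
    rw [sum_sub_distrib, net, net]; ring
  rw [this]
  refine (abs_sum_le_sum_abs _ _).trans ?_
  rw [← nsmul_eq_mul]
  refine sum_le_card_nsmul _ _ _ fun a ha => ?_
  have h₁ := h.le a ha v hv
  have h₂ := h.neg_le ha hv
  rw [hφ' a ha v hv, abs_le]
  rcases le_total δ (φ a v) with h₃ | h₃ <;> rcases le_total (φ a v) (-δ) with h₄ | h₄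
  · rw [min_eq_left h₃, max_eq_right (by linarith)]
    constructor <;> linarith
  · rw [min_eq_left h₃, max_eq_right (by linarith)]
    constructor <;> linarith
  · rw [min_eq_right h₃, max_eq_left (by linarith)]
    constructor <;> linarith
  · rw [min_eq_right h₃, max_eq_right (by linarith)]
    constructor <;> linarith

/-- A scaling phase: there are `O(k ^ 2)` augmentations, since by weak duality the negative part of `z`
is at most `k ^ 2 * δ` above the value of the set `W` with which the previous phase ended. -/
theorem wp_phase {E : Env n f} {δ : ℝ} {zv : ℕ → ℝ} (hC : Core E (2 * δ) zv σ) (hδ : 0 < δ)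
    (hm : σ.nat .m 0 0 ≤ n + 1)
    (hW : ∃ W ⊆ E.V, E.g W - E.k * (2 * δ) ≤ negSum E.V zv) :
    wp f phase σ (fun σ' t => (∃ zv', Core E δ zv' σ' ∧ σ'.nat .m 0 0 ≤ n + 1 ∧
      ∃ W ⊆ E.V, E.g W - E.k * δ ≤ negSum E.V zv') ∧ t ≤ 320000 * n ^ 5) := by
  have hn := E.pos
  have hkn := E.k_le
  obtain ⟨W₀, hW₀, hgW₀⟩ := hW
  unfold phase
  simp only [wp_seq, wp_rset, wp_nset]
  refine wp_clip (δ := δ) (by simp [hC.delta]) hδ.le ?_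
  intro σ₁ t₁ hφ hA₁ ht₁
  have hφ₁ : ∀ a ∈ E.V, ∀ b ∈ E.V, σ₁.real .phi a b = max (-δ) (min δ (σ.real .phi a b)) := by
    intro a ha b hb
    rw [hφ a (E.lt a ha) b (E.lt b hb)]
    simp
  set zv₁ : ℕ → ℝ := fun v => σ.real .x v 0 - net E.V (σ₁.real .phi) v with hzv₁
  have eR₁ : ∀ a, a ≠ .delta → a ≠ .phi → σ₁.real a = σ.real a := by
    intro a h₁ h₂
    rw [hA₁.real a (by simp [clip, forTo, when, Cmd.writesReal, h₂])]
    simp [h₁]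
  have hC₁ : Core E δ zv₁ σ₁ := by
    refine ⟨hC.holds.congr (hA₁.nat _ rfl) (hA₁.nat _ rfl) (hA₁.nat _ rfl) (hA₁.nat _ rfl)
      (eR₁ _ (by simp) (by simp)) (eR₁ _ (by simp) (by simp)), ?_, hC.flow.clip hδ.le hφ₁, ?_, ?_⟩
    · rw [hA₁.nat .m rfl, hA₁.nat .L rfl, eR₁ .y (by simp) (by simp), eR₁ .lam (by simp) (by simp),
        eR₁ .x (by simp) (by simp)]
      exact hC.family
    · intro v hv
      rw [eR₁ .x (by simp) (by simp)]
    · rw [hA₁.real .delta rfl]; simp [hC.delta]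
  have hm₁ : σ₁.nat .m 0 0 ≤ n + 1 := by rw [hA₁.nat .m rfl]; exact hm
  have hstart : E.g W₀ - E.k * (2 * δ) - E.k * (E.k * δ) ≤ negSum E.V zv₁ := by
    have := negSum_clip hC.flow hδ.le hφ₁ hC.z (z' := zv₁) fun v _ => rfl
    rw [E.card] at this
    linarith
  have hn5 : n * n ≤ n ^ 5 := by
    rw [← sq]; exact Nat.pow_le_pow_right hn (by norm_num)
  have hnn : n ≤ n * n := Nat.le_mul_self n
  have hkk : E.k * E.k ≤ n * n := Nat.mul_le_mul hkn hkn
  have hnnn : n * n ≤ n * n * n := Nat.le_mul_of_pos_right _ hn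
  -- Each augmentation raises the negative part of `z` by `δ`. It starts at least `2 * k * δ + k ^ 2 * δ`
  -- below `E.g W₀` and ends at most `k ^ 2 * δ` above it, hence the number of rounds.
  refine wp_loop (fun σ' τ => ∃ zv', Core E δ zv' σ' ∧ σ'.nat .m 0 0 ≤ n + 1 ∧
    ((σ'.nat .run 0 0 = 1 ∧ ∃ j : ℕ,
      E.g W₀ - E.k * (2 * δ) - E.k * (E.k * δ) + j * δ ≤ negSum E.V zv' ∧
        τ = (2 * (E.k * E.k) + 2 * E.k + 1 - j) * (60000 * n * n * n)) ∨
      (σ'.nat .run 0 0 = 0 ∧ ∃ W ⊆ E.V, E.g W - E.k * δ ≤ negSum E.V zv')))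
    ((2 * (E.k * E.k) + 2 * E.k + 1) * (60000 * n * n * n)) ?_ ?_ ?_
  · refine ⟨zv₁, ?_, by simpa using hm₁, Or.inl ⟨by simp, 0, by simpa using hstart, by simp⟩⟩
    exact hC₁.congr (by rintro a (rfl | rfl | rfl | rfl | rfl | rfl) <;> simp) (by simp)
  · rintro σ₂ τ ⟨zv₂, hC₂, hm₂, h | h⟩ hA₂ hb
    swap
    · simp [h.1] at hb
    obtain ⟨hrun, j, hj, rfl⟩ := h
    have hbase := hC₂.family.isBase E.submodOn E.g_empty
    have hjle : j ≤ 2 * (E.k * E.k) + 2 * E.k := by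
      have h₁ := negSum_le hC₂.flow hδ.le hbase hC₂.z hW₀
      rw [E.card] at h₁
      have h₂ : (j : ℝ) * δ ≤ (2 * (E.k * E.k) + 2 * E.k) * δ := by linarith
      exact_mod_cast le_of_mul_le_mul_right h₂ hδ
    have hcredit : (2 * (E.k * E.k) + 2 * E.k + 1 - (j + 1)) * (60000 * n * n * n) +
        60000 * (n * n * n) = (2 * (E.k * E.k) + 2 * E.k + 1 - j) * (60000 * n * n * n) := by
      rw [show 2 * (E.k * E.k) + 2 * E.k + 1 - j =
        2 * (E.k * E.k) + 2 * E.k + 1 - (j + 1) + 1 by omega]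
      ring
    rw [wp_seq]
    refine wp_computeZ hC₂.holds.k hC₂.holds.enum hkn hC₂.delta ?_
    intro σ₃ t₃ hz hs hT hA₃ ht₃
    have hC₃ : Core E δ zv₂ σ₃ := hC₂.agree hA₃
    have hz₃ : ∀ v ∈ E.V, σ₃.real .z v 0 = zv₂ v := fun v hv => by rw [hz v hv, hC₂.z v hv]
    have hm₃ : σ₃.nat .m 0 0 ≤ n + 1 := by rw [hA₃.nat .m rfl]; exact hm₂
    refine wp_cond ?_ ?_
    · intro hb₃
      simp only [BExp.eval, NExp.eval, NExp.eval_ofNat] at hb₃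
      rw [wp_nset]
      refine ⟨0, ⟨zv₂, ?_, by simpa using hm₃, Or.inr ⟨by simp, ?_⟩⟩, ?_⟩
      · exact hC₃.congr (by rintro a (rfl | rfl | rfl | rfl | rfl | rfl) <;> simp) (by simp)
      · rcases hb₃ with h | h
        · refine ⟨∅, empty_subset _, ?_⟩
          rw [← E.card]
          refine le_negSum_of_cut (x := fun v => σ₂.real .x v 0) hC₂.flow hδ.le
            (empty_subset _) (by simp [E.g_empty]) hC₂.z (by simp) ?_ (by simp)
          intro v hv _
          rw [← hz₃ v hv]
          exact hs.1 h v hv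
        · refine ⟨E.V, subset_rfl, ?_⟩
          rw [← E.card]
          refine le_negSum_of_cut (x := fun v => σ₂.real .x v 0) hC₂.flow hδ.le
            subset_rfl hbase.eq hC₂.z ?_ (fun v hv h => absurd hv h) (fun a _ b hb h => absurd hb h)
          intro v hv
          rw [← hz₃ v hv]
          exact hT.1 h v hv
      · simp [mul_assoc] at ht₃ hcredit hnnn ⊢
        omega
    · intro hb₃
      rw [wp_seq]
      refine wp_mono (wp_search hC₃ hδ hz₃ hm₃) ?_
      rintro σ₄ t₄ ⟨hC₄, hm₄, hres, ht₄⟩ hA₄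
      rw [wp_seq]
      refine wp_cond ?_ ?_
      · intro hb₄
        simp at hb₄
        have hR : Reached E.V δ σ₄ := by
          rcases hres with h | h
          · exact h.2
          · omega
        have hz₄ : ∀ v ∈ E.V, σ₄.real .z v 0 = zv₂ v := by rw [hA₄.real .z rfl]; exact hz₃
        refine wp_mono (wp_augment hC₄.delta hδ hC₄.flow hR hb₄) ?_
        rintro σ₅ t₅ ⟨hF₅, ⟨s, hsV, hzs, r, hrV, hzr, hnet⟩, ht₅⟩ hA₅
        set zv₅ : ℕ → ℝ := fun v => zv₂ v + (if v = s then δ else 0) - (if v = r then δ else 0)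
          with hzv₅
        have hC₅ : Core E δ zv₅ σ₅ := by
          refine ⟨hC₄.holds.agree hA₅, ?_, hF₅, ?_, by rw [hA₅.real .delta rfl]; exact hC₄.delta⟩
          · rw [hA₅.nat .m rfl, hA₅.nat .L rfl, hA₅.real .y rfl, hA₅.real .lam rfl, hA₅.real .x rfl]
            exact hC₄.family
          · intro v hv
            rw [hA₅.real .x rfl, hnet v, hzv₅]
            simp only [hC₄.z v hv]
            ring
        have haug := negSum_augment (V := E.V) (z := zv₂) (z' := zv₅) hδ.le hsV
          (by rw [← hz₄ s hsV]; exact hzs) (by rw [← hz₄ r hrV]; exact hzr) fun v _ => rfl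
        refine wp_reduce hC₅ (by rw [hA₅.nat .m rfl]; exact hm₄) ?_
        intro σ₆ t₆ hC₆ hm₆ hA₆ ht₆
        refine ⟨_, ⟨zv₅, hC₆, hm₆, Or.inl ⟨?_, j + 1, ?_, rfl⟩⟩, ?_⟩
        · rw [hA₆.nat .run rfl, hA₅.nat .run rfl, hA₄.nat .run rfl, hA₃.nat .run rfl, hrun]
        · push_cast
          linarith
        · rw [E.card] at ht₅
          simp [mul_assoc] at ht₃ ht₄ ht₅ ht₆ hcredit hnnn ⊢
          omega
      · intro hb₄
        simp at hb₄
        have hcut : ∃ W ⊆ E.V, E.g W - E.k * δ ≤ negSum E.V zv₂ := by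
          rcases hres with h | h
          · exact absurd h.1 hb₄
          · exact h.2
        rw [wp_nset]
        refine wp_reduce (E := E) (δ := δ) (zv := zv₂) (hC₄.congr
          (by rintro a (rfl | rfl | rfl | rfl | rfl | rfl) <;> simp) (by simp))
          (by simpa using hm₄) ?_
        intro σ₆ t₆ hC₆ hm₆ hA₆ ht₆
        refine ⟨0, ⟨zv₂, hC₆, hm₆, Or.inr ⟨?_, hcut⟩⟩, ?_⟩
        · rw [hA₆.nat .run rfl]; simp
        · simp [mul_assoc] at ht₃ ht₄ ht₆ hcredit hnnn ⊢
          omega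
  · rintro σ₂ τ t₂ ⟨zv₂, hC₂, hm₂, h | h⟩ hA₂ hb ht₂
    · simp [h.1] at hb
    refine ⟨⟨zv₂, hC₂, hm₂, h.2⟩, ?_⟩
    have h₁ : (2 * (E.k * E.k) + 2 * E.k + 1) * (60000 * n * n * n) ≤
        5 * (n * n) * (60000 * n * n * n) := Nat.mul_le_mul_right _ (by omega)
    have h₂ : 5 * (n * n) * (60000 * n * n * n) = 300000 * n ^ 5 := by ring
    simp [mul_assoc] at ht₁ ht₂ h₁ h₂ ⊢
    omega

/-! ### The procedure `fix` -/

theorem Enum.snoc {k : ℕ} {L L' : ℕ → ℕ} {V : Finset ℕ} (h : Enum k L V) {v : ℕ} (hv : v ∉ V)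
    (hL : ∀ p < k, L' p = L p) (hk : L' k = v) : Enum (k + 1) L' (insert v V) where
  mem p hp := by
    rcases Nat.lt_or_ge p k with h' | h'
    · rw [hL p h']; exact mem_insert_of_mem (h.mem p h')
    · rw [show p = k by omega, hk]; exact mem_insert_self _ _
  inj p q hp hq hpq := by
    rcases Nat.lt_or_ge p k with h₁ | h₁ <;> rcases Nat.lt_or_ge q k with h₂ | h₂
    · rw [hL p h₁, hL q h₂] at hpq; exact h.inj p q h₁ h₂ hpq
    · rw [hL p h₁, show q = k by omega, hk] at hpq
      exact absurd (hpq ▸ h.mem p h₁) hv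
    · rw [hL q h₂, show p = k by omega, hk] at hpq
      exact absurd (hpq ▸ h.mem q h₂) hv
    · omega
  surj w hw := by
    rcases mem_insert.1 hw with rfl | hw
    · exact ⟨k, Nat.lt_succ_self k, hk⟩
    · obtain ⟨p, hp, rfl⟩ := h.surj w hw
      exact ⟨p, by omega, hL p hp⟩

/-- Ordering the vertices by the number of vertices they reach; in an acyclic digraph this is a
consistent ordering. -/
theorem wp_consistentOrder {V : Finset ℕ} (hV : ∀ v ∈ V, v < n)
    (hsel : ∀ v < n, σ.nat .sel v 0 = if v ∈ V then 1 else 0)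
    (hR01 : ∀ v < n, ∀ b < n, σ.nat .R v b ≤ 1) (hRv : ∀ v ∈ V, σ.nat .R v v = 1) :
    wp f consistentOrder σ (fun σ' t =>
      σ'.nat .k 0 0 = V.card ∧
      Enum V.card (fun p => σ'.nat .G p 0) V ∧
      (∀ p q, p < q → q < V.card →
        ∑ b ∈ range n, σ.nat .R (σ'.nat .G p 0) b ≤
          ∑ b ∈ range n, σ.nat .R (σ'.nat .G q 0) b) ∧
      t ≤ 200 * n * n + 200 * n + 100) := by
  set N : ℕ → ℕ := fun v => ∑ b ∈ range n, σ.nat .R v b with hN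
  have hNle : ∀ v ∈ V, 1 ≤ N v ∧ N v ≤ n := by
    intro v hv
    constructor
    · rw [← hRv v hv]
      exact single_le_sum (f := fun b => σ.nat .R v b) (fun _ _ => Nat.zero_le _)
        (mem_range.2 (hV v hv))
    · have : N v ≤ ∑ b ∈ range n, 1 :=
        sum_le_sum fun b hb => hR01 v (hV v hv) b (mem_range.1 hb)
      simpa using this
  unfold consistentOrder
  rw [wp_seq]
  refine wp_forTo_zero n (fun v' σ' => ∀ v < v', σ'.nat .num v 0 = N v) (40 * n + 30) rfl
    (fun _ _ => rfl) (by simp) ?_ ?_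
  · intro v σ' hv hI hvv hA
    rw [wp_seq, wp_nset]
    refine wp_forTo_zero n (fun b' σ'' => (∀ a, a ≠ v → σ''.nat .num a 0 = σ'.nat .num a 0) ∧
      σ''.nat .num v 0 = ∑ b ∈ range b', σ.nat .R v b) 20 rfl (fun _ _ => rfl) ?_ ?_ ?_
    · simp [hvv]
      intro a h h'
      exact absurd h' h
    · rintro b σ'' hb ⟨h₁, h₂⟩ hbb hA'
      have ev : σ''.nat .v 0 0 = v := by rw [hA'.nat .v rfl]; simp [hvv]
      have eR : σ''.nat .R = σ.nat .R := by rw [hA'.nat .R rfl]; simp [hA.nat .R rfl]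
      rw [wp_nset]
      refine ⟨by simp, ?_, ?_⟩
      · intro a ha
        simp [ev, ha, h₁ a ha]
      · simp [ev, h₂, hbb, eR, sum_range_succ]
    · rintro σ'' t ⟨h₁, h₂⟩ hA' ht
      refine ⟨by simp at ht ⊢; omega, ?_⟩
      intro a ha
      simp
      by_cases h : a = v
      · rw [h, h₂]
      · rw [h₁ a h]; exact hI a (by omega)
  intro σ₁ t₁ hI₁ hA₁ ht₁
  have eR : σ₁.nat .R = σ.nat .R := hA₁.nat .R rfl
  have es : σ₁.nat .sel = σ.nat .sel := hA₁.nat .sel rfl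
  rw [wp_seq, wp_nset]
  set S : ℕ → ℕ → Finset ℕ := fun l v => V.filter fun w => N w < l ∨ (N w = l ∧ w < v) with hS
  set P : ℕ → ℕ → Mem → Prop := fun l v σ' => ∃ K, σ'.nat .k 0 0 = K ∧
    Enum K (fun p => σ'.nat .G p 0) (S l v) ∧
    ∀ p q, p < q → q < K → N (σ'.nat .G p 0) ≤ N (σ'.nat .G q 0) with hP
  refine wp_forTo (n + 1) (fun l => P l 0) (fun _ => 80 * n + 20) rfl (by simp)
    (fun _ _ => rfl) ?_ ?_ ?_
  · have : S 1 0 = ∅ := by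
      refine filter_eq_empty_iff.2 fun w hw => ?_
      have := hNle w hw
      omega
    refine ⟨0, by simp, ?_, fun p q _ h => absurd h (Nat.not_lt_zero q)⟩
    simp only [NExp.eval, NExp.eval_ofNat, this]
    exact ⟨fun p h => absurd h (Nat.not_lt_zero p), fun p q h => absurd h (Nat.not_lt_zero p),
      fun v h => absurd h (notMem_empty v)⟩
  · intro l σ₂ hl hln hI₂ hll hA₂
    refine wp_forTo_zero n (fun v => P l v) 60 rfl (fun _ _ => rfl) ?_ ?_ ?_
    · simpa [hP] using hI₂
    · rintro v σ₃ hv ⟨K, hK, hE, hsort⟩ hvv hA₃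
      have el : σ₃.nat .l 0 0 = l := by rw [hA₃.nat .l rfl]; simp [hll]
      have es₃ : σ₃.nat .sel = σ.nat .sel := by
        rw [hA₃.nat .sel rfl, hA₂.nat .sel rfl, Mem.setNat_nat_of_ne _ (by simp), es]
      have eN₃ : σ₃.nat .num v 0 = N v := by
        rw [hA₃.nat .num rfl, hA₂.nat .num rfl, Mem.setNat_nat_of_ne _ (by simp)]
        exact hI₁ v hv
      refine wp_when ?_ ?_
      · intro hb
        simp [hvv, es₃, hsel v hv, el, eN₃] at hb
        simp only [wp_seq, wp_nset]
        refine ⟨by simp, K + 1, by simp [hK], ?_, ?_⟩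
        · have hins : S l (v + 1) = insert v (S l v) := by
            ext w
            simp only [hS, mem_filter, mem_insert]
            constructor
            · rintro ⟨h₁, h₂ | ⟨h₂, h₃⟩⟩
              · exact Or.inr ⟨h₁, Or.inl h₂⟩
              · by_cases hwv : w = v
                · exact Or.inl hwv
                · exact Or.inr ⟨h₁, Or.inr ⟨h₂, by omega⟩⟩
            · rintro (rfl | ⟨h₁, h₂⟩)
              · exact ⟨hb.1, Or.inr ⟨hb.2, by omega⟩⟩
              · exact ⟨h₁, by omega⟩
          rw [hins]
          refine hE.snoc (by simp [hS, hb.2]) ?_ (by simp [hK, hvv])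
          intro p hp
          simp [hK, hp.ne]
        · intro p q hpq hq
          simp [hK, hvv]
          rw [if_neg (by omega)]
          split_ifs with h
          · have := hE.mem p (by omega)
            simp only [hS, mem_filter] at this
            omega
          · exact hsort p q hpq (by omega)
      · intro hb
        simp [hvv, es₃, hsel v hv, el, eN₃] at hb
        refine ⟨by simp, K, by simp [hK], ?_, by simpa using hsort⟩
        have hins : S l (v + 1) = S l v := by
          refine filter_congr fun w hw => ?_
          by_cases hwv : w = v
          · subst hwv
            have := hb hw
            omega
          · omega
        rw [hins]
        simpa using hE
    · rintro σ₃ t₃ ⟨K, hK, hE, hsort⟩ hA₃ ht₃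
      refine ⟨by simp at ht₃ ⊢; omega, K, by simp [hK], ?_, by simpa using hsort⟩
      have hnext : S (l + 1) 0 = S l n := by
        refine filter_congr fun w hw => ?_
        have := hV w hw
        omega
      rw [hnext]
      simpa using hE
  · rintro σ₂ t₂ ⟨K, hK, hE, hsort⟩ hA₂ ht₂
    have hall : S (n + 1) 0 = V := by
      refine filter_true_of_mem fun w hw => ?_
      have := hNle w hw
      omega
    rw [hall] at hE
    obtain rfl : K = V.card := hE.card.symm
    refine ⟨hK, hE, hsort, ?_⟩
    have h₁ : n * (40 * n + 30 + 14) = 40 * (n * n) + 44 * n := by ring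
    have h₂ : n * (80 * n + 20 + 16) = 80 * (n * n) + 36 * n := by ring
    simp [mul_assoc] at ht₁ ht₂ h₁ h₂ ⊢
    omega

/-- The greedy algorithm for the function handed to `fix`. -/
theorem wp_greedy {E : Env n f} (hH : E.Holds σ) (hfb : σ.set n .fb = E.B)
    (post : ∀ σ' t, σ'.nat .m 0 0 = 1 →
      Family E.V E.g E.k 1 (σ'.nat .L) (σ'.real .y) (σ'.real .lam) (σ'.real .x) →
      Greedy E.g E.k (fun p => σ.nat .G p 0) (fun v => σ'.real .x v 0) → Agree greedy σ σ' →
      t ≤ 100 * n * n + 400 * n + 200 → Q σ' t) : wp f greedy σ Q := by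
  have hkn := E.k_le
  have hEn := hH.enum
  set M : ℕ → ℕ := fun p => σ.nat .G p 0 with hM
  suffices H : wp f greedy σ (fun σ' t => σ'.nat .m 0 0 = 1 ∧ σ'.real .lam 0 0 = 1 ∧
      (∀ r < E.k, σ'.nat .L 0 r = M r ∧ σ'.real .y 0 (M r) = σ'.real .x (M r) 0 ∧
        σ'.real .x (M r) 0 = E.g (pre M (r + 1)) - E.g (pre M r)) ∧
      t ≤ 100 * n * n + 400 * n + 200) by
    refine wp_mono H ?_
    rintro σ' t ⟨h₁, h₂, h₃, ht⟩ hA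
    have hxy : ∀ v ∈ E.V, σ'.real .y 0 v = σ'.real .x v 0 := by
      intro v hv
      obtain ⟨p, hp, rfl⟩ := hEn.surj v hv
      exact (h₃ p hp).2.1
    have hgr : Greedy E.g E.k M (fun v => σ'.real .x v 0) := fun p hp => (h₃ p hp).2.2
    refine post σ' t h₁ ?_ hgr hA ht
    refine ⟨?_, ?_, ?_, by simp [h₂], ?_⟩
    · intro i hi
      obtain rfl : i = 0 := by omega
      exact hEn.congr fun p hp => (h₃ p hp).1
    · intro i hi
      obtain rfl : i = 0 := by omega
      exact hgr.congr hEn (fun p hp => (h₃ p hp).1) hxy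
    · intro i hi
      obtain rfl : i = 0 := by omega
      rw [h₂]; exact zero_le_one
    · intro v hv
      simp [h₂, hxy v hv]
  unfold greedy
  rw [wp_seq]
  refine wp_mono (wp_load (by simp) (by simp) (by simp)) ?_
  rintro σ₁ t₁ ⟨hQ₁, ht₁⟩ hA₁
  rw [hfb] at hQ₁
  have hH₁ : E.Holds σ₁ := hH.agree hA₁
  have hG₁ : σ₁.nat .G = σ.nat .G := hA₁.nat .G rfl
  rw [wp_seq, wp_rset, wp_seq]
  refine wp_forTo_zero E.k (fun p σ' => QRep σ' (E.set (pre M p)) ∧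
    σ'.real .prev 0 0 = E.g (pre M p) ∧
    ∀ r < p, σ'.nat .L 0 r = M r ∧ σ'.real .y 0 (M r) = σ'.real .x (M r) 0 ∧
      σ'.real .x (M r) 0 = E.g (pre M (r + 1)) - E.g (pre M r)) (60 * n + 200) rfl
    (fun σ' hA => by simp [hA.nat .k rfl, hH₁.k]) ?_ ?_ ?_
  · have h0 : pre M 0 = ∅ := by simp [pre]
    rw [h0, E.set_empty, E.g_empty]
    exact ⟨hQ₁.congr (by simp) (by simp), by simp, fun r hr => absurd hr (Nat.not_lt_zero r)⟩
  · rintro p σ₂ hp ⟨hQ₂, hprev, hI⟩ hpp hA₂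
    have hH₂ : E.Holds σ₂ := by
      refine hH₁.congr ?_ ?_ ?_ ?_ ?_ ?_
      · rw [hA₂.nat .k rfl]; simp
      · rw [hA₂.nat .G rfl]; simp
      · rw [hA₂.nat .start rfl]; simp
      · rw [hA₂.nat .mem rfl]; simp
      · rw [hA₂.real .top rfl]; simp
      · rw [hA₂.real .sub rfl]; simp
    have hG₂ : σ₂.nat .G p 0 = M p := by rw [hA₂.nat .G rfl]; simp [hG₁, hM]
    have hvV : M p ∈ E.V := hEn.mem p hp
    rw [wp_seq, wp_nset]
    simp only [NExp.eval, NExp.eval_ofNat, hpp, hG₂]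
    rw [wp_seq]
    refine wp_insertClass (w := M p) (fun σ' hA => by simp [hA.nat .vv rfl]) (by simp)
      (by simpa using hH₂.listing) (E.lt _ hvV) (hQ₂.congr (by simp) (by simp))
      (E.disjoint_set (hEn.pre_subset hp.le) hvV (hEn.notMem_pre hp le_rfl)) ?_
    intro σ₃ t₃ hQ₃ hA₃ ht₃
    rw [← E.set_insert, ← pre_succ] at hQ₃
    have eR : σ₃.real = σ₂.real := by ext a r c; rw [hA₃.real a rfl]; simp
    have evv : σ₃.nat .vv 0 0 = M p := by rw [hA₃.nat .vv rfl]; simp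
    have ep : σ₃.nat .p 0 0 = p := by rw [hA₃.nat .p rfl]; simp [hpp]
    have eL : σ₃.nat .L = σ₂.nat .L := by rw [hA₃.nat .L rfl]; simp
    rw [wp_seq]
    refine wp_evalQ (fh := E.fh) hQ₃ E.fh_eq (by rw [eR]; exact hH₂.full) (by simp) ?_
    intro t₄ ht₄
    rw [eR, hH₂.sub]
    change wp f _ (σ₃.setReal .r₁ 0 0 (E.g (pre M (p + 1)))) _
    simp only [wp_seq, wp_rset, wp_nset]
    refine ⟨?_, ?_, ?_, ?_⟩
    · have := card_le_univ (E.Cl (M p))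
      simp at this ⊢
      omega
    · exact hQ₃.congr (by simp) (by simp)
    · simp
    · intro r hr
      simp [evv, ep, eL, eR, hprev]
      rcases Nat.lt_or_ge r p with h | h
      · have hne : M r ≠ M p := fun h' => absurd (hEn.inj r p (by omega) hp h') h.ne
        simp [hne, h.ne]
        exact hI r h
      · obtain rfl : r = p := by omega
        simp
  · rintro σ₂ t₂ ⟨hQ₂, hprev, hI⟩ hA₂ ht₂
    simp only [wp_seq, wp_rset, wp_nset]
    refine ⟨by simp, by simp, by simpa using hI, ?_⟩
    have h₁ : E.k * (60 * n + 200 + 16) ≤ n * (60 * n + 200 + 16) := Nat.mul_le_mul_right _ hkn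
    have h₂ : n * (60 * n + 200 + 16) = 60 * (n * n) + 216 * n := by ring
    have h₃ : 100 * n * n = 100 * (n * n) := by ring
    simp at ht₁ ht₂ ⊢
    omega

/-- `fix` finds an element of all minimizers of a set function with a minimum of at most
`-η / 2`, if all marginals at sets that are consistent with the digraph are at most `η`. -/
theorem wp_fix {E : Env n f} {η : ℝ} (hη : 0 < η) (heta : σ.real .eta 0 0 = η)
    (hsel : ∀ v < n, σ.nat .sel v 0 = if v ∈ E.V then 1 else 0)
    (hfb : σ.set n .fb = E.B) (hlist : Listing (σ.nat .start) (σ.nat .mem) E.Cl)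
    (hfull : σ.real .top 0 0 + σ.real .sub 0 0 = E.fh univ)
    (hsub : σ.real .sub 0 0 = E.fh E.B)
    (hR01 : ∀ v < n, ∀ b < n, σ.nat .R v b ≤ 1) (hRv : ∀ v ∈ E.V, σ.nat .R v v = 1)
    (htrans : ∀ a ∈ E.V, ∀ b ∈ E.V, σ.nat .R a b = 1 → ∀ c < n, σ.nat .R b c = 1 →
      σ.nat .R a c = 1)
    (hanti : ∀ a ∈ E.V, ∀ b ∈ E.V, σ.nat .R a b = 1 → σ.nat .R b a = 1 → a = b)
    (hmarg : ∀ v ∈ E.V, ∀ Y ⊆ E.V, (∀ b ∈ E.V, σ.nat .R v b = 1 → b ≠ v → b ∈ Y) → v ∉ Y →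
      E.g (insert v Y) - E.g Y ≤ η)
    (hmin : ∃ Y ⊆ E.V, E.g Y ≤ -(η / 2)) :
    wp f fix σ (fun σ' t => σ'.nat .w 0 0 ∈ E.V ∧
      (∀ Y ⊆ E.V, (∀ Z ⊆ E.V, E.g Y ≤ E.g Z) → σ'.nat .w 0 0 ∈ Y) ∧
      t ≤ 1000000 * n ^ 5 * (3 * Nat.log 2 n + 5)) := by
  have hn := E.pos
  have hkn := E.k_le
  have hk0 : 0 < E.k := by
    rcases Nat.eq_zero_or_pos E.k with h | h
    · obtain ⟨Y, hY, hgY⟩ := hmin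
      rw [← E.card, card_eq_zero] at h
      rw [h, subset_empty] at hY
      rw [hY, E.g_empty] at hgY
      linarith
    · exact h
  have hk1 : (1 : ℝ) ≤ E.k := by exact_mod_cast hk0
  unfold fix
  rw [wp_seq]
  refine wp_mono (wp_consistentOrder E.lt hsel hR01 hRv) ?_
  rintro σ₁ t₁ ⟨hk₁, hG₁, hsort, ht₁⟩ hA₁
  rw [E.card] at hk₁ hG₁ hsort
  have hH₁ : E.Holds σ₁ := ⟨hk₁, hG₁, by rw [hA₁.nat .start rfl, hA₁.nat .mem rfl]; exact hlist,
    by rw [hA₁.real .top rfl, hA₁.real .sub rfl]; exact hfull,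
    by rw [hA₁.real .sub rfl]; exact hsub⟩
  rw [wp_seq]
  refine wp_greedy hH₁ (by rw [Mem.set_congr (hA₁.nat .fb rfl)]; exact hfb) ?_
  intro σ₂ t₂ hm₂ hF₂ hgr hA₂ ht₂
  have hH₂ : E.Holds σ₂ := hH₁.agree hA₂
  set M : ℕ → ℕ := fun p => σ₁.nat .G p 0 with hM
  have hx : ∀ v ∈ E.V, σ₂.real .x v 0 ≤ η := by
    intro v hv
    obtain ⟨p, hp, rfl⟩ := hG₁.surj v hv
    have h₁ := hgr p hp
    have h₁' : σ₂.real .x (M p) 0 = E.g (pre M (p + 1)) - E.g (pre M p) := h₁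
    rw [h₁', pre_succ]
    refine hmarg (M p) hv _ (hG₁.pre_subset hp.le) ?_ (hG₁.notMem_pre hp le_rfl)
    intro b hb hvb hne
    obtain ⟨q, hq, rfl⟩ := hG₁.surj b hb
    rw [mem_pre]
    refine ⟨q, ?_, rfl⟩
    by_contra hqp
    have hpq : p < q := by
      rcases Nat.lt_or_ge p q with h | h
      · exact h
      · exact absurd (show M q = M p by rw [show q = p by omega]) hne
    -- A vertex reachable from another one reaches fewer vertices.
    refine absurd (hsort p q hpq hq) (not_le.2 ?_)
    refine sum_lt_sum ?_ ⟨M p, mem_range.2 (E.lt _ hv), ?_⟩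
    · intro c hc
      have hc := mem_range.1 hc
      have h01 := hR01 (M q) (E.lt _ hb) c hc
      rcases Nat.eq_zero_or_pos (σ.nat .R (M q) c) with h | h
      · change σ.nat .R (M q) c ≤ σ.nat .R (M p) c
        omega
      · have h₂ : σ.nat .R (M q) c = 1 := by omega
        have h₃ : σ.nat .R (M p) c = 1 := htrans _ hv _ hb hvb c hc h₂
        exact (h₂.trans h₃.symm).le
    · have h₂ : σ.nat .R (M p) (M p) = 1 := hRv _ hv
      have h01 := hR01 (M q) (E.lt _ hb) (M p) (E.lt _ hv)
      have h₃ : σ.nat .R (M q) (M p) ≠ 1 := fun h => hne (hanti _ hv _ hb hvb h).symm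
      change σ.nat .R (M q) (M p) < σ.nat .R (M p) (M p)
      omega
  rw [wp_seq]
  refine wp_forTo_forTo (fun a b σ' => (∀ a' < a, ∀ b' < n, σ'.real .phi a' b' = 0) ∧
    ∀ b' < b, σ'.real .phi a b' = 0) 10 (by simp) rfl rfl (by simp) (by simp) ?_ ?_ ?_
  · rintro a b σ' ha hb ⟨h₁, h₂⟩ haa hbb hA
    rw [wp_rset]
    refine ⟨by simp, ?_, ?_⟩
    · intro a' ha' b' hb'
      simp [haa, hbb, ha'.ne, h₁ a' ha' b' hb']
    · intro b' hb'
      simp [haa, hbb]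
      intro hne
      exact h₂ b' (by omega)
  · rintro a σ' ha ⟨h₁, h₂⟩
    refine ⟨fun a' ha' b' hb' => ?_, fun b' hb' => absurd hb' (Nat.not_lt_zero _)⟩
    rcases Nat.lt_or_ge a' a with h | h
    · exact h₁ a' h b' hb'
    · rw [show a' = a by omega]; exact h₂ b' hb'
  rintro σ₃ t₃ ⟨hφ, -⟩ hA₃ ht₃
  have hφV : ∀ a ∈ E.V, ∀ b ∈ E.V, σ₃.real .phi a b = 0 := fun a ha b hb =>
    hφ a (E.lt a ha) b (E.lt b hb)
  have hC₃ : Core E η (fun v => σ₂.real .x v 0) (σ₃.setReal .delta 0 0 η) := by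
    refine ⟨(hH₂.agree hA₃).congr (by simp) (by simp) (by simp) (by simp) (by simp) (by simp),
      ?_, ?_, ?_, by simp⟩
    · simp only [Mem.setReal_nat, Mem.setReal_real_of_ne, ne_eq, reduceCtorEq, not_false_eq_true]
      rw [hA₃.nat .m rfl, hA₃.nat .L rfl, hA₃.real .y rfl, hA₃.real .lam rfl, hA₃.real .x rfl, hm₂]
      exact hF₂
    · refine ⟨fun a ha b hb => ?_, fun a ha b hb => ?_⟩
      · simp [hφV a ha b hb, hφV b hb a ha]
      · simpa [hφV a ha b hb] using hη.le
    · intro v hv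
      have : net E.V (σ₃.real .phi) v = 0 := sum_eq_zero fun a ha => hφV a ha v hv
      simp [this, hA₃.real .x rfl]
  have heta₃ : σ₃.real .eta 0 0 = η := by
    rw [hA₃.real .eta rfl, hA₂.real .eta rfl, hA₁.real .eta rfl, heta]
  have hbase₂ := hF₂.isBase E.submodOn E.g_empty
  simp only [wp_seq, wp_rset]
  have hσ₃ : σ₃.setReal .delta 0 0 η = σ₃.setReal ((⟨.delta, 0, 0⟩ : RRef).arr)
      ((⟨.delta, 0, 0⟩ : RRef).row.eval n σ₃) ((⟨.delta, 0, 0⟩ : RRef).col.eval n σ₃)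
      ((RExp.get .eta 0 0).eval n σ₃) := by simp [heta₃]
  rw [← hσ₃]
  set Λ := Nat.log 2 n with hΛ
  refine wp_loop (fun σ' τ => ∃ zv, ∃ j : ℕ, Core E (η / 2 ^ j) zv σ' ∧ σ'.nat .m 0 0 ≤ n + 1 ∧
    (∃ W ⊆ E.V, E.g W - E.k * (η / 2 ^ j) ≤ negSum E.V zv) ∧
    τ = (3 * Λ + 4 - j) * (320100 * n ^ 5)) _ ⟨_, 0, by simpa using hC₃, ?_, ?_, rfl⟩ ?_ ?_
  · simp [hA₃.nat .m rfl, hm₂]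
  · refine ⟨E.V, subset_rfl, ?_⟩
    rw [← E.card, pow_zero, div_one]
    exact le_negSum_of_le hη.le hbase₂ hx
  · rintro σ₄ τ ⟨zv, j, hC₄, hm₄, hW₄, rfl⟩ hA₄ hb₄
    have heta₄ : σ₄.real .eta 0 0 = η := by rw [hA₄.real .eta rfl]; simp [heta₃]
    simp [heta₄, hC₄.holds.k, hC₄.delta] at hb₄
    -- As long as `δ = η / 2 ^ j` is at least `η / (2 * k ^ 3)`, the exponent `j` is at most
    -- `1 + 3 * log k`.
    have hj : j < 3 * Λ + 4 := by
      have h2 : (0 : ℝ) < 2 ^ j := by positivity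
      have hkkk : (0 : ℝ) < E.k * E.k * E.k := by positivity
      have h₁ : (2 : ℝ) ^ j ≤ 2 * (E.k * E.k * E.k) := by
        rw [div_div, div_le_div_iff₀ (by positivity) h2] at hb₄
        exact le_of_mul_le_mul_left hb₄ hη
      have h₂ : 2 ^ j ≤ 2 * (E.k * E.k * E.k) := by exact_mod_cast h₁
      have h₃ : E.k < 2 ^ (Λ + 1) := lt_of_le_of_lt hkn (Nat.lt_pow_succ_log_self (by norm_num) n)
      have h₄ : E.k * E.k * E.k < 2 ^ (Λ + 1) * 2 ^ (Λ + 1) * 2 ^ (Λ + 1) :=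
        Nat.mul_lt_mul'' (Nat.mul_lt_mul'' h₃ h₃) h₃
      have h₅ : 2 ^ j < 2 ^ (3 * Λ + 4) := by
        calc 2 ^ j ≤ 2 * (E.k * E.k * E.k) := h₂
          _ < 2 * (2 ^ (Λ + 1) * 2 ^ (Λ + 1) * 2 ^ (Λ + 1)) := by omega
          _ = 2 ^ (3 * Λ + 4) := by ring
      exact (Nat.pow_lt_pow_iff_right (by norm_num)).1 h₅
    have hhalf : η / 2 ^ j = 2 * (η / 2 ^ (j + 1)) := by
      rw [pow_succ]; field_simp
    rw [hhalf] at hC₄ hW₄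
    refine wp_mono (wp_phase hC₄ (by positivity) hm₄ hW₄) ?_
    rintro σ₅ t₅ ⟨⟨zv₅, hC₅, hm₅, hW₅⟩, ht₅⟩ hA₅
    refine ⟨_, ⟨zv₅, j + 1, hC₅, hm₅, hW₅, rfl⟩, ?_⟩
    have h₁ : (3 * Λ + 4 - j) * (320100 * n ^ 5) =
        (3 * Λ + 4 - (j + 1)) * (320100 * n ^ 5) + 320100 * n ^ 5 := by
      rw [show 3 * Λ + 4 - j = 3 * Λ + 4 - (j + 1) + 1 by omega]; ring
    have h₂ : 0 < n ^ 5 := by positivity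
    rw [h₁]
    simp
    omega
  · rintro σ₄ τ t₄ ⟨zv, j, hC₄, hm₄, ⟨W, hW, hgW⟩, rfl⟩ hA₄ hb₄ ht₄
    have heta₄ : σ₄.real .eta 0 0 = η := by rw [hA₄.real .eta rfl]; simp [heta₃]
    simp only [BExp.eval, RExp.eval, NExp.eval, NExp.eval_ofNat, RExp.eval_ofNat] at hb₄
    simp [heta₄, hC₄.holds.k, hC₄.delta] at hb₄
    set δ := η / 2 ^ j with hδ
    have hδ0 : 0 < δ := by positivity
    have hkkk : (0 : ℝ) < E.k * E.k * E.k := by positivity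
    have hlt : (E.V.card : ℝ) * E.V.card * E.V.card * δ < η / 2 := by
      rw [E.card]
      rw [lt_div_iff₀ hkkk] at hb₄
      linarith
    have hbase₄ := hC₄.family.isBase E.submodOn E.g_empty
    obtain ⟨Y, hY, hgY⟩ := hmin
    obtain ⟨w₀, hw₀, hxw₀⟩ := exists_very_negative hbase₄ hY hgY hδ0.le hlt
    rw [E.card] at hxw₀
    obtain ⟨p₀, hp₀, hp₀w⟩ := hC₄.holds.enum.surj w₀ hw₀
    refine wp_forTo_zero E.k (fun p σ' => p₀ < p → σ'.nat .w 0 0 ∈ E.V ∧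
      σ₄.real .x (σ'.nat .w 0 0) 0 < -(E.k * E.k * δ)) 40 rfl
      (fun σ' hA => by simp [hA.nat .k rfl, hC₄.holds.k]) (by simp) ?_ ?_
    · intro p σ₅ hp hI hpp hA₅
      have eG : σ₅.nat .G p 0 = σ₄.nat .G p 0 := by rw [hA₅.nat .G rfl]
      have hV : σ₄.nat .G p 0 ∈ E.V := hC₄.holds.enum.mem p hp
      have ek : σ₅.nat .k 0 0 = E.k := by rw [hA₅.nat .k rfl, hC₄.holds.k]
      have ex : σ₅.real .x = σ₄.real .x := hA₅.real .x rfl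
      have ed : σ₅.real .delta 0 0 = δ := by rw [hA₅.real .delta rfl, hC₄.delta]
      refine wp_when ?_ ?_
      · intro hb
        simp [hpp, eG, ek, ex, ed] at hb
        rw [wp_nset]
        refine ⟨by simp, fun _ => ?_⟩
        simp [hpp, eG, hb]
        exact hV
      · intro hb
        simp [hpp, eG, ek, ex, ed] at hb
        refine ⟨by simp, fun hlt => ?_⟩
        simp
        refine hI ?_
        rcases Nat.lt_or_ge p₀ p with h | h
        · exact h
        · rw [show p = p₀ by omega] at hb
          rw [hp₀w] at hb
          linarith
    · intro σ₅ t₅ hI hA₅ ht₅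
      obtain ⟨hwV, hxw⟩ := hI hp₀
      refine ⟨hwV, fun Y hY hmin => ?_, ?_⟩
      · refine mem_minimizer hC₄.flow hδ0.le hbase₄ hC₄.z hW ?_ hwV ?_ hY hmin
        · rw [E.card]; exact hgW
        · rw [E.card]; exact hxw
      · have h₁ : n * n ≤ n ^ 5 := by rw [← sq]; exact Nat.pow_le_pow_right hn (by norm_num)
        have h₂ : n ≤ n * n := Nat.le_mul_self n
        have h₃ : n * (n * (10 + 14) + 24) = 24 * (n * n) + 24 * n := by ring
        have h₄ : (3 * Λ + 4 - 0) * (320100 * n ^ 5) = 320100 * (n ^ 5 * (3 * Λ + 4)) := by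
          rw [Nat.sub_zero]; ring
        have h₅ : 1000000 * n ^ 5 * (3 * Λ + 5) =
          1000000 * (n ^ 5 * (3 * Λ + 4)) + 1000000 * n ^ 5 := by ring
        have h₆ : 200 * n * n = 200 * (n * n) := by ring
        have h₇ : 100 * n * n = 100 * (n * n) := by ring
        rw [h₄] at ht₄
        rw [h₃] at ht₃
        rw [h₅]
        simp at ht₁ ht₂ ht₃ ht₄ ht₅ ⊢
        omega

section

/-! ### The state of the main loop -/

/-- The subset of the ground set represented by the vertex set `Y`, together with the deleted
elements; `cls j` is the vertex that stands for `j`, or `n` if `j` has been deleted. -/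
def repr (n : ℕ) (cls : ℕ → ℕ) (Y : Finset ℕ) : Finset (Fin n) :=
  univ.filter fun j : Fin n => cls j = n ∨ cls j ∈ Y

theorem mem_repr {cls : ℕ → ℕ} {Y : Finset ℕ} {j : Fin n} :
    j ∈ repr n cls Y ↔ cls j = n ∨ cls j ∈ Y := by simp [repr]

/-- The arcs of the digraph with adjacency matrix `F`. -/
def Arc (n : ℕ) (F : ℕ → ℕ → ℕ) (a b : ℕ) : Prop := a < n ∧ b < n ∧ F a b = 1

/-- Reachability in the digraph with adjacency matrix `F`. -/
def Reach (n : ℕ) (F : ℕ → ℕ → ℕ) : ℕ → ℕ → Prop := Relation.ReflTransGen (Arc n F)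

theorem Reach.refl {F : ℕ → ℕ → ℕ} (a : ℕ) : Reach n F a a := Relation.ReflTransGen.refl

theorem Reach.trans {F : ℕ → ℕ → ℕ} {a b c : ℕ} (h₁ : Reach n F a b) (h₂ : Reach n F b c) :
    Reach n F a c := Relation.ReflTransGen.trans h₁ h₂

open Classical in
/-- The set of vertices reachable from `v`. -/
noncomputable def reachSet (n : ℕ) (F : ℕ → ℕ → ℕ) (V : Finset ℕ) (v : ℕ) : Finset ℕ :=
  V.filter (Reach n F v)

theorem mem_reachSet {F : ℕ → ℕ → ℕ} {V : Finset ℕ} {v b : ℕ} :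
    b ∈ reachSet n F V v ↔ b ∈ V ∧ Reach n F v b := by simp [reachSet]

/-- The data of a call of `fix` on the vertex set `V`, with the classes of the vertices in `U`
added to every set. -/
def Env.of (hn : 0 < n) (cls : ℕ → ℕ) (U V : Finset ℕ) (fh : Finset (Fin n) → ℝ)
    (hV : ∀ v ∈ V, v < n) (hUV : Disjoint U V) (hcls : ∀ j < n, cls j = n ∨ cls j ∈ U ∪ V)
    (hfh : ∀ S, S ≠ univ → fh S = f S)
    (hsub : ∀ S T, fh (S ∪ T) + fh (S ∩ T) ≤ fh S + fh T) : Env n f where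
  V := V
  k := V.card
  Cl v := univ.filter fun j : Fin n => cls j = v
  B := repr n cls U
  fh := fh
  pos := hn
  card := rfl
  lt := hV
  disj v _ w _ h := by
    rw [disjoint_filter]
    intro j _ h₁ h₂
    exact h (h₁ ▸ h₂)
  disjB v hv := by
    rw [repr, disjoint_filter]
    intro j _ h₁ h₂
    rcases h₁ with h | h
    · exact absurd (hV v hv) (by omega)
    · exact disjoint_left.1 hUV h (h₂ ▸ hv)
  cover := by
    ext j
    have := hcls j j.2
    simp only [mem_union, mem_repr, mem_biUnion, mem_filter,
      mem_univ, true_and, iff_true] at this ⊢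
    rcases this with h | h | h
    · exact Or.inl (Or.inl h)
    · exact Or.inl (Or.inr h)
    · exact Or.inr ⟨_, h, rfl⟩
  fh_eq := hfh
  submod := hsub

theorem repr_union (cls : ℕ → ℕ) (U Y : Finset ℕ) :
    repr n cls U ∪ Y.biUnion (fun v => univ.filter fun j : Fin n => cls j = v) =
      repr n cls (U ∪ Y) := by
  ext j
  simp only [mem_union, mem_repr, mem_biUnion, mem_filter, mem_univ,
    true_and]
  constructor
  · rintro (h | ⟨v, hv, rfl⟩)
    · tauto
    · exact Or.inr (Or.inr hv)
  · rintro (h | h | h)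
    · exact Or.inl (Or.inl h)
    · exact Or.inl (Or.inr h)
    · exact Or.inr ⟨_, h, rfl⟩

/-- The invariant of the main loop for the vertex set `V`. The set function `fh` agrees with `f`
except that its value at the whole ground set may have been lowered, and `ms` is the minimum
of `f`. The element `j` belongs to the class of the vertex `cls j`, or has been moved to the output if
`cls j = n`; every class is represented by one of its elements. Values are stored relative to the
value `off` at the empty vertex set, `fV` being the value at `V`. Some minimizer of `fh` is the union
of the deleted elements and of the classes of a vertex set, and every minimizer of this form is closed
under the arcs. While `fV < 0`, no minimum is lost by returning to `f` (`univ_eq`). -/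
structure Inv (f : Finset (Fin n) → ℝ) (ms : ℝ) (V : Finset ℕ) (cls : ℕ → ℕ) (F : ℕ → ℕ → ℕ)
    (fh : Finset (Fin n) → ℝ) (fV off : ℝ) : Prop where
  lt : ∀ v ∈ V, v < n
  cases : ∀ j < n, cls j = n ∨ cls j ∈ V
  self : ∀ v ∈ V, cls v = v
  arc : ∀ a b, Arc n F a b → a ∈ V ∧ b ∈ V
  anti : ∀ a b, Reach n F a b → Reach n F b a → a = b
  fh_eq : ∀ S, S ≠ univ → fh S = f S
  fh_le : fh univ ≤ f univ
  tau : fV + off = fh univ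
  off_eq : V.Nonempty → off = fh (repr n cls ∅)
  ge : ∀ S, ms ≤ fh S
  ex : ∃ Y ⊆ V, fh (repr n cls Y) = ms
  closed : ∀ Y ⊆ V, fh (repr n cls Y) = ms → ∀ a ∈ Y, ∀ b, Arc n F a b → b ∈ Y
  univ_eq : fV < 0 → fh univ = ms → f univ = ms
  done : V = ∅ → f univ = ms

variable {ms : ℝ} {V : Finset ℕ} {cls : ℕ → ℕ} {F : ℕ → ℕ → ℕ} {fh : Finset (Fin n) → ℝ}
  {fV off : ℝ}

theorem Inv.ne_n (h : Inv f ms V cls F fh fV off) {v : ℕ} (hv : v ∈ V) : v ≠ n := (h.lt v hv).ne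

/-- Submodularity survives the lowering of the value at the whole ground set. -/
theorem Inv.submod (h : Inv f ms V cls F fh fV off)
    (hf : ∀ S T : Finset (Fin n), f (S ∪ T) + f (S ∩ T) ≤ f S + f T) (S T : Finset (Fin n)) :
    fh (S ∪ T) + fh (S ∩ T) ≤ fh S + fh T := by
  by_cases hS : S = univ
  · rw [hS, univ_inter, union_eq_left.2 (subset_univ T)]
  by_cases hT : T = univ
  · rw [hT, inter_univ, union_eq_right.2 (subset_univ S), add_comm]
  have hI : S ∩ T ≠ univ := fun hI => hS (eq_univ_of_forall fun j =>
    (mem_inter.1 (hI ▸ mem_univ j)).1)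
  rw [h.fh_eq S hS, h.fh_eq T hT, h.fh_eq _ hI]
  refine le_trans ?_ (hf S T)
  by_cases hU : S ∪ T = univ
  · rw [hU]
    linarith [h.fh_le]
  · rw [h.fh_eq _ hU]

theorem Inv.repr_V (h : Inv f ms V cls F fh fV off) : repr n cls V = univ :=
  eq_univ_of_forall fun j => mem_repr.2 (h.cases j j.2)

theorem Inv.repr_ne_univ (h : Inv f ms V cls F fh fV off) {Y : Finset ℕ} {v : ℕ} (hv : v ∈ V)
    (hvY : v ∉ Y) : repr n cls Y ≠ univ := by
  intro hu
  have := hu ▸ mem_univ (⟨v, h.lt v hv⟩ : Fin n)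
  rw [mem_repr] at this
  simp only [h.self v hv] at this
  exact this.elim (h.ne_n hv) hvY

theorem Inv.reach_mem (h : Inv f ms V cls F fh fV off) {a b : ℕ} (ha : a ∈ V)
    (hab : Reach n F a b) : b ∈ V := by
  induction hab with
  | refl => exact ha
  | tail _ hbc _ => exact (h.arc _ _ hbc).2

/-- Minimizers contain all vertices that are reachable from their elements. -/
theorem Inv.closed_reach (h : Inv f ms V cls F fh fV off) {Y : Finset ℕ} (hY : Y ⊆ V)
    (hm : fh (repr n cls Y) = ms) {a b : ℕ} (ha : a ∈ Y) (hab : Reach n F a b) : b ∈ Y := by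
  induction hab with
  | refl => exact ha
  | tail _ hbc ih => exact h.closed Y hY hm _ ih _ hbc

theorem Inv.marginal (h : Inv f ms V cls F fh fV off)
    (hf : ∀ S T : Finset (Fin n), f (S ∪ T) + f (S ∩ T) ≤ f S + f T) (hn : 0 < n)
    {A Y : Finset ℕ} (hAY : A ⊆ Y) (hY : Y ⊆ V) {v : ℕ} (hv : v ∈ V) (hvY : v ∉ Y) :
    fh (repr n cls (insert v Y)) - fh (repr n cls Y) ≤
      fh (repr n cls (insert v A)) - fh (repr n cls A) := by
  set E : Env n f := Env.of hn cls ∅ V fh h.lt (disjoint_empty_left V)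
    (by simpa using h.cases) h.fh_eq (h.submod hf) with hE
  have hset : ∀ Y, E.g Y = fh (repr n cls Y) - fh E.B := by
    intro Y
    have := repr_union (n := n) cls ∅ Y
    rw [empty_union] at this
    rw [← this]
    rfl
  have := E.submodOn.marginal hAY hY hv hvY
  simp only [hset] at this
  linarith

/-- The marginal value of `v` at the set of the other vertices reachable from `v`. -/
noncomputable def topMarginal (cls : ℕ → ℕ) (F : ℕ → ℕ → ℕ) (V : Finset ℕ)
    (fh : Finset (Fin n) → ℝ) (v : ℕ) : ℝ :=
  fh (repr n cls (reachSet n F V v)) - fh (repr n cls ((reachSet n F V v).erase v))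

/-- Marginal values at sets that contain all other vertices reachable from `v`. -/
theorem Inv.marginal_le (h : Inv f ms V cls F fh fV off)
    (hf : ∀ S T : Finset (Fin n), f (S ∪ T) + f (S ∩ T) ≤ f S + f T) (hn : 0 < n)
    {Y : Finset ℕ} (hY : Y ⊆ V) {v : ℕ} (hv : v ∈ V) (hvY : v ∉ Y)
    (hR : (reachSet n F V v).erase v ⊆ Y) :
    fh (repr n cls (insert v Y)) - fh (repr n cls Y) ≤ topMarginal cls F V fh v := by
  have := h.marginal hf hn hR hY hv hvY
  rwa [insert_erase (mem_reachSet.2 ⟨hv, Reach.refl v⟩)] at this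

/-- If no marginal value is positive, then the set of all vertices is a minimizer: a minimizer is
closed under the arcs, and the remaining vertices can be added in a consistent order. -/
theorem Inv.fh_univ_eq (h : Inv f ms V cls F fh fV off)
    (hf : ∀ S T : Finset (Fin n), f (S ∪ T) + f (S ∩ T) ≤ f S + f T) (hn : 0 < n)
    (htop : ∀ v ∈ V, topMarginal cls F V fh v ≤ 0) : fh univ = ms := by
  have key : ∀ d, ∀ Y ⊆ V, (V \ Y).card = d → (∀ a ∈ Y, ∀ b, Reach n F a b → b ∈ Y) →
      fh (repr n cls Y) ≤ ms → fh (repr n cls V) ≤ ms := by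
    intro d
    induction d with
    | zero =>
      intro Y hY hd _ hm
      rw [card_eq_zero, sdiff_eq_empty_iff_subset] at hd
      rwa [Subset.antisymm hd hY]
    | succ d ih =>
      intro Y hY hd hcl hm
      have hne : (V \ Y).Nonempty := card_pos.1 (by omega)
      obtain ⟨v, hv, hmin⟩ := exists_min_image (V \ Y)
        (fun v => (reachSet n F V v).card) hne
      rw [mem_sdiff] at hv
      have hR : (reachSet n F V v).erase v ⊆ Y := by
        intro b hb
        rw [mem_erase, mem_reachSet] at hb
        obtain ⟨hbv, hbV, hvb⟩ := hb
        by_contra hbY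
        refine absurd (hmin b (mem_sdiff.2 ⟨hbV, hbY⟩)) (not_le.2 ?_)
        refine card_lt_card ⟨?_, ?_⟩
        · intro c hc
          rw [mem_reachSet] at hc ⊢
          exact ⟨hc.1, hvb.trans hc.2⟩
        · intro hsub
          have := hsub (mem_reachSet.2 ⟨hv.1, Reach.refl v⟩)
          exact hbv (h.anti b v (mem_reachSet.1 this).2 hvb)
      have hYv : insert v Y ⊆ V := insert_subset hv.1 hY
      refine ih (insert v Y) hYv ?_ ?_ ?_
      · have h₁ := card_sdiff_add_card_eq_card hY
        have h₂ := card_sdiff_add_card_eq_card hYv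
        rw [card_insert_of_notMem hv.2] at h₂
        omega
      · intro a ha b hab
        rcases mem_insert.1 ha with rfl | ha
        · by_cases hba : b = a
          · exact hba ▸ mem_insert_self _ _
          · exact mem_insert_of_mem (hR (mem_erase.2
              ⟨hba, mem_reachSet.2 ⟨h.reach_mem hv.1 hab, hab⟩⟩))
        · exact mem_insert_of_mem (hcl a ha b hab)
      · have := h.marginal_le hf hn hY hv.1 hv.2 hR
        linarith [htop v hv.1]
  obtain ⟨Y, hY, hm⟩ := h.ex
  have := key _ Y hY rfl (fun a ha b hab => h.closed_reach hY hm ha hab) hm.le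
  rw [h.repr_V] at this
  exact le_antisymm this (h.ge _)

/-- Lowering `fh` at the whole ground set to the value at the empty vertex set. -/
theorem Inv.reset (h : Inv f ms V cls F fh fV off) (hV : V.Nonempty) (hfV : 0 < fV) :
    Inv f ms V cls F (fun S => if S = univ then off else fh S) 0 off := by
  obtain ⟨v, hv⟩ := hV
  have h0 : repr n cls ∅ ≠ univ := h.repr_ne_univ hv (notMem_empty v)
  have hoff := h.off_eq ⟨v, hv⟩
  have hge : ms ≤ off := by rw [hoff]; exact h.ge _
  refine ⟨h.lt, h.cases, h.self, h.arc, h.anti, ?_, ?_, ?_, ?_, ?_, ?_, ?_, ?_, ?_⟩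
  · intro S hS
    simp only [if_neg hS, h.fh_eq S hS]
  · simp only [if_true]
    linarith [h.tau, h.fh_le]
  · simp
  · intro _
    simp only [if_neg h0]
    exact hoff
  · intro S
    by_cases hS : S = univ
    · simpa only [if_pos hS] using hge
    · simpa only [if_neg hS] using h.ge S
  · obtain ⟨Y, hY, hm⟩ := h.ex
    refine ⟨Y, hY, ?_⟩
    rw [if_neg]
    · exact hm
    · intro hu
      rw [hu] at hm
      linarith [h.tau]
  · intro Y hY hm a ha b hab
    by_cases hYu : repr n cls Y = univ
    · have : V ⊆ Y := fun v hv => by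
        by_contra hvY
        exact h.repr_ne_univ hv hvY hYu
      exact this (h.arc a b hab).2
    · rw [if_neg hYu] at hm
      exact h.closed Y hY hm a ha b hab
  · intro h'
    exact absurd h' (lt_irrefl _)
  · exact h.done

end

section

variable {ms : ℝ} {V : Finset ℕ} {cls : ℕ → ℕ} {F F' : ℕ → ℕ → ℕ} {fh : Finset (Fin n) → ℝ}
  {fV off : ℝ} {u w : ℕ}

/-! ### The steps of the main loop -/

open Classical in
/-- The progress of the algorithm: the number of pairs of elements of which one has been deleted or
whose representatives are known to be ordered, plus the number of deleted elements. -/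
noncomputable def progress (n : ℕ) (cls : ℕ → ℕ) (F : ℕ → ℕ → ℕ) : ℕ :=
  (univ.filter fun p : Fin n × Fin n =>
    cls p.1 = n ∨ cls p.2 = n ∨ Reach n F (cls p.1) (cls p.2)).card +
  (univ.filter fun j : Fin n => cls j = n).card

theorem progress_le (cls : ℕ → ℕ) (F : ℕ → ℕ → ℕ) : progress n cls F ≤ n * n + n := by
  classical
  refine Nat.add_le_add ?_ ?_
  · refine (card_le_univ _).trans ?_
    simp
  · refine (card_le_univ _).trans ?_
    simp

/-- The progress increases if no known fact is lost and a new one is learned. -/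
theorem progress_lt {cls' : ℕ → ℕ} (h₁ : ∀ j < n, cls j = n → cls' j = n)
    (h₂ : ∀ i < n, ∀ j < n, cls i ≠ n → cls j ≠ n → Reach n F (cls i) (cls j) →
      cls' i = n ∨ cls' j = n ∨ Reach n F' (cls' i) (cls' j))
    (h₃ : (∃ i < n, ∃ j < n, cls i ≠ n ∧ cls j ≠ n ∧ ¬ Reach n F (cls i) (cls j) ∧
        Reach n F' (cls' i) (cls' j)) ∨ ∃ j < n, cls j ≠ n ∧ cls' j = n) :
    progress n cls F < progress n cls' F' := by
  classical
  have hs₁ : (univ.filter fun p : Fin n × Fin n =>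
      cls p.1 = n ∨ cls p.2 = n ∨ Reach n F (cls p.1) (cls p.2)) ⊆
      (univ.filter fun p : Fin n × Fin n =>
      cls' p.1 = n ∨ cls' p.2 = n ∨ Reach n F' (cls' p.1) (cls' p.2)) := by
    rintro ⟨i, j⟩ h
    simp only [mem_filter, mem_univ, true_and] at h ⊢
    by_cases hi : cls i = n
    · exact Or.inl (h₁ i i.2 hi)
    by_cases hj : cls j = n
    · exact Or.inr (Or.inl (h₁ j j.2 hj))
    exact h₂ i i.2 j j.2 hi hj ((h.resolve_left hi).resolve_left hj)
  have hs₂ : (univ.filter fun j : Fin n => cls j = n) ⊆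
      (univ.filter fun j : Fin n => cls' j = n) := by
    intro j h
    simp only [mem_filter, mem_univ, true_and] at h ⊢
    exact h₁ j j.2 h
  rcases h₃ with ⟨i, hi, j, hj, hin, hjn, hij, hij'⟩ | ⟨j, hj, hjn, hjn'⟩
  · refine Nat.add_lt_add_of_lt_of_le (card_lt_card ⟨hs₁, fun hs => ?_⟩)
      (card_le_card hs₂)
    have := @hs (⟨i, hi⟩, ⟨j, hj⟩) (by simp [hij'])
    simp [hin, hjn, hij] at this
  · refine Nat.add_lt_add_of_le_of_lt (card_le_card hs₁)
      (card_lt_card ⟨hs₂, fun hs => ?_⟩)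
    have := @hs ⟨j, hj⟩ (by simp [hjn'])
    simp [hjn] at this

/-- A path in the digraph with one more arc either avoids this arc or passes it. -/
theorem reach_of_add {r : ℕ → ℕ → Prop} {a b : ℕ}
    (h : Relation.ReflTransGen (fun a b => r a b ∨ (a = u ∧ b = w)) a b) :
    Relation.ReflTransGen r a b ∨
      (Relation.ReflTransGen r a u ∧ Relation.ReflTransGen r w b) := by
  induction h with
  | refl => exact Or.inl Relation.ReflTransGen.refl
  | tail _ hbc ih =>
    rcases hbc with hbc | ⟨rfl, rfl⟩
    · rcases ih with ih | ih
      · exact Or.inl (ih.tail hbc)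
      · exact Or.inr ⟨ih.1, ih.2.tail hbc⟩
    · rcases ih with ih | ih
      · exact Or.inr ⟨ih, Relation.ReflTransGen.refl⟩
      · exact Or.inr ⟨ih.1, Relation.ReflTransGen.refl⟩

/-- If every minimizer that contains `u` contains `w`, then the arc `(u, w)` may be added. -/
theorem Inv.addArc (h : Inv f ms V cls F fh fV off) (hu : u ∈ V) (hw : w ∈ V)
    (hwu : ¬ Reach n F w u)
    (hmin : ∀ Y ⊆ V, fh (repr n cls Y) = ms → u ∈ Y → w ∈ Y)
    (hF' : ∀ a b, F' a b = if a = u ∧ b = w then 1 else F a b) :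
    Inv f ms V cls F' fh fV off := by
  have harc : ∀ a b, Arc n F' a b → Arc n F a b ∨ (a = u ∧ b = w) := by
    intro a b hab
    by_cases h' : a = u ∧ b = w
    · exact Or.inr h'
    · refine Or.inl ⟨hab.1, hab.2.1, ?_⟩
      have := hab.2.2
      rwa [hF', if_neg h'] at this
  have hreach : ∀ a b, Reach n F' a b → Reach n F a b ∨ (Reach n F a u ∧ Reach n F w b) :=
    fun a b hab => reach_of_add (Relation.ReflTransGen.mono harc _ _ hab)
  refine { h with arc := ?_, anti := ?_, closed := ?_ }
  · intro a b hab
    rcases harc a b hab with h' | ⟨rfl, rfl⟩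
    · exact h.arc a b h'
    · exact ⟨hu, hw⟩
  · intro a b hab hba
    rcases hreach a b hab with h₁ | ⟨h₁, h₂⟩ <;> rcases hreach b a hba with h₃ | ⟨h₃, h₄⟩
    · exact h.anti a b h₁ h₃
    · exact absurd (h₄.trans (h₁.trans h₃)) hwu
    · exact absurd (h₂.trans (h₃.trans h₁)) hwu
    · exact absurd (h₂.trans h₃) hwu
  · intro Y hY hm a ha b hab
    rcases harc a b hab with h' | ⟨rfl, rfl⟩
    · exact h.closed Y hY hm a ha b h'
    · exact hmin Y hY hm ha

theorem Inv.progress_addArc (h : Inv f ms V cls F fh fV off) (hu : u ∈ V) (hw : w ∈ V)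
    (huw : ¬ Reach n F u w) (hF' : ∀ a b, F' a b = if a = u ∧ b = w then 1 else F a b) :
    progress n cls F < progress n cls F' := by
  refine progress_lt (fun _ _ h => h) ?_ (Or.inl ⟨u, h.lt u hu, w, h.lt w hw, ?_, ?_, ?_, ?_⟩)
  · intro i _ j _ _ _ hij
    refine Or.inr (Or.inr (Relation.ReflTransGen.mono ?_ _ _ hij))
    intro a b hab
    refine ⟨hab.1, hab.2.1, ?_⟩
    rw [hF']
    split_ifs
    · rfl
    · exact hab.2.2
  · rw [h.self u hu]; exact h.ne_n hu
  · rw [h.self w hw]; exact h.ne_n hw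
  · rwa [h.self u hu, h.self w hw]
  · rw [h.self u hu, h.self w hw]
    exact Relation.ReflTransGen.single ⟨h.lt u hu, h.lt w hw, by rw [hF', if_pos ⟨rfl, rfl⟩]⟩

/-- The vertices on the paths from `w` to `u`. -/
def Between (n : ℕ) (F : ℕ → ℕ → ℕ) (w u v : ℕ) : Prop := Reach n F w v ∧ Reach n F v u

open Classical in
/-- The contraction of the vertices on the paths from `w` to `u` to the vertex `u`. -/
noncomputable def quot (n : ℕ) (F : ℕ → ℕ → ℕ) (w u v : ℕ) : ℕ :=
  if Between n F w u v then u else v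

theorem quot_self : quot n F w u u = u := by
  unfold quot; split_ifs <;> rfl

open Classical in
/-- If moreover `u` is reachable from `w`, then the vertices between `w` and `u` belong to the same
minimizers, and may be contracted. -/
theorem Inv.contract (h : Inv f ms V cls F fh fV off) (hu : u ∈ V) (hw : w ∈ V)
    (hwu : Reach n F w u) (hmin : ∀ Y ⊆ V, fh (repr n cls Y) = ms → u ∈ Y → w ∈ Y)
    {V' : Finset ℕ} {cls' : ℕ → ℕ}
    (hV' : V' = V.filter fun v => v = u ∨ ¬ Between n F w u v)
    (hcls' : ∀ j < n, cls' j = quot n F w u (cls j))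
    (h₁ : ∀ a b, Arc n F' a b → a ∈ V' ∧ b ∈ V')
    (h₂ : ∀ a b, Arc n F' a b → a = b ∨
      ∃ a₀ b₀, Arc n F a₀ b₀ ∧ quot n F w u a₀ = a ∧ quot n F w u b₀ = b) :
    Inv f ms V' cls' F' fh fV off := by
  have huw : Between n F w u u := ⟨hwu, Reach.refl u⟩
  have hmV : ∀ v, v ∈ V' ↔ v ∈ V ∧ (v = u ∨ ¬ Between n F w u v) := by simp [hV']
  have huV' : u ∈ V' := (hmV u).2 ⟨hu, Or.inl rfl⟩
  have hVV : V' ⊆ V := fun v hv => ((hmV v).1 hv).1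
  have hqV' : ∀ v ∈ V, quot n F w u v ∈ V' := by
    intro v hv
    unfold quot
    split_ifs with hb
    · exact huV'
    · exact (hmV v).2 ⟨hv, Or.inr hb⟩
  have hqs : ∀ v ∈ V', quot n F w u v = v := by
    intro v hv
    rcases ((hmV v).1 hv).2 with rfl | hb
    · exact quot_self
    · exact if_neg hb
  have hqn : quot n F w u n = n :=
    if_neg fun hb => h.ne_n (h.reach_mem hw hb.1) rfl
  have hqn' : ∀ j < n, cls' j = n ↔ cls j = n := by
    intro j hj
    rw [hcls' j hj]
    refine ⟨fun hq => ?_, fun hj => by rw [hj, hqn]⟩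
    rcases h.cases j hj with hc | hc
    · exact hc
    · exact absurd hq (h.ne_n (hVV (hqV' _ hc)))
  have hrepr : ∀ Y', repr n cls' Y' = repr n cls (V.filter fun v => quot n F w u v ∈ Y') := by
    intro Y'
    ext j
    rw [mem_repr, mem_repr, hqn' j j.2, mem_filter, hcls' j j.2]
    rcases h.cases j j.2 with hc | hc
    · simp [hc]
    · simp [hc]
  -- The new digraph is a subgraph of the old one with the arc from `u` to `w`.
  have hplus : ∀ a b, Reach n F' a b →
      Relation.ReflTransGen (fun a b => Arc n F a b ∨ (a = u ∧ b = w)) a b := by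
    have hsub : ∀ {a b}, Reach n F a b →
        Relation.ReflTransGen (fun a b => Arc n F a b ∨ (a = u ∧ b = w)) a b :=
      fun hab => Relation.ReflTransGen.mono (fun _ _ h => Or.inl h) _ _ hab
    have huv : ∀ v, Relation.ReflTransGen (fun a b => Arc n F a b ∨ (a = u ∧ b = w))
        (quot n F w u v) v ∧ Relation.ReflTransGen (fun a b => Arc n F a b ∨ (a = u ∧ b = w))
        v (quot n F w u v) := by
      intro v
      unfold quot
      split_ifs with hb
      · exact ⟨Relation.ReflTransGen.head (Or.inr ⟨rfl, rfl⟩) (hsub hb.1), hsub hb.2⟩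
      · exact ⟨Relation.ReflTransGen.refl, Relation.ReflTransGen.refl⟩
    intro a b hab
    induction hab with
    | refl => exact Relation.ReflTransGen.refl
    | tail _ hbc ih =>
      rcases h₂ _ _ hbc with rfl | ⟨a₀, b₀, hab₀, rfl, rfl⟩
      · exact ih
      · exact ((ih.trans (huv a₀).1).tail (Or.inl hab₀)).trans (huv b₀).2
  refine ⟨fun v hv => h.lt v (hVV hv), ?_, ?_, h₁, ?_, h.fh_eq, h.fh_le, h.tau, ?_, h.ge, ?_, ?_,
    h.univ_eq, ?_⟩
  · intro j hj
    rw [hqn' j hj, hcls' j hj]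
    exact (h.cases j hj).imp id (hqV' _)
  · intro v hv
    rw [hcls' v (h.lt v (hVV hv)), h.self v (hVV hv), hqs v hv]
  · intro a b hab hba
    by_cases haV : a ∈ V'
    swap
    · induction hab using Relation.ReflTransGen.head_induction_on with
      | refl => rfl
      | head hac _ _ => exact absurd (h₁ _ _ hac).1 haV
    have hbV : b ∈ V' := by
      induction hab with
      | refl => exact haV
      | tail _ hbc _ => exact (h₁ _ _ hbc).2
    have hunique : Between n F w u a → Between n F w u b → a = b := by
      intro h₃ h₄
      rw [((hmV a).1 haV).2.resolve_right (not_not.2 h₃),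
        ((hmV b).1 hbV).2.resolve_right (not_not.2 h₄)]
    rcases reach_of_add (hplus a b hab) with h₃ | ⟨h₃, h₄⟩ <;>
      rcases reach_of_add (hplus b a hba) with h₅ | ⟨h₅, h₆⟩
    · exact h.anti a b h₃ h₅
    · exact hunique ⟨h₆, Reach.trans h₃ h₅⟩ ⟨Reach.trans h₆ h₃, h₅⟩
    · exact hunique ⟨Reach.trans h₄ h₅, h₃⟩ ⟨h₄, Reach.trans h₅ h₃⟩
    · exact hunique ⟨h₆, h₃⟩ ⟨h₄, h₅⟩
  · intro _
    rw [hrepr]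
    simpa using h.off_eq ⟨u, hu⟩
  · obtain ⟨Y, hY, hm⟩ := h.ex
    refine ⟨Y ∩ V', inter_subset_right, ?_⟩
    rw [hrepr]
    have : (V.filter fun v => quot n F w u v ∈ Y ∩ V') = Y := by
      ext v
      rw [mem_filter, mem_inter]
      have hiff : v ∈ V → (quot n F w u v ∈ Y ↔ v ∈ Y) := by
        intro hv
        unfold quot
        split_ifs with hb
        · exact ⟨fun huY => h.closed_reach hY hm (hmin Y hY hm huY) hb.1,
            fun hvY => h.closed_reach hY hm hvY hb.2⟩
        · exact Iff.rfl
      constructor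
      · rintro ⟨hv, hq, -⟩
        exact (hiff hv).1 hq
      · intro hv
        exact ⟨hY hv, (hiff (hY hv)).2 hv, hqV' v (hY hv)⟩
    rw [this, hm]
  · intro Y' hY' hm a ha b hab
    rw [hrepr] at hm
    rcases h₂ a b hab with rfl | ⟨a₀, b₀, hab₀, rfl, rfl⟩
    · exact ha
    · have := h.closed _ (filter_subset _ _) hm a₀
        (mem_filter.2 ⟨(h.arc _ _ hab₀).1, ha⟩) b₀ hab₀
      exact (mem_filter.1 this).2
  · intro h'
    exact absurd (h' ▸ huV') (notMem_empty u)

theorem Inv.progress_contract (h : Inv f ms V cls F fh fV off) (hu : u ∈ V) (hw : w ∈ V)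
    (hwu : Reach n F w u) (huw : ¬ Reach n F u w) {cls' : ℕ → ℕ}
    (hcls' : ∀ j < n, cls' j = quot n F w u (cls j))
    (h₃ : ∀ a b, Arc n F a b → quot n F w u a ≠ quot n F w u b →
      Arc n F' (quot n F w u a) (quot n F w u b)) :
    progress n cls F < progress n cls' F' := by
  have hqn : quot n F w u n = n :=
    if_neg fun hb => h.ne_n (h.reach_mem hw hb.1) rfl
  refine progress_lt ?_ ?_ (Or.inl ⟨u, h.lt u hu, w, h.lt w hw, ?_, ?_, ?_, ?_⟩)
  · intro j hj hjn
    rw [hcls' j hj, hjn, hqn]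
  · intro i hi j hj _ _ hij
    refine Or.inr (Or.inr ?_)
    rw [hcls' i hi, hcls' j hj]
    generalize cls i = a at hij ⊢
    generalize cls j = b at hij ⊢
    induction hij with
    | refl => exact Reach.refl _
    | @tail b c _ hbc ih =>
      by_cases hq : quot n F w u b = quot n F w u c
      · rw [← hq]; exact ih
      · exact Relation.ReflTransGen.tail ih (h₃ _ _ hbc hq)
  · rw [h.self u hu]; exact h.ne_n hu
  · rw [h.self w hw]; exact h.ne_n hw
  · rwa [h.self u hu, h.self w hw]
  · rw [hcls' u (h.lt u hu), hcls' w (h.lt w hw), h.self u hu, h.self w hw, quot_self]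
    have : quot n F w u w = u := if_pos ⟨Reach.refl w, hwu⟩
    rw [this]
    exact Reach.refl u

/-- If every minimizer contains `w`, then the vertices reachable from `w` may be moved to the output. -/
theorem Inv.delete (h : Inv f ms V cls F fh fV off) (hfV : fV ≤ 0) (hw : w ∈ V)
    (hmin : ∀ Y ⊆ V, fh (repr n cls Y) = ms → w ∈ Y) {cls' : ℕ → ℕ}
    (hcls' : ∀ j < n, cls' j = if cls j ∈ reachSet n F V w then n else cls j)
    (hF' : ∀ a b, Arc n F' a b →
      Arc n F a b ∧ a ∉ reachSet n F V w ∧ b ∉ reachSet n F V w) :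
    Inv f ms (V \ reachSet n F V w) cls' F' fh (fV - (fh (repr n cls (reachSet n F V w)) - off))
      (off + (fh (repr n cls (reachSet n F V w)) - off)) := by
  set U := reachSet n F V w with hU
  have hUV : U ⊆ V := fun v hv => (mem_reachSet.1 hv).1
  have hrepr : ∀ Y', repr n cls' Y' = repr n cls (U ∪ Y') ∨ ¬ Y' ⊆ V \ U := by
    intro Y'
    by_cases hY' : Y' ⊆ V \ U
    swap
    · exact Or.inr hY'
    refine Or.inl ?_
    ext j
    rw [mem_repr, mem_repr, hcls' j j.2, mem_union]
    split_ifs with hj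
    · simp [hj]
    · simp [hj]
  have huniv : fh univ = ms → f univ = ms := by
    intro hm
    rcases hfV.lt_or_eq with h' | h'
    · exact h.univ_eq h' hm
    · have h₁ := h.off_eq ⟨w, hw⟩
      have h₂ := h.tau
      exact absurd (hmin ∅ (empty_subset _) (by linarith)) (notMem_empty w)
  have hsub : ∀ Y ⊆ V, fh (repr n cls Y) = ms → U ⊆ Y := by
    intro Y hY hm v hv
    exact h.closed_reach hY hm (hmin Y hY hm) (mem_reachSet.1 hv).2
  have hreach : ∀ a b, Reach n F' a b → Reach n F a b := fun a b hab =>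
    Relation.ReflTransGen.mono (fun a b h => (hF' a b h).1) _ _ hab
  refine ⟨fun v hv => h.lt v (mem_sdiff.1 hv).1, ?_, ?_, ?_, ?_, h.fh_eq, h.fh_le, ?_, ?_,
    h.ge, ?_, ?_, fun _ => huniv, ?_⟩
  · intro j hj
    rw [hcls' j hj]
    split_ifs with hc
    · exact Or.inl rfl
    · exact (h.cases j hj).imp id fun h' => mem_sdiff.2 ⟨h', hc⟩
  · intro v hv
    rw [mem_sdiff] at hv
    rw [hcls' v (h.lt v hv.1), h.self v hv.1, if_neg hv.2]
  · intro a b hab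
    obtain ⟨h₁, h₂, h₃⟩ := hF' a b hab
    have := h.arc a b h₁
    exact ⟨mem_sdiff.2 ⟨this.1, h₂⟩, mem_sdiff.2 ⟨this.2, h₃⟩⟩
  · intro a b hab hba
    exact h.anti a b (hreach a b hab) (hreach b a hba)
  · linarith [h.tau]
  · intro _
    rcases hrepr ∅ with h' | h'
    · rw [h', union_empty]
      ring
    · exact absurd (empty_subset _) h'
  · obtain ⟨Y, hY, hm⟩ := h.ex
    have hsd : Y \ U ⊆ V \ U := sdiff_subset_sdiff hY subset_rfl
    refine ⟨Y \ U, hsd, ?_⟩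
    rw [(hrepr _).resolve_right (not_not.2 hsd), union_sdiff_of_subset (hsub Y hY hm), hm]
  · intro Y' hY' hm a ha b hab
    rw [(hrepr _).resolve_right (not_not.2 hY')] at hm
    have hYV : U ∪ Y' ⊆ V := union_subset hUV (hY'.trans sdiff_subset)
    obtain ⟨h₁, h₂, h₃⟩ := hF' a b hab
    have := h.closed _ hYV hm a (mem_union_right _ ha) b h₁
    exact (mem_union.1 this).resolve_left h₃
  · intro h'
    obtain ⟨Y, hY, hm⟩ := h.ex
    have : V ⊆ Y := (sdiff_eq_empty_iff_subset.1 h').trans (hsub Y hY hm)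
    rw [Subset.antisymm hY this, h.repr_V] at hm
    exact huniv hm

theorem Inv.progress_delete (h : Inv f ms V cls F fh fV off) (hw : w ∈ V) {cls' : ℕ → ℕ}
    (hcls' : ∀ j < n, cls' j = if cls j ∈ reachSet n F V w then n else cls j)
    (hF' : ∀ a b, Arc n F a b → a ∉ reachSet n F V w → b ∉ reachSet n F V w → Arc n F' a b) :
    progress n cls F < progress n cls' F' := by
  refine progress_lt ?_ ?_ (Or.inr ⟨w, h.lt w hw, ?_, ?_⟩)
  · intro j hj hjn
    rw [hcls' j hj, hjn, if_neg fun h' => h.ne_n (mem_reachSet.1 h').1 rfl]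
  · intro i hi j hj hin hjn hij
    rw [hcls' i hi, hcls' j hj]
    by_cases hiU : cls i ∈ reachSet n F V w
    · rw [if_pos hiU]; exact Or.inl rfl
    by_cases hjU : cls j ∈ reachSet n F V w
    · rw [if_pos hjU]; exact Or.inr (Or.inl rfl)
    rw [if_neg hiU, if_neg hjU]
    refine Or.inr (Or.inr ?_)
    -- A path that ends outside of the closed set of the vertices reachable from `w` avoids it.
    generalize cls i = a at hij hiU ⊢
    generalize cls j = b at hij hjU ⊢
    induction hij using Relation.ReflTransGen.head_induction_on with
    | refl => exact Reach.refl _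
    | @head a c hac hcb ih =>
      have hcU : c ∉ reachSet n F V w := by
        intro hc
        have : Reach n F w b := (mem_reachSet.1 hc).2.trans hcb
        exact hjU (mem_reachSet.2 ⟨h.reach_mem hw this, this⟩)
      exact Relation.ReflTransGen.head (hF' a c hac hiU hcU) (ih hcU)
  · rw [h.self w hw]; exact h.ne_n hw
  · rw [hcls' w (h.lt w hw), h.self w hw, if_pos (mem_reachSet.2 ⟨hw, Reach.refl w⟩)]

end

/-! ### The transitive closure -/

/-- The relation `R` lies between the arcs and reachability, and paths may be shortened at the
vertices less than `l`. -/
structure Warshall (n : ℕ) (F : ℕ → ℕ → ℕ) (l : ℕ) (R : ℕ → ℕ → ℕ) : Prop where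
  le_one : ∀ a < n, ∀ b < n, R a b ≤ 1
  refl : ∀ a < n, R a a = 1
  arc : ∀ a b, Arc n F a b → R a b = 1
  sound : ∀ a < n, ∀ b < n, R a b = 1 → Reach n F a b
  trans : ∀ a < n, ∀ b < n, ∀ i < l, i < n → R a i = 1 → R i b = 1 → R a b = 1

theorem Warshall.iff_reach {F R : ℕ → ℕ → ℕ} (h : Warshall n F n R) {a b : ℕ} (ha : a < n)
    (hb : b < n) : R a b = 1 ↔ Reach n F a b := by
  refine ⟨h.sound a ha b hb, fun hab => ?_⟩
  induction hab with
  | refl => exact h.refl a ha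
  | tail _ hbc ih =>
    exact h.trans a ha _ hbc.2.1 _ hbc.1 hbc.1 (ih hbc.1) (h.arc _ _ hbc)

/-- One more round of Warshall's algorithm. -/
theorem Warshall.succ {F R R' : ℕ → ℕ → ℕ} {l : ℕ} (h : Warshall n F l R) (hl : l < n)
    (h01 : ∀ a < n, ∀ b < n, R' a b ≤ 1)
    (hR' : ∀ a < n, ∀ b < n, R' a b = 1 ↔ R a b = 1 ∨ (R a l = 1 ∧ R l b = 1)) :
    Warshall n F (l + 1) R' := by
  refine ⟨h01, fun a ha => (hR' a ha a ha).2 (Or.inl (h.refl a ha)),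
    fun a b hab => (hR' a hab.1 b hab.2.1).2 (Or.inl (h.arc a b hab)), ?_, ?_⟩
  · intro a ha b hb hab
    rcases (hR' a ha b hb).1 hab with h' | ⟨h₁, h₂⟩
    · exact h.sound a ha b hb h'
    · exact (h.sound a ha l hl h₁).trans (h.sound l hl b hb h₂)
  · intro a ha b hb i hil hi hai hib
    rw [hR' a ha i hi] at hai
    rw [hR' i hi b hb] at hib
    rw [hR' a ha b hb]
    rcases Nat.lt_succ_iff_lt_or_eq.1 hil with hil | rfl
    · rcases hai with h₁ | ⟨h₁, h₂⟩ <;> rcases hib with h₃ | ⟨h₃, h₄⟩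
      · exact Or.inl (h.trans a ha b hb i hil hi h₁ h₃)
      · exact Or.inr ⟨h.trans a ha l hl i hil hi h₁ h₃, h₄⟩
      · exact Or.inr ⟨h₁, h.trans l hl b hb i hil hi h₂ h₃⟩
      · exact Or.inr ⟨h₁, h₄⟩
    · exact Or.inr ⟨hai.elim id And.left, hib.elim id And.right⟩

theorem wp_closure (hF : ∀ a < n, ∀ b < n, σ.nat .F a b ≤ 1) :
    wp f closure σ (fun σ' t => Warshall n (σ.nat .F) n (σ'.nat .R) ∧
      t ≤ 200 * n ^ 3 + 200 * n ^ 2 + 200 * n + 100) := by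
  unfold closure
  rw [wp_seq]
  refine wp_forTo_forTo (fun a b σ' => ∀ a' < n, ∀ b' < n, (a' < a ∨ (a' = a ∧ b' < b)) →
    σ'.nat .R a' b' = if a' = b' then 1 else σ.nat .F a' b') 30 (by simp) rfl rfl
    (by simp) (by intro a' _ b' _ h; omega) ?_ ?_ ?_
  · intro a b σ' ha hb hI hσa hσb hA
    have eF : σ'.nat .F = σ.nat .F := hA.nat .F rfl
    have hstep : ∀ a' b', (a' < a ∨ (a' = a ∧ b' < b + 1)) → ¬ (a' = a ∧ b' = b) →
        (a' < a ∨ (a' = a ∧ b' < b)) := by omega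
    refine wp_cond ?_ ?_
    · intro h
      simp [hσa, hσb] at h
      rw [wp_nset]
      refine ⟨by simp, ?_⟩
      intro a' ha' b' hb' h'
      simp only [Mem.setNat_nat_self, NExp.eval, NExp.eval_ofNat, hσa, hσb]
      by_cases hc : a' = a ∧ b' = b
      · rw [if_pos hc, if_pos (by omega)]
      · rw [if_neg hc]
        exact hI a' ha' b' hb' (hstep a' b' h' hc)
    · intro h
      simp [hσa, hσb] at h
      rw [wp_nset]
      refine ⟨by simp, ?_⟩
      intro a' ha' b' hb' h'
      simp only [Mem.setNat_nat_self, NExp.eval, NExp.eval_ofNat, hσa, hσb, eF]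
      by_cases hc : a' = a ∧ b' = b
      · rw [if_pos hc, if_neg (by omega), hc.1, hc.2]
      · rw [if_neg hc]
        exact hI a' ha' b' hb' (hstep a' b' h' hc)
  · intro a σ' ha hI a' ha' b' hb' h
    exact hI a' ha' b' hb' (by omega)
  intro σ₁ t₁ hI₁ hA₁ ht₁
  have hR₁ : ∀ a < n, ∀ b < n, σ₁.nat .R a b = if a = b then 1 else σ.nat .F a b :=
    fun a ha b hb => hI₁ a ha b hb (Or.inl ha)
  refine wp_forTo_zero n (fun l σ' => Warshall n (σ.nat .F) l (σ'.nat .R))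
    (n * (n * (40 + 14) + 24) + 10) rfl (fun _ _ => rfl) ?_ ?_ ?_
  · simp only [Mem.setNat_nat_of_ne, ne_eq, reduceCtorEq, not_false_eq_true]
    refine ⟨?_, ?_, ?_, ?_, fun _ _ _ _ _ hi => absurd hi (Nat.not_lt_zero _)⟩
    · intro a ha b hb
      rw [hR₁ a ha b hb]
      split_ifs
      · exact le_rfl
      · exact hF a ha b hb
    · intro a ha
      rw [hR₁ a ha a ha, if_pos rfl]
    · intro a b hab
      rw [hR₁ a hab.1 b hab.2.1, hab.2.2, ite_self]
    · intro a ha b hb h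
      rw [hR₁ a ha b hb] at h
      split_ifs at h with hab
      · rw [hab]; exact Reach.refl b
      · exact Relation.ReflTransGen.single ⟨ha, hb, h⟩
  · intro l σ₂ hl hW hll hA₂
    refine wp_forTo_forTo (fun a b σ' => (∀ a' < n, ∀ b' < n, σ'.nat .R a' b' ≤ 1) ∧
      (∀ a' < n, ∀ b' < n, σ'.nat .R a' b' = 1 ↔ σ₂.nat .R a' b' = 1 ∨
        ((a' < a ∨ (a' = a ∧ b' < b)) ∧ σ₂.nat .R a' l = 1 ∧ σ₂.nat .R l b' = 1))) 40 (by simp)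
      rfl rfl (by simp) ⟨hW.le_one, ?_⟩ ?_ ?_ ?_
    · intro a' _ b' _
      simp
    · rintro a b σ' ha hb ⟨h01, hI⟩ hσa hσb hA
      have hl' : σ'.nat .l 0 0 = l := by rw [hA.nat .l rfl, hll]
      have hal : σ'.nat .R a l = 1 ↔ σ₂.nat .R a l = 1 := by
        rw [hI a ha l hl]; tauto
      have hlb : σ'.nat .R l b = 1 ↔ σ₂.nat .R l b = 1 := by
        rw [hI l hl b hb]; tauto
      have hstep : ∀ a' b', (a' < a ∨ (a' = a ∧ b' < b + 1)) ↔
        (a' < a ∨ (a' = a ∧ b' < b)) ∨ (a' = a ∧ b' = b) := by omega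
      refine wp_when ?_ ?_
      · intro h
        simp [hσa, hσb, hl', hal, hlb] at h
        rw [wp_nset]
        simp only [NExp.eval, NExp.eval_ofNat, hσa, hσb, Mem.setNat_nat_self]
        refine ⟨by simp, ?_, ?_⟩
        · intro a' ha' b' hb'
          split_ifs
          · exact le_rfl
          · exact h01 a' ha' b' hb'
        · intro a' ha' b' hb'
          rw [hstep]
          by_cases hc : a' = a ∧ b' = b
          · rw [if_pos hc]
            obtain ⟨rfl, rfl⟩ := hc
            simp [h]
          · rw [if_neg hc, hI a' ha' b' hb']
            tauto
      · intro h
        simp [hσa, hσb, hl', hal, hlb] at h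
        refine ⟨by simp, h01, ?_⟩
        intro a' ha' b' hb'
        rw [hstep, hI a' ha' b' hb']
        refine or_congr_right ⟨fun h' => ⟨Or.inl h'.1, h'.2⟩, ?_⟩
        rintro ⟨h' | ⟨rfl, rfl⟩, h₁, h₂⟩
        · exact ⟨h', h₁, h₂⟩
        · exact absurd h₂ (h h₁)
    · rintro a σ' ha ⟨h01, hI⟩
      refine ⟨h01, fun a' ha' b' hb' => ?_⟩
      rw [hI a' ha' b' hb']
      refine or_congr_right (and_congr_left fun _ => ?_)
      omega
    · rintro σ' t ⟨h01, hI⟩ hA ht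
      refine ⟨ht, ?_⟩
      simp only [Mem.setNat_nat_of_ne, ne_eq, reduceCtorEq, not_false_eq_true]
      refine hW.succ hl h01 fun a ha b hb => ?_
      rw [hI a ha b hb]
      exact or_congr_right (and_iff_right (Or.inl ha))
  · intro σ' t hW hA ht
    refine ⟨hW, ?_⟩
    have h₁ : n * (n * (n * (40 + 14) + 24) + 10 + 14) = 54 * n ^ 3 + 24 * n ^ 2 + 24 * n := by ring
    have h₂ : n * (n * (30 + 14) + 24) = 44 * n ^ 2 + 24 * n := by ring
    simp only [NExp.cost] at ht
    rw [h₁] at ht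
    rw [h₂] at ht₁
    omega

/-! ### Evaluating the sets of reachable vertices -/

theorem filter_lt_succ_of_mem {U : Finset ℕ} {v : ℕ} (hv : v ∈ U) :
    U.filter (· < v + 1) = insert v (U.filter (· < v)) := by
  ext c
  simp only [mem_insert, mem_filter]
  constructor
  · rintro ⟨h₁, h₂⟩
    by_cases hc : c = v
    · exact Or.inl hc
    · exact Or.inr ⟨h₁, by omega⟩
  · rintro (rfl | h)
    · exact ⟨hv, by omega⟩
    · exact ⟨h.1, by omega⟩

theorem filter_lt_succ_of_notMem {U : Finset ℕ} {v : ℕ} (hv : v ∉ U) :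
    U.filter (· < v + 1) = U.filter (· < v) := by
  refine filter_congr fun c hc => ?_
  have : c ≠ v := fun h => hv (h ▸ hc)
  omega

theorem filter_lt_zero (U : Finset ℕ) : U.filter (· < 0) = ∅ :=
  filter_false_of_mem fun c _ => Nat.not_lt_zero c

theorem disjoint_repr {cls : ℕ → ℕ} {Y : Finset ℕ} {v : ℕ} (hv : v < n) (hvY : v ∉ Y) :
    Disjoint (repr n cls Y) (univ.filter fun j : Fin n => cls j = v) := by
  rw [disjoint_left]
  intro j h₁ h₂
  rw [mem_repr] at h₁
  simp only [mem_filter, mem_univ, true_and] at h₂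
  rw [h₂] at h₁
  exact h₁.elim hv.ne hvY

theorem repr_insert (cls : ℕ → ℕ) (Y : Finset ℕ) (v : ℕ) :
    repr n cls (insert v Y) =
      repr n cls Y ∪ univ.filter fun j : Fin n => cls j = v := by
  ext j
  simp only [mem_repr, mem_insert, mem_union, mem_filter, mem_univ,
    true_and]
  tauto

/-- The set represented by the vertices that satisfy the condition `cond` is evaluated incrementally,
in quadratic time. -/
theorem wp_insertClasses {cond : BExp} {cls : ℕ → ℕ} {U : Finset ℕ} (hcost : cond.cost ≤ 40)
    (hU : ∀ v ∈ U, v < n)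
    (hcond : ∀ b < n, ∀ σ', Agree (forTo .b 0 .size (when cond (insertClass (.get .b 0 0)))) σ σ' →
      σ'.nat .b 0 0 = b → (cond.eval n σ' ↔ b ∈ U))
    (hlist : Listing (σ.nat .start) (σ.nat .mem)
      (fun v => univ.filter fun j : Fin n => cls j = v))
    (hQ : QRep σ (repr n cls ∅))
    (post : ∀ σ' t, QRep σ' (repr n cls U) →
      Agree (forTo .b 0 .size (when cond (insertClass (.get .b 0 0)))) σ σ' →
      t ≤ 60 * n ^ 2 + 200 * n + 10 → Q σ' t) :
    wp f (forTo .b 0 .size (when cond (insertClass (.get .b 0 0)))) σ Q := by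
  refine wp_forTo_zero n (fun b σ' => QRep σ' (repr n cls (U.filter (· < b)))) (60 * n + 110) rfl
    (fun _ _ => rfl) ?_ ?_ ?_
  · rw [filter_lt_zero]
    exact hQ.congr rfl rfl
  · intro b σ' hb hI hbb hA
    refine wp_when ?_ ?_
    · intro h
      have hbU := (hcond b hb σ' hA hbb).1 h
      have hd : Disjoint (repr n cls (U.filter (· < b)))
          (univ.filter fun j : Fin n => cls j = b) := disjoint_repr hb (by simp)
      refine wp_insertClass (w := b) (B := repr n cls (U.filter (· < b)))
        (Cl := fun v => univ.filter fun j : Fin n => cls j = v)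
        (fun σ'' hA' => by simp [hA'.nat .b rfl, hbb]) (by simp)
        (by rw [hA.nat .start rfl, hA.nat .mem rfl]; exact hlist) hb hI hd ?_
      intro σ'' t hQ' hA' ht
      rw [← repr_insert] at hQ'
      rw [← filter_lt_succ_of_mem hbU] at hQ'
      refine ⟨?_, hQ'.congr (by simp) (by simp)⟩
      have := card_le_univ (univ.filter fun j : Fin n => cls j = b)
      rw [Fintype.card_fin] at this
      omega
    · intro h
      have hbU : b ∉ U := fun h' => h ((hcond b hb σ' hA hbb).2 h')
      rw [filter_lt_succ_of_notMem hbU]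
      exact ⟨by omega, hI.congr (by simp) (by simp)⟩
  · intro σ' t hI hA ht
    rw [filter_true_of_mem hU] at hI
    refine post σ' t hI hA ?_
    have h₁ : n * (60 * n + 110 + 14) = 60 * n ^ 2 + 124 * n := by ring
    simp only [NExp.cost] at ht
    rw [h₁] at ht
    omega

section

/-- The memory represents a state that satisfies the invariant of the main loop. -/
structure Rep (f : Finset (Fin n) → ℝ) (ms : ℝ) (V : Finset ℕ) (fh : Finset (Fin n) → ℝ)
    (σ : Mem) : Prop where
  inv : Inv f ms V (fun j => σ.nat .cls j 0) (σ.nat .F) fh (σ.real .fV 0 0) (σ.real .off 0 0)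
  flags : ∀ v < n, σ.nat .V v 0 = if v ∈ V then 1 else 0
  card : σ.nat .nV 0 0 = V.card
  out : ∀ j < n, σ.nat .X j 0 ≠ 0 ↔ σ.nat .cls j 0 = n
  le_one : ∀ a < n, ∀ b < n, σ.nat .F a b ≤ 1

variable {ms : ℝ} {V : Finset ℕ} {fh : Finset (Fin n) → ℝ}

theorem Rep.congr (h : Rep f ms V fh σ) {σ' : Mem}
    (hN : ∀ a, a = .cls ∨ a = .F ∨ a = .V ∨ a = .nV ∨ a = .X → σ'.nat a = σ.nat a)
    (hfV : σ'.real .fV = σ.real .fV) (hoff : σ'.real .off = σ.real .off) : Rep f ms V fh σ' := by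
  refine ⟨?_, ?_, ?_, ?_, ?_⟩
  · rw [hN .cls (by simp), hN .F (by simp), hfV, hoff]; exact h.inv
  · rw [hN .V (by simp)]; exact h.flags
  · rw [hN .nV (by simp)]; exact h.card
  · rw [hN .cls (by simp), hN .X (by simp)]; exact h.out
  · rw [hN .F (by simp)]; exact h.le_one

theorem Rep.set_X (h : Rep f ms V fh σ) :
    σ.set n .X = repr n (fun j => σ.nat .cls j 0) ∅ := by
  ext j
  rw [Mem.mem_set, mem_repr, h.out j j.2]
  simp

/-- The scan over the vertices for the largest marginal value. -/
theorem wp_computeEta (hM : Rep f ms V fh σ) (hV : V.Nonempty)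
    (hlist : Listing (σ.nat .start) (σ.nat .mem)
      (fun v => univ.filter fun j : Fin n => σ.nat .cls j 0 = v))
    (hR : ∀ a < n, ∀ b < n, σ.nat .R a b = 1 ↔ Reach n (σ.nat .F) a b) :
    wp f computeEta σ (fun σ' t => (σ'.nat .u 0 0 ∈ V ∧
      σ'.real .eta 0 0 =
        topMarginal (fun j => σ.nat .cls j 0) (σ.nat .F) V fh (σ'.nat .u 0 0) ∧
      σ'.real .fu 0 0 = fh (repr n (fun j => σ.nat .cls j 0)
        (reachSet n (σ.nat .F) V (σ'.nat .u 0 0))) - σ.real .off 0 0 ∧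
      ∀ v ∈ V, topMarginal (fun j => σ.nat .cls j 0) (σ.nat .F) V fh v ≤ σ'.real .eta 0 0) ∧
      t ≤ 60 * n ^ 3 + 500 * n ^ 2 + 1000 * n + 100) := by
  set cls : ℕ → ℕ := fun j => σ.nat .cls j 0 with hcls
  set F := σ.nat .F with hF
  set off := σ.real .off 0 0 with hoff
  unfold computeEta
  rw [wp_seq, wp_nset]
  refine wp_forTo_zero n (fun v' σ' => (σ'.nat .uSet 0 0 = 0 ∧ ∀ v ∈ V, v' ≤ v) ∨
    (σ'.nat .uSet 0 0 = 1 ∧ σ'.nat .u 0 0 ∈ V ∧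
      σ'.real .eta 0 0 = topMarginal cls F V fh (σ'.nat .u 0 0) ∧
      σ'.real .fu 0 0 = fh (repr n cls (reachSet n F V (σ'.nat .u 0 0))) - off ∧
      ∀ v ∈ V, v < v' → topMarginal cls F V fh v ≤ σ'.real .eta 0 0))
    (60 * n ^ 2 + 400 * n + 500) rfl (fun _ _ => rfl) (Or.inl (by simp)) ?_ ?_
  · intro v σ₁ hv hI hvv hA
    have e₁ : σ₁.nat .V = σ.nat .V := by rw [hA.nat .V rfl]; simp
    refine wp_when ?_ ?_
    swap
    · intro hb
      simp [hvv, e₁, hM.flags v hv] at hb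
      refine ⟨by simp, ?_⟩
      simp only [Mem.setNat_nat_of_ne, Mem.setNat_real, ne_eq, reduceCtorEq, not_false_eq_true]
      rcases hI with ⟨h₁, h₂⟩ | ⟨h₁, h₂, h₃, h₄, h₅⟩
      · refine Or.inl ⟨h₁, fun c hc => ?_⟩
        have := h₂ c hc
        have : c ≠ v := fun h => hb (h ▸ hc)
        omega
      · refine Or.inr ⟨h₁, h₂, h₃, h₄, fun c hc hcv => h₅ c hc ?_⟩
        have : c ≠ v := fun h => hb (h ▸ hc)
        omega
    intro hb
    simp [hvv, e₁, hM.flags v hv] at hb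
    rw [wp_seq]
    refine wp_mono (wp_load (by simp) (by simp) (by simp)) ?_
    rintro σ₂ t₂ ⟨hQ₂, ht₂⟩ hA₂
    have eX : σ₁.set n .X = repr n cls ∅ := by
      rw [← hM.set_X]
      exact Mem.set_congr (by rw [hA.nat .X rfl]; simp)
    rw [eX] at hQ₂
    have eR₂ : σ₂.nat .R = σ.nat .R := by rw [hA₂.nat .R rfl, hA.nat .R rfl]; simp
    have ev₂ : σ₂.nat .v 0 0 = v := by rw [hA₂.nat .v rfl, hvv]
    have hl₂ : Listing (σ₂.nat .start) (σ₂.nat .mem)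
        (fun v => univ.filter fun j : Fin n => cls j = v) := by
      rw [hA₂.nat .start rfl, hA₂.nat .mem rfl, hA.nat .start rfl, hA.nat .mem rfl]
      simpa using hlist
    rw [wp_seq]
    set U := reachSet n F V v with hU
    have hvU : v ∈ U := mem_reachSet.2 ⟨hb, Reach.refl v⟩
    refine wp_insertClasses (cls := cls) (U := U.erase v) (by simp)
      (fun c hc => hM.inv.lt c (mem_reachSet.1 (mem_of_mem_erase hc)).1) ?_ hl₂ hQ₂ ?_
    · intro b hb' σ' hA' hbb
      have e₃ : σ'.nat .R = σ.nat .R := by rw [hA'.nat .R rfl, eR₂]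
      have e₄ : σ'.nat .v 0 0 = v := by rw [hA'.nat .v rfl, ev₂]
      simp only [BExp.eval, NExp.eval, NExp.eval_ofNat, hbb, e₃, e₄, hR v hv b hb',
        mem_erase, hU, mem_reachSet]
      constructor
      · rintro ⟨h₁, h₂⟩
        exact ⟨h₂, hM.inv.reach_mem hb h₁, h₁⟩
      · rintro ⟨h₁, h₂, h₃⟩
        exact ⟨h₃, h₁⟩
    intro σ₃ t₃ hQ₃ hA₃ ht₃
    have eoff₃ : σ₃.real .off = σ.real .off := by
      rw [hA₃.real .off rfl, hA₂.real .off rfl, hA.real .off rfl]; simp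
    have efV₃ : σ₃.real .fV = σ.real .fV := by
      rw [hA₃.real .fV rfl, hA₂.real .fV rfl, hA.real .fV rfl]; simp
    have ev₃ : σ₃.nat .v 0 0 = v := by rw [hA₃.nat .v rfl, ev₂]
    have hfh := hM.inv.fh_eq
    have htau := hM.inv.tau
    rw [wp_seq]
    refine wp_evalQ (fh := fh) hQ₃ hfh (by rw [eoff₃, efV₃]; exact htau) (by simp) ?_
    intro t₄ ht₄
    rw [wp_seq]
    refine wp_insertClass (w := v) (Cl := fun v => univ.filter fun j : Fin n => cls j = v)
      (fun σ' hA' => by simp [hA'.nat .v rfl, ev₃]) (by simp) ?_ hv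
      (hQ₃.congr (by simp) (by simp)) (disjoint_repr hv (by simp)) ?_
    · simp only [Mem.setReal_nat]
      rw [hA₃.nat .start rfl, hA₃.nat .mem rfl]
      exact hl₂
    intro σ₅ t₅ hQ₅ hA₅ ht₅
    rw [← repr_insert, insert_erase hvU] at hQ₅
    have eoff₅ : σ₅.real .off = σ.real .off := by rw [hA₅.real .off rfl]; simp [eoff₃]
    have efV₅ : σ₅.real .fV = σ.real .fV := by rw [hA₅.real .fV rfl]; simp [efV₃]
    have er₂ : σ₅.real .r₂ 0 0 = fh (repr n cls (U.erase v)) - off := by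
      rw [hA₅.real .r₂ rfl]; simp [eoff₃, hoff]
    rw [wp_seq]
    refine wp_evalQ (fh := fh) hQ₅ hfh (by rw [eoff₅, efV₅]; exact htau) (by simp) ?_
    intro t₆ ht₆
    have ev₅ : σ₅.nat .v 0 0 = v := by rw [hA₅.nat .v rfl]; simp [ev₃]
    have eu₅ : σ₅.nat .u = σ₁.nat .u := by
      rw [hA₅.nat .u rfl]; simp [hA₃.nat .u rfl, hA₂.nat .u rfl]
    have es₅ : σ₅.nat .uSet = σ₁.nat .uSet := by
      rw [hA₅.nat .uSet rfl]; simp [hA₃.nat .uSet rfl, hA₂.nat .uSet rfl]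
    have ee₅ : σ₅.real .eta = σ₁.real .eta := by
      rw [hA₅.real .eta rfl]; simp [hA₃.real .eta rfl, hA₂.real .eta rfl]
    have ef₅ : σ₅.real .fu = σ₁.real .fu := by
      rw [hA₅.real .fu rfl]; simp [hA₃.real .fu rfl, hA₂.real .fu rfl]
    have hd : fh (repr n cls U) - off - (fh (repr n cls (U.erase v)) - off) =
        topMarginal cls F V fh v := by
      unfold topMarginal; rw [hU]; ring
    have hT : t₂ + (t₃ + (t₄ + (t₅ + t₆))) ≤ 60 * n ^ 2 + 400 * n + 300 := by
      have := card_le_univ (univ.filter fun j : Fin n => cls j = v)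
      rw [Fintype.card_fin] at this
      omega
    rw [wp_seq, wp_rset]
    refine wp_when ?_ ?_
    · intro h
      simp [es₅, ee₅, er₂, eoff₅, ← hoff, hd] at h
      simp only [wp_seq, wp_nset, wp_rset]
      refine ⟨by simp; omega, Or.inr ?_⟩
      simp [ev₅, er₂, eoff₅, ← hoff, hd]
      refine ⟨hb, hU ▸ rfl, fun c hc hcv => ?_⟩
      by_cases hcv' : c = v
      · rw [hcv']
      · rcases hI with ⟨h₁, h₂⟩ | ⟨h₁, h₂, h₃, h₄, h₅⟩
        · exact absurd (h₂ c hc) (by omega)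
        · refine (h₅ c hc (by omega)).trans ?_
          rcases h with h | h
          · omega
          · exact h.le
    · intro h
      simp [es₅, ee₅, er₂, eoff₅, ← hoff, hd] at h
      refine ⟨by simp; omega, Or.inr ?_⟩
      simp [es₅, eu₅, ee₅, ef₅]
      rcases hI with ⟨h₁, h₂⟩ | ⟨h₁, h₂, h₃, h₄, h₅⟩
      · exact absurd h₁ h.1
      · refine ⟨h₁, h₂, h₃, h₄, fun c hc hcv => ?_⟩
        by_cases hcv' : c = v
        · rw [hcv']; exact h.2
        · exact h₅ c hc (by omega)
  · intro σ' t hI hA ht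
    refine ⟨?_, ?_⟩
    · obtain ⟨v, hv⟩ := hV
      rcases hI with ⟨h₁, h₂⟩ | ⟨h₁, h₂, h₃, h₄, h₅⟩
      · exact absurd (h₂ v hv) (not_le.2 (hM.inv.lt v hv))
      · exact ⟨h₂, h₃, h₄, fun c hc => h₅ c hc (hM.inv.lt c hc)⟩
    · have h₁ : n * (60 * n ^ 2 + 400 * n + 500 + 14) = 60 * n ^ 3 + 400 * n ^ 2 + 514 * n := by
        ring
      simp at ht ⊢
      omega

end

/-! ### Deletion and contraction of vertices -/

theorem wp_deleteVertex {v : ℕ} (hv : σ.nat .v 0 0 = v) :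
    wp f deleteVertex σ (fun σ' t =>
      (∀ x, σ'.nat .V x 0 = if x = v then 0 else σ.nat .V x 0) ∧
      σ'.nat .nV 0 0 = σ.nat .nV 0 0 - 1 ∧
      (∀ x < n, ∀ y < n, σ'.nat .F x y = if x = v ∨ y = v then 0 else σ.nat .F x y) ∧
      t ≤ 60 * n + 60) := by
  unfold deleteVertex
  simp only [wp_seq, wp_nset]
  refine wp_forTo_zero n (fun a σ' => ∀ x y, σ'.nat .F x y =
    if (x = v ∧ y < a) ∨ (y = v ∧ x < a) then 0 else σ.nat .F x y) 30 rfl (fun _ _ => rfl)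
    (by simp) ?_ ?_
  · intro a σ' ha hI haa hA
    have ev : σ'.nat .v 0 0 = v := by rw [hA.nat .v rfl]; simp [hv]
    simp only [wp_seq, wp_nset]
    refine ⟨by simp, fun x y => ?_⟩
    simp only [NExp.eval, NExp.eval_ofNat, ev, haa, Mem.setNat_nat_self, Mem.setNat_nat_of_ne,
      ne_eq, reduceCtorEq, not_false_eq_true, hI]
    by_cases h₁ : x = v ∧ y = a
    · obtain ⟨rfl, rfl⟩ := h₁
      simp
    by_cases h₂ : x = a ∧ y = v
    · obtain ⟨rfl, rfl⟩ := h₂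
      simp
    rw [if_neg h₁, if_neg h₂]
    refine if_congr ?_ rfl rfl
    omega
  · intro σ' t hI hA ht
    refine ⟨?_, ?_, ?_, ?_⟩
    · intro x
      rw [hA.nat .V rfl]
      simp [hv]
    · rw [hA.nat .nV rfl]
      simp
    · intro x hx y hy
      rw [hI]
      refine if_congr ?_ rfl rfl
      omega
    · simp at ht ⊢
      omega

/-- The contraction of the vertices in `M` to the vertex `u`. -/
def mergeInto (u : ℕ) (M : Finset ℕ) (x : ℕ) : ℕ := if x ∈ M then u else x

/-- The state `σ'` arises from `σ` by the contraction of the vertices in `M` to the vertex `u`, up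
to the self-loops of the digraph. -/
structure Contracted (n : ℕ) (V : Finset ℕ) (u : ℕ) (M : Finset ℕ) (σ σ' : Mem) : Prop where
  cls : ∀ j < n, σ'.nat .cls j 0 = mergeInto u M (σ.nat .cls j 0)
  flags : ∀ x < n, σ'.nat .V x 0 = if x ∈ V \ M then 1 else 0
  card : σ'.nat .nV 0 0 = (V \ M).card
  le_one : ∀ a < n, ∀ b < n, σ'.nat .F a b ≤ 1
  sound : ∀ a b, Arc n (σ'.nat .F) a b → a ∈ V \ M ∧ b ∈ V \ M ∧
    ∃ a₀ b₀, Arc n (σ.nat .F) a₀ b₀ ∧ mergeInto u M a₀ = a ∧ mergeInto u M b₀ = b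
  complete : ∀ a b, Arc n (σ.nat .F) a b → mergeInto u M a ≠ mergeInto u M b →
    Arc n (σ'.nat .F) (mergeInto u M a) (mergeInto u M b)

theorem Contracted.congr {V : Finset ℕ} {u : ℕ} {M : Finset ℕ} {σ σ₁ σ₂ : Mem}
    (h : Contracted n V u M σ σ₁)
    (hN : ∀ a, a = .cls ∨ a = .F ∨ a = .V ∨ a = .nV → σ₂.nat a = σ₁.nat a) :
    Contracted n V u M σ σ₂ := by
  refine ⟨?_, ?_, ?_, ?_, ?_, ?_⟩
  · rw [hN .cls (by simp)]; exact h.cls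
  · rw [hN .V (by simp)]; exact h.flags
  · rw [hN .nV (by simp)]; exact h.card
  · rw [hN .F (by simp)]; exact h.le_one
  · rw [hN .F (by simp)]; exact h.sound
  · rw [hN .F (by simp)]; exact h.complete

section

local infixr:20 " ;; " => Cmd.seq
local infix:40 " ≔ " => Cmd.nset
local infix:50 " =ₙ " => BExp.natEq

open NName

/-- Contract the vertex `v` to the vertex `u`. -/
def mergeVertex : Cmd :=
  forTo j 0 .size (when (cls.at₁ j =ₙ v) (cls.at₁ j ≔ u)) ;;
  forTo a 0 .size (
    when (F.at₂ v a =ₙ 1) (F.at₂ u a ≔ 1) ;;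
    when (F.at₂ a v =ₙ 1) (F.at₂ a u ≔ 1)) ;;
  deleteVertex

end

/-- The arcs of `F'` comprise the arcs of `F` and project under `φ` to the same arcs. -/
structure SameArcs (n : ℕ) (φ : ℕ → ℕ) (F F' : ℕ → ℕ → ℕ) : Prop where
  le_one : ∀ x < n, ∀ y < n, F' x y ≤ 1
  sound : ∀ x y, Arc n F' x y → ∃ x₀ y₀, Arc n F x₀ y₀ ∧ φ x₀ = φ x ∧ φ y₀ = φ y
  mono : ∀ x y, Arc n F x y → Arc n F' x y

theorem SameArcs.insert {φ : ℕ → ℕ} {F F' F'' : ℕ → ℕ → ℕ} (h : SameArcs n φ F F')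
    {a b c d : ℕ} (hcd : Arc n F' c d) (hc : φ c = φ a) (hd : φ d = φ b) (ha : a < n) (hb : b < n)
    (hF : ∀ x y, F'' x y = if x = a ∧ y = b then 1 else F' x y) :
    SameArcs n φ F F'' ∧ Arc n F'' a b ∧ ∀ x y, Arc n F' x y → Arc n F'' x y := by
  have hmono : ∀ x y, Arc n F' x y → Arc n F'' x y :=
    fun x y hxy => ⟨hxy.1, hxy.2.1, by rw [hF, hxy.2.2, ite_self]⟩
  refine ⟨⟨fun x hx y hy => ?_, ?_, fun x y hxy => hmono x y (h.mono x y hxy)⟩,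
    ⟨ha, hb, by rw [hF, if_pos ⟨rfl, rfl⟩]⟩, hmono⟩
  · rw [hF]
    split_ifs
    · exact le_rfl
    · exact h.le_one x hx y hy
  · rintro x y ⟨hx, hy, hxy⟩
    rw [hF] at hxy
    split_ifs at hxy with hab
    · obtain ⟨x₀, y₀, h₁, h₂, h₃⟩ := h.sound c d hcd
      exact ⟨x₀, y₀, h₁, by rw [h₂, hc, hab.1], by rw [h₃, hd, hab.2]⟩
    · exact h.sound x y ⟨hx, hy, hxy⟩

/-- The vertices between `w` and `u` are contracted to `u` one by one; `M` is the set of those already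
contracted. -/
theorem wp_mergeVertex {V M : Finset ℕ} {u v : ℕ} {σ₀ : Mem} (hV : ∀ v ∈ V, v < n) (hu : u ∈ V)
    (hv : v ∈ V) (huM : u ∉ M) (hvM : v ∉ M) (huv : u ≠ v) (hσu : σ.nat .u 0 0 = u)
    (hσv : σ.nat .v 0 0 = v) (h : Contracted n V u M σ₀ σ) :
    wp f mergeVertex σ (fun σ' t =>
      Contracted n V u (insert v M) σ₀ σ' ∧
      t ≤ 300 * n + 200) := by
  have hun := hV u hu
  have hvn := hV v hv
  have hvu : v ≠ u := huv.symm
  -- Contracting `v` after `M` is contracting both.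
  have hq : ∀ x, mergeInto u (insert v M) x = mergeInto u {v} (mergeInto u M x) := by
    intro x
    unfold mergeInto
    by_cases h₁ : x ∈ M
    · simp [h₁, huv]
    · by_cases h₂ : x = v
      · simp [hvM, h₂]
      · simp [h₁, h₂]
  unfold mergeVertex
  rw [wp_seq]
  refine wp_forTo_zero n (fun j' σ' => ∀ j, σ'.nat .cls j 0 =
    if j < j' then mergeInto u {v} (σ.nat .cls j 0) else σ.nat .cls j 0) 30 rfl (fun _ _ => rfl)
    (by simp) ?_ ?_
  · intro j σ' hj hI hjj hA
    have eu : σ'.nat .u 0 0 = u := by rw [hA.nat .u rfl, hσu]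
    have ev : σ'.nat .v 0 0 = v := by rw [hA.nat .v rfl, hσv]
    have ec : σ'.nat .cls j 0 = σ.nat .cls j 0 := by rw [hI, if_neg (lt_irrefl j)]
    refine wp_when ?_ ?_
    · intro hb
      simp [hjj, ev, ec] at hb
      rw [wp_nset]
      refine ⟨by simp, fun j₁ => ?_⟩
      simp only [NExp.eval, NExp.eval_ofNat, hjj, eu, Mem.setNat_nat_self, Mem.setNat_nat_of_ne,
        ne_eq, reduceCtorEq, not_false_eq_true, and_true]
      by_cases hc : j₁ = j
      · rw [if_pos hc, if_pos (by omega), hc, hb]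
        simp [mergeInto]
      · rw [if_neg hc, hI]
        refine if_congr ?_ rfl rfl
        omega
    · intro hb
      simp [hjj, ev, ec] at hb
      refine ⟨by simp, fun j₁ => ?_⟩
      simp only [Mem.setNat_nat_of_ne, ne_eq, reduceCtorEq, not_false_eq_true]
      rw [hI]
      by_cases hc : j₁ = j
      · rw [if_neg (by omega), if_pos (by omega), hc]
        simp [mergeInto, hb]
      · refine if_congr ?_ rfl rfl
        omega
  intro σ₁ t₁ hI₁ hA₁ ht₁
  have eF₁ : σ₁.nat .F = σ.nat .F := hA₁.nat .F rfl
  have eu₁ : σ₁.nat .u 0 0 = u := by rw [hA₁.nat .u rfl, hσu]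
  have ev₁ : σ₁.nat .v 0 0 = v := by rw [hA₁.nat .v rfl, hσv]
  rw [wp_seq]
  refine wp_forTo_zero n (fun a σ' => SameArcs n (mergeInto u {v}) (σ.nat .F) (σ'.nat .F) ∧
    (∀ y < a, Arc n (σ.nat .F) v y → Arc n (σ'.nat .F) u y) ∧
    (∀ x < a, Arc n (σ.nat .F) x v → Arc n (σ'.nat .F) x u)) 60 rfl (fun _ _ => rfl) ?_ ?_ ?_
  · simp only [Mem.setNat_nat_of_ne, ne_eq, reduceCtorEq, not_false_eq_true, eF₁]
    exact ⟨⟨h.le_one, fun x y hxy => ⟨x, y, hxy, rfl, rfl⟩, fun _ _ h => h⟩,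
      fun y hy => absurd hy (Nat.not_lt_zero y), fun x hx => absurd hx (Nat.not_lt_zero x)⟩
  · intro a σ₂ ha hI haa hA₂
    have eu₂ : σ₂.nat .u 0 0 = u := by rw [hA₂.nat .u rfl, eu₁]
    have ev₂ : σ₂.nat .v 0 0 = v := by rw [hA₂.nat .v rfl, ev₁]
    have hqu : mergeInto u {v} v = mergeInto u {v} u := by simp [mergeInto, huv]
    rw [wp_seq]
    -- The first conditional assignment takes care of the arcs from `v`.
    have hfirst : wp f (when (.natEq (.get .F (.get .v 0 0) (.get .a 0 0)) 1)
        (.nset ⟨.F, .get .u 0 0, .get .a 0 0⟩ 1)) σ₂ (fun σ' t => t ≤ 20 ∧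
        SameArcs n (mergeInto u {v}) (σ.nat .F) (σ'.nat .F) ∧
        (∀ y < a + 1, Arc n (σ.nat .F) v y → Arc n (σ'.nat .F) u y) ∧
        (∀ x < a, Arc n (σ.nat .F) x v → Arc n (σ'.nat .F) x u)) := by
      obtain ⟨h₁, h₂, h₃⟩ := hI
      refine wp_when ?_ ?_
      · intro hb
        simp [haa, ev₂] at hb
        rw [wp_nset]
        simp only [NExp.eval, NExp.eval_ofNat, eu₂, haa]
        obtain ⟨hS, hua, hmono⟩ := h₁.insert (F'' := (σ₂.setNat .F u a 1).nat .F) ⟨hvn, ha, hb⟩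
          hqu rfl hun ha fun x y => by simp
        refine ⟨by simp, hS, ?_, fun x hx hxv => hmono x u (h₃ x hx hxv)⟩
        intro y hy hvy
        by_cases hc : y = a
        · exact hc ▸ hua
        · exact hmono u y (h₂ y (by omega) hvy)
      · intro hb
        simp [haa, ev₂] at hb
        refine ⟨by simp, h₁, ?_, h₃⟩
        intro y hy hvy
        by_cases hc : y = a
        · subst hc
          exact absurd (h₁.mono v y hvy).2.2 hb
        · exact h₂ y (by omega) hvy
    refine wp_mono hfirst ?_
    rintro σ₃ t₃ ⟨ht₃, h₁, h₂, h₃⟩ hA₃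
    have eu₃ : σ₃.nat .u 0 0 = u := by rw [hA₃.nat .u rfl, eu₂]
    have ev₃ : σ₃.nat .v 0 0 = v := by rw [hA₃.nat .v rfl, ev₂]
    have ea₃ : σ₃.nat .a 0 0 = a := by rw [hA₃.nat .a rfl, haa]
    refine wp_when ?_ ?_
    · intro hb
      simp [ea₃, ev₃] at hb
      rw [wp_nset]
      simp only [NExp.eval, NExp.eval_ofNat, eu₃, ea₃]
      obtain ⟨hS, hau, hmono⟩ := h₁.insert (F'' := (σ₃.setNat .F a u 1).nat .F) ⟨ha, hvn, hb⟩
        rfl hqu ha hun fun x y => by simp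
      refine ⟨by simp; omega, hS, fun y hy hvy => hmono u y (h₂ y hy hvy), ?_⟩
      intro x hx hxv
      by_cases hc : x = a
      · exact hc ▸ hau
      · exact hmono x u (h₃ x (by omega) hxv)
    · intro hb
      simp [ea₃, ev₃] at hb
      refine ⟨by simp; omega, h₁, h₂, ?_⟩
      intro x hx hxv
      by_cases hc : x = a
      · subst hc
        exact absurd (h₁.mono x v hxv).2.2 hb
      · exact h₃ x (by omega) hxv
  rintro σ₂ t₂ ⟨h₁, h₂, h₃⟩ hA₂ ht₂
  refine wp_mono (wp_deleteVertex (v := v) (by rw [hA₂.nat .v rfl, ev₁])) ?_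
  rintro σ₃ t₃ ⟨hV₃, hnV₃, hF₃, ht₃⟩ hA₃
  have harc : ∀ x y, Arc n (σ₃.nat .F) x y ↔ x ≠ v ∧ y ≠ v ∧ Arc n (σ₂.nat .F) x y := by
    intro x y
    unfold Arc
    constructor
    · rintro ⟨hx, hy, hxy⟩
      rw [hF₃ x hx y hy] at hxy
      split_ifs at hxy with hc
      rw [not_or] at hc
      exact ⟨hc.1, hc.2, hx, hy, hxy⟩
    · rintro ⟨hxv, hyv, hx, hy, hxy⟩
      refine ⟨hx, hy, ?_⟩
      rw [hF₃ x hx y hy, if_neg (by tauto), hxy]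
  have hsd : ∀ x, x ∈ V \ insert v M ↔ x ∈ V \ M ∧ x ≠ v := by
    intro x
    simp only [mem_sdiff, mem_insert]
    tauto
  have hqv : ∀ x, x ≠ v → mergeInto u {v} x = x := by
    intro x hx
    simp [mergeInto, hx]
  refine ⟨⟨?_, ?_, ?_, ?_, ?_, ?_⟩, ?_⟩
  · intro j hj
    rw [hA₃.nat .cls rfl, hA₂.nat .cls rfl, hI₁ j, if_pos hj, h.cls j hj, hq]
  · intro x hx
    rw [hV₃ x, hA₂.nat .V rfl, hA₁.nat .V rfl, h.flags x hx]
    by_cases hc : x = v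
    · rw [if_pos hc, if_neg]
      rw [hsd]
      exact fun h => h.2 hc
    · rw [if_neg hc]
      refine if_congr ?_ rfl rfl
      rw [hsd]
      tauto
  · have : V \ insert v M = (V \ M).erase v := by
      ext x
      rw [hsd, mem_erase]
      tauto
    rw [hnV₃, hA₂.nat .nV rfl, hA₁.nat .nV rfl, h.card, this,
      card_erase_of_mem (mem_sdiff.2 ⟨hv, hvM⟩)]
  · intro x hx y hy
    rw [hF₃ x hx y hy]
    split_ifs
    · exact Nat.zero_le 1
    · exact h₁.le_one x hx y hy
  · intro x y hxy
    obtain ⟨hxv, hyv, hxy⟩ := (harc x y).1 hxy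
    obtain ⟨x₁, y₁, hxy₁, hx₁, hy₁⟩ := h₁.sound x y hxy
    rw [hqv x hxv] at hx₁
    rw [hqv y hyv] at hy₁
    obtain ⟨hx₂, hy₂, x₀, y₀, hxy₀, hx₀, hy₀⟩ := h.sound x₁ y₁ hxy₁
    have hmem : ∀ z₁ z, z₁ ∈ V \ M → mergeInto u {v} z₁ = z → z ∈ V \ M := by
      rintro z₁ z hz rfl
      unfold mergeInto
      split_ifs
      · exact mem_sdiff.2 ⟨hu, huM⟩
      · exact hz
    refine ⟨(hsd x).2 ⟨hmem _ _ hx₂ hx₁, hxv⟩, (hsd y).2 ⟨hmem _ _ hy₂ hy₁, hyv⟩, x₀, y₀, hxy₀,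
      by rw [hq, hx₀, hx₁], by rw [hq, hy₀, hy₁]⟩
  · intro x y hxy hne
    rw [hq, hq] at hne ⊢
    have hxy₁ := h.complete x y hxy fun h' => hne (by rw [h'])
    set x₁ := mergeInto u M x
    set y₁ := mergeInto u M y
    have hnv : ∀ z, mergeInto u {v} z ≠ v := by
      intro z
      unfold mergeInto
      split_ifs with hz
      · exact huv
      · simpa using hz
    refine (harc _ _).2 ⟨hnv _, hnv _, ?_⟩
    have hqu : mergeInto u {v} v = u := by simp [mergeInto]
    by_cases hx : x₁ = v <;> by_cases hy : y₁ = v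
    · exact absurd (by rw [hx, hy]) hne
    · rw [hx, hqu, hqv _ hy]
      exact h₂ y₁ hxy₁.2.1 (hx ▸ hxy₁)
    · rw [hy, hqu, hqv _ hx]
      exact h₃ x₁ hxy₁.1 (hy ▸ hxy₁)
    · rw [hqv _ hx, hqv _ hy]
      exact h₁.mono _ _ hxy₁
  · simp at ht₁ ht₂ ⊢
    omega

section

variable {ms : ℝ} {V : Finset ℕ} {fh : Finset (Fin n) → ℝ}

open Classical in
theorem wp_contract (hM : Rep f ms V fh σ) {u w : ℕ} (hu : u ∈ V) (hw : w ∈ V)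
    (hσu : σ.nat .u 0 0 = u) (hσw : σ.nat .w 0 0 = w)
    (hR : ∀ a < n, ∀ b < n, σ.nat .R a b = 1 ↔ Reach n (σ.nat .F) a b)
    (hwu : Reach n (σ.nat .F) w u) (huw : ¬ Reach n (σ.nat .F) u w)
    (hmin : ∀ Y ⊆ V, fh (repr n (fun j => σ.nat .cls j 0) Y) = ms → u ∈ Y → w ∈ Y)
    (post : ∀ σ' t V', Rep f ms V' fh σ' →
      progress n (fun j => σ.nat .cls j 0) (σ.nat .F) <
        progress n (fun j => σ'.nat .cls j 0) (σ'.nat .F) →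
      Agree contract σ σ' → t ≤ 400 * n ^ 2 + 400 * n + 100 → Q σ' t) : wp f contract σ Q := by
  have hun := hM.inv.lt u hu
  have hwn := hM.inv.lt w hw
  set B : Finset ℕ := V.filter fun v => Between n (σ.nat .F) w u v ∧ v ≠ u with hB
  have huB : u ∉ B := by simp [hB]
  have hmemB : ∀ v < n, (v ∈ B ↔ σ.nat .R w v = 1 ∧ σ.nat .R v u = 1 ∧ v ≠ u) := by
    intro v hv
    rw [hB, mem_filter, hR w hwn v hv, hR v hv u hun]
    constructor
    · rintro ⟨h₁, h₂, h₃⟩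
      exact ⟨h₂.1, h₂.2, h₃⟩
    · rintro ⟨h₁, h₂, h₃⟩
      exact ⟨hM.inv.reach_mem hw h₁, ⟨h₁, h₂⟩, h₃⟩
  unfold contract
  rw [wp_seq]
  refine wp_forTo_zero n (fun v σ' => Contracted n V u (B.filter (· < v)) σ σ')
    (300 * n + 250) rfl (fun _ _ => rfl) ?_ ?_ ?_
  · rw [filter_lt_zero]
    refine ⟨?_, ?_, ?_, ?_, ?_, ?_⟩
    · intro j _
      simp [mergeInto]
    · simpa using hM.flags
    · simpa using hM.card
    · exact hM.le_one
    · intro a b hab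
      have := hM.inv.arc a b hab
      exact ⟨by simpa using this.1, by simpa using this.2, a, b, hab, by simp [mergeInto],
        by simp [mergeInto]⟩
    · intro a b hab _
      simpa [mergeInto] using hab
  · intro v σ' hv hI hvv hA
    have eR : σ'.nat .R = σ.nat .R := hA.nat .R rfl
    have eu : σ'.nat .u 0 0 = u := by rw [hA.nat .u rfl, hσu]
    have ew : σ'.nat .w 0 0 = w := by rw [hA.nat .w rfl, hσw]
    refine wp_when ?_ ?_
    · intro hb
      simp only [BExp.eval, NExp.eval, NExp.eval_ofNat, eR, eu, ew, hvv] at hb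
      have hvB := (hmemB v hv).2 hb
      change wp f mergeVertex _ _
      refine wp_mono (wp_mergeVertex (fun x hx => hM.inv.lt x hx) hu (mem_filter.1 hvB).1
        (fun h => huB (mem_filter.1 h).1) (by simp) (fun h => hb.2.2 h.symm) eu hvv hI) ?_
      rintro σ'' t ⟨hC, ht⟩ hA'
      rw [filter_lt_succ_of_mem hvB]
      refine ⟨by simp; omega, hC.congr ?_⟩
      rintro a (rfl | rfl | rfl | rfl) <;> simp
    · intro hb
      simp only [BExp.eval, NExp.eval, NExp.eval_ofNat, eR, eu, ew, hvv] at hb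
      rw [filter_lt_succ_of_notMem fun h => hb ((hmemB v hv).1 h)]
      refine ⟨by simp, hI.congr ?_⟩
      rintro a (rfl | rfl | rfl | rfl) <;> simp
  intro σ₁ t₁ hC hA₁ ht₁
  rw [filter_true_of_mem fun x hx => hM.inv.lt x (mem_filter.1 hx).1] at hC
  have eu₁ : σ₁.nat .u 0 0 = u := by rw [hA₁.nat .u rfl, hσu]
  have hquot : ∀ x, quot n (σ.nat .F) w u x = mergeInto u B x := by
    intro x
    unfold quot mergeInto
    by_cases hx : x = u
    · rw [hx, ite_self, ite_self]
    · refine if_congr ?_ rfl rfl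
      rw [hB, mem_filter]
      exact ⟨fun h => ⟨hM.inv.reach_mem hw h.1, h, hx⟩, fun h => h.2.1⟩
  -- Deleting the loop at `u` affects neither of the two properties of the new digraph.
  set σ₂ : Mem := σ₁.setNat .F u u 0 with hσ₂
  have eF₂ : ∀ x y, σ₂.nat .F x y = if x = u ∧ y = u then 0 else σ₁.nat .F x y := fun x y => by
    simp [hσ₂]
  have hsub : ∀ x y, Arc n (σ₂.nat .F) x y → Arc n (σ₁.nat .F) x y := by
    rintro x y ⟨hx, hy, hxy⟩
    rw [eF₂] at hxy
    split_ifs at hxy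
    exact ⟨hx, hy, hxy⟩
  have hcls : ∀ j < n, σ₂.nat .cls j 0 = quot n (σ.nat .F) w u (σ.nat .cls j 0) := by
    intro j hj
    rw [hquot, ← hC.cls j hj, hσ₂]
    simp
  have hVB : (V.filter fun v => v = u ∨ ¬ Between n (σ.nat .F) w u v) = V \ B := by
    ext x
    rw [mem_filter, mem_sdiff, hB, mem_filter]
    tauto
  have eoff : σ₂.real .off = σ.real .off := by simp [hσ₂, hA₁.real .off rfl]
  have efV : σ₂.real .fV = σ.real .fV := by simp [hσ₂, hA₁.real .fV rfl]
  suffices H : Rep f ms (V \ B) fh σ₂ ∧ progress n (fun j => σ.nat .cls j 0) (σ.nat .F) <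
      progress n (fun j => σ₂.nat .cls j 0) (σ₂.nat .F) by
    have hfin : wp f (.nset ⟨.F, .get .u 0 0, .get .u 0 0⟩ 0) σ₁
        (fun σ' t => σ' = σ₂ ∧ t ≤ 10) := by
      rw [wp_nset]
      simp [eu₁, hσ₂]
    refine wp_mono (Q := fun σ' t => σ' = σ₂ ∧ t ≤ 10) hfin ?_
    rintro _ t₂ ⟨rfl, ht₂⟩ hA₂
    refine post σ₂ _ (V \ B) H.1 H.2 ?_ ?_
    · refine ⟨fun a ha => ?_, fun a ha => ?_⟩
      · have h₁ : a ≠ .F := by rintro rfl; simp [contract, forTo, when, Cmd.writesNat] at ha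
        rw [hσ₂, Mem.setNat_nat_of_ne _ h₁]
        refine hA₁.nat a ?_
        simp only [contract, Cmd.writesNat, Bool.or_eq_false_iff] at ha
        exact ha.1
      · rw [hσ₂, Mem.setNat_real]
        refine hA₁.real a ?_
        simp only [contract, Cmd.writesReal, Bool.or_eq_false_iff] at ha
        exact ha.1
    · have h₁ : n * (300 * n + 250 + 14) = 300 * n ^ 2 + 264 * n := by ring
      simp only [NExp.cost] at ht₁
      rw [h₁] at ht₁
      omega
  refine ⟨⟨?_, ?_, ?_, ?_, ?_⟩, ?_⟩
  · rw [efV, eoff]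
    refine hM.inv.contract hu hw hwu hmin hVB.symm hcls ?_ ?_
    · intro a b hab
      have := hC.sound a b (hsub a b hab)
      exact ⟨this.1, this.2.1⟩
    · intro a b hab
      obtain ⟨-, -, a₀, b₀, h₁, h₂, h₃⟩ := hC.sound a b (hsub a b hab)
      exact Or.inr ⟨a₀, b₀, h₁, by rw [hquot, h₂], by rw [hquot, h₃]⟩
  · intro x hx
    rw [← hC.flags x hx]
    simp [hσ₂]
  · rw [← hC.card]
    simp [hσ₂]
  · intro j hj
    have e₁ : σ₂.nat .X = σ.nat .X := by simp [hσ₂, hA₁.nat .X rfl]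
    rw [e₁, hM.out j hj, hcls j hj]
    rcases hM.inv.cases j hj with hc | hc
    · rw [hc, hquot, mergeInto, if_neg]
      rw [hB, mem_filter]
      exact fun h => hM.inv.ne_n h.1 rfl
    · have h₁ := hM.inv.ne_n hc
      refine ⟨fun h => absurd h h₁, fun h => ?_⟩
      unfold quot at h
      split_ifs at h
      · exact absurd h hun.ne
      · exact h
  · intro a ha b hb
    rw [eF₂]
    split_ifs
    · exact Nat.zero_le 1
    · exact hC.le_one a ha b hb
  · refine hM.inv.progress_contract hu hw hwu huw hcls ?_
    intro a b hab hne
    rw [hquot, hquot] at hne ⊢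
    obtain ⟨h₁, h₂, h₃⟩ := hC.complete a b hab hne
    refine ⟨h₁, h₂, ?_⟩
    rw [eF₂, if_neg, h₃]
    rintro ⟨h₄, h₅⟩
    exact hne (h₄.trans h₅.symm)

/-- The state `σ'` arises from `σ` by the deletion of the vertices in `M`. -/
structure Deleted (n : ℕ) (V M : Finset ℕ) (σ σ' : Mem) : Prop where
  cls : ∀ j < n, σ'.nat .cls j 0 = if σ.nat .cls j 0 ∈ M then n else σ.nat .cls j 0
  out : ∀ j < n, σ'.nat .X j 0 ≠ 0 ↔ σ'.nat .cls j 0 = n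
  flags : ∀ x < n, σ'.nat .V x 0 = if x ∈ V \ M then 1 else 0
  card : σ'.nat .nV 0 0 = (V \ M).card
  graph : ∀ a < n, ∀ b < n, σ'.nat .F a b = if a ∈ M ∨ b ∈ M then 0 else σ.nat .F a b

theorem Deleted.congr {M : Finset ℕ} {σ σ₁ σ₂ : Mem} (h : Deleted n V M σ σ₁)
    (hN : ∀ a, a = .cls ∨ a = .X ∨ a = .F ∨ a = .V ∨ a = .nV → σ₂.nat a = σ₁.nat a) :
    Deleted n V M σ σ₂ := by
  refine ⟨?_, ?_, ?_, ?_, ?_⟩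
  · rw [hN .cls (by simp)]; exact h.cls
  · rw [hN .cls (by simp), hN .X (by simp)]; exact h.out
  · rw [hN .V (by simp)]; exact h.flags
  · rw [hN .nV (by simp)]; exact h.card
  · rw [hN .F (by simp)]; exact h.graph

section

local infixr:20 " ;; " => Cmd.seq
local infix:40 " ≔ " => Cmd.nset
local infix:50 " =ₙ " => BExp.natEq

open NName

/-- Delete the vertex `v` and add its class to the output. -/
def removeVertex : Cmd :=
  forTo j 0 .size (
    when (cls.at₁ j =ₙ v) (
      X.at₁ j ≔ 1 ;;
      cls.at₁ j ≔ .size)) ;;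
  deleteVertex

end

/-- The vertices are deleted one by one; `M` is the set of those already deleted. -/
theorem wp_removeVertex {M : Finset ℕ} {v : ℕ} {σ₀ : Mem} (hvn : v < n) (hv : v ∈ V)
    (hvM : v ∉ M) (hσv : σ.nat .v 0 0 = v) (h : Deleted n V M σ₀ σ) :
    wp f removeVertex σ (fun σ' t =>
      Deleted n V (insert v M) σ₀ σ' ∧
      t ≤ 200 * n + 200) := by
  unfold removeVertex
  rw [wp_seq]
  refine wp_forTo_zero n (fun j' σ' => (∀ j, σ'.nat .cls j 0 =
    if j < j' ∧ σ.nat .cls j 0 = v then n else σ.nat .cls j 0) ∧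
    ∀ j < n, σ'.nat .X j 0 ≠ 0 ↔ σ'.nat .cls j 0 = n) 40 rfl (fun _ _ => rfl)
    (by simpa using h.out) ?_ ?_
  · rintro j σ' hj ⟨hI, hX⟩ hjj hA
    have ev : σ'.nat .v 0 0 = v := by rw [hA.nat .v rfl, hσv]
    have ec : σ'.nat .cls j 0 = σ.nat .cls j 0 := by
      rw [hI, if_neg fun h => lt_irrefl j h.1]
    refine wp_when ?_ ?_
    · intro hb
      simp [hjj, ev, ec] at hb
      rw [wp_seq, wp_nset, wp_nset]
      refine ⟨by simp, fun j₁ => ?_, fun j₁ hj₁ => ?_⟩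
      · simp only [NExp.eval, NExp.eval_ofNat, hjj, Mem.setNat_nat_self, Mem.setNat_nat_of_ne,
          ne_eq, reduceCtorEq, not_false_eq_true, and_true]
        by_cases hc : j₁ = j
        · rw [if_pos hc, if_pos ⟨by omega, hc ▸ hb⟩]
        · rw [if_neg hc, hI]
          refine if_congr ?_ rfl rfl
          omega
      · simp only [NExp.eval, NExp.eval_ofNat, hjj, Mem.setNat_nat_self, Mem.setNat_nat_of_ne,
          ne_eq, reduceCtorEq, not_false_eq_true, and_true]
        by_cases hc : j₁ = j
        · simp [hc]
        · rw [if_neg hc, if_neg hc]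
          exact hX j₁ hj₁
    · intro hb
      simp [hjj, ev, ec] at hb
      refine ⟨by simp, fun j₁ => ?_, by simpa using hX⟩
      simp only [Mem.setNat_nat_of_ne, ne_eq, reduceCtorEq, not_false_eq_true]
      rw [hI]
      by_cases hc : j₁ = j
      · rw [hc, if_neg fun h => lt_irrefl j h.1, if_neg fun h => hb h.2]
      · refine if_congr ?_ rfl rfl
        omega
  rintro σ₁ t₁ ⟨hI₁, hX₁⟩ hA₁ ht₁
  refine wp_mono (wp_deleteVertex (v := v) (by rw [hA₁.nat .v rfl, hσv])) ?_
  rintro σ₂ t₂ ⟨hV₂, hnV₂, hF₂, ht₂⟩ hA₂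
  have hsd : ∀ x, x ∈ V \ insert v M ↔ x ∈ V \ M ∧ x ≠ v := by
    intro x
    simp only [mem_sdiff, mem_insert]
    tauto
  refine ⟨⟨?_, ?_, ?_, ?_, ?_⟩, ?_⟩
  · intro j hj
    rw [hA₂.nat .cls rfl, hI₁ j, h.cls j hj]
    by_cases h₁ : σ₀.nat .cls j 0 ∈ M
    · rw [if_pos h₁, if_pos (mem_insert_of_mem h₁), ite_self]
    · rw [if_neg h₁]
      refine if_congr ?_ rfl rfl
      rw [mem_insert]
      tauto
  · intro j hj
    rw [hA₂.nat .cls rfl, hA₂.nat .X rfl]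
    exact hX₁ j hj
  · intro x hx
    rw [hV₂ x, hA₁.nat .V rfl, h.flags x hx]
    by_cases hc : x = v
    · rw [if_pos hc, if_neg]
      rw [hsd]
      exact fun h => h.2 hc
    · rw [if_neg hc]
      refine if_congr ?_ rfl rfl
      rw [hsd]
      tauto
  · have : V \ insert v M = (V \ M).erase v := by
      ext x
      rw [hsd, mem_erase]
      tauto
    rw [hnV₂, hA₁.nat .nV rfl, h.card, this,
      card_erase_of_mem (mem_sdiff.2 ⟨hv, hvM⟩)]
  · intro a ha b hb
    rw [hF₂ a ha b hb, hA₁.nat .F rfl, h.graph a ha b hb]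
    simp only [mem_insert]
    by_cases h₁ : a = v ∨ b = v
    · rw [if_pos h₁, if_pos (by tauto)]
    · rw [if_neg h₁]
      refine if_congr ?_ rfl rfl
      tauto
  · simp at ht₁ ⊢
    omega

end

section

variable {ms : ℝ} {V : Finset ℕ} {fh : Finset (Fin n) → ℝ}

/-! ### The two cases of an iteration -/

/-- The arrays for the evaluation of the set function and the transitive closure are up to date. -/
structure Prepared (n : ℕ) (σ : Mem) : Prop where
  listing : Listing (σ.nat .start) (σ.nat .mem)
    (fun v => univ.filter fun j : Fin n => σ.nat .cls j 0 = v)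
  le_one : ∀ a < n, ∀ b < n, σ.nat .R a b ≤ 1
  reach : ∀ a < n, ∀ b < n, σ.nat .R a b = 1 ↔ Reach n (σ.nat .F) a b

theorem Prepared.congr (h : Prepared n σ) {σ' : Mem}
    (hN : ∀ a, a = .start ∨ a = .mem ∨ a = .cls ∨ a = .R ∨ a = .F → σ'.nat a = σ.nat a) :
    Prepared n σ' := by
  refine ⟨?_, ?_, ?_⟩
  · rw [hN .start (by simp), hN .mem (by simp), hN .cls (by simp)]; exact h.listing
  · rw [hN .R (by simp)]; exact h.le_one
  · rw [hN .R (by simp), hN .F (by simp)]; exact h.reach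

/-- A call of `fix` for the current set function, contracted to the vertices outside of `U`. -/
theorem wp_fix_of_rep (hf : ∀ S T : Finset (Fin n), f (S ∪ T) + f (S ∩ T) ≤ f S + f T)
    (hn : 0 < n) (hM : Rep f ms V fh σ) (hP : Prepared n σ) {U : Finset ℕ} (hUV : U ⊆ V) {η : ℝ}
    (hη : 0 < η) (heta : σ.real .eta 0 0 = η)
    (hmax : ∀ v ∈ V, topMarginal (fun j => σ.nat .cls j 0) (σ.nat .F) V fh v ≤ η)
    (hsel : ∀ v < n, σ.nat .sel v 0 = if v ∈ V \ U then 1 else 0)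
    (hfb : σ.set n .fb = repr n (fun j => σ.nat .cls j 0) U)
    (hfull : σ.real .top 0 0 + σ.real .sub 0 0 = fh univ)
    (hsub : σ.real .sub 0 0 = fh (repr n (fun j => σ.nat .cls j 0) U))
    (hmin : ∃ Y ⊆ V \ U, fh (repr n (fun j => σ.nat .cls j 0) (U ∪ Y)) -
      fh (repr n (fun j => σ.nat .cls j 0) U) ≤ -(η / 2))
    (post : ∀ σ' t w, σ'.nat .w 0 0 = w → w ∈ V \ U →
      (∀ Y ⊆ V, fh (repr n (fun j => σ.nat .cls j 0) Y) = ms → U ⊆ Y → w ∈ Y) →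
      Agree fix σ σ' → t ≤ 1000000 * n ^ 5 * (3 * Nat.log 2 n + 5) → Q σ' t) : wp f fix σ Q := by
  have hI := hM.inv
  set cls : ℕ → ℕ := fun j => σ.nat .cls j 0 with hcls
  have hlt : ∀ v ∈ V \ U, v < n := fun v hv => hI.lt v (mem_sdiff.1 hv).1
  set E : Env n f := Env.of hn cls U (V \ U) fh hlt disjoint_sdiff
    (by rw [union_sdiff_of_subset hUV]; exact hI.cases) hI.fh_eq (hI.submod hf) with hE
  have hg : ∀ Y, E.g Y = fh (repr n cls (U ∪ Y)) - fh (repr n cls U) := by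
    intro Y
    rw [← repr_union]
    rfl
  have hR := hP.reach
  have hgVU : ∀ v ∈ E.V, v < n := hlt
  refine wp_mono (wp_fix (E := E) hη heta hsel hfb hP.listing hfull hsub hP.le_one
    ?_ ?_ ?_ ?_ ?_) ?_
  · intro v hv
    exact (hR v (hlt v hv) v (hlt v hv)).2 (Reach.refl v)
  · intro a ha b hb hab c hc hbc
    rw [hR a (hlt a ha) b (hlt b hb)] at hab
    rw [hR b (hlt b hb) c hc] at hbc
    exact (hR a (hlt a ha) c hc).2 (hab.trans hbc)
  · intro a ha b hb hab hba
    rw [hR a (hlt a ha) b (hlt b hb)] at hab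
    rw [hR b (hlt b hb) a (hlt a ha)] at hba
    exact hI.anti a b hab hba
  · intro v hv Y hY hcl hvY
    have hv' := mem_sdiff.1 (show v ∈ V \ U from hv)
    have hYV : Y ⊆ V \ U := hY
    rw [hg, hg, union_insert]
    have h₁ := hI.marginal_le (Y := U ∪ Y) hf hn
      (union_subset hUV (hYV.trans sdiff_subset)) hv'.1
      (by rw [mem_union, not_or]; exact ⟨hv'.2, hvY⟩) ?_
    · have h₂ := hmax v hv'.1
      linarith
    · intro b hb
      rw [mem_erase, mem_reachSet] at hb
      rw [mem_union]
      by_cases hbU : b ∈ U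
      · exact Or.inl hbU
      · refine Or.inr (hcl b (mem_sdiff.2 ⟨hb.2.1, hbU⟩) ?_ hb.1)
        exact (hR v (hI.lt v hv'.1) b (hI.lt b hb.2.1)).2 hb.2.2
  · obtain ⟨Y, hY, h⟩ := hmin
    exact ⟨Y, hY, by rw [hg]; exact h⟩
  · rintro σ' t ⟨hw, hall, ht⟩ hA
    refine post σ' t _ rfl hw (fun Y hY hm hUY => ?_) hA ht
    have := hall (Y \ U) (sdiff_subset_sdiff hY subset_rfl) fun Z _ => by
      rw [hg, hg, union_sdiff_of_subset hUY, hm]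
      linarith [hI.ge (repr n cls (U ∪ Z))]
    exact (mem_sdiff.1 this).1

/-- The time of one case. -/
def caseTime (n : ℕ) : ℕ := 1000000 * n ^ 5 * (3 * Nat.log 2 n + 5) + 1000 * n ^ 2 + 1000 * n + 1000

/-- The case of a large value `f(R(u))`: the modified value at the whole set being at most zero, the
set `V \ R(u)` has a value of at most `-η / 2` for `f_u`, so that `fix` returns a vertex `w` that
is contained in every minimizer that contains `u`. -/
theorem wp_caseArc (hf : ∀ S T : Finset (Fin n), f (S ∪ T) + f (S ∩ T) ≤ f S + f T)
    (hn : 0 < n) (hM : Rep f ms V fh σ) (hP : Prepared n σ) {u : ℕ} (hu : u ∈ V)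
    (hσu : σ.nat .u 0 0 = u) {η : ℝ} (hη : 0 < η) (heta : σ.real .eta 0 0 = η)
    (hmax : ∀ v ∈ V, topMarginal (fun j => σ.nat .cls j 0) (σ.nat .F) V fh v ≤ η)
    (hfu : σ.real .fu 0 0 = fh (repr n (fun j => σ.nat .cls j 0) (reachSet n (σ.nat .F) V u)) -
      σ.real .off 0 0)
    (hfV : σ.real .fV 0 0 ≤ 0) (hge : η / 2 ≤ σ.real .fu 0 0) :
    wp f caseArc σ (fun σ' t => (∃ V', Rep f ms V' fh σ' ∧
      progress n (fun j => σ.nat .cls j 0) (σ.nat .F) <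
        progress n (fun j => σ'.nat .cls j 0) (σ'.nat .F)) ∧ t ≤ caseTime n) := by
  set cls : ℕ → ℕ := fun j => σ.nat .cls j 0 with hcls
  set U := reachSet n (σ.nat .F) V u with hU
  have hI := hM.inv
  have hun := hI.lt u hu
  have hUV : U ⊆ V := fun v hv => (mem_reachSet.1 hv).1
  have hUR : ∀ b < n, (σ.nat .R u b = 1 ↔ b ∈ U) := by
    intro b hb
    rw [hP.reach u hun b hb, hU, mem_reachSet]
    exact ⟨fun h => ⟨hI.reach_mem hu h, h⟩, And.right⟩
  unfold caseArc
  rw [wp_seq]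
  refine wp_forTo_zero n (fun v' σ' => ∀ v < v', σ'.nat .sel v 0 = if v ∈ V \ U then 1 else 0) 40
    rfl (fun _ _ => rfl) (by simp) ?_ ?_
  · intro v σ' hv hsel hvv hA
    have eR : σ'.nat .R = σ.nat .R := hA.nat .R rfl
    have eV : σ'.nat .V = σ.nat .V := hA.nat .V rfl
    have eu : σ'.nat .u 0 0 = u := by rw [hA.nat .u rfl, hσu]
    have h01 := hP.le_one u hun v hv
    have hiff : (σ.nat .V v 0 = 1 ∧ σ.nat .R u v = 0) ↔ v ∈ V \ U := by
      rw [hM.flags v hv, mem_sdiff, ← hUR v hv]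
      by_cases hvV : v ∈ V
      · simp [hvV]; omega
      · simp [hvV]
    refine wp_cond ?_ ?_
    · intro hb
      simp only [BExp.eval, NExp.eval, NExp.eval_ofNat, eR, eV, eu, hvv, hiff] at hb
      rw [wp_nset]
      refine ⟨by simp, fun c hc => ?_⟩
      simp only [NExp.eval, NExp.eval_ofNat, hvv, Mem.setNat_nat_self, Mem.setNat_nat_of_ne,
        ne_eq, reduceCtorEq, not_false_eq_true, and_true]
      by_cases hcv : c = v
      · rw [if_pos hcv, hcv, if_pos hb]
      · rw [if_neg hcv]
        exact hsel c (by omega)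
    · intro hb
      simp only [BExp.eval, NExp.eval, NExp.eval_ofNat, eR, eV, eu, hvv, hiff] at hb
      rw [wp_nset]
      refine ⟨by simp, fun c hc => ?_⟩
      simp only [NExp.eval, NExp.eval_ofNat, hvv, Mem.setNat_nat_self, Mem.setNat_nat_of_ne,
        ne_eq, reduceCtorEq, not_false_eq_true, and_true]
      by_cases hcv : c = v
      · rw [if_pos hcv, hcv, if_neg hb]
      · rw [if_neg hcv]
        exact hsel c (by omega)
  intro σ₁ t₁ hsel₁ hA₁ ht₁
  rw [wp_seq]
  refine wp_mono (wp_load (by simp) (by simp) (by simp)) ?_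
  rintro σ₂ t₂ ⟨hQ₂, ht₂⟩ hA₂
  rw [Mem.set_congr (hA₁.nat .X rfl), hM.set_X] at hQ₂
  rw [wp_seq]
  refine wp_insertClasses (cls := cls) (U := U) (by simp) (fun v hv => hI.lt v (hUV hv)) ?_
    (by rw [hA₂.nat .start rfl, hA₂.nat .mem rfl, hA₁.nat .start rfl, hA₁.nat .mem rfl];
        exact hP.listing) hQ₂ ?_
  · intro b hb σ' hA hbb
    have eR : σ'.nat .R = σ.nat .R := by rw [hA.nat .R rfl, hA₂.nat .R rfl, hA₁.nat .R rfl]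
    have eu : σ'.nat .u 0 0 = u := by
      rw [hA.nat .u rfl, hA₂.nat .u rfl, hA₁.nat .u rfl, hσu]
    simp only [BExp.eval, NExp.eval, NExp.eval_ofNat, eR, eu, hbb, hUR b hb]
  intro σ₃ t₃ hQ₃ hA₃ ht₃
  rw [wp_seq]
  refine wp_forTo_zero n (fun j' σ' => ∀ j < j', σ'.nat .fb j 0 = σ₃.nat .Q j 0) 20 rfl
    (fun _ _ => rfl) (by simp) ?_ ?_
  · intro j σ' hj hfb hjj hA
    rw [wp_nset]
    refine ⟨by simp, fun c hc => ?_⟩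
    simp only [NExp.eval, NExp.eval_ofNat, hjj, Mem.setNat_nat_self, Mem.setNat_nat_of_ne,
      ne_eq, reduceCtorEq, not_false_eq_true, and_true]
    by_cases hcj : c = j
    · rw [if_pos hcj, hcj, hA.nat .Q rfl]
    · rw [if_neg hcj]
      exact hfb c (by omega)
  intro σ₄ t₄ hfb₄ hA₄ ht₄
  have hfbU : σ₄.set n .fb = repr n cls U := by
    rw [← hQ₃.set]
    ext j
    rw [Mem.mem_set, Mem.mem_set, hfb₄ j j.2]
  have eR₄ : σ₄.real = σ.real := by
    ext a r c
    rw [hA₄.real a rfl, hA₃.real a rfl, hA₂.real a rfl, hA₁.real a rfl]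
  have eN₄ : ∀ a, (a = .cls ∨ a = .F ∨ a = .V ∨ a = .nV ∨ a = .X ∨ a = .start ∨ a = .mem ∨ a = .R ∨
      a = .u) → σ₄.nat a = σ.nat a := by
    rintro a (rfl | rfl | rfl | rfl | rfl | rfl | rfl | rfl | rfl) <;>
      rw [hA₄.nat _ rfl, hA₃.nat _ rfl, hA₂.nat _ rfl, hA₁.nat _ rfl]
  have hsel₄ : ∀ v < n, σ₄.nat .sel v 0 = if v ∈ V \ U then 1 else 0 := by
    intro v hv
    rw [hA₄.nat .sel rfl, hA₃.nat .sel rfl, hA₂.nat .sel rfl]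
    exact hsel₁ v hv
  simp only [wp_seq (c₁ := .rset _ _), wp_rset]
  simp only [RExp.eval, NExp.eval, NExp.eval_ofNat, eR₄]
  set τ : ℝ := σ.real .fV 0 0 - σ.real .fu 0 0 with hτ
  set σ₅ : Mem := (σ₄.setReal .top 0 0 τ).setReal .sub 0 0 (σ.real .off 0 0 + σ.real .fu 0 0)
    with hσ₅
  have eτ : (σ₄.setReal .top 0 0 τ).real .off 0 0 + (σ₄.setReal .top 0 0 τ).real .fu 0 0 =
      σ.real .off 0 0 + σ.real .fu 0 0 := by simp [eR₄]
  rw [eτ, ← hσ₅]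
  have eN₅ : σ₅.nat = σ₄.nat := by simp [hσ₅]
  have hM₅ : Rep f ms V fh σ₅ := by
    refine hM.congr ?_ (by simp [hσ₅, eR₄]) (by simp [hσ₅, eR₄])
    rintro a (rfl | rfl | rfl | rfl | rfl) <;> rw [eN₅] <;> exact eN₄ _ (by simp)
  have hP₅ : Prepared n σ₅ := by
    refine hP.congr ?_
    rintro a (rfl | rfl | rfl | rfl | rfl) <;> rw [eN₅] <;> exact eN₄ _ (by simp)
  have ecls₅ : σ₅.nat .cls = σ.nat .cls := by rw [eN₅]; exact eN₄ _ (by simp)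
  have eF₅ : σ₅.nat .F = σ.nat .F := by rw [eN₅]; exact eN₄ _ (by simp)
  have htau := hI.tau
  rw [wp_seq]
  refine wp_fix_of_rep hf hn hM₅ hP₅ hUV hη (by simp [hσ₅, eR₄, heta])
    (by rw [ecls₅, eF₅]; exact hmax) (by rw [eN₅]; exact hsel₄) (by
      rw [ecls₅]; simpa [hσ₅] using hfbU) (by simp [hσ₅, hτ]; linarith)
    (by rw [ecls₅]; simp [hσ₅]; linarith) ?_ ?_
  · refine ⟨V \ U, subset_rfl, ?_⟩
    rw [ecls₅, union_sdiff_of_subset hUV, hI.repr_V]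
    linarith
  intro σ₆ t₆ w hσw hw hall hA₆ ht₆
  rw [ecls₅] at hall
  have hw' := mem_sdiff.1 hw
  have hwn := hI.lt w hw'.1
  have hM₆ : Rep f ms V fh σ₆ := by
    refine hM₅.congr ?_ (hA₆.real .fV rfl) (hA₆.real .off rfl)
    rintro a (rfl | rfl | rfl | rfl | rfl) <;> exact hA₆.nat _ rfl
  have ecls₆ : σ₆.nat .cls = σ.nat .cls := by rw [hA₆.nat .cls rfl, ecls₅]
  have eF₆ : σ₆.nat .F = σ.nat .F := by rw [hA₆.nat .F rfl, eF₅]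
  have eR₆ : σ₆.nat .R = σ.nat .R := by
    rw [hA₆.nat .R rfl, eN₅]; exact eN₄ _ (by simp)
  have eu₆ : σ₆.nat .u 0 0 = u := by
    rw [hA₆.nat .u rfl, eN₅, eN₄ _ (by simp), hσu]
  have huw : ¬ Reach n (σ.nat .F) u w := fun h => hw'.2 (mem_reachSet.2 ⟨hw'.1, h⟩)
  have hminw : ∀ Y ⊆ V, fh (repr n cls Y) = ms → u ∈ Y → w ∈ Y := fun Y hY hm huY =>
    hall Y hY hm fun b hb => hI.closed_reach hY hm huY (mem_reachSet.1 hb).2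
  have hT : t₁ + (t₂ + (t₃ + (t₄ + (10 + (10 + t₆))))) ≤
      1000000 * n ^ 5 * (3 * Nat.log 2 n + 5) + 100 * n ^ 2 + 500 * n + 300 := by
    simp at ht₁ ht₄
    omega
  refine wp_cond ?_ ?_
  · intro hb
    simp only [BExp.eval, NExp.eval, NExp.eval_ofNat, eR₆, eu₆, hσw, hP.reach w hwn u hun] at hb
    refine wp_contract hM₆ hu hw'.1 eu₆ hσw (by rw [eR₆, eF₆]; exact hP.reach)
      (by rw [eF₆]; exact hb) (by rw [eF₆]; exact huw) (by rw [ecls₆]; exact hminw) ?_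
    intro σ₇ t₇ V' hM₇ hpr hA₇ ht₇
    rw [ecls₆, eF₆] at hpr
    refine ⟨⟨V', hM₇, hpr⟩, ?_⟩
    unfold caseTime
    simp
    omega
  · intro hb
    simp only [BExp.eval, NExp.eval, NExp.eval_ofNat, eR₆, eu₆, hσw, hP.reach w hwn u hun] at hb
    rw [wp_nset]
    simp only [NExp.eval, NExp.eval_ofNat, eu₆, hσw]
    have eF₇ : ∀ a b, (σ₆.setNat .F u w 1).nat .F a b =
        if a = u ∧ b = w then 1 else σ.nat .F a b := by
      intro a b
      simp [eF₆]
    refine ⟨⟨V, ⟨?_, ?_, ?_, ?_, ?_⟩, ?_⟩, ?_⟩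
    · have hI₆ := hM₆.inv
      rw [ecls₆, eF₆] at hI₆
      have := hI₆.addArc hu hw'.1 hb hminw eF₇
      simpa [ecls₆] using this
    · simpa using hM₆.flags
    · simpa using hM₆.card
    · simpa using hM₆.out
    · intro a ha b hb
      rw [eF₇]
      split_ifs
      · exact le_rfl
      · exact hM.le_one a ha b hb
    · have := hI.progress_addArc hu hw'.1 huw eF₇
      simpa [ecls₆] using this
    · unfold caseTime
      simp
      omega

end

section

variable {ms : ℝ} {V : Finset ℕ} {fh : Finset (Fin n) → ℝ}

/-- The case of a small value `f(R(u))`: the set `R(u) \ {u}` has a value of at most `-η / 2`, so that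
`fix` returns a vertex of every minimizer. -/
theorem wp_caseDelete (hf : ∀ S T : Finset (Fin n), f (S ∪ T) + f (S ∩ T) ≤ f S + f T)
    (hn : 0 < n) (hM : Rep f ms V fh σ) (hP : Prepared n σ) {u : ℕ} (hu : u ∈ V)
    {η : ℝ} (hη : 0 < η) (heta : σ.real .eta 0 0 = η)
    (htop : η = topMarginal (fun j => σ.nat .cls j 0) (σ.nat .F) V fh u)
    (hmax : ∀ v ∈ V, topMarginal (fun j => σ.nat .cls j 0) (σ.nat .F) V fh v ≤ η)
    (hfu : σ.real .fu 0 0 = fh (repr n (fun j => σ.nat .cls j 0) (reachSet n (σ.nat .F) V u)) -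
      σ.real .off 0 0)
    (hfV : σ.real .fV 0 0 ≤ 0) (hlt : σ.real .fu 0 0 < η / 2) :
    wp f caseDelete σ (fun σ' t => (∃ V', Rep f ms V' fh σ' ∧
      progress n (fun j => σ.nat .cls j 0) (σ.nat .F) <
        progress n (fun j => σ'.nat .cls j 0) (σ'.nat .F)) ∧ t ≤ caseTime n) := by
  set cls : ℕ → ℕ := fun j => σ.nat .cls j 0 with hcls
  have hI := hM.inv
  unfold caseDelete
  rw [wp_seq]
  refine wp_forTo_zero n (fun v' σ' => ∀ v < v', σ'.nat .sel v 0 = σ.nat .V v 0) 20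
    rfl (fun _ _ => rfl) (by simp) ?_ ?_
  · intro v σ' hv hsel hvv hA
    rw [wp_nset]
    refine ⟨by simp, fun c hc => ?_⟩
    simp only [NExp.eval, NExp.eval_ofNat, hvv, Mem.setNat_nat_self, Mem.setNat_nat_of_ne,
      ne_eq, reduceCtorEq, not_false_eq_true, and_true]
    by_cases hcv : c = v
    · rw [if_pos hcv, hcv, hA.nat .V rfl]
    · rw [if_neg hcv]
      exact hsel c (by omega)
  intro σ₁ t₁ hsel₁ hA₁ ht₁
  rw [wp_seq]
  refine wp_forTo_zero n (fun j' σ' => ∀ j < j', σ'.nat .fb j 0 = σ.nat .X j 0) 20 rfl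
    (fun _ _ => rfl) (by simp) ?_ ?_
  · intro j σ' hj hfb hjj hA
    rw [wp_nset]
    refine ⟨by simp, fun c hc => ?_⟩
    simp only [NExp.eval, NExp.eval_ofNat, hjj, Mem.setNat_nat_self, Mem.setNat_nat_of_ne,
      ne_eq, reduceCtorEq, not_false_eq_true, and_true]
    by_cases hcj : c = j
    · rw [if_pos hcj, hcj, hA.nat .X rfl, hA₁.nat .X rfl]
    · rw [if_neg hcj]
      exact hfb c (by omega)
  intro σ₄ t₄ hfb₄ hA₄ ht₄
  have hfbU : σ₄.set n .fb = repr n cls ∅ := by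
    rw [← hM.set_X]
    ext j
    rw [Mem.mem_set, Mem.mem_set, hfb₄ j j.2]
  have eR₄ : σ₄.real = σ.real := by
    ext a r c
    rw [hA₄.real a rfl, hA₁.real a rfl]
  have eN₄ : ∀ a, (a = .cls ∨ a = .F ∨ a = .V ∨ a = .nV ∨ a = .X ∨ a = .start ∨ a = .mem ∨
      a = .R) → σ₄.nat a = σ.nat a := by
    rintro a (rfl | rfl | rfl | rfl | rfl | rfl | rfl | rfl) <;>
      rw [hA₄.nat _ rfl, hA₁.nat _ rfl]
  have hsel₄ : ∀ v < n, σ₄.nat .sel v 0 = if v ∈ V \ ∅ then 1 else 0 := by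
    intro v hv
    rw [hA₄.nat .sel rfl, hsel₁ v hv, hM.flags v hv, sdiff_empty]
  simp only [wp_seq (c₁ := .rset _ _), wp_rset]
  simp only [RExp.eval, NExp.eval, NExp.eval_ofNat, eR₄]
  set σ₅ : Mem := (σ₄.setReal .top 0 0 (σ.real .fV 0 0)).setReal .sub 0 0 (σ.real .off 0 0)
    with hσ₅
  have eτ : (σ₄.setReal .top 0 0 (σ.real .fV 0 0)).real .off 0 0 = σ.real .off 0 0 := by
    simp [eR₄]
  rw [eτ, ← hσ₅]
  have eN₅ : σ₅.nat = σ₄.nat := by simp [hσ₅]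
  have hM₅ : Rep f ms V fh σ₅ := by
    refine hM.congr ?_ (by simp [hσ₅, eR₄]) (by simp [hσ₅, eR₄])
    rintro a (rfl | rfl | rfl | rfl | rfl) <;> rw [eN₅] <;> exact eN₄ _ (by simp)
  have hP₅ : Prepared n σ₅ := by
    refine hP.congr ?_
    rintro a (rfl | rfl | rfl | rfl | rfl) <;> rw [eN₅] <;> exact eN₄ _ (by simp)
  have ecls₅ : σ₅.nat .cls = σ.nat .cls := by rw [eN₅]; exact eN₄ _ (by simp)
  have eF₅ : σ₅.nat .F = σ.nat .F := by rw [eN₅]; exact eN₄ _ (by simp)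
  have htau := hI.tau
  have hoff := hI.off_eq ⟨u, hu⟩
  rw [wp_seq]
  refine wp_fix_of_rep hf hn hM₅ hP₅ (empty_subset V) hη (by simp [hσ₅, eR₄, heta])
    (by rw [ecls₅, eF₅]; exact hmax) (by rw [eN₅]; exact hsel₄) (by
      rw [ecls₅]; simpa [hσ₅] using hfbU) (by simp [hσ₅]; linarith)
    (by rw [ecls₅]; simp [hσ₅]; linarith) ?_ ?_
  · -- The set `R(u) \ {u}` has the value `f(R(u)) - η`.
    refine ⟨(reachSet n (σ.nat .F) V u).erase u, ?_, ?_⟩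
    · rw [sdiff_empty]
      exact (erase_subset _ _).trans fun v hv => (mem_reachSet.1 hv).1
    · rw [ecls₅, empty_union]
      unfold topMarginal at htop
      linarith
  intro σ₆ t₆ w hσw hw hall hA₆ ht₆
  rw [ecls₅] at hall
  rw [sdiff_empty] at hw
  have hwn := hI.lt w hw
  set U := reachSet n (σ.nat .F) V w with hU
  have hUV : U ⊆ V := fun v hv => (mem_reachSet.1 hv).1
  have hUR : ∀ b < n, (σ.nat .R w b = 1 ↔ b ∈ U) := by
    intro b hb
    rw [hP.reach w hwn b hb, hU, mem_reachSet]
    exact ⟨fun h => ⟨hI.reach_mem hw h, h⟩, And.right⟩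
  have eN₆ : ∀ a, (a = .cls ∨ a = .F ∨ a = .V ∨ a = .nV ∨ a = .X ∨ a = .start ∨ a = .mem ∨
      a = .R) → σ₆.nat a = σ.nat a := by
    intro a ha
    have : fix.writesNat a = false := by
      rcases ha with rfl | rfl | rfl | rfl | rfl | rfl | rfl | rfl <;> rfl
    rw [hA₆.nat a this, eN₅, eN₄ a ha]
  have eoff₆ : σ₆.real .off = σ.real .off := by rw [hA₆.real .off rfl]; simp [hσ₅, eR₄]
  have efV₆ : σ₆.real .fV = σ.real .fV := by rw [hA₆.real .fV rfl]; simp [hσ₅, eR₄]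
  rw [wp_seq]
  refine wp_mono (wp_load (by simp) (by simp) (by simp)) ?_
  rintro σ₇ t₇ ⟨hQ₇, ht₇⟩ hA₇
  rw [Mem.set_congr (eN₆ .X (by simp)), hM.set_X] at hQ₇
  rw [wp_seq]
  refine wp_insertClasses (cls := cls) (U := U) (by simp) (fun v hv => hI.lt v (hUV hv)) ?_
    (by rw [hA₇.nat .start rfl, hA₇.nat .mem rfl, eN₆ _ (by simp), eN₆ _ (by simp)];
        exact hP.listing) hQ₇ ?_
  · intro b hb σ' hA hbb
    have eR : σ'.nat .R = σ.nat .R := by rw [hA.nat .R rfl, hA₇.nat .R rfl, eN₆ _ (by simp)]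
    have ew : σ'.nat .w 0 0 = w := by rw [hA.nat .w rfl, hA₇.nat .w rfl, hσw]
    simp only [BExp.eval, NExp.eval, NExp.eval_ofNat, eR, ew, hbb, hUR b hb]
  intro σ₈ t₈ hQ₈ hA₈ ht₈
  have eoff₈ : σ₈.real .off 0 0 = σ.real .off 0 0 := by
    rw [hA₈.real .off rfl, hA₇.real .off rfl, eoff₆]
  have efV₈ : σ₈.real .fV 0 0 = σ.real .fV 0 0 := by
    rw [hA₈.real .fV rfl, hA₇.real .fV rfl, efV₆]
  rw [wp_seq]
  refine wp_evalQ (fh := fh) hQ₈ hI.fh_eq (by rw [eoff₈, efV₈]; exact htau) (by simp) ?_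
  intro t₉ ht₉
  simp only [wp_seq (c₁ := .rset _ _), wp_rset]
  set ρ : ℝ := fh (repr n cls U) - σ.real .off 0 0 with hρ
  obtain ⟨σ₉, hσ₉⟩ : ∃ σ₉ : Mem, σ₉ = ((σ₈.setReal .r₁ 0 0 ρ).setReal .fV 0 0
    (σ.real .fV 0 0 - ρ)).setReal .off 0 0 (σ.real .off 0 0 + ρ) := ⟨_, rfl⟩
  have hfin : ∀ s, s = σ₉ → wp f (forTo .v 0 .size
      (when (.natEq (.get .R (.get .w 0 0) (.get .v 0 0)) 1) removeVertex)) s (fun σ' t =>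
      (∃ V', Rep f ms V' fh σ' ∧ progress n cls (σ.nat .F) < progress n (fun j => σ'.nat .cls j 0) (σ'.nat .F)) ∧
      t ≤ 300 * n ^ 2 + 300 * n + 100) := by
    intro s hs
    rw [hs]
    have eN₉ : ∀ a, (a = .cls ∨ a = .F ∨ a = .V ∨ a = .nV ∨ a = .X ∨ a = .start ∨ a = .mem ∨
        a = .R) → σ₉.nat a = σ.nat a := by
      intro a ha
      have e₁ : σ₉.nat = σ₈.nat := by simp [hσ₉]
      rw [e₁, ← eN₆ a ha]
      rcases ha with rfl | rfl | rfl | rfl | rfl | rfl | rfl | rfl <;>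
        rw [hA₈.nat _ rfl, hA₇.nat _ rfl]
    have ew₉ : σ₉.nat .w 0 0 = w := by
      have e₁ : σ₉.nat = σ₈.nat := by simp [hσ₉]
      rw [e₁, hA₈.nat .w rfl, hA₇.nat .w rfl, hσw]
    refine wp_forTo_zero n (fun v σ' => Deleted n V (U.filter (· < v)) σ σ')
      (200 * n + 230) rfl (fun _ _ => rfl) ?_ ?_ ?_
    · rw [filter_lt_zero]
      refine Deleted.congr (σ₁ := σ) ⟨?_, hM.out, ?_, ?_, ?_⟩ ?_
      · intro j _
        simp
      · simpa using hM.flags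
      · simpa using hM.card
      · intro a _ b _
        simp
      · rintro a (rfl | rfl | rfl | rfl | rfl) <;> simp [eN₉]
    · intro v σ' hv hD hvv hA
      have eR : σ'.nat .R = σ.nat .R := by rw [hA.nat .R rfl, eN₉ _ (by simp)]
      have ew : σ'.nat .w 0 0 = w := by rw [hA.nat .w rfl, ew₉]
      refine wp_when ?_ ?_
      · intro hb
        simp only [BExp.eval, NExp.eval, NExp.eval_ofNat, eR, ew, hvv, hUR v hv] at hb
        refine wp_mono (wp_removeVertex hv (hUV hb) (by simp) hvv hD) ?_
        rintro σ'' t ⟨hD', ht⟩ hA'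
        rw [filter_lt_succ_of_mem hb]
        refine ⟨by simp; omega, hD'.congr ?_⟩
        rintro a (rfl | rfl | rfl | rfl | rfl) <;> simp
      · intro hb
        simp only [BExp.eval, NExp.eval, NExp.eval_ofNat, eR, ew, hvv, hUR v hv] at hb
        rw [filter_lt_succ_of_notMem hb]
        refine ⟨by simp, hD.congr ?_⟩
        rintro a (rfl | rfl | rfl | rfl | rfl) <;> simp
    · intro σ' t hD hA ht
      rw [filter_true_of_mem fun v hv => hI.lt v (hUV hv)] at hD
      have eoff : σ'.real .off 0 0 = σ.real .off 0 0 + ρ := by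
        rw [hA.real .off rfl, hσ₉]; simp
      have efV : σ'.real .fV 0 0 = σ.real .fV 0 0 - ρ := by
        rw [hA.real .fV rfl, hσ₉]; simp
      refine ⟨⟨V \ U, ⟨?_, hD.flags, hD.card, hD.out, ?_⟩, ?_⟩, ?_⟩
      · rw [eoff, efV]
        refine hI.delete hfV hw (fun Y hY hm => hall Y hY hm (empty_subset Y)) hD.cls ?_
        rintro a b ⟨ha, hb, hab⟩
        rw [hD.graph a ha b hb] at hab
        split_ifs at hab with hc
        rw [not_or] at hc
        exact ⟨⟨ha, hb, hab⟩, hc.1, hc.2⟩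
      · intro a ha b hb
        rw [hD.graph a ha b hb]
        split_ifs
        · exact Nat.zero_le 1
        · exact hM.le_one a ha b hb
      · refine hI.progress_delete hw hD.cls ?_
        rintro a b ⟨ha, hb, hab⟩ haU hbU
        refine ⟨ha, hb, ?_⟩
        rw [hD.graph a ha b hb, if_neg (by tauto), hab]
      · have h₁ : n * (200 * n + 230 + 14) = 200 * n ^ 2 + 244 * n := by ring
        simp only [NExp.cost] at ht
        rw [h₁] at ht
        omega
  refine wp_mono (hfin _ (by rw [hσ₉]; simp [eoff₈, efV₈, hρ])) ?_
  rintro σ' t ⟨h, ht⟩ hA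
  refine ⟨h, ?_⟩
  unfold caseTime
  simp at ht₁ ht₄ ⊢
  omega

end

section

variable {ms : ℝ} {V : Finset ℕ} {fh : Finset (Fin n) → ℝ}

/-! ### The main loop -/

/-- The invariant holds at the start, with singletons as classes and without arcs. -/
theorem Inv.init (hn : 0 < n) (h0 : f ∅ = 0) {S₀ : Finset (Fin n)} (hmin : ∀ S, f S₀ ≤ f S)
    {cls : ℕ → ℕ} {F : ℕ → ℕ → ℕ} (hcls : ∀ j < n, cls j = j)
    (hF : ∀ a < n, ∀ b < n, F a b = 0) :
    Inv f (f S₀) (range n) cls F f (f univ) 0 := by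
  have harc : ∀ a b, ¬ Arc n F a b := by
    rintro a b ⟨ha, hb, hab⟩
    rw [hF a ha b hb] at hab
    exact absurd hab (by norm_num)
  refine ⟨fun v hv => mem_range.1 hv, ?_, fun v hv => hcls v (mem_range.1 hv),
    fun a b hab => absurd hab (harc a b), ?_, fun _ _ => rfl, le_rfl, add_zero _, ?_, hmin, ?_,
    fun _ _ _ _ _ b hab => absurd hab (harc _ b), fun _ h => h, ?_⟩
  · intro j hj
    rw [hcls j hj]
    exact Or.inr (mem_range.2 hj)
  · intro a b hab _
    induction hab with
    | refl => rfl
    | tail _ hbc _ => exact absurd hbc (harc _ _)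
  · intro _
    have : repr n cls ∅ = ∅ := by
      ext j
      simp [mem_repr, hcls j j.2, j.2.ne]
    rw [this, h0]
  · refine ⟨S₀.image Fin.val, ?_, congrArg f ?_⟩
    · intro v hv
      obtain ⟨j, -, rfl⟩ := mem_image.1 hv
      exact mem_range.2 j.2
    · ext j
      simp [mem_repr, hcls j j.2, j.2.ne, Fin.val_inj]
  · intro h
    rw [range_eq_empty_iff] at h
    omega

theorem wp_setup (hn : 0 < n) (h0 : f ∅ = 0) {S₀ : Finset (Fin n)} (hmin : ∀ S, f S₀ ≤ f S)
    (post : ∀ σ' t, Rep f (f S₀) (range n) f σ' → σ'.nat .go 0 0 = 1 →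
      t ≤ 100 * n ^ 2 + 100 * n + 100 → Q σ' t) : wp f setup σ Q := by
  unfold setup
  rw [wp_seq]
  refine wp_forTo_zero n (fun j' σ' => ∀ j < j', σ'.nat .X j 0 = 0 ∧ σ'.nat .V j 0 = 1 ∧
    σ'.nat .cls j 0 = j ∧ σ'.nat .Q j 0 = 1 ∧ ∀ l < n, σ'.nat .F j l = 0) (30 * n + 50) rfl
    (fun _ _ => rfl) (by simp) ?_ ?_
  · intro j σ' hj hI hjj hA
    simp only [wp_seq, wp_nset]
    refine wp_forTo_zero n (fun l' σ'' => ∀ a b, σ''.nat .F a b =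
      if a = j ∧ b < l' then 0 else σ'.nat .F a b) 15 rfl (fun _ _ => rfl) (by simp) ?_ ?_
    · intro l σ'' hl hF hll hA'
      have ej : σ''.nat .j 0 0 = j := by rw [hA'.nat .j rfl]; simp [hjj]
      rw [wp_nset]
      refine ⟨by simp, fun a b => ?_⟩
      simp only [NExp.eval, NExp.eval_ofNat, ej, hll, Mem.setNat_nat_self, Mem.setNat_nat_of_ne,
        ne_eq, reduceCtorEq, not_false_eq_true]
      by_cases hc : a = j ∧ b = l
      · rw [if_pos hc, if_pos (by omega)]
      · rw [if_neg hc, hF]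
        refine if_congr ?_ rfl rfl
        omega
    · intro σ'' t hF hA' ht
      refine ⟨by simp at ht ⊢; omega, fun i hi => ?_⟩
      have e₁ : σ''.nat .X i 0 = if i = j then 0 else σ'.nat .X i 0 := by
        rw [hA'.nat .X rfl]; simp [hjj]
      have e₂ : σ''.nat .V i 0 = if i = j then 1 else σ'.nat .V i 0 := by
        rw [hA'.nat .V rfl]; simp [hjj]
      have e₃ : σ''.nat .cls i 0 = if i = j then j else σ'.nat .cls i 0 := by
        rw [hA'.nat .cls rfl]; simp [hjj]
      have e₄ : σ''.nat .Q i 0 = if i = j then 1 else σ'.nat .Q i 0 := by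
        rw [hA'.nat .Q rfl]; simp [hjj]
      simp only [Mem.setNat_nat_of_ne, ne_eq, reduceCtorEq, not_false_eq_true, e₁, e₂, e₃, e₄, hF]
      by_cases hc : i = j
      · simp +contextual [hc]
      · simpa [hc] using hI i (by omega)
  · intro σ₁ t₁ hI hA ht
    have hQ : σ₁.set n .Q = univ := by
      ext j
      simp [Mem.mem_set, hI j j.2]
    simp only [wp_seq, wp_nset, wp_rset, wp_query]
    refine post _ _ ⟨?_, ?_, ?_, ?_, ?_⟩ (by simp) ?_
    · simp [hQ]
      exact Inv.init hn h0 hmin (fun j hj => (hI j hj).2.2.1) fun a ha =>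
        (hI a ha).2.2.2.2
    · intro v hv
      simp [hI v hv, hv]
    · simp
    · intro j hj
      simp [hI j hj, hj.ne]
    · intro a ha b hb
      simp [(hI a ha).2.2.2.2 b hb]
    · have h₁ : n * (30 * n + 50 + 14) = 30 * n ^ 2 + 64 * n := by ring
      simp only [NExp.cost] at ht
      rw [h₁] at ht
      simp
      omega

section

local infixr:20 " ;; " => Cmd.seq
local infix:40 " ≔ " => Cmd.nset
local infixl:70 " /ᵣ " => RExp.div
local infix:50 " ≤ᵣ " => BExp.realLe

open NName RName

/-- The body of the main loop after the value at the set of all vertices has been lowered. -/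
def mainStep : Cmd :=
  listClasses ;;
  closure ;;
  computeEta ;;
  .cond (eta ≤ᵣ 0) (go ≔ 0) (
    .cond (eta /ᵣ 2 ≤ᵣ fu) caseArc caseDelete)

end

/-- A bound on the time of an iteration of the main loop. -/
def iterTime (n : ℕ) : ℕ := caseTime n + 300 * n ^ 3 + 1000 * n ^ 2 + 2000 * n + 1000

/-- An iteration either makes progress, or ends the loop with the certificate that the whole ground set
is a minimizer of the modified function. -/
theorem wp_mainStep (hf : ∀ S T : Finset (Fin n), f (S ∪ T) + f (S ∩ T) ≤ f S + f T)
    (hn : 0 < n) (hM : Rep f ms V fh σ) (hV : V.Nonempty) (hfV : σ.real .fV 0 0 ≤ 0)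
    (hgo : σ.nat .go 0 0 = 1)
    (cont : ∀ σ' t V', Rep f ms V' fh σ' → σ'.nat .go 0 0 = 1 →
      progress n (fun j => σ.nat .cls j 0) (σ.nat .F) <
        progress n (fun j => σ'.nat .cls j 0) (σ'.nat .F) → t ≤ iterTime n → Q σ' t)
    (halt : ∀ σ' t, Rep f ms V fh σ' → σ'.nat .go 0 0 = 0 → σ'.real .fV 0 0 ≤ 0 →
      fh univ = ms → t ≤ iterTime n → Q σ' t) : wp f mainStep σ Q := by
  unfold mainStep
  rw [wp_seq]
  refine wp_mono (wp_listClasses) ?_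
  rintro σ₁ t₁ ⟨hl₁, ht₁⟩ hA₁
  have hM₁ : Rep f ms V fh σ₁ := by
    refine hM.congr ?_ (hA₁.real .fV rfl) (hA₁.real .off rfl)
    rintro a (rfl | rfl | rfl | rfl | rfl) <;> exact hA₁.nat _ rfl
  rw [wp_seq]
  refine wp_mono (wp_closure hM₁.le_one) ?_
  rintro σ₂ t₂ ⟨hR, ht₂⟩ hA₂
  have hM₂ : Rep f ms V fh σ₂ := by
    refine hM₁.congr ?_ (hA₂.real .fV rfl) (hA₂.real .off rfl)
    rintro a (rfl | rfl | rfl | rfl | rfl) <;> exact hA₂.nat _ rfl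
  have hP₂ : Prepared n σ₂ := by
    refine ⟨?_, hR.le_one, ?_⟩
    · rw [hA₂.nat .start rfl, hA₂.nat .mem rfl, hA₂.nat .cls rfl, hA₁.nat .cls rfl]
      exact hl₁
    · rw [hA₂.nat .F rfl]
      exact fun a ha b hb => hR.iff_reach ha hb
  rw [wp_seq]
  refine wp_mono (wp_computeEta hM₂ hV hP₂.listing hP₂.reach) ?_
  rintro σ₃ t₃ ⟨⟨hu, hη, hfu, hmax⟩, ht₃⟩ hA₃
  obtain ⟨u, hσu⟩ : ∃ u, σ₃.nat .u 0 0 = u := ⟨_, rfl⟩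
  rw [hσu] at hu hη hfu
  have hM₃ : Rep f ms V fh σ₃ := by
    refine hM₂.congr ?_ (hA₃.real .fV rfl) (hA₃.real .off rfl)
    rintro a (rfl | rfl | rfl | rfl | rfl) <;> exact hA₃.nat _ rfl
  have hP₃ : Prepared n σ₃ := by
    refine hP₂.congr ?_
    rintro a (rfl | rfl | rfl | rfl | rfl) <;> exact hA₃.nat _ rfl
  have hfV₃ : σ₃.real .fV 0 0 ≤ 0 := by
    rw [hA₃.real .fV rfl, hA₂.real .fV rfl, hA₁.real .fV rfl]; exact hfV
  have hgo₃ : σ₃.nat .go 0 0 = 1 := by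
    rw [hA₃.nat .go rfl, hA₂.nat .go rfl, hA₁.nat .go rfl, hgo]
  have ecls : σ₃.nat .cls = σ.nat .cls := by
    rw [hA₃.nat .cls rfl, hA₂.nat .cls rfl, hA₁.nat .cls rfl]
  have eF : σ₃.nat .F = σ.nat .F := by rw [hA₃.nat .F rfl, hA₂.nat .F rfl, hA₁.nat .F rfl]
  have hT : t₁ + (t₂ + t₃) ≤ 300 * n ^ 3 + 1000 * n ^ 2 + 2000 * n + 500 := by
    have h₁ : 100 * n * n = 100 * n ^ 2 := by ring
    omega
  rw [← hA₃.nat .cls rfl, ← hA₃.nat .F rfl] at hmax hη hfu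
  rw [← hA₃.real .off rfl] at hfu
  refine wp_cond ?_ ?_
  · intro hb
    simp at hb
    rw [wp_nset]
    refine halt _ _ ?_ (by simp) (by simpa using hfV₃) ?_ ?_
    · refine hM₃.congr ?_ (by simp) (by simp)
      rintro a (rfl | rfl | rfl | rfl | rfl) <;> simp
    · exact hM₃.inv.fh_univ_eq hf hn fun v hv => (hmax v hv).trans hb
    · unfold iterTime
      simp
      omega
  · intro hb
    simp at hb
    refine wp_cond ?_ ?_
    · intro hb₂
      simp at hb₂
      refine wp_mono (wp_caseArc hf hn hM₃ hP₃ hu hσu hb rfl hmax hfu hfV₃ hb₂) ?_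
      rintro σ₄ t₄ ⟨⟨V', hM₄, hpr⟩, ht₄⟩ hA₄
      rw [ecls, eF] at hpr
      refine cont σ₄ _ V' hM₄ (by rw [hA₄.nat .go rfl, hgo₃]) hpr ?_
      unfold iterTime
      simp
      omega
    · intro hb₂
      simp at hb₂
      refine wp_mono (wp_caseDelete hf hn hM₃ hP₃ hu hb rfl hη hmax hfu hfV₃ hb₂) ?_
      rintro σ₄ t₄ ⟨⟨V', hM₄, hpr⟩, ht₄⟩ hA₄
      rw [ecls, eF] at hpr
      refine cont σ₄ _ V' hM₄ (by rw [hA₄.nat .go rfl, hgo₃]) hpr ?_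
      unfold iterTime
      simp
      omega

/-- The whole algorithm computes a minimizer. -/
theorem wp_algorithm (hf : ∀ S T : Finset (Fin n), f (S ∪ T) + f (S ∩ T) ≤ f S + f T)
    (hn : 0 < n) (h0 : f ∅ = 0) :
    wp f algorithm σ (fun σ' t => (∀ Y, f (σ'.set n .X) ≤ f Y) ∧
      t ≤ (n * n + n + 1) * (iterTime n + 100) + 100 * n ^ 2 + 200 * n + 300) := by
  obtain ⟨S₀, -, hS₀⟩ := exists_min_image (univ : Finset (Finset (Fin n))) f
    ⟨∅, mem_univ _⟩
  have hS₀ : ∀ S, f S₀ ≤ f S := fun S => hS₀ S (mem_univ S)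
  suffices H : wp f algorithm σ (fun σ' t => f (σ'.set n .X) = f S₀ ∧
      t ≤ (n * n + n + 1) * (iterTime n + 100) + 100 * n ^ 2 + 200 * n + 300) from
    wp_mono H fun σ' t h _ => ⟨fun Y => h.1.trans_le (hS₀ Y), h.2⟩
  unfold algorithm
  rw [wp_seq]
  refine wp_setup hn h0 hS₀ ?_
  intro σ₁ t₁ hM₁ hgo₁ ht₁
  set K := iterTime n + 100 with hK
  rw [wp_seq]
  -- Every iteration but the last one raises `progress`, which is at most `n * n + n`.
  refine wp_loop (fun σ' τ => ∃ V fh, Rep f (f S₀) V fh σ' ∧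
    ((σ'.nat .go 0 0 = 1 ∧
      τ = (n * n + n + 1 - progress n (fun j => σ'.nat .cls j 0) (σ'.nat .F)) * K) ∨
    (σ'.nat .go 0 0 = 0 ∧ V.Nonempty ∧ σ'.real .fV 0 0 ≤ 0 ∧ fh univ = f S₀ ∧ τ = 0)))
    _ ⟨range n, f, hM₁, Or.inl ⟨hgo₁, rfl⟩⟩ ?_ ?_
  · rintro σ₂ τ ⟨V, fh, hM₂, h₂⟩ hA₂ hb₂
    simp [hM₂.card] at hb₂
    obtain ⟨hV, hgo₂⟩ := hb₂
    obtain ⟨-, rfl⟩ := h₂.resolve_right fun h => by rw [hgo₂] at h; exact absurd h.1 (by norm_num)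
    set p := progress n (fun j => σ₂.nat .cls j 0) (σ₂.nat .F) with hp
    have hstep : ∀ (fh' : Finset (Fin n) → ℝ) (σ₃ : Mem) (t₃ : ℕ), t₃ ≤ 30 →
        Rep f (f S₀) V fh' σ₃ → σ₃.nat = σ₂.nat → σ₃.real .fV 0 0 ≤ 0 →
        wp f mainStep σ₃ (fun σ₄ t₄ => ∃ τ', (∃ V fh, Rep f (f S₀) V fh σ₄ ∧
        ((σ₄.nat .go 0 0 = 1 ∧
          τ' = (n * n + n + 1 - progress n (fun j => σ₄.nat .cls j 0) (σ₄.nat .F)) * K) ∨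
        (σ₄.nat .go 0 0 = 0 ∧ V.Nonempty ∧ σ₄.real .fV 0 0 ≤ 0 ∧ fh univ = f S₀ ∧
          τ' = 0))) ∧ 30 + (t₃ + t₄) + τ' ≤ (n * n + n + 1 - p) * K) := by
      intro fh' σ₃ t₃ ht₃ hM₃ eN hfV
      refine wp_mainStep hf hn hM₃ hV hfV (by rw [eN, hgo₂]) ?_ ?_
      · intro σ₄ t₄ V' hM₄ hgo₄ hpr ht₄
        rw [eN, ← hp] at hpr
        refine ⟨_, ⟨V', fh', hM₄, Or.inl ⟨hgo₄, rfl⟩⟩, ?_⟩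
        have hle := progress_le (n := n) (fun j => σ₄.nat .cls j 0) (σ₄.nat .F)
        set p' := progress n (fun j => σ₄.nat .cls j 0) (σ₄.nat .F) with hp'
        have h₁ : (n * n + n + 1 - p' + 1) * K ≤ (n * n + n + 1 - p) * K :=
          Nat.mul_le_mul_right K (by omega)
        rw [add_mul, one_mul] at h₁
        omega
      · intro σ₄ t₄ hM₄ hgo₄ hfV₄ hun ht₄
        refine ⟨0, ⟨V, fh', hM₄, Or.inr ⟨hgo₄, hV, hfV₄, hun, rfl⟩⟩, ?_⟩
        have hle := progress_le (n := n) (fun j => σ₂.nat .cls j 0) (σ₂.nat .F)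
        have h₁ : 1 * K ≤ (n * n + n + 1 - p) * K := Nat.mul_le_mul_right K (by omega)
        omega
    rw [wp_seq]
    refine wp_when ?_ ?_
    · intro hpos
      simp at hpos
      rw [wp_rset]
      refine wp_mono (hstep (fun S => if S = univ then σ₂.real .off 0 0 else fh S) _ 20
        (by norm_num) (Rep.mk ?_ (by simpa using hM₂.flags)
        (by simpa using hM₂.card) (by simpa using hM₂.out) (by simpa using hM₂.le_one)) ?_ ?_) ?_
      · simpa using hM₂.inv.reset hV hpos
      · simp
      · simp
      · rintro σ₄ t₄ ⟨τ', h, hτ⟩ _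
        refine ⟨τ', h, ?_⟩
        simp
        omega
    · intro hpos
      simp at hpos
      refine wp_mono (hstep fh σ₂ 20 (by norm_num) hM₂ rfl hpos) ?_
      rintro σ₄ t₄ ⟨τ', h, hτ⟩ _
      refine ⟨τ', h, ?_⟩
      simp
      omega
  · rintro σ₂ τ t₂ ⟨V, fh, hM₂, h₂⟩ hA₂ hb₂ ht₂
    simp [hM₂.card] at hb₂
    have hI := hM₂.inv
    have hT₂ : t₂ ≤ (n * n + n + 1) * K + 20 := by
      have h₁ : (n * n + n + 1 - progress n (fun j => σ₁.nat .cls j 0) (σ₁.nat .F)) * K ≤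
        (n * n + n + 1) * K := Nat.mul_le_mul_right K (Nat.sub_le _ _)
      simp at ht₂
      omega
    have hend : V = ∅ ∨ (V.Nonempty ∧ σ₂.real .fV 0 0 ≤ 0 ∧ fh univ = f S₀) := by
      rcases h₂ with h | h
      · refine Or.inl (not_nonempty_iff_eq_empty.1 fun hV => ?_)
        exact hb₂ hV h.1
      · exact Or.inr ⟨h.2.1, h.2.2.1, h.2.2.2.1⟩
    refine wp_when ?_ ?_
    · intro hneg
      simp at hneg
      -- The elements of `V` complete the output to the whole ground set.
      refine wp_forTo_zero n (fun j' σ' => ∀ j < n, (j < j' → σ'.nat .X j 0 ≠ 0) ∧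
        (σ₂.nat .X j 0 ≠ 0 → σ'.nat .X j 0 ≠ 0)) 30 rfl (fun _ _ => rfl) (by simp) ?_ ?_
      · intro j σ' hj hX hjj hA
        have ecls : σ'.nat .cls = σ₂.nat .cls := hA.nat .cls rfl
        refine wp_when ?_ ?_
        · intro hb
          rw [wp_nset]
          refine ⟨by simp, fun i hi => ?_⟩
          simp only [NExp.eval, NExp.eval_ofNat, hjj, Mem.setNat_nat_self, Mem.setNat_nat_of_ne,
            ne_eq, reduceCtorEq, not_false_eq_true, and_true]
          by_cases hc : i = j
          · simp [hc]
          · rw [if_neg hc]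
            exact ⟨fun h => (hX i hi).1 (by omega), (hX i hi).2⟩
        · intro hb
          simp [hjj, ecls] at hb
          refine ⟨by simp, fun i hi => ?_⟩
          simp only [Mem.setNat_nat_of_ne, ne_eq, reduceCtorEq, not_false_eq_true]
          refine ⟨fun h => ?_, (hX i hi).2⟩
          by_cases hc : i = j
          · rw [hc]
            exact (hX j hj).2 ((hM₂.out j hj).2 hb)
          · exact (hX i hi).1 (by omega)
      · intro σ' t hX hA ht
        have hset : σ'.set n .X = univ :=
          eq_univ_of_forall fun j => Mem.mem_set.2 ((hX j j.2).1 j.2)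
        refine ⟨?_, ?_⟩
        · rw [hset]
          rcases hend with h | h
          · exact hI.done h
          · exact hI.univ_eq hneg h.2.2
        · simp at ht ⊢
          omega
    · intro hneg
      simp at hneg
      refine ⟨?_, ?_⟩
      · rcases hend with h | ⟨h₃, h₄, h₅⟩
        · rw [← hI.done h]
          refine congrArg f (eq_univ_of_forall fun j => Mem.mem_set.2 ?_)
          refine (hM₂.out j j.2).2 ((hI.cases j j.2).resolve_right ?_)
          rw [h]
          exact notMem_empty _
        · have htau := hI.tau
          have hoff := hI.off_eq h₃
          obtain ⟨v, hv⟩ := h₃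
          rw [hM₂.set_X, ← hI.fh_eq _ (hI.repr_ne_univ hv (notMem_empty v)), ← hoff]
          linarith
      · simp
        omega

theorem log_two_le (n : ℕ) : (Nat.log 2 n : ℝ) ≤ 2 * Real.log n := by
  rcases Nat.eq_zero_or_pos n with rfl | hn
  · simp
  have h₁ : ((2 : ℝ) ^ Nat.log 2 n) ≤ n := by exact_mod_cast Nat.pow_log_le_self 2 hn.ne'
  have h₂ := Real.log_le_log (by positivity) h₁
  rw [Real.log_pow] at h₂
  have h₃ := Real.log_two_gt_d9
  have h₄ : (0 : ℝ) ≤ Nat.log 2 n := Nat.cast_nonneg _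
  nlinarith

/-- The product of the number of iterations, `O(n ^ 2)`, and of the time of one of them,
`O(n ^ 5 log n)`. -/
theorem time_le (hn : 0 < n) :
    (n * n + n + 1) * (iterTime n + 100) + 100 * n ^ 2 + 200 * n + 300 ≤
      10000000 * (n ^ 7 * (3 * Nat.log 2 n + 5)) := by
  set L := 3 * Nat.log 2 n + 5 with hL
  have hp : ∀ k, k ≤ 5 → n ^ k ≤ n ^ 5 * L := fun k hk =>
    (Nat.pow_le_pow_right hn hk).trans (Nat.le_mul_of_pos_right _ (by omega))
  have h₀ := hp 0 (by norm_num)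
  have h₁ := hp 1 (by norm_num)
  have h₂ := hp 2 (by norm_num)
  have h₃ := hp 3 (by norm_num)
  rw [pow_zero] at h₀
  rw [pow_one] at h₁
  have hc : 1000000 * n ^ 5 * L = 1000000 * (n ^ 5 * L) := mul_assoc _ _ _
  have hiter : iterTime n + 100 ≤ 1010000 * (n ^ 5 * L) := by
    unfold iterTime caseTime
    rw [← hL, hc]
    omega
  have hn2 : n * n + n + 1 ≤ 3 * n ^ 2 := by nlinarith
  have h₄ : (n * n + n + 1) * (iterTime n + 100) ≤ 3 * n ^ 2 * (1010000 * (n ^ 5 * L)) :=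
    Nat.mul_le_mul hn2 hiter
  have h₅ : 3 * n ^ 2 * (1010000 * (n ^ 5 * L)) = 3030000 * (n ^ 7 * L) := by ring
  have h₆ : n ^ 5 * L ≤ n ^ 7 * L :=
    Nat.mul_le_mul_right L (Nat.pow_le_pow_right hn (by norm_num))
  omega

end

end SFM

theorem mainTheorem3 :
    ∃ C : ℝ, ∀ n : ℕ, 1 ≤ n → ∀ f : Finset (Fin n) → ℝ,
      f ∅ = 0 →
      (∀ Y Z : Finset (Fin n), f (Y ∪ Z) + f (Y ∩ Z) ≤ f Y + f Z) →
      ∃ (σ : SFM.Mem) (t : ℕ),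
        SFM.Exec f SFM.algorithm SFM.Mem.zero σ t ∧
        (∀ Y : Finset (Fin n), f (σ.set n SFM.NName.X) ≤ f Y) ∧
        (t : ℝ) ≤ C * max 1 ((n : ℝ) ^ 7 * Real.log n) := by
  refine ⟨200000000, fun n hn f h0 hf => ?_⟩
  obtain ⟨σ, t, hexec, hmin, ht⟩ := SFM.wp_algorithm (σ := SFM.Mem.zero) hf hn h0
  refine ⟨σ, t, hexec, hmin, ?_⟩
  have h₁ : (t : ℝ) ≤ 10000000 * ((n : ℝ) ^ 7 * (3 * Nat.log 2 n + 5)) := by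
    exact_mod_cast ht.trans (SFM.time_le hn)
  have h₂ := SFM.log_two_le n
  rcases hn.eq_or_lt with rfl | hn2
  · norm_num at h₁ ⊢
    linarith
  · -- Here `1 ≤ 2 log n`, which absorbs the constant term.
    have h₃ : Real.log 2 ≤ Real.log n := Real.log_le_log (by norm_num) (by exact_mod_cast hn2)
    have h₄ := Real.log_two_gt_d9
    have h₅ : (3 * Nat.log 2 n + 5 : ℝ) ≤ 20 * Real.log n := by linarith
    calc (t : ℝ) ≤ 10000000 * ((n : ℝ) ^ 7 * (3 * Nat.log 2 n + 5)) := h₁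
      _ ≤ 10000000 * ((n : ℝ) ^ 7 * (20 * Real.log n)) := by gcongr
      _ = 200000000 * ((n : ℝ) ^ 7 * Real.log n) := by ring
      _ ≤ 200000000 * max 1 ((n : ℝ) ^ 7 * Real.log n) := by gcongr; exact le_max_right _ _
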